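/- **Setting.** For a square size $N$, let $(p,q)$ be a pair of complex $N\times N$ matrices, with the symplectic form $\omega=\mathrm{Tr}(dp\wedge dq)$. A (time-dependent) Hamiltonian $H(p,q;t)$ defines the dynamics $\dot q=\partial H/\partial p$, $\dot p=-\partial H/\partial q$ ($t\in\mathbb C$), i.e. the kernel of $\omega-dH\wedge dt$. The matrix Painlevé systems, with scalar parameters, are given by * PII$(\alpha_0,\alpha_1)$, $\alpha_0+\alpha_1=1$: $H=\mathrm{Tr}\big(\tfrac12p^2-\tfrac12(q^2+\tfrac t2)^2-(\alpha_1-\tfrac12)q\big)$; * PIV$(\alpha_0,\alpha_1,\alpha_2)$, $\sum\alpha_i=1$: $H=\mathrm{Tr}\big((p-q-2t)pq-2\alpha_1p-2\alpha_2q\big)$; * PV$(\alpha_0,\dots,\alpha_3)$, $\sum\alpha_i=1$, $t\ne0$: $tH=\mathrm{Tr}\big(p(p+t)q(q-1)-(\alpha_1+\alpha_3)pq+\alpha_1p+\alpha_2tq\big)$; * PIII$(D_6)(\alpha_0,\alpha_1,\beta_0,\beta_1)$, $\alpha_0+\alpha_1=\beta_0+\beta_1=1$, $t\neq 0$: $tH=\mathrm{Tr}\big(p^2q^2-(q^2-(\alpha_1+\beta_1)q-t)p-\alpha_1q\big)$;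 * PIII$(D_8)$, $t\ne0$, $q$ invertible: $tH=\mathrm{Tr}\big(pqpq+pq-q-tq^{-1}\big)$; * PVI$(\alpha_0,\dots,\alpha_4)$, $\alpha_0+\alpha_1+2\alpha_2+\alpha_3+\alpha_4=1$, $t\ne0,1$: $t(t-1)H=\mathrm{Tr}\big(pq(q-1)p(q-t)-(\alpha_4(q-1)(q-t)+\alpha_3q(q-t)+(\alpha_0-1)q(q-1))p+\alpha_2(\alpha_1+\alpha_2)(q-t)\big)$. Let $n\ge 0$ and $d\in\{2,3,4\}$. Write $nd\times nd$ matrices in $n\times n$ blocks $A_{ij}$, $1\le i,j\le d$, and let $S_d=\mathrm{diag}(1,\zeta 1,\dots,\zeta^{d-1}1)$, $\zeta=e^{2\pi i/d}$. For a transformation $w$ of the $nd\times nd$ system, the twisted fixed point set at time $t$ is $$M_t^{\bar w}=\{(p,q):\ S_dqS_d^{-1}=w(q),\ S_dpS_d^{-1}=w(p)\}$$ (with $q$ invertible where $w$ involves $q^{-1}$). The group $\mathrm{GL}_n^{d-1}=\{\mathrm{diag}(1,h_2,\dots,h_d)\}$ acts by simultaneous conjugation. The moment map is $(m_2,\dots,m_d)$,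 $m_j=[p,q]_{jj}$. For $\mathbf g=(g_2,\dots,g_d)\in\mathbb C^{d-1}$ we fix $m_j=ig_j1$. **Theorem.** Consider the eight cases below. In each of them let the parameters be normalized as above and preserved by the action of $w$ on the parameters. Let $D\subset\mathbb C$ be an open set of times, with $0\notin D$ in cases 2, 3, 5–8 and $1\notin D$ in case 8; in cases 2, 3, 6–8 let $\ell$ be a holomorphic branch of $\log t$ on $D$ and $\sqrt t=e^{\ell/2}$. Let $U_t$ be the set of points of $M_t^{\bar w}$ with $m_j=ig_j1$ ($j\ge2$) for which the listed matrices are invertible. Put $X^{(c)}=(e^{cC}Pe^{-cC},e^{cC}Qe^{-cC})$ for $X=(P,Q)$, $C=[P,Q]$. In cases 1–3 let $\tilde P=p_{12}q_{12}^{-1}$, $\tilde Q=q_{12}q_{21}$. In cases 6–8 let $\tilde P=2tq_{21}^{-1}p_{21}q_{11}^{-1}$, $\tilde Q=q_{11}$. 1. PII $\to$ PII$(1+ig_2,-ig_2)$. $w(p,q)=(-p,-q)$, exchanging $\alpha_0,\alpha_1$; $d=2$. $q_{12}$ invertible. $s=-ct$ with $c^3=2$; $Q=-c^{-1}\tilde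 P$, $P=c\tilde Q-Q^2-\tfrac s2$. $V$: all $(P,Q)$. 2. PIII$(D_6)\to$ PIII$(D_8)$. $w(p,q)=(1-p+(\alpha_0-\beta_0)q^{-1}-tq^{-2},-q)$, exchanging $\alpha_0,\alpha_1$ and $\beta_0,\beta_1$; $d=2$. $q_{12},q_{21}$ invertible. $s=t^2/16$; $(P,Q)=\big(4(\tilde P+\tfrac{ig_2}2\tilde Q^{-1}),\tfrac14\tilde Q\big)^{(-\ell)}$. $V$: $Q$ invertible. 3. PV $\to$ PIII$(D_6)(1+ig_2,-ig_2,1-2\alpha_1,2\alpha_1)$. $w(p,q)=(-t-p,1-q)$, exchanging $\alpha_0,\alpha_2$ and $\alpha_1,\alpha_3$; $d=2$. $q_{12}$ invertible. $s=-t^2/16$; $(P,Q)=\big(4\tilde Q,-\tfrac14\tilde P\big)^{(\ell)}$. $V$: all $(P,Q)$. 4. PIV $\to$ PIV$\big(1+\tfrac{ig_3}2,-\tfrac{ig_2+ig_3}2,\tfrac{ig_2}2\big)$. $w(p,q)=(-p+q+2t,-p)$, rotating the parameters; $d=3$. $q_{13},q_{23}$ invertible. $s=\kappa t$ with $\kappa^2=-\sqrt3i$;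 $P=\kappa^{-1}\sqrt3i\,q_{12}q_{23}q_{13}^{-1}$, $Q=\kappa q_{13}q_{23}^{-1}q_{21}$. $V$: all $(P,Q)$. 5. PV $\to$ PV$(1+ig_2,ig_3+ig_4,-ig_4,-ig_2-ig_3)$. $w(p,q)=(t(q-1),-t^{-1}p)$, rotating the parameters; $d=4$. With $\tilde P=2it\,q_{12}q_{32}^{-1}q_{34}q_{41}$, $\tilde Q=q_{14}q_{34}^{-1}q_{32}q_{12}^{-1}$: $q_{12},q_{32},q_{34},\tilde Q-1$ invertible. $s=-2it$; $P=-((\tilde Q-1)\tilde P-ig_4)(\tilde Q-1)$, $Q=\tilde Q(\tilde Q-1)^{-1}$. $V$: $Q-1$ invertible. 6. PIII$(D_8)\to$ PIII$(D_6)(1-ig_2,ig_2,1-ig_2,ig_2)$. $w(p,q)=(-t^{-1}q(pq+\tfrac12),tq^{-1})$; $d=2$. $q_{11},q_{21}$ invertible. $s=16\sqrt t$; $(P,Q)=\big(-\tfrac12(\tfrac{\tilde Q}{\sqrt t}-1),\,2\sqrt t(\tilde P+(ig_2-\tfrac12)\tilde Q^{-1})\big)^{(\ell/2)}$. $V$: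 $1-2P$ invertible. 7. PIII$(D_6)\to$ PV$(1-ig_2-\alpha_1,ig_2,\alpha_1-ig_2,ig_2)$. $w(p,q)=(-t^{-1}q(pq+\alpha_1),tq^{-1})$, exchanging $\beta_0,\beta_1$; $d=2$. $q_{11},q_{21}$ invertible. $s=-8\sqrt t$; $(P,Q)=\big(2\sqrt t(\tilde P+(ig_2-\alpha_1)\tilde Q^{-1}),\tfrac12(\tfrac{\tilde Q}{\sqrt t}+1)\big)^{(-\ell/2)}$. $V$: $2Q-1$ invertible. 8. PVI $\to$ PVI$(2\alpha_0,2\alpha_1,\alpha_2-ig_2,ig_2,ig_2)$. $w(p,q)=(-t^{-1}q(pq+\alpha_2),tq^{-1})$, exchanging $\alpha_0,\alpha_3$ and $\alpha_1,\alpha_4$; $d=2$. $q_{11},q_{21}$ invertible. $s=\tfrac12+\tfrac14(\sqrt t+\tfrac1{\sqrt t})$; $(P,Q)=\big(2\sqrt t(\tilde P+(ig_2-\alpha_2)\tilde Q^{-1}),\tfrac12(\tfrac{\tilde Q}{\sqrt t}+1)\big)^{(\ell/2)}$. $V$: $2Q-1$ invertible. Then the reduction of the $nd\times nd$ system on the left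 is equivalent, through $\Phi_t:(p,q)\mapsto(P,Q)$, to the $n\times n$ system on the right in the time $s$, with Hamiltonian $H'$. That is: * On $M_t^{\bar w}$ the matrix $[p,q]$ is block diagonal. Its diagonal blocks are the moment map of the conjugation by block diagonal matrices. The invertibility conditions define an open set, which is dense in the part $\mathrm{Tr}(S_dq)=0$ of $M_t^{\bar w}$. * $\mathrm{GL}_n^{d-1}$ acts on $U_t$, freely. The Hamiltonian vector field of the $nd\times nd$ system is tangent to $U=\{(t,x):t\in D,\ x\in U_t\}$. * $V$ is open and dense in the space of pairs of $n\times n$ matrices. $\Phi_t(U_t)=V$, and the fibres of $\Phi_t$ on $U_t$ are exactly the $\mathrm{GL}_n^{d-1}$-orbits. The time change $s$ is holomorphic with $s'\ne0$. $\Phi$ is holomorphic in $(t,p,q)$ and has a holomorphic section $D\times V\to U$. * The map $(t,x)\mapsto(s(t),\Phi_t(x))$ pulls $\mathrm{Tr}(dP\wedge dQ)-dH'\wedge ds$ back to the restriction of $\mathrm{Tr}(dp\wedge dq)-dH\wedge dt$ to $U$. * For every open $D'\subset D$, a holomorphic curve $x(t)\in U_t$, $t\in D'$, represents a solution of the reduced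 dynamics (its velocity is the Hamiltonian vector up to a vector tangent to the $\mathrm{GL}_n^{d-1}$-orbit) if and only if $\Phi_t(x(t))$ solves the $n\times n$ system in the time $s$. -/

import Mathlib

open Matrix Topology

noncomputable section

namespace MatrixPainleve

/-! ### Phase spaces and Hamiltonian dynamics -/

/-- The phase space of pairs `(p, q)` of square complex matrices. -/
abbrev Phase (m : Type) := Matrix m m ℂ × Matrix m m ℂ

section Dynamics

variable {m : Type} [Fintype m] [DecidableEq m]

/-- The symplectic form `Tr (dp ∧ dq)`, evaluated on two tangent vectors. -/
def sympl (u v : Phase m) : ℂ := trace (u.1 * v.2) - trace (v.1 * u.2)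

/-- The commutator `[p, q]`. -/
def comm (x : Phase m) : Matrix m m ℂ := x.1 * x.2 - x.2 * x.1

/-- `v = (p', q')` is the Hamiltonian vector of `H` at time `t` and point `x`, that is
`dH = Tr (q' dp - p' dq)`, or `q' = ∂H/∂p`, `p' = -∂H/∂q`. -/
def IsHamVec (H : ℂ → Phase m → ℂ) (t : ℂ) (x v : Phase m) : Prop :=
  ∀ u : Phase m, HasDerivAt (fun ε : ℂ => H t (x + ε • u)) (sympl u v) 0

/-- The curve `y` on the time domain `D` solves the non-autonomous Hamiltonian system of `H` with
respect to the time `s = s(t)`, that is `dy/dt = s'(t) X_H(s(t), y)`. -/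
def IsSolution (H : ℂ → Phase m → ℂ) (s : ℂ → ℂ) (D : Set ℂ) (y : ℂ → Phase m) : Prop :=
  ∀ t ∈ D, ∃ v, IsHamVec H (s t) (y t) v ∧ HasDerivAt y (deriv s t • v) t

/-- The value of the 2-form `Tr (dp ∧ dq) - dH ∧ dt` of the extended phase space of triples
`(t, (p, q))` at the point `z`, on the tangent vectors `a` and `b`. The `dt`-part of `dH` does not
contribute to `dH ∧ dt`. -/
def extForm (H : ℂ → Phase m → ℂ) (z a b : ℂ × Phase m) : ℂ :=
  sympl a.2 b.2
    - (deriv (fun ε : ℂ => H z.1 (z.2 + ε • a.2)) 0 * b.1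
      - deriv (fun ε : ℂ => H z.1 (z.2 + ε • b.2)) 0 * a.1)

/-- `a` is a tangent vector at `z` of the subset `Z` of the extended phase space. -/
def IsTangent (Z : Set (ℂ × Phase m)) (z a : ℂ × Phase m) : Prop :=
  ∃ γ : ℂ → ℂ × Phase m, γ 0 = z ∧ (∀ᶠ ε in 𝓝 0, γ ε ∈ Z) ∧ HasDerivAt γ a 0

end Dynamics

/-! ### The matrix Painlevé Hamiltonians, in terms of root variables -/

section Hamiltonians

variable {m : Type} [Fintype m] [DecidableEq m]

/-- Matrix PII`(α₀, α₁)`, where `α₀ + α₁ = 1` and `θ = α₁ - 1/2`. -/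
def hamII (α : Fin 2 → ℂ) (t : ℂ) (x : Phase m) : ℂ :=
  trace ((1 / 2 : ℂ) • x.1 ^ 2 - (1 / 2 : ℂ) • (x.2 ^ 2 + (t / 2) • 1) ^ 2
    - (α 1 - 1 / 2) • x.2)

/-- Matrix PIV`(α₀, α₁, α₂)`, where `α₀ + α₁ + α₂ = 1`. -/
def hamIV (α : Fin 3 → ℂ) (t : ℂ) (x : Phase m) : ℂ :=
  trace ((x.1 - x.2 - (2 * t) • 1) * x.1 * x.2 - (2 * α 1) • x.1 - (2 * α 2) • x.2)

/-- Matrix PV`(α₀, α₁, α₂, α₃)`, where `α₀ + α₁ + α₂ + α₃ = 1`, for `t ≠ 0`. -/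
def hamV (α : Fin 4 → ℂ) (t : ℂ) (x : Phase m) : ℂ :=
  t⁻¹ * trace (x.1 * (x.1 + t • 1) * x.2 * (x.2 - 1) - (α 1 + α 3) • (x.1 * x.2)
    + α 1 • x.1 + (α 2 * t) • x.2)

/-- Matrix PIII(D₆)`(α₀, α₁, β₀, β₁)`, where `α₀ + α₁ = 1` and `β₀ + β₁ = 1`, for `t ≠ 0`. -/
def hamIIID6 (α β : Fin 2 → ℂ) (t : ℂ) (x : Phase m) : ℂ :=
  t⁻¹ * trace (x.1 ^ 2 * x.2 ^ 2 - (x.2 ^ 2 - (α 1 + β 1) • x.2 - t • 1) * x.1 - α 1 • x.2)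

/-- Matrix PIII(D₈), for `t ≠ 0` and invertible `q`. -/
def hamIIID8 (t : ℂ) (x : Phase m) : ℂ :=
  t⁻¹ * trace (x.1 * x.2 * x.1 * x.2 + x.1 * x.2 - x.2 - t • x.2⁻¹)

/-- Matrix PVI`(α₀, α₁, α₂, α₃, α₄)`, where `α₀ + α₁ + 2 α₂ + α₃ + α₄ = 1`, for `t ≠ 0, 1`. -/
def hamVI (α : Fin 5 → ℂ) (t : ℂ) (x : Phase m) : ℂ :=
  (t * (t - 1))⁻¹ * trace (x.1 * x.2 * (x.2 - 1) * x.1 * (x.2 - t • 1)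
    - (α 4 • ((x.2 - 1) * (x.2 - t • 1)) + α 3 • (x.2 * (x.2 - t • 1))
        + (α 0 - 1) • (x.2 * (x.2 - 1))) * x.1
    + (α 2 * (α 1 + α 2)) • (x.2 - t • 1))

/-! ### The Bäcklund transformations: action on `(p, q)` and on the root variables -/

/-- `r` for PII. -/
def backIIr (_t : ℂ) (x : Phase m) : Phase m := (-x.1, -x.2)

/-- `π ∘ π'` for PIII(D₆); it exchanges `α₀` with `α₁` and `β₀` with `β₁`. -/
def backIIID6pp (α β : Fin 2 → ℂ) (t : ℂ) (x : Phase m) : Phase m :=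
  (1 - x.1 + (α 0 - β 0) • x.2⁻¹ - t • (x.2⁻¹) ^ 2, -x.2)

/-- `π'` for PIII(D₆); it exchanges `β₀` with `β₁`. -/
def backIIID6p (α : Fin 2 → ℂ) (t : ℂ) (x : Phase m) : Phase m :=
  (-(t⁻¹ • (x.2 * (x.1 * x.2 + α 1 • 1))), t • x.2⁻¹)

/-- `π` for PV; it rotates the root variables. -/
def backVpi (t : ℂ) (x : Phase m) : Phase m := (t • (x.2 - 1), -(t⁻¹ • x.1))

/-- `π` for PIV; it rotates the root variables. -/
def backIVpi (t : ℂ) (x : Phase m) : Phase m := (-x.1 + x.2 + (2 * t) • 1, -x.1)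

/-- `π` for PIII(D₈). -/
def backIIID8pi (t : ℂ) (x : Phase m) : Phase m :=
  (-(t⁻¹ • (x.2 * (x.1 * x.2 + (1 / 2 : ℂ) • 1))), t • x.2⁻¹)

/-- `π₁` for PVI; it exchanges `α₀` with `α₃` and `α₁` with `α₄`. -/
def backVIpi1 (α : Fin 5 → ℂ) (t : ℂ) (x : Phase m) : Phase m :=
  (-(t⁻¹ • (x.2 * (x.1 * x.2 + α 2 • 1))), t • x.2⁻¹)

/-- The exchange of two root variables. -/
def swapParam (α : Fin 2 → ℂ) : Fin 2 → ℂ := ![α 1, α 0]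

/-- The cyclic rotation of root variables. -/
def rotParam {k : ℕ} [NeZero k] (α : Fin k → ℂ) : Fin k → ℂ := fun i => α (i + 1)

/-- The action of `π₁` on the root variables of PVI. -/
def pi1Param (α : Fin 5 → ℂ) : Fin 5 → ℂ := ![α 3, α 4, α 2, α 0, α 1]

end Hamiltonians

/-! ### Block matrices, twisted fixed points, gauge action and moment map

Matrices of size `nd × nd` are indexed by `Fin n × Fin d`; the second index is the number of the
block, counted from `0`. -/

section Blocks

variable {n d : ℕ}

/-- The `n × n` block of `A` in block row `i` and block column `j`. -/
def blk (A : Matrix (Fin n × Fin d) (Fin n × Fin d) ℂ) (i j : Fin d) : Matrix (Fin n) (Fin n) ℂ :=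
  A.submatrix (fun a => (a, i)) (fun b => (b, j))

/-- `S_d = diag (1, ζ 1, …, ζ ^ (d - 1) 1)` with `ζ = exp (2 π i / d)`. -/
def twist (n d : ℕ) : Matrix (Fin n × Fin d) (Fin n × Fin d) ℂ :=
  diagonal fun a => Complex.exp (2 * Real.pi * Complex.I / d) ^ (a.2 : ℕ)

/-- The fixed points of a transformation `w` twisted by `S_d`, among the points of the domain `reg`
of `w`: `S_d q S_d⁻¹ = w(q)` and `S_d p S_d⁻¹ = w(p)`. -/
def fixedSet (reg : Set (Phase (Fin n × Fin d)))
    (w : ℂ → Phase (Fin n × Fin d) → Phase (Fin n × Fin d)) (t : ℂ) :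
    Set (Phase (Fin n × Fin d)) :=
  {x | x ∈ reg ∧ twist n d * x.1 * (twist n d)⁻¹ = (w t x).1 ∧
    twist n d * x.2 * (twist n d)⁻¹ = (w t x).2}

/-- The action of `diag (h₁, …, h_d)` by simultaneous conjugation. -/
def gauge (h : Fin d → GL (Fin n) ℂ) (x : Phase (Fin n × Fin d)) : Phase (Fin n × Fin d) :=
  let A := blockDiagonal fun i => (h i : Matrix (Fin n) (Fin n) ℂ)
  let B := blockDiagonal fun i => ((h i)⁻¹ : GL (Fin n) ℂ).1
  (A * x.1 * B, A * x.2 * B)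

/-- The infinitesimal action of `diag (ξ₁, …, ξ_d)`. -/
def infGauge (ξ : Fin d → Matrix (Fin n) (Fin n) ℂ) (x : Phase (Fin n × Fin d)) :
    Phase (Fin n × Fin d) :=
  (blockDiagonal ξ * x.1 - x.1 * blockDiagonal ξ, blockDiagonal ξ * x.2 - x.2 * blockDiagonal ξ)

/-- The components `m_i` of the moment map: the diagonal blocks of `[p, q]`. -/
def moment (x : Phase (Fin n × Fin d)) (i : Fin d) : Matrix (Fin n) (Fin n) ℂ := blk (comm x) i i

/-- The level set `m_i = i g_i 1` for all blocks but the first one, whose entry `g 0` is unused. -/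
def momentLevel [NeZero d] (g : Fin d → ℂ) : Set (Phase (Fin n × Fin d)) :=
  {x | ∀ i, i ≠ 0 → moment x i = (Complex.I * g i) • 1}

/-- The curve `x` represents a solution of the dynamics induced by `H` on the quotient by
`{diag (1, h₂, …, h_d)}`: its velocity is the Hamiltonian vector up to a vector tangent to the
orbit. -/
def IsReducedSolution [NeZero d] (H : ℂ → Phase (Fin n × Fin d) → ℂ) (D : Set ℂ)
    (x : ℂ → Phase (Fin n × Fin d)) : Prop :=
  ∀ t ∈ D, ∃ v ξ, ξ 0 = 0 ∧ IsHamVec H t (x t) v ∧ HasDerivAt x (v + infGauge ξ (x t)) t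

/-- The block reduction of the system `H` of size `nd` along the twisted fixed points of `w`, at the
moment value `g`, is equivalent over the time domain `D` to the system `H'` of size `n` in the
time `s(t)`. The equivalence is the map `Φ`, defined on the fixed points in `gen` of the given
moment value, modulo the group `GL_n ^ (d - 1)` of block diagonal matrices with first block `1`,
and has the image `V`. -/
structure IsBlockReduction [NeZero d]
    (D : Set ℂ) (H : ℂ → Phase (Fin n × Fin d) → ℂ)
    (reg : Set (Phase (Fin n × Fin d)))
    (w : ℂ → Phase (Fin n × Fin d) → Phase (Fin n × Fin d))
    (g : Fin d → ℂ) (gen : Set (Phase (Fin n × Fin d)))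
    (H' : ℂ → Phase (Fin n) → ℂ) (V : Set (Phase (Fin n)))
    (s : ℂ → ℂ) (Φ : ℂ → Phase (Fin n × Fin d) → Phase (Fin n)) : Prop where
  /-- `gen` is open, and it is dense in the part `Tr (S_d q) = 0` of the fixed point set. -/
  isOpen_gen : IsOpen gen
  dense_gen : ∀ t ∈ D, fixedSet reg w t ∩ {x | trace (twist n d * x.2) = 0} ⊆
    closure (fixedSet reg w t ∩ gen)
  /-- `[p, q]` is block diagonal on the fixed point set, and its blocks are the moment map. -/
  comm_blk : ∀ t ∈ D, ∀ x ∈ fixedSet reg w t, ∀ i j, i ≠ j → blk (comm x) i j = 0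
  moment_map : ∀ (ξ : Fin d → Matrix (Fin n) (Fin n) ℂ) (x u : Phase (Fin n × Fin d)),
    HasDerivAt (fun ε : ℂ => ∑ i, trace (ξ i * moment (x + ε • u) i)) (sympl (infGauge ξ x) u) 0
  /-- The group acts freely on the domain of `Φ`. -/
  gauge_mem : ∀ t ∈ D, ∀ x ∈ fixedSet reg w t ∩ momentLevel g ∩ gen,
    ∀ h : Fin d → GL (Fin n) ℂ, h 0 = 1 → gauge h x ∈ fixedSet reg w t ∩ momentLevel g ∩ gen
  gauge_free : ∀ t ∈ D, ∀ x ∈ fixedSet reg w t ∩ momentLevel g ∩ gen,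
    ∀ h : Fin d → GL (Fin n) ℂ, h 0 = 1 → gauge h x = x → h = 1
  /-- The Hamiltonian vector field of `H` is tangent to the domain of `Φ`. -/
  tangent : ∀ t ∈ D, ∀ x ∈ fixedSet reg w t ∩ momentLevel g ∩ gen, ∃ v, IsHamVec H t x v ∧
    IsTangent {z | z.1 ∈ D ∧ z.2 ∈ fixedSet reg w z.1 ∩ momentLevel g ∩ gen} (t, x) (1, v)
  /-- The fibres of `Φ` are the orbits, and its image is the open dense set `V`. -/
  isOpen_image : IsOpen V
  dense_image : Dense V
  image_eq : ∀ t ∈ D, Φ t '' (fixedSet reg w t ∩ momentLevel g ∩ gen) = V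
  fiber_eq : ∀ t ∈ D, ∀ x ∈ fixedSet reg w t ∩ momentLevel g ∩ gen,
    ∀ y ∈ fixedSet reg w t ∩ momentLevel g ∩ gen,
      Φ t x = Φ t y ↔ ∃ h : Fin d → GL (Fin n) ℂ, h 0 = 1 ∧ gauge h x = y
  /-- `s` and `Φ` are holomorphic, `s' ≠ 0`, and `Φ` has a holomorphic section. -/
  holo_time : DifferentiableOn ℂ s D
  deriv_time : ∀ t ∈ D, deriv s t ≠ 0
  holo : DifferentiableOn ℂ (fun z : ℂ × Phase (Fin n × Fin d) => Φ z.1 z.2) (D ×ˢ gen)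
  holo_section : ∃ σ : ℂ × Phase (Fin n) → Phase (Fin n × Fin d), DifferentiableOn ℂ σ (D ×ˢ V) ∧
    ∀ t ∈ D, ∀ y ∈ V,
      σ (t, y) ∈ fixedSet reg w t ∩ momentLevel g ∩ gen ∧ Φ t (σ (t, y)) = y
  /-- `(s, Φ)` pulls `Tr (dP ∧ dQ) - dH' ∧ ds` back to the restriction of
  `Tr (dp ∧ dq) - dH ∧ dt`. -/
  form_eq : ∀ t ∈ D, ∀ x ∈ fixedSet reg w t ∩ momentLevel g ∩ gen, ∀ a b,
    IsTangent {z | z.1 ∈ D ∧ z.2 ∈ fixedSet reg w z.1 ∩ momentLevel g ∩ gen} (t, x) a →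
    IsTangent {z | z.1 ∈ D ∧ z.2 ∈ fixedSet reg w z.1 ∩ momentLevel g ∩ gen} (t, x) b →
    extForm H (t, x) a b = extForm H' (s t, Φ t x)
      (fderiv ℂ (fun z : ℂ × Phase (Fin n × Fin d) => (s z.1, Φ z.1 z.2)) (t, x) a)
      (fderiv ℂ (fun z : ℂ × Phase (Fin n × Fin d) => (s z.1, Φ z.1 z.2)) (t, x) b)
  /-- `Φ` maps the solutions of the reduced dynamics to the solutions of the system `H'`, and
  every curve that it maps to a solution is a solution. -/
  dynamics : ∀ D' : Set ℂ, IsOpen D' → D' ⊆ D → ∀ x : ℂ → Phase (Fin n × Fin d),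
    DifferentiableOn ℂ x D' → (∀ t ∈ D', x t ∈ fixedSet reg w t ∩ momentLevel g ∩ gen) →
    (IsReducedSolution H D' x ↔ IsSolution H' s D' fun t => Φ t (x t))

end Blocks

/-! ### The explicit equivalences -/

section Maps

variable {n : ℕ}

/-- `ℓ` is a holomorphic branch of the logarithm on `D`. -/
def IsLogBranch (D : Set ℂ) (ℓ : ℂ → ℂ) : Prop :=
  DifferentiableOn ℂ ℓ D ∧ ∀ t ∈ D, Complex.exp (ℓ t) = t

/-- Conjugation of `(P, Q)` by `exp (c [P, Q])`. -/
def conjComm (c : ℂ) (x : Phase (Fin n)) : Phase (Fin n) :=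
  (NormedSpace.exp (c • comm x) * x.1 * NormedSpace.exp (-(c • comm x)),
    NormedSpace.exp (c • comm x) * x.2 * NormedSpace.exp (-(c • comm x)))

/-- The pairs with invertible `q`. -/
def regQ (m : Type) [Fintype m] [DecidableEq m] : Set (Phase m) := {x | IsUnit x.2}

/-- The locus of the reductions with target PII and with source PV, `d = 2`: `q₁₂` is invertible. -/
def genLin : Set (Phase (Fin n × Fin 2)) := {x | IsUnit (blk x.2 0 1)}

/-- `(P̃, Q̃) = (p₁₂ q₁₂⁻¹, q₁₂ q₂₁)`. -/
def redLin (x : Phase (Fin n × Fin 2)) : Phase (Fin n) :=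
  (blk x.1 0 1 * (blk x.2 0 1)⁻¹, blk x.2 0 1 * blk x.2 1 0)

/-- PII to PII, where `c ^ 3 = 2` and `s = -c t`. -/
def mapII (c t : ℂ) (x : Phase (Fin n × Fin 2)) : Phase (Fin n) :=
  let Q := -(c⁻¹ • (redLin x).1)
  (c • (redLin x).2 - Q ^ 2 - (-c * t / 2) • 1, Q)

/-- The locus where `q₁₂` and `q₂₁` are invertible. -/
def genLin' : Set (Phase (Fin n × Fin 2)) := {x | IsUnit (blk x.2 0 1) ∧ IsUnit (blk x.2 1 0)}

/-- PIII(D₆) to PIII(D₈), where `s = t² / 16`. -/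
def mapD6D8 (ℓ : ℂ → ℂ) (g₂ t : ℂ) (x : Phase (Fin n × Fin 2)) : Phase (Fin n) :=
  conjComm (-ℓ t)
    ((4 : ℂ) • ((redLin x).1 + (Complex.I * g₂ / 2) • (redLin x).2⁻¹), (1 / 4 : ℂ) • (redLin x).2)

/-- PV to PIII(D₆), where `s = -t² / 16`. -/
def mapVD6 (ℓ : ℂ → ℂ) (t : ℂ) (x : Phase (Fin n × Fin 2)) : Phase (Fin n) :=
  conjComm (ℓ t) ((4 : ℂ) • (redLin x).2, -((1 / 4 : ℂ) • (redLin x).1))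

/-- The locus for PIV: `q₁₃` and `q₂₃` are invertible. -/
def genIV : Set (Phase (Fin n × Fin 3)) := {x | IsUnit (blk x.2 0 2) ∧ IsUnit (blk x.2 1 2)}

/-- PIV to PIV, where `κ ^ 2 = -√3 i` and `s = κ t`. Note `ϖ - ϖ⁻¹ = √3 i` for
`ϖ = exp (2 π i / 3)`. -/
def mapIV (κ _t : ℂ) (x : Phase (Fin n × Fin 3)) : Phase (Fin n) :=
  ((κ⁻¹ * (Real.sqrt 3 * Complex.I)) • (blk x.2 0 1 * blk x.2 1 2 * (blk x.2 0 2)⁻¹),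
    κ • (blk x.2 0 2 * (blk x.2 1 2)⁻¹ * blk x.2 1 0))

/-- `(P̃, Q̃) = (2 i t q₁₂ q₃₂⁻¹ q₃₄ q₄₁, q₁₄ q₃₄⁻¹ q₃₂ q₁₂⁻¹)`. -/
def redV (t : ℂ) (x : Phase (Fin n × Fin 4)) : Phase (Fin n) :=
  ((2 * Complex.I * t) • (blk x.2 0 1 * (blk x.2 2 1)⁻¹ * blk x.2 2 3 * blk x.2 3 0),
    blk x.2 0 3 * (blk x.2 2 3)⁻¹ * blk x.2 2 1 * (blk x.2 0 1)⁻¹)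

/-- The locus for PV, `d = 4`: `q₁₂`, `q₃₂`, `q₃₄` and `Q̃ - 1` are invertible. -/
def genV : Set (Phase (Fin n × Fin 4)) :=
  {x | IsUnit (blk x.2 0 1) ∧ IsUnit (blk x.2 2 1) ∧ IsUnit (blk x.2 2 3) ∧
    IsUnit (blk x.2 0 3 * (blk x.2 2 3)⁻¹ * blk x.2 2 1 * (blk x.2 0 1)⁻¹ - 1)}

/-- PV to PV, where `s = -2 i t`. -/
def mapV (g₄ t : ℂ) (x : Phase (Fin n × Fin 4)) : Phase (Fin n) :=
  (-((((redV t x).2 - 1) * (redV t x).1 - (Complex.I * g₄) • 1) * ((redV t x).2 - 1)),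
    (redV t x).2 * ((redV t x).2 - 1)⁻¹)

/-- The locus of the non-linear reductions: `q₁₁` and `q₂₁` are invertible. -/
def genNL : Set (Phase (Fin n × Fin 2)) := {x | IsUnit (blk x.2 0 0) ∧ IsUnit (blk x.2 1 0)}

/-- `(P̃, Q̃) = (2 t q₂₁⁻¹ p₂₁ q₁₁⁻¹, q₁₁)`. -/
def redNL (t : ℂ) (x : Phase (Fin n × Fin 2)) : Phase (Fin n) :=
  ((2 * t) • ((blk x.2 1 0)⁻¹ * blk x.1 1 0 * (blk x.2 0 0)⁻¹), blk x.2 0 0)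

/-- PIII(D₈) to PIII(D₆), where `s = 16 √t` and `√t = exp (ℓ t / 2)`. -/
def mapD8D6 (ℓ : ℂ → ℂ) (g₂ t : ℂ) (x : Phase (Fin n × Fin 2)) : Phase (Fin n) :=
  let r := Complex.exp (ℓ t / 2)
  conjComm (ℓ t / 2)
    (-((1 / 2 : ℂ) • (r⁻¹ • (redNL t x).2 - 1)),
      (2 * r) • ((redNL t x).1 + (Complex.I * g₂ - 1 / 2) • (redNL t x).2⁻¹))

/-- PIII(D₆) to PV, where `s = -8 √t`, with `ν = α₁`, and PVI to PVI, where
`s = 1/2 + (√t + 1/√t) / 4`, with `ν = α₂`; here `√t = exp (ℓ t / 2)`, and `e = -1/2` in the first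
case and `e = 1/2` in the second one. -/
def mapNL (e : ℂ) (ℓ : ℂ → ℂ) (ν g₂ t : ℂ) (x : Phase (Fin n × Fin 2)) : Phase (Fin n) :=
  let r := Complex.exp (ℓ t / 2)
  conjComm (e * ℓ t)
    ((2 * r) • ((redNL t x).1 + (Complex.I * g₂ - ν) • (redNL t x).2⁻¹),
      (1 / 2 : ℂ) • (r⁻¹ • (redNL t x).2 + 1))

end Maps

end MatrixPainleve

end

open Matrix Topology

set_option linter.unusedSectionVars false
set_option linter.unusedSimpArgs false

noncomputable section

namespace MatrixPainleve

open scoped Matrix.Norms.Operator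


/-! All eight cases are instances of one argument of symplectic reduction, `Slice.isBlockReduction`.
A normalization of off-diagonal blocks of q (q₁₂ = 1 in cases 1–3; q₁₃ = q₂₃ = 1 for PIV; q₃₂ = q₃₄
= 1 and q₁₄ - q₁₂ = 1 for PV to PV; q₂₁ = 1 in cases 6–8) selects exactly one point of every orbit.
The equations of the twisted fixed points and of the moment level then express all other blocks
through (P, Q). This gives a section σ of Φ whose image is a slice of the action.

For such a section three facts suffice. First, σ is symplectic at fixed time. Second, orbit
directions are symplectically orthogonal to the moment level, which is the moment map property of
the commutator (`sympl_adP`). Third, on the slice the Hamiltonian vector of H is, up to an orbit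
direction, the velocity of σ along the flow of H'. Since (1, X_H) lies in the kernel of Tr(dp ∧ dq)
- dH ∧ dt (`extForm_eq`), these facts give the equality of the forms (`Slice.form_eq`) and of the
dynamics (`Slice.dynamics`).

In cases 2, 3 and 6–8 the third fact holds only up to a multiple of the field x ↦ [[P, Q], x]. Its
flow is the conjugation by exp(c[P, Q]), generated up to sign by the Hamiltonian Tr[P, Q]²/2, hence
symplectic (`sympl_conjComm`). The flow of H' conserves [P, Q], so the conjugation with c(t) a
multiple of log t removes the extra term (`Slice.conj_exp`).

The comparison of the vector fields is a finite list of identities between noncommutative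
polynomials. The fields are therefore defined over an arbitrary ℂ-algebra R, and block matrices are
treated as d × d matrices over R (`vecII_linBlk`, `vecV_linBlk`, `vecIIID6_linBlk`,
`vecIV_fixBlkIV`, `doffV_eq`, `vecV_target`). For cases 6–8 they are verified in a sheared frame,
where q is a companion matrix (`vecVI_shBlk`, `vecVI_target`, `dnlBlk_eq`, and their analogues).

Density rests on determinants being polynomials along a line. Where w is affine, the fixed points
form an affine space. In cases 6–8 the matrix T = S₂q satisfies T² = t and the fixed point equations
are invariant under conjugation of (pS₂, S₂q); if Tr T = 0 then T is conjugate to a model matrix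
with the required invertible blocks (`dense_genNL`). -/

theorem hasDerivAt_comp {E F : Type*} [NormedAddCommGroup E] [NormedSpace ℂ E]
    [NormedAddCommGroup F] [NormedSpace ℂ F] {f : E → F} {f' : E →L[ℂ] F} {γ : ℂ → E} {γ' : E}
    {z : ℂ} (hf : HasFDerivAt f f' (γ z)) (h : HasDerivAt γ γ' z) :
    HasDerivAt (fun ε => f (γ ε)) (f' γ') z := hf.comp_hasDerivAt z h

theorem differentiableOn_comp_fst {E F : Type*} [NormedAddCommGroup E] [NormedSpace ℂ E]
    [NormedAddCommGroup F] [NormedSpace ℂ F] {f : ℂ → F} {D : Set ℂ} (hf : DifferentiableOn ℂ f D)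
    (V : Set E) : DifferentiableOn ℂ (fun z : ℂ × E => f z.1) (D ×ˢ V) :=
  hf.comp differentiableOn_fst Set.mapsTo_fst_prod

/-! ### Conjugation -/

section Conjugation

variable {m : Type} [Fintype m] [DecidableEq m]

/-- Conjugation by a unit, as an algebra homomorphism. -/
def conjAlg (u : (Matrix m m ℂ)ˣ) : Matrix m m ℂ →ₐ[ℂ] Matrix m m ℂ where
  toFun A := u * A * (u⁻¹ : (Matrix m m ℂ)ˣ)
  map_one' := by simp
  map_mul' A B := by simp [mul_assoc]
  map_zero' := by simp
  map_add' A B := by simp [mul_add, add_mul]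
  commutes' r := by simp [Algebra.algebraMap_eq_smul_one]

theorem conjAlg_apply (u : (Matrix m m ℂ)ˣ) (A : Matrix m m ℂ) :
    conjAlg u A = u * A * (u⁻¹ : (Matrix m m ℂ)ˣ) := rfl

theorem conjAlg_mul (u v : (Matrix m m ℂ)ˣ) (A : Matrix m m ℂ) :
    conjAlg (u * v) A = conjAlg u (conjAlg v A) := by
  simp [conjAlg_apply, mul_assoc]

@[simp] theorem conjAlg_one (A : Matrix m m ℂ) : conjAlg 1 A = A := by simp [conjAlg_apply]

@[simp] theorem trace_conjAlg (u : (Matrix m m ℂ)ˣ) (A : Matrix m m ℂ) :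
    trace (conjAlg u A) = trace A := by
  rw [conjAlg_apply, trace_mul_comm, ← mul_assoc]; simp

theorem isUnit_conjAlg {u : (Matrix m m ℂ)ˣ} {A : Matrix m m ℂ} (h : IsUnit A) :
    IsUnit (conjAlg u A) := h.map _

theorem conjAlg_inv (u : (Matrix m m ℂ)ˣ) (A : Matrix m m ℂ) :
    conjAlg u A⁻¹ = (conjAlg u A)⁻¹ := by
  rw [conjAlg_apply, conjAlg_apply, Matrix.mul_inv_rev, Matrix.mul_inv_rev,
    ← Matrix.coe_units_inv, ← Matrix.coe_units_inv, inv_inv, mul_assoc]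

/-- Simultaneous conjugation by a unit. -/
def conjP (u : (Matrix m m ℂ)ˣ) : Phase m →ₗ[ℂ] Phase m :=
  (conjAlg u).toLinearMap.prodMap (conjAlg u).toLinearMap

theorem conjP_apply (u : (Matrix m m ℂ)ˣ) (x : Phase m) :
    conjP u x = (conjAlg u x.1, conjAlg u x.2) := rfl

@[simp] theorem conjP_fst (u : (Matrix m m ℂ)ˣ) (x : Phase m) :
    (conjP u x).1 = conjAlg u x.1 := rfl

@[simp] theorem conjP_snd (u : (Matrix m m ℂ)ˣ) (x : Phase m) :
    (conjP u x).2 = conjAlg u x.2 := rfl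

theorem conjP_mul (u v : (Matrix m m ℂ)ˣ) (x : Phase m) :
    conjP (u * v) x = conjP u (conjP v x) := by
  simp [conjP_apply, conjAlg_mul]

@[simp] theorem conjP_one (x : Phase m) : conjP 1 x = x := by simp [conjP_apply]

@[simp] theorem conjP_inv_conjP (u : (Matrix m m ℂ)ˣ) (x : Phase m) :
    conjP u⁻¹ (conjP u x) = x := by simp [← conjP_mul]

@[simp] theorem conjP_conjP_inv (u : (Matrix m m ℂ)ˣ) (x : Phase m) :
    conjP u (conjP u⁻¹ x) = x := by simp [← conjP_mul]

theorem hasDerivAt_conjP (u : (Matrix m m ℂ)ˣ) {y : ℂ → Phase m} {y' : Phase m} {z : ℂ}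
    (h : HasDerivAt y y' z) : HasDerivAt (fun ε => conjP u (y ε)) (conjP u y') z :=
  (LinearMap.toContinuousLinearMap (conjP u)).hasFDerivAt.comp_hasDerivAt z h

theorem comm_conjP (u : (Matrix m m ℂ)ˣ) (x : Phase m) :
    comm (conjP u x) = conjAlg u (comm x) := by
  simp [comm]

/-! ### The symplectic form -/

theorem sympl_conjP (u : (Matrix m m ℂ)ˣ) (x y : Phase m) :
    sympl (conjP u x) (conjP u y) = sympl x y := by
  simp only [sympl, conjP_fst, conjP_snd, ← map_mul, trace_conjAlg]

theorem sympl_add_left (x y z : Phase m) : sympl (x + y) z = sympl x z + sympl y z := by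
  simp only [sympl, Prod.fst_add, Prod.snd_add, add_mul, mul_add, trace_add]; ring

theorem sympl_add_right (x y z : Phase m) : sympl x (y + z) = sympl x y + sympl x z := by
  simp only [sympl, Prod.fst_add, Prod.snd_add, add_mul, mul_add, trace_add]; ring

theorem sympl_sub_left (x y z : Phase m) : sympl (x - y) z = sympl x z - sympl y z := by
  simp only [sympl, Prod.fst_sub, Prod.snd_sub, sub_mul, mul_sub, trace_sub]; ring

theorem sympl_sub_right (x y z : Phase m) : sympl x (y - z) = sympl x y - sympl x z := by
  simp only [sympl, Prod.fst_sub, Prod.snd_sub, sub_mul, mul_sub, trace_sub]; ring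

theorem sympl_smul_left (c : ℂ) (x y : Phase m) : sympl (c • x) y = c * sympl x y := by
  simp only [sympl, Prod.smul_fst, Prod.smul_snd, smul_mul_assoc, mul_smul_comm, trace_smul,
    smul_eq_mul]; ring

theorem sympl_smul_right (c : ℂ) (x y : Phase m) : sympl x (c • y) = c * sympl x y := by
  simp only [sympl, Prod.smul_fst, Prod.smul_snd, smul_mul_assoc, mul_smul_comm, trace_smul,
    smul_eq_mul]; ring

theorem sympl_swap (x y : Phase m) : sympl y x = -sympl x y := by
  simp only [sympl]; ring

theorem sympl_self (x : Phase m) : sympl x x = 0 := by simp [sympl]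

theorem sympl_nondegenerate {v w : Phase m} (h : ∀ u, sympl u v = sympl u w) : v = w := by
  refine Prod.ext (ext_iff_trace_mul_left.2 fun A => ?_) (ext_iff_trace_mul_left.2 fun A => ?_)
  · have := h (0, A)
    simpa [sympl, trace_mul_comm _ A] using this
  · simpa [sympl] using h (A, 0)

theorem IsHamVec.unique {H : ℂ → Phase m → ℂ} {t : ℂ} {x v w : Phase m}
    (hv : IsHamVec H t x v) (hw : IsHamVec H t x w) : v = w :=
  sympl_nondegenerate fun u => (hv u).unique (hw u)

/-- Invariance of a Hamiltonian under simultaneous conjugation. -/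
def ConjInvariant (H : ℂ → Phase m → ℂ) : Prop := ∀ t u x, H t (conjP u x) = H t x

theorem IsHamVec.conjP {H : ℂ → Phase m → ℂ} (hH : ConjInvariant H) {t : ℂ} {x v : Phase m}
    (hv : IsHamVec H t x v) (u : (Matrix m m ℂ)ˣ) :
    IsHamVec H t (conjP u x) (conjP u v) := by
  intro w
  have := hv (MatrixPainleve.conjP u⁻¹ w)
  rw [← sympl_conjP u, conjP_conjP_inv] at this
  convert! this using 2 with ε
  rw [← hH t u (x + _), map_add, map_smul, conjP_conjP_inv]

/-- The vector (1, v) is in the kernel of the form, so each tangent vector may be replaced by its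
difference with a multiple of (1, v), which has no time component. -/
theorem extForm_eq {H : ℂ → Phase m → ℂ} {t : ℂ} {x v : Phase m} (hv : IsHamVec H t x v)
    (a b : ℂ × Phase m) :
    extForm H (t, x) a b = sympl (a.2 - a.1 • v) (b.2 - b.1 • v) := by
  have h : ∀ u, deriv (fun ε : ℂ => H t (x + ε • u)) 0 = sympl u v := fun u => (hv u).deriv
  simp only [extForm, h, sympl_sub_left, sympl_sub_right, sympl_smul_left, sympl_smul_right,
    sympl_self, sympl_swap b.2 v]
  ring

/-! ### Infinitesimal conjugation and the commutator -/

/-- The infinitesimal simultaneous conjugation. -/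
def adP (ξ : Matrix m m ℂ) (x : Phase m) : Phase m := (ξ * x.1 - x.1 * ξ, ξ * x.2 - x.2 * ξ)

/-- The derivative of the commutator. -/
def dcomm (x u : Phase m) : Matrix m m ℂ := u.1 * x.2 + x.1 * u.2 - (u.2 * x.1 + x.2 * u.1)

theorem hasDerivAt_matrix_mul {A B : ℂ → Matrix m m ℂ} {A' B' : Matrix m m ℂ} {z : ℂ}
    (hA : HasDerivAt A A' z) (hB : HasDerivAt B B' z) :
    HasDerivAt (fun ε => A ε * B ε) (A' * B z + A z * B') z := hA.mul hB

theorem hasDerivAt_comm {x : ℂ → Phase m} {x' : Phase m} {z : ℂ} (h : HasDerivAt x x' z) :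
    HasDerivAt (fun ε => comm (x ε)) (dcomm (x z) x') z := by
  have h1 : HasDerivAt (fun ε => (x ε).1) x'.1 z := h.fst
  have h2 : HasDerivAt (fun ε => (x ε).2) x'.2 z := h.snd
  exact (h1.mul h2).sub (h2.mul h1)

/-- The commutator is the moment map of simultaneous conjugation: the right side is the derivative
of Tr(ξ[p, q]) along u. Only cyclicity of the trace is needed. -/
theorem sympl_adP (ξ : Matrix m m ℂ) (x u : Phase m) :
    sympl (adP ξ x) u = trace (ξ * dcomm x u) := by
  simp only [sympl, adP, dcomm, sub_mul, mul_sub, mul_add, trace_sub, trace_add]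
  have h3 := trace_mul_cycle' u.1 x.2 ξ
  have h4 := trace_mul_cycle' ξ u.2 x.1
  have h5 := trace_mul_cycle' ξ x.2 u.1
  simp only [← mul_assoc] at h3 h4 h5 ⊢
  linear_combination h3 + h4 + h5

theorem adP_sub_left (ξ ζ : Matrix m m ℂ) (x : Phase m) : adP (ξ - ζ) x = adP ξ x - adP ζ x := by
  ext : 1 <;> simp only [adP, Prod.fst_sub, Prod.snd_sub] <;> noncomm_ring

theorem hasDerivAt_trace {A : ℂ → Matrix m m ℂ} {A' : Matrix m m ℂ} {z : ℂ}
    (h : HasDerivAt A A' z) : HasDerivAt (fun ε => trace (A ε)) (trace A') z :=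
  (LinearMap.toContinuousLinearMap (traceLinearMap m ℂ ℂ)).hasFDerivAt.comp_hasDerivAt z h

theorem hasDerivAt_matrix_inv {A : ℂ → Matrix m m ℂ} {A' : Matrix m m ℂ} {z : ℂ}
    (h : HasDerivAt A A' z) (hA : IsUnit (A z)) :
    HasDerivAt (fun ε => (A ε)⁻¹) (-((A z)⁻¹ * A' * (A z)⁻¹)) z := by
  obtain ⟨u, hu⟩ := hA
  simp only [nonsing_inv_eq_ringInverse]
  have := (hu ▸ hasFDerivAt_ringInverse (𝕜 := ℂ) u).comp_hasDerivAt z h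
  convert! this using 1
  simp [← hu]

theorem differentiableAt_matrix_inv {A : Matrix m m ℂ} (hA : IsUnit A) :
    DifferentiableAt ℂ (fun B : Matrix m m ℂ => B⁻¹) A := by
  simp only [nonsing_inv_eq_ringInverse]
  exact differentiableAt_inverse hA

theorem isOpen_isUnit_matrix : IsOpen {A : Matrix m m ℂ | IsUnit A} := Units.isOpen

theorem hasDerivAt_fst {x : ℂ → Phase m} {x' : Phase m}
    {z : ℂ} (h : HasDerivAt x x' z) : HasDerivAt (fun ε => (x ε).1) x'.1 z := h.fst

theorem hasDerivAt_snd {x : ℂ → Phase m} {x' : Phase m}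
    {z : ℂ} (h : HasDerivAt x x' z) : HasDerivAt (fun ε => (x ε).2) x'.2 z := h.snd

/-- The exponential, as a unit. -/
def expUnit (A : Matrix m m ℂ) : (Matrix m m ℂ)ˣ where
  val := NormedSpace.exp A
  inv := NormedSpace.exp (-A)
  val_inv := by
    rw [Matrix.exp_neg, mul_nonsing_inv _ ((isUnit_iff_isUnit_det _).1 (Matrix.isUnit_exp A))]
  inv_val := by
    rw [Matrix.exp_neg, nonsing_inv_mul _ ((isUnit_iff_isUnit_det _).1 (Matrix.isUnit_exp A))]

theorem hasDerivAt_exp_smul (A : Matrix m m ℂ) :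
    HasDerivAt (fun ε : ℂ => NormedSpace.exp (ε • A)) A 0 := by
  have h := hasDerivAt_exp_smul_const A (0 : ℂ)
  rw [zero_smul, NormedSpace.exp_zero, one_mul] at h
  exact h

end Conjugation

/-! ### Blocks -/

section Blocks

variable {n d : ℕ}

/-- The decomposition into blocks, as an isomorphism of algebras. -/
def blkAlg (n d : ℕ) : Matrix (Fin n × Fin d) (Fin n × Fin d) ℂ ≃ₐ[ℂ]
    Matrix (Fin d) (Fin d) (Matrix (Fin n) (Fin n) ℂ) :=
  (reindexAlgEquiv ℂ ℂ (Equiv.prodComm (Fin n) (Fin d))).trans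
    (compAlgEquiv (Fin d) (Fin n) ℂ ℂ).symm

theorem blkAlg_apply (A : Matrix (Fin n × Fin d) (Fin n × Fin d) ℂ) (i j : Fin d) :
    blkAlg n d A i j = blk A i j := rfl

theorem blk_injective {A B : Matrix (Fin n × Fin d) (Fin n × Fin d) ℂ}
    (h : ∀ i j, blk A i j = blk B i j) : A = B :=
  (blkAlg n d).injective (Matrix.ext h)

theorem blk_symm (B : Matrix (Fin d) (Fin d) (Matrix (Fin n) (Fin n) ℂ)) (i j : Fin d) :
    blk ((blkAlg n d).symm B) i j = B i j := by
  rw [← blkAlg_apply, AlgEquiv.apply_symm_apply]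

theorem blk_mul (A B : Matrix (Fin n × Fin d) (Fin n × Fin d) ℂ) (i j : Fin d) :
    blk (A * B) i j = ∑ k, blk A i k * blk B k j := by
  simp only [← blkAlg_apply, map_mul, Matrix.mul_apply]

theorem blk_add (A B : Matrix (Fin n × Fin d) (Fin n × Fin d) ℂ) (i j : Fin d) :
    blk (A + B) i j = blk A i j + blk B i j := rfl

theorem blk_sub (A B : Matrix (Fin n × Fin d) (Fin n × Fin d) ℂ) (i j : Fin d) :
    blk (A - B) i j = blk A i j - blk B i j := rfl

theorem blk_neg (A : Matrix (Fin n × Fin d) (Fin n × Fin d) ℂ) (i j : Fin d) :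
    blk (-A) i j = -blk A i j := rfl

theorem blk_smul (c : ℂ) (A : Matrix (Fin n × Fin d) (Fin n × Fin d) ℂ) (i j : Fin d) :
    blk (c • A) i j = c • blk A i j := rfl

theorem blk_one (i j : Fin d) :
    blk (1 : Matrix (Fin n × Fin d) (Fin n × Fin d) ℂ) i j = if i = j then 1 else 0 := by
  rw [← blkAlg_apply, map_one, Matrix.one_apply]

theorem blk_blockDiagonal (ξ : Fin d → Matrix (Fin n) (Fin n) ℂ) (i j : Fin d) :
    blk (blockDiagonal ξ) i j = if i = j then ξ i else 0 := by
  ext a b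
  by_cases h : i = j <;> simp [blk, blockDiagonal_apply, h]

theorem trace_eq_sum_blk (A : Matrix (Fin n × Fin d) (Fin n × Fin d) ℂ) :
    trace A = ∑ i, trace (blk A i i) := by
  simp only [trace, diag, blk, submatrix_apply, Fintype.sum_prod_type]
  exact Finset.sum_comm

theorem trace_blockDiagonal_mul (ξ : Fin d → Matrix (Fin n) (Fin n) ℂ)
    (A : Matrix (Fin n × Fin d) (Fin n × Fin d) ℂ) :
    trace (blockDiagonal ξ * A) = ∑ i, trace (ξ i * blk A i i) := by
  simp [trace_eq_sum_blk, blk_mul, blk_blockDiagonal]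

theorem infGauge_eq (ξ : Fin d → Matrix (Fin n) (Fin n) ℂ) (x : Phase (Fin n × Fin d)) :
    infGauge ξ x = adP (blockDiagonal ξ) x := rfl

theorem hasDerivAt_moment (ξ : Fin d → Matrix (Fin n) (Fin n) ℂ)
    {x : ℂ → Phase (Fin n × Fin d)} {x' : Phase (Fin n × Fin d)} {z : ℂ}
    (h : HasDerivAt x x' z) :
    HasDerivAt (fun ε => ∑ i, trace (ξ i * moment (x ε) i)) (sympl (infGauge ξ (x z)) x') z := by
  simp only [moment, ← trace_blockDiagonal_mul, infGauge_eq, sympl_adP]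
  exact hasDerivAt_trace ((hasDerivAt_comm h).const_mul _)

theorem hasDerivAt_line {m : Type} [Fintype m] (x u : Phase m) :
    HasDerivAt (fun ε : ℂ => x + ε • u) u 0 := by
  have := ((hasDerivAt_id (0 : ℂ)).smul_const u).const_add x
  rwa [one_smul] at this

/-- The block diagonal matrix with the given invertible blocks. -/
def blockUnit (h : Fin d → GL (Fin n) ℂ) : (Matrix (Fin n × Fin d) (Fin n × Fin d) ℂ)ˣ where
  val := blockDiagonal fun i => (h i : Matrix (Fin n) (Fin n) ℂ)
  inv := blockDiagonal fun i => ((h i)⁻¹ : GL (Fin n) ℂ).1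
  val_inv := by
    rw [← blockDiagonal_mul, ← blockDiagonal_one]; congr 1; ext1 i; exact (h i).mul_inv
  inv_val := by
    rw [← blockDiagonal_mul, ← blockDiagonal_one]; congr 1; ext1 i; exact (h i).inv_mul

theorem gauge_eq (h : Fin d → GL (Fin n) ℂ) (x : Phase (Fin n × Fin d)) :
    gauge h x = conjP (blockUnit h) x := rfl

theorem blockUnit_inv (h : Fin d → GL (Fin n) ℂ) : blockUnit h⁻¹ = (blockUnit h)⁻¹ := by
  ext1; simp [blockUnit]

theorem blk_conjAlg (h : Fin d → GL (Fin n) ℂ) (A : Matrix (Fin n × Fin d) (Fin n × Fin d) ℂ)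
    (i j : Fin d) :
    blk (conjAlg (blockUnit h) A) i j =
      (h i : Matrix (Fin n) (Fin n) ℂ) * blk A i j * ((h j)⁻¹ : GL (Fin n) ℂ).1 := by
  have : conjAlg (blockUnit h) A = blockDiagonal (fun i => (h i : Matrix (Fin n) (Fin n) ℂ)) * A *
    blockDiagonal fun i => ((h i)⁻¹ : GL (Fin n) ℂ).1 := rfl
  simp [this, blk_mul, blk_blockDiagonal]

/-- The twist as a unit. -/
def twistUnit (n d : ℕ) : (Matrix (Fin n × Fin d) (Fin n × Fin d) ℂ)ˣ where
  val := twist n d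
  inv := diagonal fun a => (Complex.exp (2 * Real.pi * Complex.I / d) ^ (a.2 : ℕ))⁻¹
  val_inv := by
    rw [twist, diagonal_mul_diagonal, ← diagonal_one]; congr 1; ext a
    exact mul_inv_cancel₀ (pow_ne_zero _ (Complex.exp_ne_zero _))
  inv_val := by
    rw [twist, diagonal_mul_diagonal, ← diagonal_one]; congr 1; ext a
    exact inv_mul_cancel₀ (pow_ne_zero _ (Complex.exp_ne_zero _))

theorem mem_fixedSet {reg : Set (Phase (Fin n × Fin d))}
    {w : ℂ → Phase (Fin n × Fin d) → Phase (Fin n × Fin d)} {t : ℂ} {x : Phase (Fin n × Fin d)} :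
    x ∈ fixedSet reg w t ↔ x ∈ reg ∧ conjP (twistUnit n d) x = w t x := by
  have : (twist n d)⁻¹ = ((twistUnit n d)⁻¹ : (Matrix _ _ ℂ)ˣ) :=
    (Matrix.coe_units_inv (twistUnit n d)).symm
  rw [Prod.ext_iff, fixedSet, Set.mem_ofPred_eq, this]
  rfl

theorem twist_blockDiagonal (ξ : Fin d → Matrix (Fin n) (Fin n) ℂ) :
    twist n d * blockDiagonal ξ = blockDiagonal ξ * twist n d := by
  ext ⟨a, i⟩ ⟨b, j⟩
  by_cases h : i = j <;> simp [twist, blockDiagonal_apply, h, mul_comm]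

theorem blk_conjAlg_twist (A : Matrix (Fin n × Fin d) (Fin n × Fin d) ℂ) (i j : Fin d) :
    blk (conjAlg (twistUnit n d) A) i j =
      (Complex.exp (2 * Real.pi * Complex.I / d) ^ (i : ℕ) *
        (Complex.exp (2 * Real.pi * Complex.I / d) ^ (j : ℕ))⁻¹) • blk A i j := by
  have : conjAlg (twistUnit n d) A = twist n d * A *
    diagonal fun a => (Complex.exp (2 * Real.pi * Complex.I / d) ^ (a.2 : ℕ))⁻¹ := rfl
  ext a b
  simp [this, blk, twist, mul_diagonal, diagonal_mul, smul_eq_mul]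
  ring

/-- Conjugation by the twist multiplies the block (i, j) by ζ^(i-j), and this is not 1 off the
diagonal because ζ is a primitive d-th root of unity. -/
theorem blk_eq_zero_of_commute_twist {A : Matrix (Fin n × Fin d) (Fin n × Fin d) ℂ}
    (h : conjAlg (twistUnit n d) A = A) {i j : Fin d} (hij : i ≠ j) : blk A i j = 0 := by
  have h1 := blk_conjAlg_twist A i j
  rw [h] at h1
  set ζ := Complex.exp (2 * Real.pi * Complex.I / d)
  have hζ : ζ ≠ 0 := Complex.exp_ne_zero _
  have hd : d ≠ 0 := by rintro rfl; exact i.elim0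
  have h2 : ζ ^ (i : ℕ) * (ζ ^ (j : ℕ))⁻¹ ≠ 1 := by
    intro h3
    rw [mul_inv_eq_one₀ (pow_ne_zero _ hζ)] at h3
    exact hij (Fin.ext ((Complex.isPrimitiveRoot_exp d hd).pow_inj i.2 j.2 h3))
  have h3 : (ζ ^ (i : ℕ) * (ζ ^ (j : ℕ))⁻¹ - 1) • blk A i j = 0 := by
    rw [sub_smul, one_smul, ← h1, sub_self]
  exact (smul_eq_zero.1 h3).resolve_left (sub_ne_zero.2 h2)

theorem hasDerivAt_blockDiagonal {ξ : ℂ → Fin d → Matrix (Fin n) (Fin n) ℂ}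
    {ξ' : Fin d → Matrix (Fin n) (Fin n) ℂ} {z : ℂ} (h : HasDerivAt ξ ξ' z) :
    HasDerivAt (fun ε => blockDiagonal (ξ ε)) (blockDiagonal ξ') z := by
  let L : (Fin d → Matrix (Fin n) (Fin n) ℂ) →ₗ[ℂ] Matrix (Fin n × Fin d) (Fin n × Fin d) ℂ :=
    { toFun := blockDiagonal
      map_add' := blockDiagonal_add
      map_smul' := blockDiagonal_smul }
  exact (LinearMap.toContinuousLinearMap L).hasFDerivAt.comp_hasDerivAt z h

theorem infGauge_zero_left (x : Phase (Fin n × Fin d)) : infGauge 0 x = 0 := by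
  simp [infGauge]

theorem infGauge_sub_left (ξ ζ : Fin d → Matrix (Fin n) (Fin n) ℂ) (x : Phase (Fin n × Fin d)) :
    infGauge (ξ - ζ) x = infGauge ξ x - infGauge ζ x := by
  rw [infGauge_eq, blockDiagonal_sub, adP_sub_left]; rfl

theorem infGauge_smul_left (a : ℂ) (ξ : Fin d → Matrix (Fin n) (Fin n) ℂ)
    (x : Phase (Fin n × Fin d)) : infGauge (a • ξ) x = a • infGauge ξ x := by
  simp [infGauge, blockDiagonal_smul, smul_sub]

end Blocks


/-! ### Reductions from a slice -/

section Slice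

variable {n d : ℕ} [NeZero d]

/-- The domain of the reduction at time `t`. -/
def redSet (reg : Set (Phase (Fin n × Fin d)))
    (w : ℂ → Phase (Fin n × Fin d) → Phase (Fin n × Fin d)) (g : Fin d → ℂ)
    (gen : Set (Phase (Fin n × Fin d))) (t : ℂ) : Set (Phase (Fin n × Fin d)) :=
  fixedSet reg w t ∩ momentLevel g ∩ gen

/-- A slice `σ` of the gauge group action on the domain of a reduction `Φ`, with the gauge
transformation `η` that moves a point to the slice. The Hamiltonian vector of `H` on the slice is,
up to a gauge direction, the image of the one of `H'` plus the velocity of the conjugation by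
`exp (-c(t) [P, Q])`. -/
structure Slice (D : Set ℂ) (H : ℂ → Phase (Fin n × Fin d) → ℂ)
    (reg : Set (Phase (Fin n × Fin d)))
    (w : ℂ → Phase (Fin n × Fin d) → Phase (Fin n × Fin d))
    (g : Fin d → ℂ) (gen : Set (Phase (Fin n × Fin d)))
    (H' : ℂ → Phase (Fin n) → ℂ) (V : Set (Phase (Fin n)))
    (s : ℂ → ℂ) (Φ : ℂ → Phase (Fin n × Fin d) → Phase (Fin n)) (c : ℂ → ℂ)
    (η : Phase (Fin n × Fin d) → Fin d → Matrix (Fin n) (Fin n) ℂ)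
    (σ : ℂ → Phase (Fin n) → Phase (Fin n × Fin d)) : Prop where
  isOpen_time : IsOpen D
  isOpen_gen : IsOpen gen
  dense_gen : ∀ t ∈ D, fixedSet reg w t ∩ {x | trace (twist n d * x.2) = 0} ⊆
    closure (fixedSet reg w t ∩ gen)
  comm_w : ∀ t ∈ D, ∀ x ∈ reg, comm (w t x) = comm x
  conj_reg : ∀ u, ∀ x ∈ reg, conjP u x ∈ reg
  conj_w : ∀ t ∈ D, ∀ u, ∀ x ∈ reg, w t (conjP u x) = conjP u (w t x)
  gauge_gen : ∀ h, ∀ x ∈ gen, gauge h x ∈ gen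
  η_diff : DifferentiableOn ℂ η gen
  η_zero : ∀ x, η x 0 = 1
  η_unit : ∀ x ∈ gen, ∀ i, IsUnit (η x i)
  η_gauge : ∀ x ∈ gen, ∀ h : Fin d → GL (Fin n) ℂ, h 0 = 1 → ∀ i,
    η (gauge h x) i = η x i * ((h i)⁻¹ : GL (Fin n) ℂ).1
  Φ_gauge : ∀ t ∈ D, ∀ x ∈ gen, ∀ h : Fin d → GL (Fin n) ℂ, h 0 = 1 → Φ t (gauge h x) = Φ t x
  slice_eq : ∀ t ∈ D, ∀ x ∈ redSet reg w g gen t, (∀ i, η x i = 1) →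
    Φ t x ∈ V ∧ σ t (Φ t x) = x
  section_mem : ∀ t ∈ D, ∀ y ∈ V, σ t y ∈ redSet reg w g gen t ∧ Φ t (σ t y) = y
  isOpen_image : IsOpen V
  dense_image : Dense V
  conj_image : ∀ u, ∀ y ∈ V, conjP u y ∈ V
  holo_time : DifferentiableOn ℂ s D
  deriv_time : ∀ t ∈ D, deriv s t ≠ 0
  holo_conj : DifferentiableOn ℂ c D
  holo : DifferentiableOn ℂ (fun z : ℂ × Phase (Fin n × Fin d) => Φ z.1 z.2) (D ×ˢ gen)
  holo_section : DifferentiableOn ℂ (fun z : ℂ × Phase (Fin n) => σ z.1 z.2) (D ×ˢ V)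
  sympl_section : ∀ t ∈ D, ∀ y ∈ V, ∀ u u', ∃ v v',
    HasDerivAt (fun ε : ℂ => σ t (y + ε • u)) v 0 ∧
    HasDerivAt (fun ε : ℂ => σ t (y + ε • u')) v' 0 ∧ sympl v v' = sympl u u'
  conj_ham : ConjInvariant H
  conj_ham' : ConjInvariant H'
  ham : ∀ t ∈ D, ∀ y ∈ V, ∃ v v' ξ, ξ 0 = 0 ∧ IsHamVec H t (σ t y) v ∧ IsHamVec H' (s t) y v' ∧
    HasDerivAt (fun ε : ℂ => σ (t + ε) (y + ε • (deriv s t • v' - deriv c t • adP (comm y) y)))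
      (v + infGauge ξ (σ t y)) 0

variable {D : Set ℂ} {H : ℂ → Phase (Fin n × Fin d) → ℂ} {reg : Set (Phase (Fin n × Fin d))}
  {w : ℂ → Phase (Fin n × Fin d) → Phase (Fin n × Fin d)}
  {g : Fin d → ℂ} {gen : Set (Phase (Fin n × Fin d))}
  {H' : ℂ → Phase (Fin n) → ℂ} {V : Set (Phase (Fin n))}
  {s : ℂ → ℂ} {Φ : ℂ → Phase (Fin n × Fin d) → Phase (Fin n)} {c : ℂ → ℂ}
  {η : Phase (Fin n × Fin d) → Fin d → Matrix (Fin n) (Fin n) ℂ}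
  {σ : ℂ → Phase (Fin n) → Phase (Fin n × Fin d)}

namespace Slice

/-- Block diagonal matrices commute with the twist, and w is equivariant under conjugation. -/
theorem gauge_fixedSet (S : Slice D H reg w g gen H' V s Φ c η σ) {t : ℂ} (ht : t ∈ D)
    {x : Phase (Fin n × Fin d)} (hx : x ∈ fixedSet reg w t) (h : Fin d → GL (Fin n) ℂ) :
    gauge h x ∈ fixedSet reg w t := by
  rw [mem_fixedSet] at hx ⊢
  have hu : twistUnit n d * blockUnit h = blockUnit h * twistUnit n d :=
    Units.ext (twist_blockDiagonal _)
  rw [gauge_eq, ← conjP_mul, hu, conjP_mul, hx.2, S.conj_w t ht _ x hx.1]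
  exact ⟨S.conj_reg _ _ hx.1, rfl⟩

theorem gauge_inv_mul (h k : Fin d → GL (Fin n) ℂ) (x : Phase (Fin n × Fin d)) :
    gauge (fun i => (k i)⁻¹ * h i) x = conjP (blockUnit k)⁻¹ (gauge h x) := by
  have : blockUnit (fun i => (k i)⁻¹ * h i) = (blockUnit k)⁻¹ * blockUnit h :=
    Units.ext (blockDiagonal_mul (fun i => ((k i)⁻¹ : GL (Fin n) ℂ).1) fun i => (h i).1)
  rw [gauge_eq, this, conjP_mul, ← gauge_eq]

theorem gauge_momentLevel {x : Phase (Fin n × Fin d)} (hx : x ∈ momentLevel g)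
    (h : Fin d → GL (Fin n) ℂ) : gauge h x ∈ momentLevel g := by
  intro i hi
  have := hx i hi
  rw [moment] at this ⊢
  rw [gauge_eq, comm_conjP, blk_conjAlg, this]
  simp

theorem gauge_mem (S : Slice D H reg w g gen H' V s Φ c η σ) {t : ℂ} (ht : t ∈ D)
    {x : Phase (Fin n × Fin d)} (hx : x ∈ redSet reg w g gen t) (h : Fin d → GL (Fin n) ℂ) :
    gauge h x ∈ redSet reg w g gen t :=
  ⟨⟨S.gauge_fixedSet ht hx.1.1 h, gauge_momentLevel hx.1.2 h⟩, S.gauge_gen h x hx.2⟩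

/-- The normalizing matrices `η` are invertible and turn the action into right multiplication, so a
stabilizer is trivial. -/
theorem gauge_free (S : Slice D H reg w g gen H' V s Φ c η σ)
    {x : Phase (Fin n × Fin d)} (hx : x ∈ gen) {h : Fin d → GL (Fin n) ℂ} (h0 : h 0 = 1)
    (hg : gauge h x = x) : h = 1 := by
  funext i
  have h1 := S.η_gauge x hx h h0 i
  rw [hg] at h1
  have h2 := (S.η_unit x hx i).mul_left_cancel ((mul_one _).trans h1)
  exact (inv_eq_one.1 (Units.ext h2.symm))

/-- The gauge transformation that moves a point to the slice. -/
def nrm (S : Slice D H reg w g gen H' V s Φ c η σ) {x : Phase (Fin n × Fin d)} (hx : x ∈ gen) :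
    Fin d → GL (Fin n) ℂ := fun i => (S.η_unit x hx i).unit

theorem nrm_zero (S : Slice D H reg w g gen H' V s Φ c η σ) {x : Phase (Fin n × Fin d)}
    (hx : x ∈ gen) : S.nrm hx 0 = 1 := Units.ext (S.η_zero x)

theorem gauge_nrm (S : Slice D H reg w g gen H' V s Φ c η σ) {t : ℂ} (ht : t ∈ D)
    {x : Phase (Fin n × Fin d)} (hx : x ∈ redSet reg w g gen t) :
    Φ t x ∈ V ∧ gauge (S.nrm hx.2) x = σ t (Φ t x) := by
  have := S.slice_eq t ht _ (S.gauge_mem ht hx (S.nrm hx.2)) fun i => by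
    rw [S.η_gauge x hx.2 _ (S.nrm_zero hx.2)]
    exact (S.η_unit x hx.2 i).unit.mul_inv
  rw [S.Φ_gauge t ht x hx.2 _ (S.nrm_zero hx.2)] at this
  exact ⟨this.1, this.2.symm⟩

theorem eq_gauge_section (S : Slice D H reg w g gen H' V s Φ c η σ) {t : ℂ} (ht : t ∈ D)
    {x : Phase (Fin n × Fin d)} (hx : x ∈ redSet reg w g gen t) :
    conjP (blockUnit (S.nrm hx.2))⁻¹ (σ t (Φ t x)) = x := by
  rw [← (S.gauge_nrm ht hx).2, gauge_eq, conjP_inv_conjP]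

theorem image_eq (S : Slice D H reg w g gen H' V s Φ c η σ) {t : ℂ} (ht : t ∈ D) :
    Φ t '' redSet reg w g gen t = V := by
  ext y
  constructor
  · rintro ⟨x, hx, rfl⟩
    exact (S.gauge_nrm ht hx).1
  · intro hy
    exact ⟨σ t y, S.section_mem t ht y hy⟩

theorem fiber_eq (S : Slice D H reg w g gen H' V s Φ c η σ) {t : ℂ} (ht : t ∈ D)
    {x y : Phase (Fin n × Fin d)} (hx : x ∈ redSet reg w g gen t)
    (hy : y ∈ redSet reg w g gen t) :
    Φ t x = Φ t y ↔ ∃ h : Fin d → GL (Fin n) ℂ, h 0 = 1 ∧ gauge h x = y := by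
  constructor
  · intro h
    -- Both points are normalized to the same point of the slice; one normalization followed by the
    -- inverse of the other connects them.
    refine ⟨fun i => (S.nrm hy.2 i)⁻¹ * S.nrm hx.2 i, ?_, ?_⟩
    · exact (congrArg₂ (fun a b => a⁻¹ * b) (S.nrm_zero hy.2) (S.nrm_zero hx.2)).trans (by simp)
    · rw [gauge_inv_mul, (S.gauge_nrm ht hx).2, h, S.eq_gauge_section ht hy]
  · rintro ⟨h, h0, rfl⟩
    exact (S.Φ_gauge t ht x hx.2 h h0).symm

/-- The domain of the reduction in the extended phase space. -/
abbrev total (_ : Slice D H reg w g gen H' V s Φ c η σ) : Set (ℂ × Phase (Fin n × Fin d)) :=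
  {z | z.1 ∈ D ∧ z.2 ∈ redSet reg w g gen z.1}

/-- The equivalence, including the time change. -/
abbrev full (_ : Slice D H reg w g gen H' V s Φ c η σ) (z : ℂ × Phase (Fin n × Fin d)) :
    ℂ × Phase (Fin n) := (s z.1, Φ z.1 z.2)

theorem differentiableAt_map (S : Slice D H reg w g gen H' V s Φ c η σ) {t : ℂ} (ht : t ∈ D)
    {x : Phase (Fin n × Fin d)} (hx : x ∈ gen) :
    DifferentiableAt ℂ (fun z : ℂ × Phase (Fin n × Fin d) => Φ z.1 z.2) (t, x) :=
  S.holo.differentiableAt ((S.isOpen_time.prod S.isOpen_gen).mem_nhds ⟨ht, hx⟩)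

theorem differentiableAt_section (S : Slice D H reg w g gen H' V s Φ c η σ) {t : ℂ} (ht : t ∈ D)
    {y : Phase (Fin n)} (hy : y ∈ V) :
    DifferentiableAt ℂ (fun z : ℂ × Phase (Fin n) => σ z.1 z.2) (t, y) :=
  S.holo_section.differentiableAt ((S.isOpen_time.prod S.isOpen_image).mem_nhds ⟨ht, hy⟩)

theorem hasFDerivAt_full (S : Slice D H reg w g gen H' V s Φ c η σ) {t : ℂ} (ht : t ∈ D)
    {x : Phase (Fin n × Fin d)} (hx : x ∈ gen) :
    HasFDerivAt S.full (fderiv ℂ S.full (t, x)) (t, x) := by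
  refine DifferentiableAt.hasFDerivAt (DifferentiableAt.prodMk ?_ (S.differentiableAt_map ht hx))
  have : DifferentiableAt ℂ s t := S.holo_time.differentiableAt (S.isOpen_time.mem_nhds ht)
  exact DifferentiableAt.comp (𝕜 := ℂ) (g := s) (t, x) this differentiableAt_fst

theorem hasDerivAt_full (S : Slice D H reg w g gen H' V s Φ c η σ) {t : ℂ} (ht : t ∈ D)
    {x : Phase (Fin n × Fin d)} (hx : x ∈ gen) {γ : ℂ → ℂ × Phase (Fin n × Fin d)}
    {a : ℂ × Phase (Fin n × Fin d)} {z : ℂ} (h0 : γ z = (t, x)) (h : HasDerivAt γ a z) :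
    HasDerivAt (fun ε => S.full (γ ε)) (fderiv ℂ S.full (t, x) a) z := by
  have := S.hasFDerivAt_full ht hx
  rw [← h0] at this ⊢
  exact this.comp_hasDerivAt z h

theorem hasDerivAt_map (S : Slice D H reg w g gen H' V s Φ c η σ) {t : ℂ} (ht : t ∈ D)
    {x : Phase (Fin n × Fin d)} (hx : x ∈ gen) {γ : ℂ → ℂ × Phase (Fin n × Fin d)}
    {a : ℂ × Phase (Fin n × Fin d)} {z : ℂ} (h0 : γ z = (t, x)) (h : HasDerivAt γ a z) :
    HasDerivAt (fun ε => Φ (γ ε).1 (γ ε).2) (fderiv ℂ S.full (t, x) a).2 z :=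
  (S.hasDerivAt_full ht hx h0 h).snd

theorem fderiv_full_fst (S : Slice D H reg w g gen H' V s Φ c η σ) {t : ℂ} (ht : t ∈ D)
    {x : Phase (Fin n × Fin d)} (hx : x ∈ gen) (a : ℂ × Phase (Fin n × Fin d)) :
    (fderiv ℂ S.full (t, x) a).1 = a.1 * deriv s t := by
  have h1 : HasDerivAt (fun ε : ℂ => (t, x) + ε • a) a 0 := by
    have := ((hasDerivAt_id (0 : ℂ)).smul_const a).const_add (t, x)
    rwa [one_smul] at this
  have h2 : HasDerivAt (fun ε : ℂ => s ((t, x) + ε • a).1) (fderiv ℂ S.full (t, x) a).1 0 :=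
    (S.hasDerivAt_full ht hx (by simp) h1).fst
  have h3 : HasDerivAt s (deriv s t) (t + 0 * a.1) := by
    rw [zero_mul, add_zero]
    exact (S.holo_time.differentiableAt (S.isOpen_time.mem_nhds ht)).hasDerivAt
  have h4 : HasDerivAt (fun ε : ℂ => t + ε * a.1) a.1 0 := by
    simpa using ((hasDerivAt_id (0 : ℂ)).mul_const a.1).const_add t
  have h5 := h3.comp (0 : ℂ) h4
  rw [mul_comm]
  exact h2.unique h5

theorem hasDerivAt_section (S : Slice D H reg w g gen H' V s Φ c η σ) {t : ℂ} (ht : t ∈ D)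
    {y : Phase (Fin n)} (hy : y ∈ V) {γ : ℂ → ℂ × Phase (Fin n)}
    {a : ℂ × Phase (Fin n)} {z : ℂ} (h0 : γ z = (t, y)) (h : HasDerivAt γ a z) :
    HasDerivAt (fun ε => σ (γ ε).1 (γ ε).2)
      (fderiv ℂ (fun z : ℂ × Phase (Fin n) => σ z.1 z.2) (t, y) a) z := by
  have := (S.differentiableAt_section ht hy).hasFDerivAt
  rw [← h0] at this ⊢
  exact this.comp_hasDerivAt z h

/-- The left side is the derivative of the moment pairing along a curve in the domain. The blocks
other than the first are constant there, and ξ 0 = 0 removes the first one, whose value is not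
prescribed. -/
theorem sympl_infGauge_tangent (S : Slice D H reg w g gen H' V s Φ c η σ) {t : ℂ}
    {x : Phase (Fin n × Fin d)} {a : ℂ × Phase (Fin n × Fin d)}
    (ha : IsTangent S.total (t, x) a) (ξ : Fin d → Matrix (Fin n) (Fin n) ℂ) (hξ : ξ 0 = 0) :
    sympl (infGauge ξ x) a.2 = 0 := by
  obtain ⟨γ, h0, hγ, h1⟩ := ha
  have h2 := hasDerivAt_moment ξ h1.snd
  rw [h0] at h2
  refine h2.unique ?_
  have h3 : (fun ε => ∑ i, trace (ξ i * moment (γ ε).2 i)) =ᶠ[𝓝 0]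
      fun _ => ∑ i, trace (ξ i * ((Complex.I * g i) • 1)) := by
    filter_upwards [hγ] with ε hε
    refine Finset.sum_congr rfl fun i _ => ?_
    by_cases hi : i = 0
    · simp [hi, hξ]
    · rw [hε.2.1.2 i hi]
  exact (hasDerivAt_const (0 : ℂ) _).congr_of_eventuallyEq h3

/-- Tangent vectors are gauge directions plus images of tangent vectors under the section. -/
theorem tangent_decomp (S : Slice D H reg w g gen H' V s Φ c η σ) {t : ℂ} (ht : t ∈ D)
    {x : Phase (Fin n × Fin d)} (hx : x ∈ redSet reg w g gen t)
    {a : ℂ × Phase (Fin n × Fin d)} (ha : IsTangent S.total (t, x) a) :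
    ∃ ξ, ξ 0 = 0 ∧ a.2 + infGauge ξ x = conjP (blockUnit (S.nrm hx.2))⁻¹
      (fderiv ℂ (fun z : ℂ × Phase (Fin n) => σ z.1 z.2) (t, Φ t x)
        (a.1, (fderiv ℂ S.full (t, x) a).2)) := by
  obtain ⟨γ, h0, hγ, h1⟩ := ha
  set b := fderiv ℂ (fun z : ℂ × Phase (Fin n) => σ z.1 z.2) (t, Φ t x)
        (a.1, (fderiv ℂ S.full (t, x) a).2) with hb
  have hy := (S.gauge_nrm ht hx).1
  have hσ : HasDerivAt (fun ε => σ (γ ε).1 (Φ (γ ε).1 (γ ε).2)) b 0 :=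
    S.hasDerivAt_section ht hy (γ := fun ε => ((γ ε).1, Φ (γ ε).1 (γ ε).2)) (by simp [h0])
      (h1.fst.prodMk (S.hasDerivAt_map ht hx.2 h0 h1))
  have hηd : DifferentiableAt ℂ η x := S.η_diff.differentiableAt (S.isOpen_gen.mem_nhds hx.2)
  obtain ⟨η', hη'⟩ : ∃ η', HasDerivAt (fun ε => η (γ ε).2) η' 0 := by
    have h2 : HasFDerivAt η (fderiv ℂ η x) (γ 0).2 := by rw [h0]; exact hηd.hasFDerivAt
    exact ⟨_, h2.comp_hasDerivAt 0 h1.snd⟩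
  have hη'0 : η' 0 = 0 := by
    have h2 := (hasDerivAt_pi.1 hη') 0
    simp only [S.η_zero] at h2
    exact h2.unique (hasDerivAt_const _ _)
  have hE : HasDerivAt (fun ε => blockDiagonal (η (γ ε).2)) (blockDiagonal η') 0 :=
    hasDerivAt_blockDiagonal hη'
  set h := S.nrm hx.2 with hh
  have hh0 : blockDiagonal (η (γ 0).2) = (blockUnit h : Matrix _ _ ℂ) := by rw [h0]; rfl
  have hσ0 : σ (γ 0).1 (Φ (γ 0).1 (γ 0).2) = conjP (blockUnit h) x := by
    rw [h0]; exact (S.gauge_nrm ht hx).2.symm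
  -- The relation σ = η x η⁻¹ is multiplied by η on the right, so that differentiating it involves
  -- no inverse.
  have hrel : ∀ᶠ ε in 𝓝 0,
      blockDiagonal (η (γ ε).2) * (γ ε).2.1 =
        (σ (γ ε).1 (Φ (γ ε).1 (γ ε).2)).1 * blockDiagonal (η (γ ε).2) ∧
      blockDiagonal (η (γ ε).2) * (γ ε).2.2 =
        (σ (γ ε).1 (Φ (γ ε).1 (γ ε).2)).2 * blockDiagonal (η (γ ε).2) := by
    filter_upwards [hγ] with ε hε
    have h2 := (S.gauge_nrm hε.1 hε.2).2
    have h3 : blockDiagonal (η (γ ε).2) = (blockUnit (S.nrm hε.2.2) : Matrix _ _ ℂ) := rfl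
    rw [← h2, gauge_eq, h3]
    simp [conjAlg_apply, mul_assoc]
  have hp := (hasDerivAt_matrix_mul hE (hasDerivAt_fst h1.snd)).unique ((hasDerivAt_matrix_mul (hasDerivAt_fst hσ) hE).congr_of_eventuallyEq
    (hrel.mono fun _ h => h.1))
  have hq := (hasDerivAt_matrix_mul hE (hasDerivAt_snd h1.snd)).unique ((hasDerivAt_matrix_mul (hasDerivAt_snd hσ) hE).congr_of_eventuallyEq
    (hrel.mono fun _ h => h.2))
  rw [hh0, hσ0] at hp hq
  simp only [h0] at hp hq
  set u := blockUnit h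
  -- The gauge direction is the logarithmic derivative h⁻¹η' of the normalization along the curve.
  refine ⟨fun i => ((h i)⁻¹ : GL (Fin n) ℂ).1 * η' i, by simp [hη'0], ?_⟩
  have hξ : blockDiagonal (fun i => ((h i)⁻¹ : GL (Fin n) ℂ).1 * η' i) =
      (u⁻¹ : (Matrix _ _ ℂ)ˣ) * blockDiagonal η' := blockDiagonal_mul _ _
  have key : ∀ A A' B' : Matrix (Fin n × Fin d) (Fin n × Fin d) ℂ,
      blockDiagonal η' * A + u * A' = B' * u + conjAlg u A * blockDiagonal η' →
      A' + ((u⁻¹ : (Matrix _ _ ℂ)ˣ) * blockDiagonal η' * A -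
        A * ((u⁻¹ : (Matrix _ _ ℂ)ˣ) * blockDiagonal η')) = conjAlg u⁻¹ B' := by
    intro A A' B' hAB
    rw [conjAlg_apply] at hAB ⊢
    have : B' * u = blockDiagonal η' * A + u * A' -
        u * A * (u⁻¹ : (Matrix _ _ ℂ)ˣ) * blockDiagonal η' := by rw [hAB]; abel
    rw [inv_inv, mul_assoc _ B', this]
    simp only [mul_add, mul_sub, ← mul_assoc, Units.inv_mul, one_mul]
    abel
  rw [infGauge_eq, hξ]
  exact Prod.ext (key _ _ _ hp) (key _ _ _ hq)

/-- The curve ε ↦ exp(-εξ) serves to absorb a gauge component of a velocity; its inverse has the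
opposite velocity, and both enter a conjugation. -/
theorem exists_gauge_curve (ξ : Fin d → Matrix (Fin n) (Fin n) ℂ) (hξ : ξ 0 = 0) :
    ∃ k : ℂ → Fin d → GL (Fin n) ℂ, (∀ ε, k ε 0 = 1) ∧ blockUnit (k 0) = 1 ∧
      HasDerivAt (fun ε => (blockUnit (k ε) : Matrix _ _ ℂ)) (-blockDiagonal ξ) 0 ∧
      HasDerivAt (fun ε => ((blockUnit (k ε))⁻¹ : (Matrix _ _ ℂ)ˣ).1) (blockDiagonal ξ) 0 := by
  refine ⟨fun ε i => expUnit (ε • -ξ i), fun ε => Units.ext (by simp [hξ, expUnit]), ?_, ?_, ?_⟩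
  · have : (fun i : Fin d => expUnit ((0 : ℂ) • -ξ i)) = 1 :=
      funext fun i => Units.ext (by simp [expUnit])
    change blockUnit (fun i : Fin d => expUnit ((0 : ℂ) • -ξ i)) = 1
    rw [this]
    exact Units.ext blockDiagonal_one
  · have : HasDerivAt (fun ε : ℂ => fun i => NormedSpace.exp (ε • -ξ i)) (-ξ) 0 :=
      hasDerivAt_pi.2 fun i => hasDerivAt_exp_smul _
    rw [← blockDiagonal_neg]
    exact hasDerivAt_blockDiagonal this
  · have : HasDerivAt (fun ε : ℂ => fun i => NormedSpace.exp (-(ε • -ξ i))) ξ 0 :=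
      hasDerivAt_pi.2 fun i => by
        simp only [smul_neg, neg_neg]
        exact hasDerivAt_exp_smul _
    exact hasDerivAt_blockDiagonal this

/-- Images of tangent vectors under the section are tangent, also after a gauge transformation. -/
theorem isTangent_section (S : Slice D H reg w g gen H' V s Φ c η σ) {t : ℂ} (ht : t ∈ D)
    {y : Phase (Fin n)} (hy : y ∈ V) (a : ℂ) (u : Phase (Fin n)) {v : Phase (Fin n × Fin d)}
    (ξ : Fin d → Matrix (Fin n) (Fin n) ℂ) (hξ : ξ 0 = 0)
    (hv : HasDerivAt (fun ε : ℂ => σ (t + ε * a) (y + ε • u)) (v + infGauge ξ (σ t y)) 0)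
    (h : Fin d → GL (Fin n) ℂ) (h0 : h 0 = 1) :
    IsTangent S.total (t, gauge h (σ t y)) (a, gauge h v) ∧
      (fderiv ℂ S.full (t, gauge h (σ t y)) (a, gauge h v)).2 = u := by
  obtain ⟨k, hk0, hb1, hk, hk'⟩ := exists_gauge_curve ξ hξ
  have ht' : HasDerivAt (fun ε : ℂ => t + ε * a) a 0 := by
    simpa using ((hasDerivAt_id (0 : ℂ)).mul_const a).const_add t
  -- Moving the section by the gauge curve of velocity -ξ cancels `infGauge ξ`, which leaves exactly
  -- v.
  have hk2 : HasDerivAt (fun ε => conjP (blockUnit (k ε)) (σ (t + ε * a) (y + ε • u))) v 0 := by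
    have h1 := hasDerivAt_matrix_mul (hasDerivAt_matrix_mul hk (hasDerivAt_fst hv)) hk'
    have h2 := hasDerivAt_matrix_mul (hasDerivAt_matrix_mul hk (hasDerivAt_snd hv)) hk'
    simp only [zero_mul, add_zero, zero_smul, hb1, inv_one, Units.val_one, one_mul, mul_one]
      at h1 h2
    have e : v = ((-blockDiagonal ξ * (σ t y).1 + (v + infGauge ξ (σ t y)).1)
        + (σ t y).1 * blockDiagonal ξ,
        (-blockDiagonal ξ * (σ t y).2 + (v + infGauge ξ (σ t y)).2)
        + (σ t y).2 * blockDiagonal ξ) := by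
      ext : 1 <;> simp only [infGauge, Prod.fst_add, Prod.snd_add] <;> noncomm_ring
    have h3 := h1.prodMk h2
    rw [← e] at h3
    simp only [conjP_apply, conjAlg_apply]
    exact h3
  simp only [gauge_eq h]
  obtain ⟨γ, hγ⟩ : ∃ γ : ℂ → ℂ × Phase (Fin n × Fin d), γ = fun ε =>
    (t + ε * a, conjP (blockUnit h) (conjP (blockUnit (k ε)) (σ (t + ε * a) (y + ε • u)))) :=
    ⟨_, rfl⟩
  have hγ0 : γ 0 = (t, conjP (blockUnit h) (σ t y)) := by
    simp only [hγ, hb1, conjP_one, zero_mul, zero_smul, add_zero]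
  have hγ1 : HasDerivAt γ (a, conjP (blockUnit h) v) 0 := by
    rw [hγ]
    exact ht'.prodMk (hasDerivAt_conjP (blockUnit h) hk2)
  have hmem : ∀ᶠ ε : ℂ in 𝓝 0, t + ε * a ∈ D ∧ y + ε • u ∈ V := by
    refine Filter.Eventually.and ?_ ?_
    · exact ht'.continuousAt.eventually_mem (by simpa using S.isOpen_time.mem_nhds ht)
    · exact (hasDerivAt_line y u).continuousAt.eventually_mem
        (by rw [zero_smul, add_zero]; exact S.isOpen_image.mem_nhds hy)
  have htot : ∀ᶠ ε in 𝓝 0, γ ε ∈ S.total := by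
    filter_upwards [hmem] with ε hε
    rw [hγ]
    exact ⟨hε.1, S.gauge_mem hε.1 (S.gauge_mem hε.1 (S.section_mem _ hε.1 _ hε.2).1 _) _⟩
  refine ⟨⟨γ, hγ0, htot, hγ1⟩, ?_⟩
  have h2 := S.hasDerivAt_map ht (S.gauge_mem ht (S.section_mem t ht y hy).1 h).2 hγ0 hγ1
  refine h2.unique ((hasDerivAt_line y u).congr_of_eventuallyEq ?_)
  filter_upwards [hmem] with ε hε
  have hm := (S.section_mem _ hε.1 _ hε.2)
  rw [hγ]
  exact (S.Φ_gauge _ hε.1 _ (S.gauge_gen _ _ hm.1.2) h h0).trans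
    ((S.Φ_gauge _ hε.1 _ hm.1.2 _ (hk0 ε)).trans hm.2)

theorem hasDerivAt_section_line (S : Slice D H reg w g gen H' V s Φ c η σ) {t : ℂ} (ht : t ∈ D)
    {y : Phase (Fin n)} (hy : y ∈ V) (a : ℂ) (u : Phase (Fin n)) :
    HasDerivAt (fun ε : ℂ => σ (t + ε * a) (y + ε • u))
      (fderiv ℂ (fun z : ℂ × Phase (Fin n) => σ z.1 z.2) (t, y) (a, u)) 0 := by
  have h1 : HasDerivAt (fun ε : ℂ => t + ε * a) a 0 := by
    simpa using ((hasDerivAt_id (0 : ℂ)).mul_const a).const_add t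
  exact S.hasDerivAt_section ht hy (γ := fun ε => (t + ε * a, y + ε • u)) (by simp)
    (h1.prodMk (hasDerivAt_line y u))

/-- At a point of the domain of the reduction, the Hamiltonian vector is tangent to the domain, and
it is mapped to the Hamiltonian vector of the target. -/
theorem ham_tangent (S : Slice D H reg w g gen H' V s Φ 0 η σ) {t : ℂ} (ht : t ∈ D)
    {x : Phase (Fin n × Fin d)} (hx : x ∈ redSet reg w g gen t) :
    ∃ v v', IsHamVec H t x v ∧ IsHamVec H' (s t) (Φ t x) v' ∧ IsTangent S.total (t, x) (1, v) ∧
      (fderiv ℂ S.full (t, x) (1, v)).2 = deriv s t • v' := by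
  have hy := (S.gauge_nrm ht hx).1
  obtain ⟨v, v', ξ, hξ, hv, hv', hσ⟩ := S.ham t ht _ hy
  set h := (S.nrm hx.2)⁻¹ with hh
  have hh0 : h 0 = 1 := inv_eq_one.2 (S.nrm_zero hx.2)
  have hx' : gauge h (σ t (Φ t x)) = x := by
    rw [gauge_eq, hh, blockUnit_inv, S.eq_gauge_section ht hx]
  have h1 := S.isTangent_section ht hy 1 (deriv s t • v') ξ hξ (by simpa using hσ) h hh0
  rw [hx'] at h1
  refine ⟨gauge h v, v', ?_, hv', h1⟩
  have := hv.conjP S.conj_ham (blockUnit h)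
  rwa [← gauge_eq, ← gauge_eq, hx'] at this

/-- `Φ` is constant along the orbits. The gauge curve has velocity -`infGauge ξ x`, whence the
change of sign at the end. -/
theorem fderiv_infGauge (S : Slice D H reg w g gen H' V s Φ c η σ) {t : ℂ} (ht : t ∈ D)
    {x : Phase (Fin n × Fin d)} (hx : x ∈ redSet reg w g gen t)
    (ξ : Fin d → Matrix (Fin n) (Fin n) ℂ) (hξ : ξ 0 = 0) :
    (fderiv ℂ S.full (t, x) (0, infGauge ξ x)).2 = 0 := by
  obtain ⟨k, hk0, hb1, hk, hk'⟩ := exists_gauge_curve ξ hξ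
  have h1 : HasDerivAt (fun ε => conjP (blockUnit (k ε)) x) (-infGauge ξ x) 0 := by
    have h1 := hasDerivAt_matrix_mul (hk.mul_const x.1) hk'
    have h2 := hasDerivAt_matrix_mul (hk.mul_const x.2) hk'
    simp only [hb1, inv_one, Units.val_one, one_mul, mul_one] at h1 h2
    have e : -infGauge ξ x = (-blockDiagonal ξ * x.1 + x.1 * blockDiagonal ξ,
        -blockDiagonal ξ * x.2 + x.2 * blockDiagonal ξ) := by
      ext : 1 <;> simp only [infGauge, Prod.fst_neg, Prod.snd_neg] <;> noncomm_ring
    have h3 := h1.prodMk h2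
    rw [← e] at h3
    simp only [conjP_apply, conjAlg_apply]
    exact h3
  have h2 := S.hasDerivAt_map ht hx.2 (γ := fun ε => (t, conjP (blockUnit (k ε)) x))
    (by simp [hb1]) ((hasDerivAt_const (0 : ℂ) t).prodMk h1)
  have h3 : (fun ε => Φ t (conjP (blockUnit (k ε)) x)) = fun _ => Φ t x :=
    funext fun ε => S.Φ_gauge t ht x hx.2 _ (hk0 ε)
  have h4 : (fderiv ℂ S.full (t, x) (0, -infGauge ξ x)).2 = 0 :=
    h2.unique (h3 ▸ hasDerivAt_const (0 : ℂ) (Φ t x))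
  have h5 : ((0 : ℂ), infGauge ξ x) = -(0, -infGauge ξ x) := by simp
  rw [h5, map_neg, Prod.snd_neg, h4, neg_zero]

/-- By `extForm_eq` both sides are values of the symplectic forms after subtracting multiples of the
Hamiltonian vectors. Modulo gauge directions the upstairs vectors are images of the downstairs ones
under the section, which is symplectic; the gauge directions drop out by orthogonality. -/
theorem form_eq (S : Slice D H reg w g gen H' V s Φ 0 η σ) {t : ℂ} (ht : t ∈ D)
    {x : Phase (Fin n × Fin d)} (hx : x ∈ redSet reg w g gen t)
    {a b : ℂ × Phase (Fin n × Fin d)} (ha : IsTangent S.total (t, x) a)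
    (hb : IsTangent S.total (t, x) b) :
    extForm H (t, x) a b = extForm H' (s t, Φ t x) (fderiv ℂ S.full (t, x) a)
      (fderiv ℂ S.full (t, x) b) := by
  obtain ⟨v, v', hv, hv', hvt, hvΦ⟩ := S.ham_tangent ht hx
  have hy := (S.gauge_nrm ht hx).1
  rw [extForm_eq hv, extForm_eq hv']
  set U := blockUnit (S.nrm hx.2) with hU
  set L := fderiv ℂ (fun z : ℂ × Phase (Fin n) => σ z.1 z.2) (t, Φ t x) with hL
  set F := fderiv ℂ S.full (t, x) with hF
  -- The decompositions of a and of (1, v) are combined. Their time components cancel, so only the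
  -- derivative of the section at fixed time remains.
  have key : ∀ a : ℂ × Phase (Fin n × Fin d), IsTangent S.total (t, x) a →
      ∃ ξ, ξ 0 = 0 ∧ a.2 - a.1 • v + infGauge ξ x =
        conjP U⁻¹ (L (0, (F a).2 - (F a).1 • v')) := by
    intro a ha
    obtain ⟨ξ, hξ, h1⟩ := S.tangent_decomp ht hx ha
    obtain ⟨ζ, hζ, h2⟩ := S.tangent_decomp ht hx hvt
    refine ⟨ξ - a.1 • ζ, by simp [hξ, hζ], ?_⟩
    have e1 : a.2 - a.1 • v + infGauge (ξ - a.1 • ζ) x =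
        (a.2 + infGauge ξ x) - a.1 • (v + infGauge ζ x) := by
      rw [infGauge_sub_left, infGauge_smul_left, smul_add]; abel
    have e2 : ((0 : ℂ), (F a).2 - (F a).1 • v') = (a.1, (F a).2) - a.1 • (1, (F (1, v)).2) := by
      rw [hvΦ, S.fderiv_full_fst ht hx.2]
      ext : 1 <;> simp [smul_smul]
    rw [e1, h1, h2, e2, map_sub, map_sub, map_smul, map_smul]
  -- A difference of two vectors tangent to the domain is still orthogonal to the gauge directions.
  have hlev : ∀ a : ℂ × Phase (Fin n × Fin d), IsTangent S.total (t, x) a →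
      ∀ ξ, ξ 0 = 0 → sympl (infGauge ξ x) (a.2 - a.1 • v) = 0 := by
    intro a ha ξ hξ
    have h1 := S.sympl_infGauge_tangent hvt ξ hξ
    rw [sympl_sub_right, sympl_smul_right, S.sympl_infGauge_tangent ha ξ hξ]
    simp only at h1
    rw [h1, mul_zero, sub_zero]
  -- The same orthogonality for images under the section: they are tangent to the domain, with zero
  -- time component.
  have hB : ∀ u, ∀ ξ, ξ 0 = 0 → sympl (infGauge ξ x) (conjP U⁻¹ (L (0, u))) = 0 := by
    intro u ξ hξ
    have h1 := S.isTangent_section ht hy 0 u (v := L (0, u)) 0 rfl (by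
      rw [infGauge_zero_left, add_zero]
      exact S.hasDerivAt_section_line ht hy 0 u) (S.nrm hx.2)⁻¹ (inv_eq_one.2 (S.nrm_zero hx.2))
    rw [gauge_eq, gauge_eq, blockUnit_inv, S.eq_gauge_section ht hx] at h1
    exact S.sympl_infGauge_tangent h1.1 ξ hξ
  obtain ⟨ξ, hξ, h1⟩ := key a ha
  obtain ⟨ζ, hζ, h2⟩ := key b hb
  obtain ⟨v₁, v₂, h3, h4, h5⟩ := S.sympl_section t ht _ hy ((F a).2 - (F a).1 • v')
    ((F b).2 - (F b).1 • v')
  have h6 : ∀ u v₁, HasDerivAt (fun ε : ℂ => σ t (Φ t x + ε • u)) v₁ 0 → v₁ = L (0, u) := by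
    intro u v₁ h
    have := S.hasDerivAt_section_line ht hy 0 u
    simp only [mul_zero, add_zero] at this
    exact h.unique this
  rw [← h5, h6 _ _ h3, h6 _ _ h4, ← sympl_conjP U⁻¹ (L _), ← h1, sympl_add_left, hB _ _ hξ,
    add_zero, ← h2, sympl_add_right, sympl_swap (infGauge ζ x), hlev a ha _ hζ]
  ring

/-- From left to right, `Φ` kills the gauge part of the velocity and sends the Hamiltonian vector to
s' times the one of H'. Conversely, two tangent vectors with time component 1 and the same image
differ by a gauge direction, by `tangent_decomp`. -/
theorem dynamics (S : Slice D H reg w g gen H' V s Φ 0 η σ) {D' : Set ℂ} (hD' : IsOpen D')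
    (hsub : D' ⊆ D) {x : ℂ → Phase (Fin n × Fin d)} (hx : DifferentiableOn ℂ x D')
    (hmem : ∀ t ∈ D', x t ∈ redSet reg w g gen t) :
    IsReducedSolution H D' x ↔ IsSolution H' s D' fun t => Φ t (x t) := by
  have hdx : ∀ t ∈ D', HasDerivAt x (deriv x t) t := fun t ht =>
    (hx.differentiableAt (hD'.mem_nhds ht)).hasDerivAt
  have htan : ∀ t ∈ D', IsTangent S.total (t, x t) (1, deriv x t) := by
    intro t ht
    have h1 : HasDerivAt (fun ε : ℂ => t + ε) 1 0 := (hasDerivAt_id (0 : ℂ)).const_add t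
    have h2 : HasDerivAt (fun ε : ℂ => x (t + ε)) (deriv x t) 0 := by
      have := HasDerivAt.scomp_of_eq (0 : ℂ) (hdx t ht) h1 (by simp)
      rwa [one_smul] at this
    refine ⟨fun ε => (t + ε, x (t + ε)), by simp, ?_, h1.prodMk h2⟩
    filter_upwards [h1.continuousAt.eventually_mem
      (by simpa using hD'.mem_nhds ht : D' ∈ 𝓝 (t + 0))] with ε hε
    exact ⟨hsub hε, hmem _ hε⟩
  have hder : ∀ t ∈ D', HasDerivAt (fun t => Φ t (x t))
      (fderiv ℂ S.full (t, x t) (1, deriv x t)).2 t := fun t ht =>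
    S.hasDerivAt_map (hsub ht) (hmem t ht).2 (γ := fun t => (t, x t)) rfl
      ((hasDerivAt_id t).prodMk (hdx t ht))
  constructor
  · intro hsol t ht
    obtain ⟨v, ξ, hξ, hv, hxt⟩ := hsol t ht
    obtain ⟨w, v', hw, hv', hwt, hwΦ⟩ := S.ham_tangent (hsub ht) (hmem t ht)
    obtain rfl := hv.unique hw
    refine ⟨v', hv', ?_⟩
    have h1 := hder t ht
    have h2 : ((1 : ℂ), deriv x t) = (1, v) + (0, infGauge ξ (x t)) := by
      rw [(hdx t ht).unique hxt]; simp
    rwa [h2, map_add, Prod.snd_add, hwΦ, S.fderiv_infGauge (hsub ht) (hmem t ht) ξ hξ,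
      add_zero] at h1
  · intro hsol t ht
    obtain ⟨v'', hv'', hyt⟩ := hsol t ht
    obtain ⟨v, v', hv, hv', hvt, hvΦ⟩ := S.ham_tangent (hsub ht) (hmem t ht)
    obtain rfl := hv''.unique hv'
    obtain ⟨ξ, hξ, h1⟩ := S.tangent_decomp (hsub ht) (hmem t ht) (htan t ht)
    obtain ⟨ζ, hζ, h2⟩ := S.tangent_decomp (hsub ht) (hmem t ht) hvt
    rw [(hder t ht).unique hyt, ← hvΦ, ← h2] at h1
    refine ⟨v, ζ - ξ, by simp [hξ, hζ], hv, ?_⟩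
    have h3 : v + infGauge (ζ - ξ) (x t) = deriv x t := by
      rw [infGauge_sub_left, ← add_sub_assoc, ← h1, add_sub_cancel_right]
    rw [h3]
    exact hdx t ht

theorem isBlockReduction (S : Slice D H reg w g gen H' V s Φ 0 η σ) :
    IsBlockReduction D H reg w g gen H' V s Φ where
  isOpen_gen := S.isOpen_gen
  dense_gen := S.dense_gen
  comm_blk := by
    intro t ht x hx i j hij
    rw [mem_fixedSet] at hx
    -- At a fixed point the twisted commutator is the commutator of w(p, q), which equals [p, q]
    -- because w preserves it.
    refine blk_eq_zero_of_commute_twist ?_ hij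
    rw [← comm_conjP, hx.2, S.comm_w t ht x hx.1]
  moment_map := by
    intro ξ x u
    have := hasDerivAt_moment ξ (hasDerivAt_line x u)
    simpa using this
  gauge_mem := fun t ht x hx h _ => S.gauge_mem ht hx h
  gauge_free := fun t _ x hx h h0 hg => S.gauge_free hx.2 h0 hg
  tangent := by
    intro t ht x hx
    obtain ⟨v, v', hv, -, h, -⟩ := S.ham_tangent ht hx
    exact ⟨v, hv, h⟩
  isOpen_image := S.isOpen_image
  dense_image := S.dense_image
  image_eq := fun t ht => S.image_eq ht
  fiber_eq := fun t ht x hx y hy => S.fiber_eq ht hx hy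
  holo_time := S.holo_time
  deriv_time := S.deriv_time
  holo := S.holo
  holo_section := ⟨fun z => σ z.1 z.2, S.holo_section, S.section_mem⟩
  form_eq := fun t ht x hx a b ha hb => S.form_eq ht hx ha hb
  dynamics := fun D' hD' hsub x hx hmem => S.dynamics hD' hsub hx hmem

end Slice

end Slice


/-! ### Conjugation by the exponential of the commutator -/

section ConjComm

variable {n : ℕ}

theorem conjComm_eq (c : ℂ) (x : Phase (Fin n)) :
    conjComm c x = conjP (expUnit (c • comm x)) x := rfl

@[simp] theorem comm_conjComm (c : ℂ) (x : Phase (Fin n)) : comm (conjComm c x) = comm x := by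
  rw [conjComm_eq, comm_conjP, conjAlg_apply]
  have : Commute (comm x) (expUnit (c • comm x) : Matrix (Fin n) (Fin n) ℂ) :=
    ((Commute.refl (comm x)).smul_right c).exp_right
  rw [← this.eq, mul_assoc, Units.mul_inv, mul_one]

theorem conjComm_zero (x : Phase (Fin n)) : conjComm 0 x = x := by
  simp [conjComm]

theorem conjComm_neg_conjComm (c : ℂ) (x : Phase (Fin n)) : conjComm (-c) (conjComm c x) = x := by
  have : expUnit (-c • comm x) = (expUnit (c • comm x))⁻¹ := by
    ext1
    change NormedSpace.exp (-c • comm x) = NormedSpace.exp (-(c • comm x))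
    rw [neg_smul]
  rw [conjComm_eq, comm_conjComm, this, conjComm_eq, conjP_inv_conjP]

/-- Two derivatives are required for the exchange of the time and space derivatives in
`hasDerivAt_fderiv_swap`. -/
theorem contDiff_conjComm :
    ContDiff ℂ 2 (fun z : ℂ × Phase (Fin n) => conjComm z.1 z.2) := by
  have hexp : ContDiff ℂ 2 (NormedSpace.exp : Matrix (Fin n) (Fin n) ℂ → Matrix (Fin n) (Fin n) ℂ) :=
    contDiff_iff_contDiffAt.2 fun x => (NormedSpace.exp_analytic (𝕂 := ℂ) x).contDiffAt
  have h1 : ContDiff ℂ 2 (fun z : ℂ × Phase (Fin n) => z.2.1) := contDiff_fst.comp contDiff_snd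
  have h2 : ContDiff ℂ 2 (fun z : ℂ × Phase (Fin n) => z.2.2) := contDiff_snd.comp contDiff_snd
  have hc : ContDiff ℂ 2 (fun z : ℂ × Phase (Fin n) => z.1 • comm z.2) :=
    contDiff_fst.smul ((h1.mul h2).sub (h2.mul h1))
  have e1 := hexp.comp hc
  have e2 := hexp.comp hc.neg
  exact ((e1.mul h1).mul e2).prodMk ((e1.mul h2).mul e2)

theorem hasDerivAt_conjComm_time (c : ℂ) (x : Phase (Fin n)) :
    HasDerivAt (fun b => conjComm b x) (adP (comm x) (conjComm c x)) c := by
  have h1 := hasDerivAt_exp_smul_const' (𝕂 := ℂ) (comm x) c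
  have h2 : HasDerivAt (fun b : ℂ => NormedSpace.exp (-(b • comm x)))
      (NormedSpace.exp (-(c • comm x)) * -comm x) c := by
    have := hasDerivAt_exp_smul_const (𝕂 := ℂ) (-comm x) c
    simp only [smul_neg] at this
    exact this
  have key : ∀ A : Matrix (Fin n) (Fin n) ℂ, HasDerivAt
      (fun b : ℂ => NormedSpace.exp (b • comm x) * A * NormedSpace.exp (-(b • comm x)))
      (comm x * (NormedSpace.exp (c • comm x) * A * NormedSpace.exp (-(c • comm x))) -
        NormedSpace.exp (c • comm x) * A * NormedSpace.exp (-(c • comm x)) * comm x) c := by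
    intro A
    convert! hasDerivAt_matrix_mul (h1.mul_const A) h2 using 1
    simp only [mul_neg, mul_assoc]
    abel
  exact (key _).prodMk (key _)

/-- This differentiates the invariance of the commutator, `comm_conjComm`. -/
theorem dcomm_fderiv_conjComm (c : ℂ) (x u v : Phase (Fin n))
    (hv : HasDerivAt (fun ε : ℂ => conjComm c (x + ε • u)) v 0) :
    dcomm (conjComm c x) v = dcomm x u := by
  have h1 := hasDerivAt_comm hv
  simp only [comm_conjComm, zero_smul, add_zero] at h1
  have h2 := hasDerivAt_comm (hasDerivAt_line x u)
  rw [zero_smul, add_zero] at h2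
  exact h1.unique h2

theorem hasDerivAt_adP {A : ℂ → Matrix (Fin n) (Fin n) ℂ} {y : ℂ → Phase (Fin n)} {A' y'} {z : ℂ}
    (hA : HasDerivAt A A' z) (hy : HasDerivAt y y' z) :
    HasDerivAt (fun ε => adP (A ε) (y ε)) (adP A' (y z) + adP (A z) y') z := by
  have h1 := hasDerivAt_fst hy
  have h2 := hasDerivAt_snd hy
  have e1 := (hasDerivAt_matrix_mul hA h1).sub (hasDerivAt_matrix_mul h1 hA)
  have e2 := (hasDerivAt_matrix_mul hA h2).sub (hasDerivAt_matrix_mul h2 hA)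
  convert! e1.prodMk e2 using 1
  ext : 1 <;> simp only [adP, Prod.fst_add, Prod.snd_add] <;> abel

/-- Infinitesimal form of the invariance of the symplectic form under conjugation by a fixed matrix.
-/
theorem trace_dcomm_adP (C : Matrix (Fin n) (Fin n) ℂ) (u v : Phase (Fin n)) :
    sympl (adP C u) v + sympl u (adP C v) = 0 := by
  rw [sympl_swap (adP C v) u, sympl_adP, sympl_adP]
  simp only [dcomm, mul_add, mul_sub, trace_add, trace_sub]
  ring

theorem sympl_hasDerivAt {x y : ℂ → Phase (Fin n)} {x' y' : Phase (Fin n)} {z : ℂ}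
    (hx : HasDerivAt x x' z) (hy : HasDerivAt y y' z) :
    HasDerivAt (fun ε => sympl (x ε) (y ε)) (sympl x' (y z) + sympl (x z) y') z := by
  have e1 := hasDerivAt_trace (hasDerivAt_matrix_mul (hasDerivAt_fst hx) (hasDerivAt_snd hy))
  have e2 := hasDerivAt_trace (hasDerivAt_matrix_mul (hasDerivAt_fst hy) (hasDerivAt_snd hx))
  convert! e1.sub e2 using 1
  simp only [sympl, trace_add]
  ring

/-- The symmetry of the second derivative, for a function of time and of a point. -/
theorem hasDerivAt_fderiv_swap {E F : Type*} [NormedAddCommGroup E] [NormedSpace ℂ E]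
    [NormedAddCommGroup F] [NormedSpace ℂ F] {Ψ : ℂ × E → F} (hΨ : ContDiff ℂ 2 Ψ)
    {G : ℂ → E → F} (hG : ∀ b y, HasDerivAt (fun b => Ψ (b, y)) (G b y) b) (x u : E) (b : ℂ)
    {g : F} (hg : HasDerivAt (fun ε : ℂ => G b (x + ε • u)) g 0) :
    HasDerivAt (fun b => fderiv ℂ Ψ (b, x) (0, u)) g b := by
  have hd : Differentiable ℂ Ψ := hΨ.differentiable (by norm_num)
  have hd2 : Differentiable ℂ (fderiv ℂ Ψ) :=
    (hΨ.fderiv_right (m := 1) (by norm_num)).differentiable (by norm_num)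
  have h0 : ∀ y, HasDerivAt (fun b : ℂ => (b, y)) ((1 : ℂ), (0 : E)) b := fun y =>
    (hasDerivAt_id b).prodMk (hasDerivAt_const b y)
  have htime : ∀ y, fderiv ℂ Ψ (b, y) (1, 0) = G b y := fun y =>
    (hasDerivAt_comp (γ := fun b : ℂ => (b, y)) (hd (b, y)).hasFDerivAt (h0 y)).unique (hG b y)
  have h2 := hasDerivAt_comp (γ := fun b : ℂ => (b, x)) (hd2 (b, x)).hasFDerivAt (h0 x)
  have h3 := h2.clm_apply (hasDerivAt_const b ((0 : ℂ), u))
  simp only [map_zero, add_zero] at h3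
  have h4 : HasDerivAt (fun ε : ℂ => (b, x + ε • u)) ((0 : ℂ), u) 0 := by
    have := ((hasDerivAt_id (0 : ℂ)).smul_const u).const_add x
    rw [one_smul] at this
    exact (hasDerivAt_const (0 : ℂ) b).prodMk this
  have h5 := hasDerivAt_comp (γ := fun ε : ℂ => (b, x + ε • u))
    (hd2 (b, x + (0 : ℂ) • u)).hasFDerivAt h4
  have h6 := h5.clm_apply (hasDerivAt_const (0 : ℂ) ((1 : ℂ), (0 : E)))
  simp only [map_zero, add_zero, zero_smul, htime] at h6
  have h9 : IsSymmSndFDerivAt ℂ Ψ (b, x) := hΨ.contDiffAt.isSymmSndFDerivAt (by simp)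
  rw [← h6.unique hg, h9.eq]
  exact h3

/-- Conjugation by `exp (c [P, Q])` is symplectic. -/
theorem sympl_conjComm (c : ℂ) (x u₁ u₂ v₁ v₂ : Phase (Fin n))
    (h₁ : HasDerivAt (fun ε : ℂ => conjComm c (x + ε • u₁)) v₁ 0)
    (h₂ : HasDerivAt (fun ε : ℂ => conjComm c (x + ε • u₂)) v₂ 0) :
    sympl v₁ v₂ = sympl u₁ u₂ := by
  set Ψ : ℂ × Phase (Fin n) → Phase (Fin n) := fun z => conjComm z.1 z.2 with hΨ
  have hd : Differentiable ℂ Ψ := contDiff_conjComm.differentiable (by norm_num)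
  have hspace : ∀ b u, HasDerivAt (fun ε : ℂ => conjComm b (x + ε • u))
      (fderiv ℂ Ψ (b, x) (0, u)) 0 := by
    intro b u
    have h1 : HasDerivAt (fun ε : ℂ => (b, x + ε • u)) (0, u) 0 :=
      (hasDerivAt_const (0 : ℂ) b).prodMk (hasDerivAt_line x u)
    have h2 := (hd (b, x + (0 : ℂ) • u)).hasFDerivAt.comp_hasDerivAt (0 : ℂ) h1
    rw [zero_smul, add_zero] at h2
    exact h2
  -- The derivative of the flow satisfies the linearized equation of the field x ↦ [[P, Q], x]; the
  -- commutator stays that of x because the flow preserves it.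
  have hsymm : ∀ b u, HasDerivAt (fun b => fderiv ℂ Ψ (b, x) (0, u))
      (adP (dcomm x u) (conjComm b x) + adP (comm x) (fderiv ℂ Ψ (b, x) (0, u))) b := by
    intro b u
    refine hasDerivAt_fderiv_swap contDiff_conjComm hasDerivAt_conjComm_time x u b ?_
    have h7 := hasDerivAt_adP (hasDerivAt_comm (hasDerivAt_line x u)) (hspace b u)
    simp only [zero_smul, add_zero] at h7
    exact h7
  -- The pulled back symplectic form does not change with b: the terms that vary the commutator are
  -- Tr(dC(u₁)dC(u₂)) with both signs, and the others cancel by `trace_dcomm_adP`. At b = 0 the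
  -- conjugation is the identity.
  have hconst : ∀ b, sympl (fderiv ℂ Ψ (b, x) (0, u₁)) (fderiv ℂ Ψ (b, x) (0, u₂)) =
      sympl (fderiv ℂ Ψ (0, x) (0, u₁)) (fderiv ℂ Ψ (0, x) (0, u₂)) := by
    intro b
    have hder : ∀ b, HasDerivAt
        (fun b => sympl (fderiv ℂ Ψ (b, x) (0, u₁)) (fderiv ℂ Ψ (b, x) (0, u₂))) 0 b := by
      intro b
      convert! sympl_hasDerivAt (hsymm b u₁) (hsymm b u₂) using 1
      have h1 := dcomm_fderiv_conjComm b x u₁ _ (hspace b u₁)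
      have h2 := dcomm_fderiv_conjComm b x u₂ _ (hspace b u₂)
      rw [sympl_add_left, sympl_add_right, sympl_adP (dcomm x u₁), h2,
        sympl_swap (adP (dcomm x u₂) (conjComm b x)), sympl_adP (dcomm x u₂), h1,
        trace_mul_comm]
      linear_combination -trace_dcomm_adP (comm x) (fderiv ℂ Ψ (b, x) (0, u₁))
        (fderiv ℂ Ψ (b, x) (0, u₂))
    exact is_const_of_deriv_eq_zero (fun b => (hder b).differentiableAt) (fun b => (hder b).deriv) b 0
  have h0 : ∀ u, fderiv ℂ Ψ (0, x) (0, u) = u := by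
    intro u
    have := hspace 0 u
    simp only [conjComm_zero] at this
    exact this.unique (hasDerivAt_line x u)
  rw [h₁.unique (hspace c u₁), h₂.unique (hspace c u₂), hconst, h0, h0]

theorem differentiable_conjComm :
    Differentiable ℂ (fun z : ℂ × Phase (Fin n) => conjComm z.1 z.2) :=
  contDiff_conjComm.differentiable (by norm_num)

theorem differentiableOn_conjComm {E : Type*} [NormedAddCommGroup E] [NormedSpace ℂ E] {c : E → ℂ}
    {y : E → Phase (Fin n)} {s : Set E} (hc : DifferentiableOn ℂ c s)
    (hy : DifferentiableOn ℂ y s) : DifferentiableOn ℂ (fun z => conjComm (c z) (y z)) s :=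
  Differentiable.comp_differentiableOn (f := fun z => (c z, y z)) differentiable_conjComm
    (hc.prodMk hy)

/-- The conjugation by `exp (c [P, Q])` moves along a curve whose velocity preserves `[P, Q]`. -/
theorem hasDerivAt_conjComm_of_dcomm {c : ℂ → ℂ} {c' t : ℂ} (hc : HasDerivAt c c' t)
    (y v : Phase (Fin n)) (hv : dcomm y v = 0) :
    HasDerivAt (fun ε : ℂ => conjComm (c (t + ε)) (y + ε • v))
      (conjP (expUnit (c t • comm y)) v + c' • adP (comm y) (conjComm (c t) y)) 0 := by
  have ht : HasDerivAt (fun ε : ℂ => c (t + ε)) c' 0 := by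
    have h1 : HasDerivAt (fun ε : ℂ => t + ε) 1 0 := (hasDerivAt_id (0 : ℂ)).const_add t
    have := HasDerivAt.scomp_of_eq (0 : ℂ) hc h1 (by simp)
    rwa [one_smul] at this
  have hexp : ∀ A : Matrix (Fin n) (Fin n) ℂ, DifferentiableAt ℂ NormedSpace.exp A := fun A =>
    (NormedSpace.exp_analytic (𝕂 := ℂ) A).differentiableAt
  have hC : HasDerivAt (fun ε : ℂ => comm (y + ε • v)) 0 0 := by
    have := hasDerivAt_comm (hasDerivAt_line y v)
    rwa [zero_smul, add_zero, hv] at this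
  have hA : HasDerivAt (fun ε : ℂ => c (t + ε) • comm (y + ε • v)) (c' • comm y) 0 := by
    have := ht.smul hC
    simp only [zero_smul, add_zero, smul_zero, zero_add] at this
    exact this
  have hA0 : HasDerivAt (fun ε : ℂ => c (t + ε) • comm y) (c' • comm y) 0 := ht.smul_const _
  -- Since v preserves the commutator to first order, the exponents c(t+ε)[y+εv] and c(t+ε)[y] have
  -- the same derivative at 0, and the commutator may be frozen.
  have hswap : ∀ (f : Matrix (Fin n) (Fin n) ℂ → Phase (Fin n)) (b : Phase (Fin n)),
      Differentiable ℂ f → HasDerivAt (fun ε : ℂ => f (c (t + ε) • comm y)) b 0 →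
      HasDerivAt (fun ε : ℂ => f (c (t + ε) • comm (y + ε • v))) b 0 := by
    intro f b hf hb
    have h1 := (hf (c (t + 0) • comm y)).hasFDerivAt.comp_hasDerivAt (0 : ℂ) hA0
    have h2 : HasFDerivAt f (fderiv ℂ f (c (t + 0) • comm y))
        (c (t + 0) • comm (y + (0 : ℂ) • v)) := by
      rw [zero_smul, add_zero y]; exact (hf _).hasFDerivAt
    have h3 := h2.comp_hasDerivAt (0 : ℂ) hA
    rw [h1.unique hb] at h3
    exact h3
  have hfix : HasDerivAt (fun ε : ℂ => conjComm (c (t + ε)) y)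
      (c' • adP (comm y) (conjComm (c t) y)) 0 :=
    HasDerivAt.scomp_of_eq (0 : ℂ) (hasDerivAt_conjComm_time (c t) y) ht (by simp)
  have hE : Differentiable ℂ (fun A : Matrix (Fin n) (Fin n) ℂ => conjP (expUnit A) y) := by
    have e1 : Differentiable ℂ (fun A : Matrix (Fin n) (Fin n) ℂ => NormedSpace.exp A) := hexp
    have e2 : Differentiable ℂ (fun A : Matrix (Fin n) (Fin n) ℂ => NormedSpace.exp (-A)) :=
      e1.comp (differentiable_id (𝕜 := ℂ) (E := Matrix (Fin n) (Fin n) ℂ)).neg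
    exact ((e1.mul_const y.1).mul e2).prodMk ((e1.mul_const y.2).mul e2)
  have h1 := hswap _ _ hE hfix
  -- Conjugation is linear in the point, so y + εv splits into a part in y and ε times a part in v;
  -- of the latter only the value of the conjugation at ε = 0 contributes.
  have hE' : Differentiable ℂ
      (fun A : Matrix (Fin n) (Fin n) ℂ => conjP (expUnit A) v) := by
    have e1 : Differentiable ℂ (fun A : Matrix (Fin n) (Fin n) ℂ => NormedSpace.exp A) := hexp
    have e2 : Differentiable ℂ (fun A : Matrix (Fin n) (Fin n) ℂ => NormedSpace.exp (-A)) :=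
      e1.comp (differentiable_id (𝕜 := ℂ) (E := Matrix (Fin n) (Fin n) ℂ)).neg
    exact ((e1.mul_const v.1).mul e2).prodMk ((e1.mul_const v.2).mul e2)
  have hEA := (hE' (c (t + 0) • comm (y + (0 : ℂ) • v))).hasFDerivAt.comp_hasDerivAt (0 : ℂ) hA
  have h2 := (hasDerivAt_id (0 : ℂ)).smul hEA
  have h3 := h1.add h2
  convert! h3 using 1
  · ext1 ε
    simp [conjComm_eq, map_add, map_smul]
  · simp [add_comm]

end ConjComm

/-! ### Composition of a slice with the conjugation by exp(c[P, Q]) -/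

namespace Slice

variable {n d : ℕ} [NeZero d]

variable {D : Set ℂ} {H : ℂ → Phase (Fin n × Fin d) → ℂ} {reg : Set (Phase (Fin n × Fin d))}
  {w : ℂ → Phase (Fin n × Fin d) → Phase (Fin n × Fin d)}
  {g : Fin d → ℂ} {gen : Set (Phase (Fin n × Fin d))}
  {H' : ℂ → Phase (Fin n) → ℂ} {V : Set (Phase (Fin n))}
  {s : ℂ → ℂ} {Φ : ℂ → Phase (Fin n × Fin d) → Phase (Fin n)} {c : ℂ → ℂ}
  {η : Phase (Fin n × Fin d) → Fin d → Matrix (Fin n) (Fin n) ℂ}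
  {σ : ℂ → Phase (Fin n) → Phase (Fin n × Fin d)}

theorem conjComm_mem (S : Slice D H reg w g gen H' V s Φ c η σ) (b : ℂ) {y : Phase (Fin n)}
    (hy : y ∈ V) : conjComm b y ∈ V := by
  rw [conjComm_eq]
  exact S.conj_image _ y hy

theorem conjComm_holo (S : Slice D H reg w g gen H' V s Φ c η σ) :
    DifferentiableOn ℂ (fun z : ℂ × Phase (Fin n × Fin d) => conjComm (c z.1) (Φ z.1 z.2))
      (D ×ˢ gen) :=
  differentiableOn_conjComm (differentiableOn_comp_fst S.holo_conj gen) S.holo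

theorem conjComm_holo_section (S : Slice D H reg w g gen H' V s Φ c η σ) :
    DifferentiableOn ℂ (fun z : ℂ × Phase (Fin n) => σ z.1 (conjComm (-c z.1) z.2))
      (D ×ˢ V) := by
  have h2 : DifferentiableOn ℂ (fun z : ℂ × Phase (Fin n) => (z.1, conjComm (-c z.1) z.2))
      (D ×ˢ V) :=
    differentiableOn_fst.prodMk (differentiableOn_conjComm
      (c := fun z : ℂ × Phase (Fin n) => -c z.1) (y := fun z => z.2)
      (differentiableOn_comp_fst S.holo_conj.neg V) differentiableOn_snd)
  have h3 : Set.MapsTo (fun z : ℂ × Phase (Fin n) => (z.1, conjComm (-c z.1) z.2)) (D ×ˢ V)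
      (D ×ˢ V) := fun z hz => Set.mk_mem_prod (Set.mem_prod.1 hz).1 (S.conjComm_mem _ (Set.mem_prod.1 hz).2)
  exact DifferentiableOn.comp (g := fun z : ℂ × Phase (Fin n) => σ z.1 z.2) S.holo_section h2 h3

theorem conjComm_sympl_section (S : Slice D H reg w g gen H' V s Φ c η σ) {t : ℂ} (ht : t ∈ D)
    {y : Phase (Fin n)} (hy : y ∈ V) (u u' : Phase (Fin n)) : ∃ v v',
    HasDerivAt (fun ε : ℂ => σ t (conjComm (-c t) (y + ε • u))) v 0 ∧
    HasDerivAt (fun ε : ℂ => σ t (conjComm (-c t) (y + ε • u'))) v' 0 ∧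
      sympl v v' = sympl u u' := by
  have hd : ∀ u, ∃ v, HasDerivAt (fun ε : ℂ => conjComm (-c t) (y + ε • u)) v 0 := by
    intro u
    have h1 : HasDerivAt (fun ε : ℂ => (-c t, y + ε • u)) (0, u) 0 :=
      (hasDerivAt_const (0 : ℂ) _).prodMk (hasDerivAt_line y u)
    exact ⟨_, hasDerivAt_comp (γ := fun ε : ℂ => (-c t, y + ε • u))
      (differentiable_conjComm _).hasFDerivAt h1⟩
  obtain ⟨v, hv⟩ := hd u
  obtain ⟨v', hv'⟩ := hd u'
  obtain ⟨z, z', hz, hz', h⟩ := S.sympl_section t ht _ (S.conjComm_mem (-c t) hy) v v'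
  have key : ∀ u v z, HasDerivAt (fun ε : ℂ => conjComm (-c t) (y + ε • u)) v 0 →
      HasDerivAt (fun ε : ℂ => σ t (conjComm (-c t) y + ε • v)) z 0 →
      HasDerivAt (fun ε : ℂ => σ t (conjComm (-c t) (y + ε • u))) z 0 := by
    intro u v z h1 h2
    have e1 := S.hasDerivAt_section ht (S.conjComm_mem (-c t) hy)
      (γ := fun ε => (t, conjComm (-c t) (y + ε • u))) (z := 0)
      (by rw [zero_smul, add_zero]) ((hasDerivAt_const (0 : ℂ) t).prodMk h1)
    have e2 := S.hasDerivAt_section ht (S.conjComm_mem (-c t) hy)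
      (γ := fun ε => (t, conjComm (-c t) y + ε • v)) (z := 0)
      (by rw [zero_smul, add_zero]) ((hasDerivAt_const (0 : ℂ) t).prodMk (hasDerivAt_line _ v))
    rw [h2.unique e2]
    exact e1
  exact ⟨z, z', key u v z hv hz, key u' v' z' hv' hz', by
    rw [h, sympl_conjComm (-c t) y u u' v v' hv hv']⟩

/-- The hypothesis on the slice is applied at the conjugated point. Its extra term -c' ad is exactly
what the time dependence of the conjugation by exp(-c[P, Q]) contributes along a direction
preserving [P, Q]. -/
theorem conjComm_ham (S : Slice D H reg w g gen H' V s Φ c η σ)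
    {t : ℂ} (ht : t ∈ D) {y : Phase (Fin n)} (hy : y ∈ V) {v'' : Phase (Fin n)}
    (hv'' : IsHamVec H' (s t) y v'') (hd : dcomm y v'' = 0) :
    ∃ v ξ, ξ 0 = 0 ∧ IsHamVec H t (σ t (conjComm (-c t) y)) v ∧
      HasDerivAt (fun ε : ℂ => σ (t + ε) (conjComm (-c (t + ε)) (y + ε • deriv s t • v'')))
        (v + infGauge ξ (σ t (conjComm (-c t) y))) 0 := by
  have hm := S.conjComm_mem (-c t) hy
  obtain ⟨v, v', ξ, hξ, hv, hv', h⟩ := S.ham t ht _ hm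
  have e1 : v' = conjP (expUnit (-c t • comm y)) v'' :=
    hv'.unique (by rw [conjComm_eq]; exact hv''.conjP S.conj_ham' _)
  refine ⟨v, ξ, hξ, hv, ?_⟩
  have hc : HasDerivAt (fun t => -c t) (-deriv c t) t :=
    (S.holo_conj.differentiableAt (S.isOpen_time.mem_nhds ht)).hasDerivAt.neg
  have hd' : dcomm y (deriv s t • v'') = 0 := by
    have : dcomm y (deriv s t • v'') = deriv s t • dcomm y v'' := by
      simp [dcomm, smul_sub, smul_add]
    rw [this, hd, smul_zero]
  have h1 := hasDerivAt_conjComm_of_dcomm hc y (deriv s t • v'') hd'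
  have ht' : HasDerivAt (fun ε : ℂ => t + ε) 1 0 := (hasDerivAt_id (0 : ℂ)).const_add t
  rw [map_smul, ← e1, neg_smul, ← sub_eq_add_neg] at h1
  rw [comm_conjComm] at h
  have e3 := S.hasDerivAt_section ht hm (γ := fun ε => (t + ε, conjComm (-c (t + ε))
    (y + ε • (deriv s t • v'')))) (z := 0) (by rw [zero_smul, add_zero, add_zero])
    (ht'.prodMk h1)
  have e4 := S.hasDerivAt_section ht hm (γ := fun ε => (t + ε, conjComm (-c t) y +
    ε • (deriv s t • v' - deriv c t • adP (comm y) (conjComm (-c t) y)))) (z := 0)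
    (by rw [zero_smul, add_zero, add_zero]) (ht'.prodMk (hasDerivAt_line _ _))
  rw [h.unique e4]
  exact e3

/-- A slice for a reduction gives one for its composition with the conjugation by
`exp (c(t) [P, Q])`. -/
theorem conj_exp (S : Slice D H reg w g gen H' V s Φ c η σ)
    (hcons : ∀ t ∈ D, ∀ y ∈ V, ∃ v, IsHamVec H' (s t) y v ∧ dcomm y v = 0) :
    Slice D H reg w g gen H' V s (fun t x => conjComm (c t) (Φ t x)) 0 η
      (fun t y => σ t (conjComm (-c t) y)) :=
  { isOpen_time := S.isOpen_time
    isOpen_gen := S.isOpen_gen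
    dense_gen := S.dense_gen
    comm_w := S.comm_w
    conj_reg := S.conj_reg
    conj_w := S.conj_w
    gauge_gen := S.gauge_gen
    η_diff := S.η_diff
    η_zero := S.η_zero
    η_unit := S.η_unit
    η_gauge := S.η_gauge
    Φ_gauge := fun t ht x hx h h0 => by rw [S.Φ_gauge t ht x hx h h0]
    slice_eq := fun t ht x hx h => by
      obtain ⟨h1, h2⟩ := S.slice_eq t ht x hx h
      exact ⟨S.conjComm_mem _ h1, by rw [conjComm_neg_conjComm, h2]⟩
    section_mem := fun t ht y hy => by
      obtain ⟨h1, h2⟩ := S.section_mem t ht _ (S.conjComm_mem (-c t) hy)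
      refine ⟨h1, ?_⟩
      have := conjComm_neg_conjComm (-c t) y
      rw [neg_neg] at this
      rw [h2, this]
    isOpen_image := S.isOpen_image
    dense_image := S.dense_image
    conj_image := S.conj_image
    holo_time := S.holo_time
    deriv_time := S.deriv_time
    holo_conj := differentiableOn_const 0
    holo := S.conjComm_holo
    holo_section := S.conjComm_holo_section
    sympl_section := fun t ht y hy u u' => S.conjComm_sympl_section ht hy u u'
    conj_ham := S.conj_ham
    conj_ham' := S.conj_ham'
    ham := fun t ht y hy => by
      obtain ⟨v'', hv'', hd⟩ := hcons t ht y hy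
      obtain ⟨v, ξ, hξ, hv, h⟩ := S.conjComm_ham ht hy hv'' hd
      have : deriv (0 : ℂ → ℂ) t = 0 := deriv_const t 0
      refine ⟨v, v'', ξ, hξ, hv, hv'', ?_⟩
      rw [this, zero_smul, sub_zero]
      exact h }

end Slice


/-! ### The Hamiltonian vector fields -/

section VectorFields

variable {R : Type*} [Ring R] [Algebra ℂ R]

/-- The vector field of PII. -/
def vecII (α : Fin 2 → ℂ) (t : ℂ) (x : R × R) : R × R :=
  ((2 : ℂ) • (x.2 * x.2 * x.2) + t • x.2 + (α 1 - 1 / 2) • 1, x.1)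

/-- The vector field of PIV. -/
def vecIV (α : Fin 3 → ℂ) (t : ℂ) (x : R × R) : R × R :=
  (-(x.1 * x.1) + x.1 * x.2 + x.2 * x.1 + (2 * t) • x.1 + (2 * α 2) • 1,
    x.1 * x.2 + x.2 * x.1 - x.2 * x.2 - (2 * t) • x.2 - (2 * α 1) • 1)

/-- The vector field of PV. -/
def vecV (α : Fin 4 → ℂ) (t : ℂ) (x : R × R) : R × R :=
  (t⁻¹ • (x.1 * (x.1 + t • 1) - x.2 * (x.1 * (x.1 + t • 1)) - x.1 * (x.1 + t • 1) * x.2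
      + (α 1 + α 3) • x.1 - (α 2 * t) • 1),
    t⁻¹ • (x.1 * (x.2 * (x.2 - 1)) + x.2 * (x.2 - 1) * x.1 + t • (x.2 * (x.2 - 1))
      - (α 1 + α 3) • x.2 + α 1 • 1))

/-- The vector field of PIII(D₆). -/
def vecIIID6 (α β : Fin 2 → ℂ) (t : ℂ) (x : R × R) : R × R :=
  (t⁻¹ • (x.2 * x.1 + x.1 * x.2 - x.2 * (x.1 * x.1) - x.1 * x.1 * x.2
      - (α 1 + β 1) • x.1 + α 1 • 1),
    t⁻¹ • (x.1 * (x.2 * x.2) + x.2 * x.2 * x.1 - x.2 * x.2 + (α 1 + β 1) • x.2 + t • 1))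

/-- The vector field of PIII(D₈), where `r` is the inverse of `q`. -/
def vecIIID8 (t : ℂ) (x : R × R) (r : R) : R × R :=
  (t⁻¹ • (1 - (2 : ℂ) • (x.1 * x.2 * x.1) - x.1 - t • (r * r)),
    t⁻¹ • ((2 : ℂ) • (x.2 * x.1 * x.2) + x.2))

/-- The vector field of PVI. -/
def vecVI (α : Fin 5 → ℂ) (t : ℂ) (x : R × R) : R × R :=
  ((t * (t - 1))⁻¹ • (x.1 * (x.2 - t • 1) * x.1
        - x.2 * (x.1 * (x.2 - t • 1) * x.1) - x.1 * (x.2 - t • 1) * x.1 * x.2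
        - x.1 * (x.2 * (x.2 - 1)) * x.1
      + (α 4 + α 3 + α 0 - 1) • (x.2 * x.1 + x.1 * x.2)
      - (α 4 * (1 + t) + α 3 * t + (α 0 - 1)) • x.1 - (α 2 * (α 1 + α 2)) • 1),
    (t * (t - 1))⁻¹ • (x.2 * (x.2 - 1) * x.1 * (x.2 - t • 1)
        + (x.2 - t • 1) * x.1 * (x.2 * (x.2 - 1))
      - (α 4 + α 3 + α 0 - 1) • (x.2 * x.2)
      + (α 4 * (1 + t) + α 3 * t + (α 0 - 1)) • x.2 - (α 4 * t) • 1))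

variable {R' : Type*} [Ring R'] [Algebra ℂ R'] (f : R →ₐ[ℂ] R')

/-- The components are noncommutative polynomials, hence natural for algebra homomorphisms. This is
applied to the passage between block matrices and matrices; the analogues for PIII and PVI are also
applied to shears. -/
theorem map_vecII (α : Fin 2 → ℂ) (t : ℂ) (x : R × R) :
    vecII α t (f x.1, f x.2) = Prod.map f f (vecII α t x) := by
  simp [vecII]

theorem map_vecIV (α : Fin 3 → ℂ) (t : ℂ) (x : R × R) :
    vecIV α t (f x.1, f x.2) = Prod.map f f (vecIV α t x) := by
  simp [vecIV]

theorem map_vecV (α : Fin 4 → ℂ) (t : ℂ) (x : R × R) :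
    vecV α t (f x.1, f x.2) = Prod.map f f (vecV α t x) := by
  simp [vecV]

theorem map_vecIIID6 (α β : Fin 2 → ℂ) (t : ℂ) (x : R × R) :
    vecIIID6 α β t (f x.1, f x.2) = Prod.map f f (vecIIID6 α β t x) := by
  simp [vecIIID6]

theorem map_vecIIID8 (t : ℂ) (x : R × R) (r : R) :
    vecIIID8 t (f x.1, f x.2) (f r) = Prod.map f f (vecIIID8 t x r) := by
  simp [vecIIID8]

theorem map_vecVI (α : Fin 5 → ℂ) (t : ℂ) (x : R × R) :
    vecVI α t (f x.1, f x.2) = Prod.map f f (vecVI α t x) := by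
  simp [vecVI]

end VectorFields

/-! ### Gradients of traces of noncommutative expressions -/

section Gradients

variable {m : Type} [Fintype m] [DecidableEq m]

/-- The matrix valued function `X` has at `x` the transposed derivative `a`. -/
def HasAdjoint (X : Phase m → Matrix m m ℂ) (x : Phase m) (a : Matrix m m ℂ → Phase m) : Prop :=
  ∀ u : Phase m, ∃ X', HasDerivAt (fun ε : ℂ => X (x + ε • u)) X' 0 ∧
    ∀ Y, trace (X' * Y) = trace (u.1 * (a Y).1) + trace (u.2 * (a Y).2)

namespace HasAdjoint

variable {x : Phase m} {X Z : Phase m → Matrix m m ℂ} {a b : Matrix m m ℂ → Phase m}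

theorem fst : HasAdjoint (fun x : Phase m => x.1) x fun Y => (Y, 0) := fun u =>
  ⟨u.1, hasDerivAt_fst (hasDerivAt_line x u), fun Y => by simp⟩

theorem snd : HasAdjoint (fun x : Phase m => x.2) x fun Y => (0, Y) := fun u =>
  ⟨u.2, hasDerivAt_snd (hasDerivAt_line x u), fun Y => by simp⟩

theorem const (A : Matrix m m ℂ) : HasAdjoint (fun _ => A) x fun _ => 0 := fun u =>
  ⟨0, hasDerivAt_const _ _, fun Y => by simp⟩

theorem add (hX : HasAdjoint X x a) (hZ : HasAdjoint Z x b) :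
    HasAdjoint (fun x => X x + Z x) x fun Y => a Y + b Y := fun u => by
  obtain ⟨X', h1, h2⟩ := hX u
  obtain ⟨Z', h3, h4⟩ := hZ u
  refine ⟨X' + Z', h1.add h3, fun Y => ?_⟩
  simp only [add_mul, trace_add, h2, h4, Prod.fst_add, Prod.snd_add, mul_add]
  ring

theorem smul (c : ℂ) (hX : HasAdjoint X x a) :
    HasAdjoint (fun x => c • X x) x fun Y => c • a Y := fun u => by
  obtain ⟨X', h1, h2⟩ := hX u
  refine ⟨c • X', h1.const_smul c, fun Y => ?_⟩
  simp only [smul_mul_assoc, trace_smul, h2, Prod.smul_fst, Prod.smul_snd, mul_smul_comm, smul_add]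

theorem sub (hX : HasAdjoint X x a) (hZ : HasAdjoint Z x b) :
    HasAdjoint (fun x => X x - Z x) x fun Y => a Y - b Y := by
  simpa [sub_eq_add_neg] using hX.add (hZ.smul (-1))

/-- By cyclicity of the trace, the remaining factors of a word are collected on the right of the
differentiated one. -/
theorem mul (hX : HasAdjoint X x a) (hZ : HasAdjoint Z x b) :
    HasAdjoint (fun x => X x * Z x) x fun Y => a (Z x * Y) + b (Y * X x) := fun u => by
  obtain ⟨X', h1, h2⟩ := hX u
  obtain ⟨Z', h3, h4⟩ := hZ u
  refine ⟨X' * Z x + X x * Z', by simpa using hasDerivAt_matrix_mul h1 h3, fun Y => ?_⟩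
  have e : trace (X x * Z' * Y) = trace (Z' * (Y * X x)) := by
    rw [mul_assoc, trace_mul_comm, mul_assoc]
  simp only [add_mul, trace_add, e, mul_assoc X', h2, h4, Prod.fst_add, Prod.snd_add, mul_add]
  ring

theorem sq (hX : HasAdjoint X x a) :
    HasAdjoint (fun x => X x ^ 2) x fun Y => a (X x * Y) + a (Y * X x) := by
  simpa only [pow_two] using hX.mul hX

theorem inv (hX : HasAdjoint X x a) (h : IsUnit (X x)) :
    HasAdjoint (fun x => (X x)⁻¹) x fun Y => a (-((X x)⁻¹ * Y * (X x)⁻¹)) := fun u => by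
  obtain ⟨X', h1, h2⟩ := hX u
  refine ⟨-((X x)⁻¹ * X' * (X x)⁻¹), ?_, fun Y => ?_⟩
  · have := hasDerivAt_matrix_inv h1 (by simpa using h)
    simpa using this
  · rw [← h2, neg_mul, mul_neg, trace_neg, trace_neg, mul_assoc, mul_assoc, trace_mul_comm]
    simp only [mul_assoc]

/-- The transposed derivative at 1 is the gradient of Tr X, and the Hamiltonian vector is the
gradient rotated by the symplectic form. -/
theorem isHamVec (hX : HasAdjoint X x a) {H : ℂ → Phase m → ℂ} {t k : ℂ}
    (hH : ∀ x, H t x = k * trace (X x)) {v : Phase m}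
    (hv : v = (-(k • (a 1).2), k • (a 1).1)) : IsHamVec H t x v := fun u => by
  obtain ⟨X', h1, h2⟩ := hX u
  have h3 := (hasDerivAt_trace h1).const_mul k
  have h4 := h2 1
  rw [mul_one] at h4
  rw [h4] at h3
  simp only [hH]
  convert! h3 using 1
  rw [hv, sympl, mul_smul_comm, neg_mul, smul_mul_assoc, trace_neg, trace_smul, trace_smul,
    trace_mul_comm (a 1).2, smul_eq_mul, smul_eq_mul]
  ring

end HasAdjoint

open HasAdjoint

theorem isHamVec_hamII (α : Fin 2 → ℂ) (t : ℂ) (x : Phase m) :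
    IsHamVec (hamII α) t x (vecII α t x) := by
  refine (((HasAdjoint.smul (1 / 2) (HasAdjoint.sq fst)).sub (HasAdjoint.smul (1 / 2) (HasAdjoint.sq ((HasAdjoint.sq snd).add (const ((t / 2) • 1)))))).sub
    (HasAdjoint.smul (α 1 - 1 / 2) snd)).isHamVec (k := 1) (fun x => by rw [one_mul]; rfl) ?_
  ext : 1 <;>
  simp only [vecII, Prod.fst_add, Prod.snd_add, Prod.fst_sub, Prod.snd_sub, Prod.smul_fst,
    Prod.smul_snd, mul_one, one_mul, add_mul, mul_add, pow_two, smul_mul_assoc, mul_smul_comm,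
    smul_smul, mul_assoc, smul_zero, add_zero, zero_add, sub_zero, zero_sub] <;>
  module

theorem isHamVec_hamIV (α : Fin 3 → ℂ) (t : ℂ) (x : Phase m) :
    IsHamVec (hamIV α) t x (vecIV α t x) := by
  refine (((((fst.sub snd).sub (const ((2 * t) • 1))).mul fst |>.mul snd).sub
    (HasAdjoint.smul (2 * α 1) fst)).sub (HasAdjoint.smul (2 * α 2) snd)).isHamVec (k := 1)
    (fun x => by rw [one_mul]; rfl) ?_
  ext : 1 <;>
  simp only [vecIV, Prod.fst_add, Prod.snd_add, Prod.fst_sub, Prod.snd_sub, Prod.smul_fst,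
    Prod.smul_snd, mul_one, one_mul, sub_mul, mul_sub, smul_mul_assoc, mul_smul_comm,
    smul_smul, mul_assoc, smul_zero, add_zero, zero_add, sub_zero, zero_sub] <;>
  module

theorem isHamVec_hamV (α : Fin 4 → ℂ) (t : ℂ) (x : Phase m) :
    IsHamVec (hamV α) t x (vecV α t x) := by
  refine (((((fst.mul (fst.add (const (t • 1)))).mul snd).mul (snd.sub (const 1))).sub
    (HasAdjoint.smul (α 1 + α 3) (fst.mul snd))).add (HasAdjoint.smul (α 1) fst) |>.add
    (HasAdjoint.smul (α 2 * t) snd)).isHamVec (k := t⁻¹) (fun x => rfl) ?_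
  ext : 1 <;>
  simp only [vecV, Prod.fst_add, Prod.snd_add, Prod.fst_sub, Prod.snd_sub, Prod.smul_fst,
    Prod.smul_snd, mul_one, one_mul, sub_mul, mul_sub, add_mul, mul_add, smul_mul_assoc,
    mul_smul_comm, Prod.fst_zero, Prod.snd_zero,
    smul_smul, mul_assoc, smul_zero, add_zero, zero_add, sub_zero, zero_sub] <;>
  module

theorem isHamVec_hamIIID6 (α β : Fin 2 → ℂ) (t : ℂ) (x : Phase m) :
    IsHamVec (hamIIID6 α β) t x (vecIIID6 α β t x) := by
  refine ((((HasAdjoint.sq fst).mul (HasAdjoint.sq snd)).sub ((((HasAdjoint.sq snd).sub (HasAdjoint.smul (α 1 + β 1) snd)).sub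
    (const (t • 1))).mul fst)).sub (HasAdjoint.smul (α 1) snd)).isHamVec (k := t⁻¹) (fun x => rfl) ?_
  ext : 1 <;>
  simp only [vecIIID6, Prod.fst_add, Prod.snd_add, Prod.fst_sub, Prod.snd_sub, Prod.smul_fst,
    Prod.smul_snd, mul_one, one_mul, sub_mul, mul_sub, add_mul, mul_add, smul_mul_assoc,
    mul_smul_comm, Prod.fst_zero, Prod.snd_zero, pow_two,
    smul_smul, mul_assoc, smul_zero, add_zero, zero_add, sub_zero, zero_sub] <;>
  module

theorem isHamVec_hamIIID8 (t : ℂ) {x : Phase m} (hx : IsUnit x.2) :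
    IsHamVec hamIIID8 t x (vecIIID8 t x x.2⁻¹) := by
  refine (((((fst.mul snd).mul fst).mul snd).add (fst.mul snd)).sub snd |>.sub
    (HasAdjoint.smul t (inv snd hx))).isHamVec (k := t⁻¹) (fun x => rfl) ?_
  ext : 1 <;>
  simp only [vecIIID8, Prod.fst_add, Prod.snd_add, Prod.fst_sub, Prod.snd_sub, Prod.smul_fst,
    Prod.smul_snd, mul_one, one_mul, sub_mul, mul_sub, add_mul, mul_add, smul_mul_assoc,
    mul_smul_comm, Prod.fst_zero, Prod.snd_zero,
    smul_smul, mul_assoc, smul_zero, add_zero, zero_add, sub_zero, zero_sub] <;>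
  module

theorem isHamVec_hamVI (α : Fin 5 → ℂ) (t : ℂ) (x : Phase m) :
    IsHamVec (hamVI α) t x (vecVI α t x) := by
  have hq := snd (x := x)
  have h1 := hq.sub (const 1)
  have ht := hq.sub (const (t • 1))
  refine (((((fst.mul snd).mul h1).mul fst).mul ht).sub
    ((((HasAdjoint.smul (α 4) (h1.mul ht)).add (HasAdjoint.smul (α 3) (snd.mul ht))).add
      (HasAdjoint.smul (α 0 - 1) (snd.mul h1))).mul fst) |>.add
    (HasAdjoint.smul (α 2 * (α 1 + α 2)) ht)).isHamVec (k := (t * (t - 1))⁻¹) (fun x => rfl) ?_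
  ext : 1 <;>
  simp only [vecVI, Prod.fst_add, Prod.snd_add, Prod.fst_sub, Prod.snd_sub, Prod.smul_fst,
    Prod.smul_snd, mul_one, one_mul, sub_mul, mul_sub, add_mul, mul_add, smul_mul_assoc,
    mul_smul_comm, Prod.fst_zero, Prod.snd_zero, smul_sub, smul_add,
    smul_smul, mul_assoc, smul_zero, add_zero, zero_add, sub_zero, zero_sub] <;>
  module

theorem conjInvariant_hamII (α : Fin 2 → ℂ) : ConjInvariant (m := m) (hamII α) := fun t u x => by
  simp only [hamII]
  conv_rhs => rw [← trace_conjAlg u]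
  simp only [map_add, map_sub, map_mul, map_pow, map_smul, map_one, conjAlg_inv, conjP_fst, conjP_snd]

theorem conjInvariant_hamIV (α : Fin 3 → ℂ) : ConjInvariant (m := m) (hamIV α) := fun t u x => by
  simp only [hamIV]
  conv_rhs => rw [← trace_conjAlg u]
  simp only [map_add, map_sub, map_mul, map_pow, map_smul, map_one, conjAlg_inv, conjP_fst, conjP_snd]

theorem conjInvariant_hamV (α : Fin 4 → ℂ) : ConjInvariant (m := m) (hamV α) := fun t u x => by
  simp only [hamV]
  conv_rhs => rw [← trace_conjAlg u]
  simp only [map_add, map_sub, map_mul, map_pow, map_smul, map_one, conjAlg_inv, conjP_fst, conjP_snd]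

theorem conjInvariant_hamIIID6 (α β : Fin 2 → ℂ) : ConjInvariant (m := m) (hamIIID6 α β) := fun t u x => by
  simp only [hamIIID6]
  conv_rhs => rw [← trace_conjAlg u]
  simp only [map_add, map_sub, map_mul, map_pow, map_smul, map_one, conjAlg_inv, conjP_fst, conjP_snd]

theorem conjInvariant_hamIIID8 : ConjInvariant (m := m) hamIIID8 := fun t u x => by
  simp only [hamIIID8]
  conv_rhs => rw [← trace_conjAlg u]
  simp only [map_add, map_sub, map_mul, map_pow, map_smul, map_one, conjAlg_inv, conjP_fst, conjP_snd]

theorem conjInvariant_hamVI (α : Fin 5 → ℂ) : ConjInvariant (m := m) (hamVI α) := fun t u x => by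
  simp only [hamVI]
  conv_rhs => rw [← trace_conjAlg u]
  simp only [map_add, map_sub, map_mul, map_pow, map_smul, map_one, conjAlg_inv, conjP_fst, conjP_snd]

/-! ### Conservation of the commutator -/

/-- Conceptually this is Noether's theorem for the invariance of the Hamiltonian under conjugation;
it is verified by expansion. -/
theorem dcomm_vecV (α : Fin 4 → ℂ) (t : ℂ) (x : Phase m) : dcomm x (vecV α t x) = 0 := by
  simp only [dcomm, vecV, mul_one, one_mul, sub_mul, mul_sub, add_mul, mul_add, smul_mul_assoc,
    mul_smul_comm, smul_smul, mul_assoc, smul_sub, smul_add]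
  module

theorem dcomm_vecIIID6 (α β : Fin 2 → ℂ) (t : ℂ) (x : Phase m) :
    dcomm x (vecIIID6 α β t x) = 0 := by
  simp only [dcomm, vecIIID6, mul_one, one_mul, sub_mul, mul_sub, add_mul, mul_add,
    smul_mul_assoc, mul_smul_comm, smul_smul, mul_assoc, smul_sub, smul_add]
  module

theorem dcomm_vecIIID8 (t : ℂ) {x : Phase m} (hx : IsUnit x.2) :
    dcomm x (vecIIID8 t x x.2⁻¹) = 0 := by
  have hd := (isUnit_iff_isUnit_det _).1 hx
  have h1 := mul_nonsing_inv _ hd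
  have h2 := nonsing_inv_mul _ hd
  have h3 := mul_nonsing_inv_cancel_left (A := x.2) x.2⁻¹ hd
  simp only [dcomm, vecIIID8, mul_one, one_mul, sub_mul, mul_sub, add_mul, mul_add,
    smul_mul_assoc, mul_smul_comm, smul_smul, mul_assoc, smul_sub, smul_add, h1, h2, h3]
  module

theorem dcomm_vecVI (α : Fin 5 → ℂ) (t : ℂ) (x : Phase m) : dcomm x (vecVI α t x) = 0 := by
  simp only [dcomm, vecVI, mul_one, one_mul, sub_mul, mul_sub, add_mul, mul_add, smul_mul_assoc,
    mul_smul_comm, smul_smul, mul_assoc, smul_sub, smul_add]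
  module

end Gradients


/-! ### Phase space points in terms of blocks -/

section OfBlk

variable {n d : ℕ}

/-- The point of the phase space with the given blocks. -/
def ofBlk (b : Matrix (Fin d) (Fin d) (Matrix (Fin n) (Fin n) ℂ) ×
    Matrix (Fin d) (Fin d) (Matrix (Fin n) (Fin n) ℂ)) : Phase (Fin n × Fin d) :=
  ((blkAlg n d).symm b.1, (blkAlg n d).symm b.2)

@[simp] theorem blk_ofBlk_fst (b : Matrix (Fin d) (Fin d) (Matrix (Fin n) (Fin n) ℂ) ×
    Matrix (Fin d) (Fin d) (Matrix (Fin n) (Fin n) ℂ)) (i j : Fin d) :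
    blk (ofBlk b).1 i j = b.1 i j := blk_symm _ _ _

@[simp] theorem blk_ofBlk_snd (b : Matrix (Fin d) (Fin d) (Matrix (Fin n) (Fin n) ℂ) ×
    Matrix (Fin d) (Fin d) (Matrix (Fin n) (Fin n) ℂ)) (i j : Fin d) :
    blk (ofBlk b).2 i j = b.2 i j := blk_symm _ _ _

theorem phase_ext {x y : Phase (Fin n × Fin d)} (h1 : ∀ i j, blk x.1 i j = blk y.1 i j)
    (h2 : ∀ i j, blk x.2 i j = blk y.2 i j) : x = y :=
  Prod.ext (blk_injective h1) (blk_injective h2)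

theorem ofBlk_add (b c : Matrix (Fin d) (Fin d) (Matrix (Fin n) (Fin n) ℂ) ×
    Matrix (Fin d) (Fin d) (Matrix (Fin n) (Fin n) ℂ)) :
    ofBlk (b + c) = ofBlk b + ofBlk c := by simp [ofBlk]

/-- The infinitesimal action of `diag (ξ₁, …, ξ_d)` on blocks. -/
def gaugeBlk {R : Type*} [Ring R] (ξ : Fin d → R)
    (b : Matrix (Fin d) (Fin d) R × Matrix (Fin d) (Fin d) R) :
    Matrix (Fin d) (Fin d) R × Matrix (Fin d) (Fin d) R :=
  (Matrix.of fun i j => ξ i * b.1 i j - b.1 i j * ξ j,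
    Matrix.of fun i j => ξ i * b.2 i j - b.2 i j * ξ j)

theorem infGauge_ofBlk (ξ : Fin d → Matrix (Fin n) (Fin n) ℂ)
    (b : Matrix (Fin d) (Fin d) (Matrix (Fin n) (Fin n) ℂ) ×
      Matrix (Fin d) (Fin d) (Matrix (Fin n) (Fin n) ℂ)) :
    infGauge ξ (ofBlk b) = ofBlk (gaugeBlk ξ b) := by
  refine phase_ext (fun i j => ?_) fun i j => ?_ <;>
    simp [infGauge, gaugeBlk, blk_sub, blk_mul, blk_blockDiagonal]

theorem moment_ofBlk (b : Matrix (Fin d) (Fin d) (Matrix (Fin n) (Fin n) ℂ) ×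
    Matrix (Fin d) (Fin d) (Matrix (Fin n) (Fin n) ℂ)) (i : Fin d) :
    moment (ofBlk b) i = (b.1 * b.2 - b.2 * b.1) i i := by
  rw [moment, ← blkAlg_apply, comm, ofBlk]
  simp only [map_sub, map_mul, AlgEquiv.apply_symm_apply]

theorem sympl_ofBlk (b c : Matrix (Fin d) (Fin d) (Matrix (Fin n) (Fin n) ℂ) ×
    Matrix (Fin d) (Fin d) (Matrix (Fin n) (Fin n) ℂ)) :
    sympl (ofBlk b) (ofBlk c) =
      ∑ i, ∑ j, (trace (b.1 i j * c.2 j i) - trace (c.1 i j * b.2 j i)) := by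
  simp only [sympl, trace_eq_sum_blk, blk_mul, trace_sum, blk_ofBlk_fst, blk_ofBlk_snd,
    Finset.sum_sub_distrib]

theorem hasDerivAt_blkAlg_symm
    {A : ℂ → Matrix (Fin d) (Fin d) (Matrix (Fin n) (Fin n) ℂ)}
    {A' : Matrix (Fin d) (Fin d) (Matrix (Fin n) (Fin n) ℂ)} {z : ℂ}
    (h : ∀ i j, HasDerivAt (fun ε => A ε i j) (A' i j) z) :
    HasDerivAt (fun ε => (blkAlg n d).symm (A ε)) ((blkAlg n d).symm A') z := by
  -- Viewed as a function of two indices, the matrix is differentiated entry by entry.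
  have key : HasDerivAt (fun ε => (blkAlg n d).symm (A ε) :
      ℂ → (Fin n × Fin d) → (Fin n × Fin d) → ℂ) ((blkAlg n d).symm A') z := by
    refine hasDerivAt_pi.2 fun a => hasDerivAt_pi.2 fun b => ?_
    have h1 : HasDerivAt (fun ε => A ε a.2 b.2 : ℂ → Fin n → Fin n → ℂ) (A' a.2 b.2) z := h a.2 b.2
    exact hasDerivAt_pi.1 (hasDerivAt_pi.1 h1 a.1) b.1
  exact key

theorem hasDerivAt_ofBlk {b : ℂ → Matrix (Fin d) (Fin d) (Matrix (Fin n) (Fin n) ℂ) ×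
      Matrix (Fin d) (Fin d) (Matrix (Fin n) (Fin n) ℂ)}
    {b' : Matrix (Fin d) (Fin d) (Matrix (Fin n) (Fin n) ℂ) ×
      Matrix (Fin d) (Fin d) (Matrix (Fin n) (Fin n) ℂ)} {z : ℂ}
    (h1 : ∀ i j, HasDerivAt (fun ε => (b ε).1 i j) (b'.1 i j) z)
    (h2 : ∀ i j, HasDerivAt (fun ε => (b ε).2 i j) (b'.2 i j) z) :
    HasDerivAt (fun ε => ofBlk (b ε)) (ofBlk b') z :=
  (hasDerivAt_blkAlg_symm h1).prodMk (hasDerivAt_blkAlg_symm h2)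

theorem differentiableOn_blkAlg_symm {E : Type*} [NormedAddCommGroup E] [NormedSpace ℂ E]
    {A : E → Matrix (Fin d) (Fin d) (Matrix (Fin n) (Fin n) ℂ)} {Z : Set E}
    (h : ∀ i j, DifferentiableOn ℂ (fun z => A z i j) Z) :
    DifferentiableOn ℂ (fun z => (blkAlg n d).symm (A z)) Z := by
  have key : DifferentiableOn ℂ (fun z => (blkAlg n d).symm (A z) :
      E → (Fin n × Fin d) → (Fin n × Fin d) → ℂ) Z := by
    refine differentiableOn_pi.2 fun a => differentiableOn_pi.2 fun b => ?_
    have h1 : DifferentiableOn ℂ (fun z => A z a.2 b.2 : E → Fin n → Fin n → ℂ) Z := h a.2 b.2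
    exact differentiableOn_pi.1 (differentiableOn_pi.1 h1 a.1) b.1
  exact key

theorem differentiableOn_ofBlk {E : Type*} [NormedAddCommGroup E] [NormedSpace ℂ E]
    {b : E → Matrix (Fin d) (Fin d) (Matrix (Fin n) (Fin n) ℂ) ×
      Matrix (Fin d) (Fin d) (Matrix (Fin n) (Fin n) ℂ)} {Z : Set E}
    (h1 : ∀ i j, DifferentiableOn ℂ (fun z => (b z).1 i j) Z)
    (h2 : ∀ i j, DifferentiableOn ℂ (fun z => (b z).2 i j) Z) :
    DifferentiableOn ℂ (fun z => ofBlk (b z)) Z :=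
  (differentiableOn_blkAlg_symm h1).prodMk (differentiableOn_blkAlg_symm h2)

/-- The block in row `i` and column `j`, as a continuous linear map. -/
def blkL (n d : ℕ) (i j : Fin d) :
    Matrix (Fin n × Fin d) (Fin n × Fin d) ℂ →L[ℂ] Matrix (Fin n) (Fin n) ℂ :=
  LinearMap.toContinuousLinearMap
    { toFun := fun A => blk A i j, map_add' := fun _ _ => rfl, map_smul' := fun _ _ => rfl }

@[fun_prop] theorem differentiable_blk (i j : Fin d) :
    Differentiable ℂ fun A : Matrix (Fin n × Fin d) (Fin n × Fin d) ℂ => blk A i j :=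
  (blkL n d i j).differentiable

@[fun_prop] theorem continuous_blk (i j : Fin d) :
    Continuous fun A : Matrix (Fin n × Fin d) (Fin n × Fin d) ℂ => blk A i j :=
  (blkL n d i j).continuous

theorem mem_fixedSet_blk {reg : Set (Phase (Fin n × Fin d))}
    {w : ℂ → Phase (Fin n × Fin d) → Phase (Fin n × Fin d)} {t : ℂ} {x : Phase (Fin n × Fin d)} :
    x ∈ fixedSet reg w t ↔ x ∈ reg ∧
      (∀ i j : Fin d, (Complex.exp (2 * Real.pi * Complex.I / d) ^ (i : ℕ) *
        (Complex.exp (2 * Real.pi * Complex.I / d) ^ (j : ℕ))⁻¹) • blk x.1 i j =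
          blk (w t x).1 i j) ∧
      ∀ i j : Fin d, (Complex.exp (2 * Real.pi * Complex.I / d) ^ (i : ℕ) *
        (Complex.exp (2 * Real.pi * Complex.I / d) ^ (j : ℕ))⁻¹) • blk x.2 i j =
          blk (w t x).2 i j := by
  rw [mem_fixedSet]
  refine and_congr_right fun _ => ?_
  simp only [← blk_conjAlg_twist]
  exact ⟨fun h => by rw [← h]; exact ⟨fun _ _ => rfl, fun _ _ => rfl⟩,
    fun h => phase_ext h.1 h.2⟩

theorem blk_gauge_fst (h : Fin d → GL (Fin n) ℂ) (x : Phase (Fin n × Fin d)) (i j : Fin d) :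
    blk (gauge h x).1 i j =
      (h i : Matrix (Fin n) (Fin n) ℂ) * blk x.1 i j * ((h j)⁻¹ : GL (Fin n) ℂ).1 := by
  rw [gauge_eq]; exact blk_conjAlg h x.1 i j

theorem blk_gauge_snd (h : Fin d → GL (Fin n) ℂ) (x : Phase (Fin n × Fin d)) (i j : Fin d) :
    blk (gauge h x).2 i j =
      (h i : Matrix (Fin n) (Fin n) ℂ) * blk x.2 i j * ((h j)⁻¹ : GL (Fin n) ℂ).1 := by
  rw [gauge_eq]; exact blk_conjAlg h x.2 i j

theorem isUnit_gauge {h k : GL (Fin n) ℂ} {A : Matrix (Fin n) (Fin n) ℂ} (hA : IsUnit A) :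
    IsUnit ((h : Matrix (Fin n) (Fin n) ℂ) * A * (k⁻¹ : GL (Fin n) ℂ).1) :=
  (h.isUnit.mul hA).mul (k⁻¹).isUnit

theorem gauge_inv {h k : GL (Fin n) ℂ} (A : Matrix (Fin n) (Fin n) ℂ) :
    ((h : Matrix (Fin n) (Fin n) ℂ) * A * (k⁻¹ : GL (Fin n) ℂ).1)⁻¹ =
      (k : Matrix (Fin n) (Fin n) ℂ) * A⁻¹ * (h⁻¹ : GL (Fin n) ℂ).1 := by
  rw [Matrix.mul_inv_rev, Matrix.mul_inv_rev, ← Matrix.coe_units_inv, ← Matrix.coe_units_inv,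
    inv_inv, mul_assoc]

end OfBlk

/-! ### Density of invertible matrices on lines -/

section Density

variable {m : Type} [Fintype m] [DecidableEq m]

theorem eventually_eval_ne_zero {P : Polynomial ℂ} {ε₀ : ℂ} (h : P.eval ε₀ ≠ 0) :
    ∀ᶠ ε in 𝓝[≠] (0 : ℂ), P.eval ε ≠ 0 := by
  have hP : P ≠ 0 := by
    rintro rfl
    exact h Polynomial.eval_zero
  have hfin : {ε | P.IsRoot ε}.Finite := Polynomial.finite_setOfPred_isRoot hP
  have h1 : ∀ᶠ ε in 𝓝 (0 : ℂ), ε ∉ {ε | P.IsRoot ε} \ {0} :=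
    (hfin.subset Set.sdiff_subset).isClosed.isOpen_compl.mem_nhds (by simp)
  filter_upwards [h1.filter_mono nhdsWithin_le_nhds, self_mem_nhdsWithin] with ε h2 h3 h4
  exact h2 ⟨h4, h3⟩

/-- The matrix `A + X B` over the polynomials. -/
def polyLine (A B : Matrix m m ℂ) : Matrix m m (Polynomial ℂ) :=
  A.map (Polynomial.C (R := ℂ)) + (Polynomial.X (R := ℂ)) • B.map (Polynomial.C (R := ℂ))

theorem polyLine_eval (A B : Matrix m m ℂ) (ε : ℂ) :
    (Polynomial.evalRingHom ε).mapMatrix (polyLine A B) = A + ε • B := by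
  ext i j
  have : (Polynomial.C (A i j) + Polynomial.X * Polynomial.C (B i j)).eval ε =
    A i j + ε * B i j := by simp only [Polynomial.eval_add, Polynomial.eval_mul,
      Polynomial.eval_C, Polynomial.eval_X]
  exact this

/-- The determinant is a polynomial in ε that does not vanish at ε₀, so it has finitely many zeros
and none in a punctured neighbourhood of 0. -/
theorem eventually_isUnit_add_smul (A B : Matrix m m ℂ) {ε₀ : ℂ} (h : IsUnit (A + ε₀ • B)) :
    ∀ᶠ ε in 𝓝[≠] (0 : ℂ), IsUnit (A + ε • B) := by
  have hM (ε : ℂ) : (polyLine A B).det.eval ε = (A + ε • B).det := by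
    rw [← Polynomial.coe_evalRingHom, RingHom.map_det, polyLine_eval]
  simp only [isUnit_iff_isUnit_det, isUnit_iff_ne_zero, ← hM] at h ⊢
  exact eventually_eval_ne_zero h

theorem mem_closure_of_eventually_line {E : Type*} [NormedAddCommGroup E] [NormedSpace ℂ E]
    {Z : Set E} (x u : E) (h : ∀ᶠ ε in 𝓝[≠] (0 : ℂ), x + ε • u ∈ Z) : x ∈ closure Z := by
  have hc : Filter.Tendsto (fun ε : ℂ => x + ε • u) (𝓝[≠] 0) (𝓝 x) := by
    have : ContinuousAt (fun ε : ℂ => x + ε • u) 0 := by fun_prop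
    have h1 := this.tendsto.mono_left (nhdsWithin_le_nhds (s := {0}ᶜ))
    simpa using h1
  exact mem_closure_of_tendsto hc h

theorem exists_isUnit_add_smul_one (A : Matrix m m ℂ) :
    ∃ μ : ℂ, IsUnit (A + μ • (1 : Matrix m m ℂ)) := by
  obtain ⟨μ, hμ⟩ := (Matrix.finite_spectrum A).exists_notMem
  refine ⟨-μ, ?_⟩
  have := (spectrum.notMem_iff.1 hμ).neg
  rw [Algebra.algebraMap_eq_smul_one, neg_sub] at this
  rwa [neg_smul, ← sub_eq_add_neg]

/-- In the direction u the matrix moves by multiples of 1, and its spectrum is finite. -/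
theorem dense_isUnit_affine (f : Phase m →ₗ[ℂ] Matrix m m ℂ) (A : Matrix m m ℂ) {u : Phase m}
    (hu : f u = 1) : Dense {y : Phase m | IsUnit (f y + A)} := fun y => by
  obtain ⟨μ, hμ⟩ := exists_isUnit_add_smul_one (f y + A)
  refine mem_closure_of_eventually_line y u ?_
  filter_upwards [eventually_isUnit_add_smul _ _ hμ] with ε hε
  show IsUnit (f (y + ε • u) + A)
  rwa [map_add, map_smul, hu, add_right_comm]

theorem isOpen_isUnit_comp {E : Type*} [TopologicalSpace E] {f : E → Matrix m m ℂ}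
    (hf : Continuous f) : IsOpen {x | IsUnit (f x)} := isOpen_isUnit_matrix.preimage hf

end Density


/-! ### The slice `q₁₂ = 1` of the linear reductions -/

section Lin

variable {n : ℕ}

theorem exp_two_pi_div_two : Complex.exp (2 * Real.pi * Complex.I / 2) = -1 := by
  rw [show 2 * (Real.pi : ℂ) * Complex.I / 2 = Real.pi * Complex.I by ring,
    Complex.exp_pi_mul_I]

theorem matrix_eq_neg_iff {m : Type} {A : Matrix m m ℂ} : A = -A ↔ A = 0 := by
  simp only [← Matrix.ext_iff, Matrix.neg_apply, Matrix.zero_apply, self_eq_neg]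

theorem matrix_neg_eq_iff {m : Type} {A : Matrix m m ℂ} : -A = A ↔ A = 0 :=
  eq_comm.trans matrix_eq_neg_iff

/-- The blocks of a point of the slice. -/
def linBlk {R : Type*} [Ring R] [Algebra ℂ R] (a : R) (b g : ℂ) (y : R × R) :
    Matrix (Fin 2) (Fin 2) R × Matrix (Fin 2) (Fin 2) R :=
  (!![a, y.1; y.2 * y.1 + (Complex.I * g) • 1, a], !![b • 1, 1; y.2, b • 1])

/-- The derivative of `linBlk`. -/
def dlinBlk {R : Type*} [Ring R] [Algebra ℂ R] (a' : R) (b' : ℂ) (y u : R × R) :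
    Matrix (Fin 2) (Fin 2) R × Matrix (Fin 2) (Fin 2) R :=
  (!![a', u.1; u.2 * y.1 + y.2 * u.1, a'], !![b' • 1, 0; u.2, b' • 1])

/-- The gauge transformation to the slice. -/
def linNrm (x : Phase (Fin n × Fin 2)) : Fin 2 → Matrix (Fin n) (Fin n) ℂ := ![1, blk x.2 0 1]

theorem hasDerivAt_linBlk {a : ℂ → Matrix (Fin n) (Fin n) ℂ} {a' : Matrix (Fin n) (Fin n) ℂ}
    {b : ℂ → ℂ} {b' g z : ℂ} {y : ℂ → Phase (Fin n)} {u : Phase (Fin n)}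
    (ha : HasDerivAt a a' z) (hb : HasDerivAt b b' z) (hy : HasDerivAt y u z) :
    HasDerivAt (fun ε => ofBlk (linBlk (a ε) (b ε) g (y ε))) (ofBlk (dlinBlk a' b' (y z) u)) z := by
  have h1 := hasDerivAt_fst hy
  have h2 := hasDerivAt_snd hy
  have h21 := (hasDerivAt_matrix_mul h2 h1).add_const ((Complex.I * g) • 1)
  refine hasDerivAt_ofBlk (fun i j => ?_) fun i j => ?_
  · fin_cases i <;> fin_cases j
    exacts [ha, h1, h21, ha]
  · fin_cases i <;> fin_cases j
    exacts [hb.smul_const _, hasDerivAt_const _ _, h2, hb.smul_const _]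

theorem differentiableOn_linBlk {E : Type*} [NormedAddCommGroup E] [NormedSpace ℂ E]
    {a : E → Matrix (Fin n) (Fin n) ℂ} {b : E → ℂ} {g : ℂ} {y : E → Phase (Fin n)} {Z : Set E}
    (ha : DifferentiableOn ℂ a Z) (hb : DifferentiableOn ℂ b Z) (hy : DifferentiableOn ℂ y Z) :
    DifferentiableOn ℂ (fun z => ofBlk (linBlk (a z) (b z) g (y z))) Z := by
  have h1 : DifferentiableOn ℂ (fun z => (y z).1) Z := hy.fst
  have h2 : DifferentiableOn ℂ (fun z => (y z).2) Z := hy.snd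
  have h21 : DifferentiableOn ℂ (fun z => (y z).2 * (y z).1 + (Complex.I * g) • 1) Z :=
    (h2.mul h1).add_const _
  refine differentiableOn_ofBlk (fun i j => ?_) fun i j => ?_
  · fin_cases i <;> fin_cases j
    exacts [ha, h1, h21, ha]
  · fin_cases i <;> fin_cases j
    exacts [hb.smul_const _, differentiableOn_const _, h2, hb.smul_const _]

/-- At fixed time the diagonal of q and q₁₂ = 1 are constant on the slice, so only p₁₂ is paired
with a varying block, namely q₂₁. -/
theorem sympl_dlinBlk (a' a'' : Matrix (Fin n) (Fin n) ℂ) (y u u' : Phase (Fin n)) :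
    sympl (ofBlk (dlinBlk a' 0 y u)) (ofBlk (dlinBlk a'' 0 y u')) = sympl u u' := by
  rw [sympl_ofBlk]
  simp [dlinBlk, sympl, Fin.sum_univ_two]

theorem differentiable_linNrm : Differentiable ℂ (linNrm (n := n)) := by
  refine differentiable_pi.2 fun i => ?_
  fin_cases i
  · exact differentiable_const _
  · exact (differentiable_blk 0 1).comp differentiable_snd

theorem linNrm_gauge (x : Phase (Fin n × Fin 2)) (h : Fin 2 → GL (Fin n) ℂ) (h0 : h 0 = 1)
    (i : Fin 2) : linNrm (gauge h x) i = linNrm x i * ((h i)⁻¹ : GL (Fin n) ℂ).1 := by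
  fin_cases i
  · simp [linNrm, h0]
  · simp [linNrm, blk_gauge_snd, h0]

theorem isUnit_linNrm {x : Phase (Fin n × Fin 2)} (hx : x ∈ genLin) (i : Fin 2) :
    IsUnit (linNrm x i) := by
  fin_cases i
  · exact isUnit_one
  · exact hx

theorem redLin_gauge (x : Phase (Fin n × Fin 2)) (h : Fin 2 → GL (Fin n) ℂ) (h0 : h 0 = 1) :
    redLin (gauge h x) = redLin x := by
  simp only [redLin, blk_gauge_fst, blk_gauge_snd, gauge_inv]
  simp [h0, mul_assoc]

theorem isOpen_genLin : IsOpen (genLin (n := n)) :=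
  isOpen_isUnit_comp ((continuous_blk 0 1).comp continuous_snd)

theorem isOpen_genLin' : IsOpen (genLin' (n := n)) :=
  isOpen_genLin.inter (isOpen_isUnit_comp ((continuous_blk 1 0).comp continuous_snd))

theorem differentiableOn_blk_inv {d : ℕ} {i j : Fin d} {Z : Set (Phase (Fin n × Fin d))}
    (hZ : ∀ x ∈ Z, IsUnit (blk x.2 i j)) :
    DifferentiableOn ℂ (fun x : Phase (Fin n × Fin d) => (blk x.2 i j)⁻¹) Z := fun x hx =>
  ((differentiableAt_matrix_inv (hZ x hx)).comp x
    ((differentiable_blk i j).comp differentiable_snd x)).differentiableWithinAt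

theorem differentiableOn_redLin {Z : Set (Phase (Fin n × Fin 2))} (hZ : Z ⊆ genLin) :
    DifferentiableOn ℂ (redLin (n := n)) Z := by
  have h1 : Differentiable ℂ fun x : Phase (Fin n × Fin 2) => blk x.1 0 1 :=
    (differentiable_blk 0 1).comp differentiable_fst
  have h2 : Differentiable ℂ fun x : Phase (Fin n × Fin 2) => blk x.2 0 1 :=
    (differentiable_blk 0 1).comp differentiable_snd
  have h3 : Differentiable ℂ fun x : Phase (Fin n × Fin 2) => blk x.2 1 0 :=
    (differentiable_blk 1 0).comp differentiable_snd
  exact (h1.differentiableOn.mul (differentiableOn_blk_inv fun x hx => hZ hx)).prodMk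
    (h2.mul h3).differentiableOn

theorem redLin_linBlk (a : Matrix (Fin n) (Fin n) ℂ) (b g : ℂ) (y : Phase (Fin n)) :
    redLin (ofBlk (linBlk a b g y)) = y := by
  simp [redLin, linBlk]

theorem linBlk_mem_momentLevel (a : Matrix (Fin n) (Fin n) ℂ) (b : ℂ) (g : Fin 2 → ℂ)
    (y : Phase (Fin n)) : ofBlk (linBlk a b (g 1) y) ∈ momentLevel g := by
  intro i hi
  fin_cases i
  · exact absurd rfl hi
  · rw [moment_ofBlk]
    simp [linBlk, Matrix.mul_apply, Fin.sum_univ_two]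

theorem linBlk_mem_genLin (a : Matrix (Fin n) (Fin n) ℂ) (b g : ℂ) (y : Phase (Fin n)) :
    ofBlk (linBlk a b g y) ∈ genLin := by
  simp [genLin, linBlk]

/-- With q₁₂ = 1, scalar diagonal blocks of q and equal diagonal blocks of p, the moment condition
becomes p₂₁ - q₂₁p₁₂ = ig. The blocks p₁₂ and q₂₁ remain free and are the components of `redLin`. -/
theorem eq_linBlk {x : Phase (Fin n × Fin 2)} {a : Matrix (Fin n) (Fin n) ℂ} {b : ℂ}
    {g : Fin 2 → ℂ} (hx : x ∈ momentLevel g) (h12 : blk x.2 0 1 = 1)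
    (hp : ∀ i, blk x.1 i i = a) (hq : ∀ i, blk x.2 i i = b • 1) :
    x = ofBlk (linBlk a b (g 1) (redLin x)) := by
  have hm := hx 1 (by simp)
  simp only [moment, comm, blk_sub, blk_mul, Fin.sum_univ_two, h12, hp, hq, mul_one,
    mul_smul_comm, smul_mul_assoc, one_mul] at hm
  have h21 : blk x.1 1 0 = blk x.2 1 0 * blk x.1 0 1 + (Complex.I * g 1) • 1 := by
    rw [← hm]; abel
  refine phase_ext (fun i j => ?_) fun i j => ?_ <;>
    fin_cases i <;> fin_cases j <;> simp [linBlk, redLin, h12, hp, hq, h21]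

theorem linNrm_eq {x : Phase (Fin n × Fin 2)} (h : ∀ i, linNrm x i = 1) : blk x.2 0 1 = 1 := h 1

theorem gauge_genLin (h : Fin 2 → GL (Fin n) ℂ) {x : Phase (Fin n × Fin 2)} (hx : x ∈ genLin) :
    gauge h x ∈ genLin := by
  show IsUnit _
  rw [blk_gauge_snd]
  exact isUnit_gauge hx

/-- The fixed points form an affine space, and the line from any of them to one with q₁₂ = 1 meets
the locus for all small nonzero parameters. -/
theorem dense_genLin {a : Matrix (Fin n) (Fin n) ℂ} {b t : ℂ}
    {w : ℂ → Phase (Fin n × Fin 2) → Phase (Fin n × Fin 2)}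
    (hF : ∀ x, x ∈ fixedSet Set.univ w t ↔ (∀ i, blk x.1 i i = a) ∧ ∀ i, blk x.2 i i = b • 1)
    {x : Phase (Fin n × Fin 2)} (hx : x ∈ fixedSet Set.univ w t) :
    x ∈ closure (fixedSet Set.univ w t ∩ genLin) := by
  refine mem_closure_of_eventually_line x (ofBlk (linBlk a b 0 0) - x) ?_
  have h1 : IsUnit (blk x.2 0 1 + (1 : ℂ) • (1 - blk x.2 0 1)) := by simp
  rw [hF] at hx
  filter_upwards [eventually_isUnit_add_smul _ _ h1] with ε hε
  refine ⟨(hF _).2 ⟨fun i => ?_, fun i => ?_⟩, ?_⟩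
  · fin_cases i <;> simp [blk_add, blk_sub, blk_smul, hx, linBlk]
  · fin_cases i <;> simp [blk_add, blk_sub, blk_smul, hx, linBlk]
  · simpa [genLin, blk_add, blk_sub, blk_smul, linBlk] using hε

theorem vecII_ofBlk {d : ℕ} (α : Fin 2 → ℂ) (t : ℂ)
    (b : Matrix (Fin d) (Fin d) (Matrix (Fin n) (Fin n) ℂ) ×
      Matrix (Fin d) (Fin d) (Matrix (Fin n) (Fin n) ℂ)) :
    vecII α t (ofBlk b) = ofBlk (vecII α t b) :=
  map_vecII (blkAlg n d).symm.toAlgHom α t b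

theorem vecIV_ofBlk {d : ℕ} (α : Fin 3 → ℂ) (t : ℂ)
    (b : Matrix (Fin d) (Fin d) (Matrix (Fin n) (Fin n) ℂ) ×
      Matrix (Fin d) (Fin d) (Matrix (Fin n) (Fin n) ℂ)) :
    vecIV α t (ofBlk b) = ofBlk (vecIV α t b) :=
  map_vecIV (blkAlg n d).symm.toAlgHom α t b

theorem vecIIID6_ofBlk {d : ℕ} (α β : Fin 2 → ℂ) (t : ℂ)
    (b : Matrix (Fin d) (Fin d) (Matrix (Fin n) (Fin n) ℂ) ×
      Matrix (Fin d) (Fin d) (Matrix (Fin n) (Fin n) ℂ)) :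
    vecIIID6 α β t (ofBlk b) = ofBlk (vecIIID6 α β t b) :=
  map_vecIIID6 (blkAlg n d).symm.toAlgHom α β t b

theorem vecV_ofBlk {d : ℕ} (α : Fin 4 → ℂ) (t : ℂ)
    (b : Matrix (Fin d) (Fin d) (Matrix (Fin n) (Fin n) ℂ) ×
      Matrix (Fin d) (Fin d) (Matrix (Fin n) (Fin n) ℂ)) :
    vecV α t (ofBlk b) = ofBlk (vecV α t b) :=
  map_vecV (blkAlg n d).symm.toAlgHom α t b

end Lin

/-! ### PII to PII -/

section II

variable {R : Type*} [Ring R] [Algebra ℂ R]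

/-- `(P̃, Q̃)` in terms of `(P, Q)`. -/
def liftII (c t : ℂ) (y : R × R) : R × R :=
  (-(c • y.2), c⁻¹ • (y.1 + y.2 * y.2 - (c * t / 2) • 1))

/-- The derivative of `liftII`. -/
def dliftII (c : ℂ) (y u : R × R) (τ : ℂ) : R × R :=
  (-(c • u.2), c⁻¹ • (u.1 + (u.2 * y.2 + y.2 * u.2) - (c * τ / 2) • 1))

/-- The PII field does not preserve q₁₂ = 1: there q̇₁₂ = p₁₂. The gauge direction with second block
p₁₂ restores it. The relation c³ = 2 adjusts the coefficients of the cubic and linear terms to those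
of PII in the time -ct. -/
theorem vecII_linBlk (α : Fin 2 → ℂ) (hα : α 1 = 1 / 2) {c : ℂ} (hc : c ^ 3 = 2) (g t : ℂ)
    (y : R × R) :
    dlinBlk 0 0 (liftII c t y) (dliftII c y (-c • vecII ![1 + Complex.I * g, -(Complex.I * g)]
      (-c * t) y) 1) = vecII α t (linBlk 0 0 g (liftII c t y)) +
      gaugeBlk ![0, (liftII c t y).1] (linBlk 0 0 g (liftII c t y)) := by
  have hc0 : c ≠ 0 := by rintro rfl; norm_num at hc
  ext i j : 2 <;> fin_cases i <;> fin_cases j <;>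
    simp [vecII, gaugeBlk, Matrix.mul_apply, Fin.sum_univ_two, hα] <;>
    simp [linBlk, dlinBlk, liftII, dliftII, mul_add, add_mul, mul_sub, sub_mul, smul_sub,
      smul_add, smul_smul, mul_assoc] <;>
    match_scalars <;> first | (field_simp; done) | (field_simp; ring; done) | grind

variable {n : ℕ}

theorem hasDerivAt_liftII (c t τ : ℂ) (y u : Phase (Fin n)) :
    HasDerivAt (fun ε : ℂ => liftII c (t + ε * τ) (y + ε • u)) (dliftII c y u τ) 0 := by
  have hy := hasDerivAt_line y u
  have h1 := hasDerivAt_fst hy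
  have h2 := hasDerivAt_snd hy
  have ht : HasDerivAt (fun ε : ℂ => c * (t + ε * τ) / 2) (c * τ / 2) 0 := by
    have := ((((hasDerivAt_id (0 : ℂ)).mul_const τ).const_add t).const_mul c).div_const 2
    simpa using this
  have h22 := hasDerivAt_matrix_mul h2 h2
  have h := ((h1.add h22).sub (ht.smul_const (1 : Matrix (Fin n) (Fin n) ℂ))).const_smul c⁻¹
  simp only [zero_smul, add_zero] at h
  exact ((h2.const_smul c).neg).prodMk h

theorem backIIr_fixedSet {t : ℂ} {x : Phase (Fin n × Fin 2)} :
    x ∈ fixedSet Set.univ backIIr t ↔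
      (∀ i, blk x.1 i i = 0) ∧ ∀ i, blk x.2 i i = 0 := by
  rw [mem_fixedSet_blk]
  simp [backIIr, blk_neg, exp_two_pi_div_two, Fin.forall_fin_two, matrix_eq_neg_iff,
    matrix_neg_eq_iff]

theorem swapParam_eq_half {α : Fin 2 → ℂ} (h : α 0 + α 1 = 1) (hs : swapParam α = α) :
    α 0 = 1 / 2 ∧ α 1 = 1 / 2 := by
  have h0 : α 1 = α 0 := congrFun hs 0
  rw [h0] at h ⊢
  have : α 0 = 1 / 2 := by linear_combination h / 2
  exact ⟨this, this⟩

theorem mapII_eq {c t : ℂ} (hc : c ≠ 0) (x : Phase (Fin n × Fin 2)) :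
    liftII c t (mapII c t x) = redLin x := by
  refine Prod.ext ?_ ?_
  · simp [liftII, mapII, smul_smul, hc]
  · simp only [liftII, mapII, pow_two]
    match_scalars <;> field_simp <;> ring

theorem mapII_of_lift {c t : ℂ} (hc : c ≠ 0) {x : Phase (Fin n × Fin 2)} {y : Phase (Fin n)}
    (h : redLin x = liftII c t y) : mapII c t x = y := by
  refine Prod.ext ?_ ?_ <;> simp only [mapII, h, liftII, pow_two]
  · simp only [smul_neg, neg_neg, smul_smul, inv_mul_cancel₀ hc, one_smul]
    match_scalars <;> field_simp <;> ring
  · simp [smul_smul, hc]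

/-- The change of variables exchanges P and Q up to scalars and adds Q² to P; the extra term Tr(dQ ∧
d(Q²)) vanishes by cyclicity. -/
theorem sympl_dliftII {c : ℂ} (hc : c ≠ 0) (y u u' : Phase (Fin n)) :
    sympl (dliftII c y u 0) (dliftII c y u' 0) = sympl u u' := by
  have e1 := trace_mul_comm u.2 u'.1
  have e2 := trace_mul_comm u'.2 u.1
  have e3 := trace_mul_cycle u.2 u'.2 y.2
  have e4 := trace_mul_cycle u'.2 u.2 y.2
  have e5 := trace_mul_cycle y.2 u.2 u'.2
  have e6 := trace_mul_cycle y.2 u'.2 u.2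
  simp only [sympl, dliftII, mul_zero, zero_div, zero_smul, sub_zero, mul_add, add_mul, smul_add,
    smul_mul_assoc, mul_smul_comm, smul_smul, neg_mul, mul_neg, smul_neg, trace_add, trace_neg, trace_smul,
    inv_mul_cancel₀ hc, mul_inv_cancel₀ hc, one_smul, one_mul, ← mul_assoc, smul_eq_mul,
    mul_inv_cancel_left₀ hc] at *
  linear_combination -e1 + e2 - e3 + e4 - e5 + e6

theorem slice_II {D : Set ℂ} (hD : IsOpen D) (α g : Fin 2 → ℂ) (c : ℂ) (hα : α 0 + α 1 = 1)
    (hs : swapParam α = α) (hc : c ^ 3 = 2) :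
    Slice (n := n) D (hamII α) Set.univ backIIr g genLin
      (hamII ![1 + Complex.I * g 1, -(Complex.I * g 1)]) Set.univ
      (fun t => -c * t) (mapII c) 0 linNrm fun t y => ofBlk (linBlk 0 0 (g 1) (liftII c t y)) := by
  have hα1 := (swapParam_eq_half hα hs).2
  have hc0 : c ≠ 0 := by rintro rfl; norm_num at hc
  have hds (t : ℂ) : HasDerivAt (fun t => -c * t) (-c) t := by
    simpa using (hasDerivAt_id t).const_mul (-c)
  have hsec (t τ : ℂ) (y u : Phase (Fin n)) :=
    hasDerivAt_linBlk (g := g 1) (hasDerivAt_const (0 : ℂ) 0) (hasDerivAt_const (0 : ℂ) 0)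
      (hasDerivAt_liftII c t τ y u)
  simp only [zero_mul, zero_smul, add_zero] at hsec
  exact
  { isOpen_time := hD
    isOpen_gen := isOpen_genLin
    dense_gen := fun t _ x hx => dense_genLin (a := 0) (b := 0) (fun x => by
      rw [backIIr_fixedSet]; simp) hx.1
    comm_w := fun t _ x _ => by simp [comm, backIIr]
    conj_reg := fun _ _ _ => trivial
    conj_w := fun t _ u x _ => by simp [backIIr, conjP_apply]
    gauge_gen := fun h x hx => gauge_genLin h hx
    η_diff := differentiable_linNrm.differentiableOn
    η_zero := fun x => rfl
    η_unit := fun x hx => isUnit_linNrm hx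
    η_gauge := fun x _ h h0 i => linNrm_gauge x h h0 i
    Φ_gauge := fun t _ x _ h h0 => by simp only [mapII, redLin_gauge x h h0]
    slice_eq := fun t _ x hx h => by
      have hf := backIIr_fixedSet.1 hx.1.1
      refine ⟨trivial, ?_⟩
      rw [mapII_eq hc0]
      exact (eq_linBlk hx.1.2 (linNrm_eq h) hf.1 (by simpa using hf.2)).symm
    section_mem := fun t _ y _ => by
      refine ⟨⟨⟨backIIr_fixedSet.2 ⟨fun i => ?_, fun i => ?_⟩, linBlk_mem_momentLevel _ _ _ _⟩,
        linBlk_mem_genLin _ _ _ _⟩, mapII_of_lift hc0 (redLin_linBlk _ _ _ _)⟩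
      · fin_cases i <;> simp [linBlk]
      · fin_cases i <;> simp [linBlk]
    isOpen_image := isOpen_univ
    dense_image := dense_univ
    conj_image := fun _ _ _ => trivial
    holo_time := fun t _ => (hds t).differentiableAt.differentiableWithinAt
    deriv_time := fun t _ => by rw [(hds t).deriv]; simpa
    holo_conj := differentiableOn_const 0
    holo := by
      have hr : DifferentiableOn ℂ (fun z : ℂ × Phase (Fin n × Fin 2) => redLin z.2)
        (D ×ˢ genLin) := (differentiableOn_redLin subset_rfl).comp differentiableOn_snd
          Set.mapsTo_snd_prod
      have hr1 := hr.fst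
      have hr2 := hr.snd
      simp only [mapII, pow_two]
      fun_prop
    holo_section := by
      refine differentiableOn_linBlk (differentiableOn_const _) (differentiableOn_const _) ?_
      simp only [liftII]
      fun_prop
    sympl_section := fun t _ y _ u u' => by
      have h1 := hsec t 0 y u
      have h2 := hsec t 0 y u'
      simp only [mul_zero, add_zero] at h1 h2
      refine ⟨_, _, h1, h2, ?_⟩
      rw [sympl_dlinBlk, sympl_dliftII hc0]
    conj_ham := conjInvariant_hamII α
    conj_ham' := conjInvariant_hamII _
    ham := fun t _ y _ => by
      refine ⟨_, _, ![0, (liftII c t y).1], rfl, isHamVec_hamII _ _ _, isHamVec_hamII _ _ _, ?_⟩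
      have h := hsec t 1 y (-c • vecII ![1 + Complex.I * g 1, -(Complex.I * g 1)] (-c * t) y)
      rw [vecII_linBlk α hα1 hc, ofBlk_add, ← infGauge_ofBlk, ← vecII_ofBlk] at h
      have h0 : deriv (0 : ℂ → ℂ) t = 0 := deriv_const t 0
      simp only [mul_one] at h
      rw [(hds t).deriv, h0, zero_smul, sub_zero]
      exact h }

theorem isBlockReduction_II {D : Set ℂ} (hD : IsOpen D) (α g : Fin 2 → ℂ) (c : ℂ)
    (hα : α 0 + α 1 = 1) (hs : swapParam α = α) (hc : c ^ 3 = 2) :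
    IsBlockReduction (n := n) D (hamII α) Set.univ backIIr g genLin
      (hamII ![1 + Complex.I * g 1, -(Complex.I * g 1)]) Set.univ
      (fun t => -c * t) (mapII c) := (slice_II hD α g c hα hs hc).isBlockReduction

end II


/-! ### Branches of the logarithm, and the field of conjugation by the commutator -/

theorem IsLogBranch.ne_zero {D : Set ℂ} {ℓ : ℂ → ℂ} (h : IsLogBranch D ℓ) {t : ℂ} (ht : t ∈ D) :
    t ≠ 0 := by
  rw [← h.2 t ht]; exact Complex.exp_ne_zero _

theorem IsLogBranch.hasDerivAt {D : Set ℂ} (hD : IsOpen D) {ℓ : ℂ → ℂ} (h : IsLogBranch D ℓ)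
    {t : ℂ} (ht : t ∈ D) : HasDerivAt ℓ t⁻¹ t := by
  have h1 := (h.1.differentiableAt (hD.mem_nhds ht)).hasDerivAt
  have h2 : HasDerivAt (fun z => Complex.exp (ℓ z)) (Complex.exp (ℓ t) * deriv ℓ t) t := h1.cexp
  have h3 : (fun z => Complex.exp (ℓ z)) =ᶠ[𝓝 t] id := by
    filter_upwards [hD.mem_nhds ht] with z hz using h.2 z hz
  have h4 := (h2.congr_of_eventuallyEq h3.symm).unique (hasDerivAt_id t)
  rw [h.2 t ht] at h4
  rwa [eq_inv_of_mul_eq_one_right h4] at h1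

/-- The action of the commutator by commutators. -/
def adComm {R : Type*} [Ring R] (y : R × R) : R × R :=
  ((y.1 * y.2 - y.2 * y.1) * y.1 - y.1 * (y.1 * y.2 - y.2 * y.1),
    (y.1 * y.2 - y.2 * y.1) * y.2 - y.2 * (y.1 * y.2 - y.2 * y.1))

theorem adP_comm {m : Type} [Fintype m] [DecidableEq m] (y : Phase m) :
    adP (comm y) y = adComm y := rfl

theorem hasDerivAt_add_mul (t τ : ℂ) : HasDerivAt (fun ε : ℂ => t + ε * τ) τ 0 := by
  simpa using ((hasDerivAt_id (0 : ℂ)).mul_const τ).const_add t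

/-! ### PV to PIII(D₆) -/

section VD6

variable {R : Type*} [Ring R] [Algebra ℂ R]

/-- `(P̃, Q̃)` in terms of `(P, Q)`. -/
def liftVD6 (y : R × R) : R × R := (-((4 : ℂ) • y.2), (1 / 4 : ℂ) • y.1)

set_option maxHeartbeats 2000000 in
-- The gauge direction is q̇₁₂, which keeps q₁₂ = 1. The factor -t/8 is the derivative of s =
-- -t²/16. The term with `adComm` has coefficient -1/t, minus the derivative of log t, and is
-- removed later by the conjugation with c = ℓ.
theorem vecV_linBlk (α : Fin 4 → ℂ) (h2 : α 2 = 1 / 2 - α 1) (h3 : α 3 = α 1) (g : ℂ) {t : ℂ}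
    (ht : t ≠ 0) (y : R × R) :
    dlinBlk ((-1 / 2 : ℂ) • 1) 0 (liftVD6 y) (liftVD6 ((-t / 8) •
      vecIIID6 ![1 + Complex.I * g, -(Complex.I * g)] ![1 - 2 * α 1, 2 * α 1] (-t ^ 2 / 16) y -
        t⁻¹ • adComm y)) =
      vecV α t (linBlk ((-t / 2) • 1) (1 / 2) g (liftVD6 y)) +
      gaugeBlk ![0, (vecV α t (linBlk ((-t / 2) • 1) (1 / 2) g (liftVD6 y))).2 0 1]
        (linBlk ((-t / 2) • 1) (1 / 2) g (liftVD6 y)) := by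
  refine Prod.ext (Matrix.ext fun i j => ?_) (Matrix.ext fun i j => ?_)
  all_goals fin_cases i <;> fin_cases j
  all_goals
    simp only [vecV, vecIIID6, gaugeBlk, h2, h3, adComm, Matrix.mul_apply, Fin.sum_univ_two, Prod.fst_add, Prod.snd_add,
      Matrix.add_apply, Matrix.sub_apply, Matrix.neg_apply, Matrix.smul_apply, Matrix.one_apply,
      Matrix.of_apply, Fin.zero_eta, Fin.mk_one, Fin.isValue, Matrix.cons_val,
      Matrix.cons_val_zero, Matrix.cons_val_one, zero_ne_one, one_ne_zero, if_true, if_false,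
      reduceIte]
    simp only [linBlk, dlinBlk, liftVD6, Prod.fst_sub, Prod.snd_sub, Prod.smul_fst, Prod.smul_snd,
      Matrix.of_apply, Matrix.cons_val, Matrix.cons_val_zero, Matrix.cons_val_one, Fin.isValue,
      mul_zero, zero_mul,
      add_zero, zero_add, smul_zero, zero_smul, sub_zero, zero_sub, mul_one, one_mul, mul_add,
      add_mul, mul_sub, sub_mul, smul_sub, smul_add, smul_smul, mul_assoc, smul_mul_assoc,
      mul_smul_comm, mul_neg, neg_mul, smul_neg]
    match_scalars <;> first | ring1 | (field_simp; ring1)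

variable {n : ℕ}

theorem hasDerivAt_liftVD6 (y u : Phase (Fin n)) :
    HasDerivAt (fun ε : ℂ => liftVD6 (y + ε • u)) (liftVD6 u) 0 :=
  ((hasDerivAt_snd (hasDerivAt_line y u)).const_smul (4 : ℂ)).neg.prodMk
    ((hasDerivAt_fst (hasDerivAt_line y u)).const_smul (1 / 4 : ℂ))

theorem rotParam_rotParam_eq {α : Fin 4 → ℂ} (h : α 0 + α 1 + α 2 + α 3 = 1)
    (hs : rotParam (rotParam α) = α) : α 2 = 1 / 2 - α 1 ∧ α 3 = α 1 := by
  have h0 : α 2 = α 0 := congrFun hs 0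
  have h1 : α 3 = α 1 := congrFun hs 1
  refine ⟨?_, h1⟩
  rw [h1, ← h0] at h
  linear_combination h / 2

/-- The square of π is (p, q) ↦ (-p - t, 1 - q). The twist changes the sign of the off-diagonal
blocks, so these satisfy the equations automatically, while the diagonal ones are forced to be
scalar. -/
theorem backVpi_backVpi_fixedSet {t : ℂ} (ht : t ≠ 0) (x : Phase (Fin n × Fin 2)) :
    x ∈ fixedSet Set.univ (fun t x => backVpi t (backVpi t x)) t ↔
      (∀ i, blk x.1 i i = (-t / 2) • 1) ∧ ∀ i, blk x.2 i i = (1 / 2 : ℂ) • 1 := by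
  rw [mem_fixedSet_blk]
  have e1 (A : Matrix (Fin n) (Fin n) ℂ) : A = -A - t • 1 ↔ A = (-t / 2) • 1 := by
    constructor
    · intro h
      have : (2 : ℂ) • A = -(t • 1) := by rw [two_smul]; nth_rewrite 1 [h]; abel
      rw [← one_smul ℂ A, show (1 : ℂ) = 2⁻¹ * 2 by norm_num, mul_smul, this]
      module
    · rintro rfl; module
  have e2 (A : Matrix (Fin n) (Fin n) ℂ) : A = 1 - A ↔ A = (1 / 2 : ℂ) • 1 := by
    constructor
    · intro h
      have : (2 : ℂ) • A = 1 := by rw [two_smul]; nth_rewrite 1 [h]; abel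
      rw [← one_smul ℂ A, show (1 : ℂ) = 2⁻¹ * 2 by norm_num, mul_smul, this]
      module
    · rintro rfl; module
  have e : backVpi t (backVpi t x) = (-x.1 - t • 1, 1 - x.2) := by
    simp [backVpi, smul_sub, smul_smul, ht]
  simp [e, blk_neg, blk_sub, blk_smul, blk_one, exp_two_pi_div_two, Fin.forall_fin_two,
    -neg_sub, e1, e2]

theorem backVpi_conjP {m : Type} [Fintype m] [DecidableEq m] (t : ℂ) (u : (Matrix m m ℂ)ˣ)
    (x : Phase m) : backVpi t (conjP u x) = conjP u (backVpi t x) := by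
  simp [backVpi, conjP_apply]

theorem comm_backVpi {m : Type} [Fintype m] [DecidableEq m] {t : ℂ} (ht : t ≠ 0) (x : Phase m) :
    comm (backVpi t x) = comm x := by
  simp [backVpi, comm, smul_smul, ht, mul_sub, sub_mul]
  abel

/-- `(P, Q)` in terms of `(P̃, Q̃)`. -/
def unliftVD6 (x : Phase (Fin n)) : Phase (Fin n) := ((4 : ℂ) • x.2, -((1 / 4 : ℂ) • x.1))

theorem liftVD6_unliftVD6 (x : Phase (Fin n)) : liftVD6 (unliftVD6 x) = x := by
  simp [liftVD6, unliftVD6, smul_smul]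

theorem unliftVD6_liftVD6 (x : Phase (Fin n)) : unliftVD6 (liftVD6 x) = x := by
  simp [liftVD6, unliftVD6, smul_smul]

theorem sympl_liftVD6 (u u' : Phase (Fin n)) : sympl (liftVD6 u) (liftVD6 u') = sympl u u' := by
  rw [sympl, trace_mul_comm (liftVD6 u).1, trace_mul_comm (liftVD6 u').1]
  simp [sympl, liftVD6, smul_smul]
  ring

theorem slice_VD6 {D : Set ℂ} (hD : IsOpen D) (α : Fin 4 → ℂ) (g : Fin 2 → ℂ) (ℓ : ℂ → ℂ)
    (hα : α 0 + α 1 + α 2 + α 3 = 1) (hs : rotParam (rotParam α) = α) (hℓ : IsLogBranch D ℓ) :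
    Slice (n := n) D (hamV α) Set.univ (fun t x => backVpi t (backVpi t x)) g genLin
      (hamIIID6 ![1 + Complex.I * g 1, -(Complex.I * g 1)] ![1 - 2 * α 1, 2 * α 1]) Set.univ
      (fun t => -t ^ 2 / 16) (fun _ x => unliftVD6 (redLin x)) ℓ linNrm
      fun t y => ofBlk (linBlk ((-t / 2) • 1) (1 / 2) (g 1) (liftVD6 y)) := by
  obtain ⟨h2, h3⟩ := rotParam_rotParam_eq hα hs
  have hds (t : ℂ) : HasDerivAt (fun t : ℂ => -t ^ 2 / 16) (-t / 8) t := by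
    convert! ((hasDerivAt_pow 2 t).neg).div_const 16 using 1
    push_cast; ring
  have hsec (t τ : ℂ) (y u : Phase (Fin n)) :
      HasDerivAt (fun ε : ℂ => ofBlk (linBlk ((-(t + ε * τ) / 2) • 1) (1 / 2) (g 1)
        (liftVD6 (y + ε • u)))) (ofBlk (dlinBlk ((-τ / 2) • 1) 0 (liftVD6 y) (liftVD6 u))) 0 := by
    have h := hasDerivAt_linBlk (g := g 1)
      (((hasDerivAt_add_mul t τ).neg.div_const 2).smul_const (1 : Matrix (Fin n) (Fin n) ℂ))
      (hasDerivAt_const (0 : ℂ) (1 / 2)) (hasDerivAt_liftVD6 y u)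
    simp only [zero_smul, add_zero] at h
    exact h
  exact
  { isOpen_time := hD
    isOpen_gen := isOpen_genLin
    dense_gen := fun t ht x hx => dense_genLin (backVpi_backVpi_fixedSet (hℓ.ne_zero ht)) hx.1
    comm_w := fun t ht x _ => by rw [comm_backVpi (hℓ.ne_zero ht), comm_backVpi (hℓ.ne_zero ht)]
    conj_reg := fun _ _ _ => trivial
    conj_w := fun t _ u x _ => by rw [backVpi_conjP, backVpi_conjP]
    gauge_gen := fun h x hx => gauge_genLin h hx
    η_diff := differentiable_linNrm.differentiableOn
    η_zero := fun x => rfl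
    η_unit := fun x hx => isUnit_linNrm hx
    η_gauge := fun x _ h h0 i => linNrm_gauge x h h0 i
    Φ_gauge := fun t _ x _ h h0 => by rw [redLin_gauge x h h0]
    slice_eq := fun t ht x hx h => by
      have hf := (backVpi_backVpi_fixedSet (hℓ.ne_zero ht) x).1 hx.1.1
      refine ⟨trivial, ?_⟩
      rw [liftVD6_unliftVD6]
      exact (eq_linBlk hx.1.2 (linNrm_eq h) hf.1 hf.2).symm
    section_mem := fun t ht y _ => by
      refine ⟨⟨⟨(backVpi_backVpi_fixedSet (hℓ.ne_zero ht) _).2 ⟨fun i => ?_, fun i => ?_⟩,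
        linBlk_mem_momentLevel _ _ _ _⟩, linBlk_mem_genLin _ _ _ _⟩, ?_⟩
      · fin_cases i <;> simp [linBlk]
      · fin_cases i <;> simp [linBlk]
      · rw [redLin_linBlk, unliftVD6_liftVD6]
    isOpen_image := isOpen_univ
    dense_image := dense_univ
    conj_image := fun _ _ _ => trivial
    holo_time := fun t _ => (hds t).differentiableAt.differentiableWithinAt
    deriv_time := fun t ht => by
      rw [(hds t).deriv]; exact div_ne_zero (neg_ne_zero.2 (hℓ.ne_zero ht)) (by norm_num)
    holo_conj := hℓ.1
    holo := by
      have hr : DifferentiableOn ℂ (fun z : ℂ × Phase (Fin n × Fin 2) => redLin z.2)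
        (D ×ˢ genLin) := (differentiableOn_redLin subset_rfl).comp differentiableOn_snd
          Set.mapsTo_snd_prod
      have hr1 := hr.fst
      have hr2 := hr.snd
      simp only [unliftVD6]
      fun_prop
    holo_section := by
      refine differentiableOn_linBlk ?_ (differentiableOn_const _) ?_
      · fun_prop
      · simp only [liftVD6]
        fun_prop
    sympl_section := fun t _ y _ u u' => by
      have h1 := hsec t 0 y u
      have h2 := hsec t 0 y u'
      simp only [mul_zero, add_zero] at h1 h2
      refine ⟨_, _, h1, h2, ?_⟩
      rw [sympl_dlinBlk, sympl_liftVD6]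
    conj_ham := conjInvariant_hamV α
    conj_ham' := conjInvariant_hamIIID6 _ _
    ham := fun t ht y _ => by
      refine ⟨_, _, ![0, (vecV α t (linBlk ((-t / 2) • 1) (1 / 2) (g 1) (liftVD6 y))).2 0 1], rfl,
        isHamVec_hamV _ _ _, isHamVec_hamIIID6 _ _ _ _, ?_⟩
      have h := hsec t 1 y ((-t / 8) •
        vecIIID6 ![1 + Complex.I * g 1, -(Complex.I * g 1)] ![1 - 2 * α 1, 2 * α 1]
          (-t ^ 2 / 16) y - t⁻¹ • adComm y)
      rw [vecV_linBlk α h2 h3 (g 1) (hℓ.ne_zero ht), ofBlk_add, ← infGauge_ofBlk,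
        ← vecV_ofBlk] at h
      simp only [mul_one] at h
      rw [(hds t).deriv, (hℓ.hasDerivAt hD ht).deriv, adP_comm]
      exact h }

theorem isBlockReduction_VD6 {D : Set ℂ} (hD : IsOpen D) (α : Fin 4 → ℂ) (g : Fin 2 → ℂ)
    (ℓ : ℂ → ℂ) (hα : α 0 + α 1 + α 2 + α 3 = 1) (hs : rotParam (rotParam α) = α)
    (hℓ : IsLogBranch D ℓ) :
    IsBlockReduction (n := n) D (hamV α) Set.univ (fun t x => backVpi t (backVpi t x)) g genLin
      (hamIIID6 ![1 + Complex.I * g 1, -(Complex.I * g 1)] ![1 - 2 * α 1, 2 * α 1]) Set.univ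
      (fun t => -t ^ 2 / 16) (mapVD6 ℓ) :=
  ((slice_VD6 hD α g ℓ hα hs hℓ).conj_exp fun _ _ _ _ =>
    ⟨_, isHamVec_hamIIID6 _ _ _ _, dcomm_vecIIID6 _ _ _ _⟩).isBlockReduction

end VD6


/-! ### PIII(D₆) to PIII(D₈) -/

section D6D8

variable {R : Type*} [Ring R] [Algebra ℂ R]

/-- `(P̃, Q̃)` in terms of `(P, Q)` and `r = Q⁻¹`. -/
def liftD6D8 (g : ℂ) (y : R × R) (r : R) : R × R :=
  ((1 / 4 : ℂ) • y.1 - (Complex.I * g / 8) • r, (4 : ℂ) • y.2)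

/-- The derivative of `liftD6D8`. -/
def dliftD6D8 (g : ℂ) (u : R × R) (r : R) : R × R :=
  ((1 / 4 : ℂ) • u.1 - (Complex.I * g / 8) • -(r * u.2 * r), (4 : ℂ) • u.2)

set_option maxHeartbeats 2000000 in
-- Here r stands for Q⁻¹. The gauge direction is q̇₁₂ and t/8 is the derivative of s = t²/16. The
-- `adComm` term has coefficient 1/t, opposite to the reduction of PV, which accounts for the
-- conjugation with c = -ℓ.
theorem vecIIID6_linBlk (α β : Fin 2 → ℂ) (hα : α 1 = 1 / 2) (hβ : β 1 = 1 / 2) (g : ℂ) {t : ℂ}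
    (ht : t ≠ 0) (y u : R × R) (r : R) (h1 : y.2 * r = 1) (h2 : r * y.2 = 1)
    (hu : u = (t / 8) • vecIIID8 (t ^ 2 / 16) y r + t⁻¹ • adComm y) :
    dlinBlk (-(1 / 8 : ℂ) • r - (t / 8) • -(r * u.2 * r)) 0 (liftD6D8 g y r) (dliftD6D8 g u r) =
      vecIIID6 α β t (linBlk ((1 / 2 : ℂ) • 1 - (t / 8) • r) 0 g (liftD6D8 g y r)) +
      gaugeBlk ![0, (vecIIID6 α β t
          (linBlk ((1 / 2 : ℂ) • 1 - (t / 8) • r) 0 g (liftD6D8 g y r))).2 0 1]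
        (linBlk ((1 / 2 : ℂ) • 1 - (t / 8) • r) 0 g (liftD6D8 g y r)) := by
  have h3 (z : R) : y.2 * (r * z) = z := by rw [← mul_assoc, h1, one_mul]
  have h4 (z : R) : r * (y.2 * z) = z := by rw [← mul_assoc, h2, one_mul]
  refine Prod.ext (Matrix.ext fun i j => ?_) (Matrix.ext fun i j => ?_)
  all_goals fin_cases i <;> fin_cases j
  all_goals
    simp only [vecIIID6, gaugeBlk, hα, hβ, Matrix.mul_apply, Fin.sum_univ_two, Prod.fst_add, Prod.snd_add,
      Matrix.add_apply, Matrix.sub_apply, Matrix.neg_apply, Matrix.smul_apply, Matrix.one_apply,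
      Matrix.of_apply, Fin.zero_eta, Fin.mk_one, Fin.isValue, Matrix.cons_val,
      Matrix.cons_val_zero, Matrix.cons_val_one, zero_ne_one, one_ne_zero, if_true, if_false,
      reduceIte]
    simp only [linBlk, dlinBlk, liftD6D8, dliftD6D8, hu, vecIIID8, adComm, Prod.fst_add,
      Prod.snd_add, Prod.smul_fst, Prod.smul_snd, Matrix.of_apply, Matrix.cons_val,
      Matrix.cons_val_zero, Matrix.cons_val_one, Fin.isValue, h1, h2, h3, h4,
      mul_zero, zero_mul,
      add_zero, zero_add, smul_zero, zero_smul, sub_zero, zero_sub, mul_one, one_mul, mul_add,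
      add_mul, mul_sub, sub_mul, smul_sub, smul_add, smul_smul, mul_assoc, smul_mul_assoc,
      mul_smul_comm, mul_neg, neg_mul, smul_neg]
    match_scalars <;> first | ring1 | (field_simp; ring1)

variable {n : ℕ}

theorem hasDerivAt_liftD6D8 (g : ℂ) (y u : Phase (Fin n)) (hy : IsUnit y.2) :
    HasDerivAt (fun ε : ℂ => liftD6D8 g (y + ε • u) (y + ε • u).2⁻¹)
      (dliftD6D8 g u y.2⁻¹) 0 := by
  have h1 := hasDerivAt_fst (hasDerivAt_line y u)
  have h2 := hasDerivAt_snd (hasDerivAt_line y u)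
  have h3 := hasDerivAt_matrix_inv h2 (by simpa using hy)
  simp only [zero_smul, add_zero] at h3
  exact ((h1.const_smul (1 / 4 : ℂ)).sub (h3.const_smul (Complex.I * g / 8))).prodMk
    (h2.const_smul (4 : ℂ))

/-- The shift of P by a multiple of Q⁻¹ is a gradient shift, by a multiple of log det Q; its
contribution is symmetric in the two vectors by cyclicity. -/
theorem sympl_dliftD6D8 (g : ℂ) (u u' : Phase (Fin n)) (r : Matrix (Fin n) (Fin n) ℂ) :
    sympl (dliftD6D8 g u r) (dliftD6D8 g u' r) = sympl u u' := by
  have e : trace (r * u.2 * r * u'.2) = trace (r * u'.2 * r * u.2) := by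
    rw [mul_assoc (r * u.2), trace_mul_comm, mul_assoc, mul_assoc, mul_assoc]
  simp only [sympl, dliftD6D8, sub_mul, mul_smul_comm, smul_mul_assoc, neg_mul, smul_neg,
    sub_neg_eq_add, add_mul, trace_add, trace_smul, smul_eq_mul, e]
  ring

theorem blk_inv_antidiag {q : Matrix (Fin n × Fin 2) (Fin n × Fin 2) ℂ} (hq : IsUnit q)
    (h : ∀ i, blk q i i = 0) :
    IsUnit (blk q 0 1) ∧ IsUnit (blk q 1 0) ∧ (∀ i, blk q⁻¹ i i = 0) ∧
      blk q⁻¹ 0 1 = (blk q 1 0)⁻¹ ∧ blk q⁻¹ 1 0 = (blk q 0 1)⁻¹ := by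
  have h1 := mul_nonsing_inv q ((isUnit_iff_isUnit_det _).1 hq)
  have e (i j : Fin 2) : blk (q * q⁻¹) i j = if i = j then 1 else 0 := by rw [h1, blk_one]
  have e00 := e 0 0
  have e01 := e 0 1
  have e10 := e 1 0
  have e11 := e 1 1
  simp only [blk_mul, Fin.sum_univ_two, h, zero_mul, zero_add, add_zero, if_true,
    show (0 : Fin 2) ≠ 1 by decide, show (1 : Fin 2) ≠ 0 by decide, if_false] at e00 e01 e10 e11
  have u01 : IsUnit (blk q 0 1) := .of_mul_eq_one _ e00
  have u10 : IsUnit (blk q 1 0) := .of_mul_eq_one _ e11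
  refine ⟨u01, u10, fun i => ?_, (inv_eq_right_inv e11).symm, (inv_eq_right_inv e00).symm⟩
  fin_cases i
  · exact u10.mul_left_cancel (e10.trans (mul_zero _).symm)
  · exact u01.mul_left_cancel (e01.trans (mul_zero _).symm)

theorem isUnit_of_antidiag {q : Matrix (Fin n × Fin 2) (Fin n × Fin 2) ℂ}
    (h : ∀ i, blk q i i = 0) (h1 : blk q 0 1 = 1) (h2 : IsUnit (blk q 1 0)) : IsUnit q := by
  refine .of_mul_eq_one ((blkAlg n 2).symm !![0, (blk q 1 0)⁻¹; 1, 0])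
    (blk_injective fun i j => ?_)
  have hi := mul_nonsing_inv _ ((isUnit_iff_isUnit_det _).1 h2)
  rw [blk_mul, blk_one]
  fin_cases i <;> fin_cases j <;> simp [Fin.sum_univ_two, blk_symm, h, h1, hi]

/-- For α₀ = β₀ the q⁻¹ term of w vanishes. The equation for q makes it block antidiagonal, so q⁻²
is block diagonal; hence the equation for p fixes its diagonal blocks and leaves the others free. -/
theorem backIIID6pp_fixedSet {α β : Fin 2 → ℂ} (hα : α 0 = 1 / 2) (hβ : β 0 = 1 / 2) {t : ℂ}
    (x : Phase (Fin n × Fin 2)) :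
    x ∈ fixedSet (regQ _) (backIIID6pp α β) t ↔ IsUnit x.2 ∧ (∀ i, blk x.2 i i = 0) ∧
      blk x.1 0 0 = (1 / 2 : ℂ) • 1 - (t / 2) • ((blk x.2 1 0)⁻¹ * (blk x.2 0 1)⁻¹) ∧
      blk x.1 1 1 = (1 / 2 : ℂ) • 1 - (t / 2) • ((blk x.2 0 1)⁻¹ * (blk x.2 1 0)⁻¹) := by
  rw [mem_fixedSet_blk]
  refine and_congr_right fun (hq : IsUnit x.2) => ?_
  have e1 (A B : Matrix (Fin n) (Fin n) ℂ) :
      A = 1 - A - t • B ↔ A = (1 / 2 : ℂ) • 1 - (t / 2) • B := by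
    constructor
    · intro h
      have : (2 : ℂ) • A = 1 - t • B := by rw [two_smul]; nth_rewrite 1 [h]; abel
      rw [← one_smul ℂ A, show (1 : ℂ) = 2⁻¹ * 2 by norm_num, mul_smul, this]
      module
    · rintro rfl; module
  have hdiag : (∀ i j : Fin 2, (Complex.exp (2 * Real.pi * Complex.I / (2 : ℕ)) ^ (i : ℕ) *
      (Complex.exp (2 * Real.pi * Complex.I / (2 : ℕ)) ^ (j : ℕ))⁻¹) • blk x.2 i j =
        blk (backIIID6pp α β t x).2 i j) ↔ ∀ i, blk x.2 i i = 0 := by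
    simp [backIIID6pp, blk_neg, exp_two_pi_div_two, Fin.forall_fin_two, matrix_eq_neg_iff,
      matrix_neg_eq_iff]
  rw [hdiag, and_comm]
  refine and_congr_right fun h0 => ?_
  obtain ⟨-, -, hi, h01, h10⟩ := blk_inv_antidiag hq h0
  simp [backIIID6pp, hα, hβ, pow_two, blk_neg, blk_sub, blk_smul, blk_one, blk_mul,
    exp_two_pi_div_two, Fin.forall_fin_two, Fin.sum_univ_two, hi, h01, h10, e1]

/-- `(P, Q)` in terms of `(P̃, Q̃)`. -/
def unliftD6D8 (g : ℂ) (x : Phase (Fin n)) : Phase (Fin n) :=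
  ((4 : ℂ) • (x.1 + (Complex.I * g / 2) • x.2⁻¹), (1 / 4 : ℂ) • x.2)

/-- The formula also holds for singular A, where the inverse is 0 by convention. Thus the lift and
its inverse cancel without any invertibility assumption. -/
theorem inv_smul_matrix {k : ℂ} (hk : k ≠ 0) (A : Matrix (Fin n) (Fin n) ℂ) :
    (k • A)⁻¹ = k⁻¹ • A⁻¹ := by
  by_cases hA : IsUnit A
  · refine inv_eq_right_inv ?_
    rw [smul_mul_smul_comm, mul_inv_cancel₀ hk, one_smul,
      mul_nonsing_inv _ ((isUnit_iff_isUnit_det _).1 hA)]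
  · have h1 := mt (isUnit_iff_isUnit_det _).2 hA
    have h2 : ¬IsUnit (k • A).det := by
      rw [det_smul]
      exact fun h => h1 (isUnit_of_mul_isUnit_right h)
    rw [nonsing_inv_apply_not_isUnit _ h1, nonsing_inv_apply_not_isUnit _ h2, smul_zero]

theorem isUnit_smul_of_ne_zero {m : Type} [Fintype m] [DecidableEq m] {c : ℂ} (hc : c ≠ 0)
    {A : Matrix m m ℂ} (hA : IsUnit A) : IsUnit (c • A) :=
  (isUnit_smul_iff (Units.mk0 c hc) A).2 hA

theorem liftD6D8_unliftD6D8 (g : ℂ) (x : Phase (Fin n)) :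
    liftD6D8 g (unliftD6D8 g x) (unliftD6D8 g x).2⁻¹ = x := by
  refine Prod.ext ?_ ?_ <;> simp only [liftD6D8, unliftD6D8]
  · rw [inv_smul_matrix (by norm_num)]
    match_scalars <;> ring
  · module

theorem unliftD6D8_liftD6D8 (g : ℂ) (x : Phase (Fin n)) :
    unliftD6D8 g (liftD6D8 g x x.2⁻¹) = x := by
  refine Prod.ext ?_ ?_ <;> simp only [liftD6D8, unliftD6D8]
  · rw [inv_smul_matrix (by norm_num)]
    match_scalars <;> ring
  · module

theorem isOpen_regQ {m : Type} [Fintype m] [DecidableEq m] : IsOpen (regQ m) :=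
  isOpen_isUnit_comp continuous_snd

theorem dense_regQ {m : Type} [Fintype m] [DecidableEq m] : Dense (regQ m) := by
  have := dense_isUnit_affine (LinearMap.snd ℂ _ _) (0 : Matrix m m ℂ) (u := (0, 1)) rfl
  simp only [add_zero] at this
  exact this

theorem slice_D6D8 {D : Set ℂ} (hD : IsOpen D) (α β g : Fin 2 → ℂ) (ℓ : ℂ → ℂ)
    (hα : α 0 + α 1 = 1) (hβ : β 0 + β 1 = 1) (hsα : swapParam α = α) (hsβ : swapParam β = β)
    (hℓ : IsLogBranch D ℓ) :
    Slice (n := n) D (hamIIID6 α β) (regQ _) (backIIID6pp α β) g genLin' hamIIID8 (regQ _)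
      (fun t => t ^ 2 / 16) (fun _ x => unliftD6D8 (g 1) (redLin x)) (fun t => -ℓ t) linNrm
      fun t y => ofBlk (linBlk ((1 / 2 : ℂ) • 1 - (t / 8) • y.2⁻¹) 0 (g 1)
        (liftD6D8 (g 1) y y.2⁻¹)) := by
  obtain ⟨hα0, hα1⟩ := swapParam_eq_half hα hsα
  obtain ⟨hβ0, hβ1⟩ := swapParam_eq_half hβ hsβ
  have hF {t : ℂ} (x : Phase (Fin n × Fin 2)) := backIIID6pp_fixedSet (t := t) hα0 hβ0 x
  have hds (t : ℂ) : HasDerivAt (fun t : ℂ => t ^ 2 / 16) (t / 8) t := by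
    convert! (hasDerivAt_pow 2 t).div_const 16 using 1
    push_cast; ring
  have hc {t : ℂ} (ht : t ∈ D) : HasDerivAt (fun t => -ℓ t) (-t⁻¹) t :=
    (hℓ.hasDerivAt hD ht).neg
  have hsec (t τ : ℂ) (y u : Phase (Fin n)) (hy : IsUnit y.2) :
      HasDerivAt (fun ε : ℂ => ofBlk (linBlk
        ((1 / 2 : ℂ) • 1 - ((t + ε * τ) / 8) • (y + ε • u).2⁻¹) 0 (g 1)
        (liftD6D8 (g 1) (y + ε • u) (y + ε • u).2⁻¹)))
        (ofBlk (dlinBlk (-((τ / 8) • y.2⁻¹ + (t / 8) • -(y.2⁻¹ * u.2 * y.2⁻¹))) 0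
          (liftD6D8 (g 1) y y.2⁻¹) (dliftD6D8 (g 1) u y.2⁻¹))) 0 := by
    have h3 := hasDerivAt_matrix_inv (hasDerivAt_snd (hasDerivAt_line y u)) (by simpa using hy)
    have ha := (((hasDerivAt_add_mul t τ).div_const 8).smul h3).const_sub
      ((1 / 2 : ℂ) • (1 : Matrix (Fin n) (Fin n) ℂ))
    have h := hasDerivAt_linBlk (g := g 1) ha (hasDerivAt_const (0 : ℂ) 0)
      (hasDerivAt_liftD6D8 (g 1) y u hy)
    simp only [zero_smul, add_zero, zero_mul] at h
    rw [add_comm ((t / 8) • _)] at h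
    exact h
  exact
  { isOpen_time := hD
    isOpen_gen := isOpen_genLin'
    dense_gen := fun t ht x hx => by
      obtain ⟨hq, h0, -⟩ := (hF x).1 hx.1
      obtain ⟨u01, u10, -⟩ := blk_inv_antidiag hq h0
      exact subset_closure ⟨hx.1, u01, u10⟩
    comm_w := fun t ht x hx => by
      have hd := (isUnit_iff_isUnit_det _).1 (show IsUnit x.2 from hx)
      simp only [comm, backIIID6pp, hα0, hβ0, pow_two, sub_self, zero_smul, add_zero, mul_neg,
        neg_mul, sub_mul, mul_sub, one_mul, mul_one, smul_mul_assoc, mul_smul_comm, mul_assoc,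
        mul_nonsing_inv_cancel_left _ _ hd, nonsing_inv_mul _ hd]
      module
    conj_reg := fun u x hx => isUnit_conjAlg hx
    conj_w := fun t _ u x _ => by
      refine Prod.ext ?_ ?_
      · simp only [backIIID6pp, conjP_fst, conjP_snd, ← conjAlg_inv, map_sub, map_add, map_smul,
          map_pow, map_one]
      · simp only [backIIID6pp, conjP_fst, conjP_snd, map_neg]
    gauge_gen := fun h x hx => by
      refine ⟨gauge_genLin h hx.1, ?_⟩
      rw [blk_gauge_snd]
      exact isUnit_gauge hx.2
    η_diff := differentiable_linNrm.differentiableOn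
    η_zero := fun x => rfl
    η_unit := fun x hx => isUnit_linNrm hx.1
    η_gauge := fun x _ h h0 i => linNrm_gauge x h h0 i
    Φ_gauge := fun t _ x _ h h0 => by rw [redLin_gauge x h h0]
    slice_eq := fun t ht x hx h => by
      obtain ⟨hq, h0, h1, h2⟩ := (hF x).1 hx.1.1
      have h12 := linNrm_eq h
      -- On the slice Q = q₂₁/4, so the scalar t/8 in the section becomes the t/2 of the fixed point
      -- equation.
      have hr : (unliftD6D8 (g 1) (redLin x)).2⁻¹ = (4 : ℂ) • (blk x.2 1 0)⁻¹ := by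
        simp only [unliftD6D8, redLin, h12, one_mul]
        rw [inv_smul_matrix (by norm_num)]
        norm_num
      refine ⟨?_, ?_⟩
      · refine isUnit_smul_of_ne_zero (by norm_num) ?_
        rw [redLin, h12, one_mul]
        exact hx.2.2
      rw [liftD6D8_unliftD6D8, hr]
      refine (eq_linBlk hx.1.2 h12 (fun i => ?_) (fun i => ?_)).symm
      · rw [h12, inv_one] at h1 h2
        rw [smul_smul, div_mul_eq_mul_div, mul_comm t 4]
        fin_cases i
        · refine h1.trans ?_
          rw [mul_one]; congr 2; ring
        · refine h2.trans ?_
          rw [one_mul]; congr 2; ring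
      · rw [h0, zero_smul]
    section_mem := fun t ht y hy => by
      have h4 : IsUnit ((4 : ℂ) • y.2) := isUnit_smul_of_ne_zero (by norm_num) hy
      refine ⟨⟨⟨(hF _).2 ⟨?_, fun i => ?_, ?_, ?_⟩,
        linBlk_mem_momentLevel _ _ _ _⟩, linBlk_mem_genLin _ _ _ _, ?_⟩, ?_⟩
      · refine isUnit_of_antidiag (fun i => ?_) ?_ ?_
        · fin_cases i <;> simp [linBlk]
        · simp [linBlk]
        · simpa [linBlk, liftD6D8] using h4
      · fin_cases i <;> simp [linBlk]
      · simp [linBlk, liftD6D8, inv_smul_matrix]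
        module
      · simp [linBlk, liftD6D8, inv_smul_matrix]
        module
      · simpa [linBlk, liftD6D8] using h4
      · rw [redLin_linBlk, unliftD6D8_liftD6D8]
    isOpen_image := isOpen_regQ
    dense_image := dense_regQ
    conj_image := fun u x hx => isUnit_conjAlg hx
    holo_time := fun t _ => (hds t).differentiableAt.differentiableWithinAt
    deriv_time := fun t ht => by
      rw [(hds t).deriv]; exact div_ne_zero (hℓ.ne_zero ht) (by norm_num)
    holo_conj := hℓ.1.neg
    holo := by
      have hr : DifferentiableOn ℂ (fun z : ℂ × Phase (Fin n × Fin 2) => redLin z.2)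
        (D ×ˢ genLin') := (differentiableOn_redLin fun x hx => hx.1).comp differentiableOn_snd
          Set.mapsTo_snd_prod
      have hr1 := hr.fst
      have hr2 := hr.snd
      have hr3 : DifferentiableOn ℂ (fun z : ℂ × Phase (Fin n × Fin 2) => (redLin z.2).2⁻¹)
        (D ×ˢ genLin') := fun z hz => (differentiableAt_matrix_inv
          (hz.2.1.mul hz.2.2)).comp_differentiableWithinAt z (hr2 z hz)
      simp only [unliftD6D8]
      fun_prop
    holo_section := by
      have hr3 : DifferentiableOn ℂ (fun z : ℂ × Phase (Fin n) => z.2.2⁻¹)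
        (D ×ˢ regQ _) := fun z hz => (differentiableAt_matrix_inv
          hz.2).comp_differentiableWithinAt z (by fun_prop)
      refine differentiableOn_linBlk ?_ (differentiableOn_const _) ?_
      · fun_prop
      · simp only [liftD6D8]
        fun_prop
    sympl_section := fun t _ y hy u u' => by
      have h1 := hsec t 0 y u hy
      have h2 := hsec t 0 y u' hy
      simp only [mul_zero, add_zero] at h1 h2
      refine ⟨_, _, h1, h2, ?_⟩
      rw [sympl_dlinBlk, sympl_dliftD6D8]
    conj_ham := conjInvariant_hamIIID6 α β
    conj_ham' := conjInvariant_hamIIID8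
    ham := fun t ht y hy => by
      refine ⟨_, _, ![0, (vecIIID6 α β t (linBlk ((1 / 2 : ℂ) • 1 - (t / 8) • y.2⁻¹) 0 (g 1)
        (liftD6D8 (g 1) y y.2⁻¹))).2 0 1], rfl,
        isHamVec_hamIIID6 _ _ _ _, isHamVec_hamIIID8 _ hy, ?_⟩
      have hd := (isUnit_iff_isUnit_det _).1 (show IsUnit y.2 from hy)
      set u := (t / 8) • vecIIID8 (t ^ 2 / 16) y y.2⁻¹ - -t⁻¹ • adComm y with hu
      have h := hsec t 1 y u hy
      have e : -((1 / 8 : ℂ) • y.2⁻¹ + (t / 8) • -(y.2⁻¹ * u.2 * y.2⁻¹)) =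
        -(1 / 8 : ℂ) • y.2⁻¹ - (t / 8) • -(y.2⁻¹ * u.2 * y.2⁻¹) := by module
      rw [e, vecIIID6_linBlk α β hα1 hβ1 (g 1) (hℓ.ne_zero ht) y u y.2⁻¹
        (mul_nonsing_inv _ hd) (nonsing_inv_mul _ hd) (by rw [hu, neg_smul, sub_neg_eq_add]),
        ofBlk_add, ← infGauge_ofBlk, ← vecIIID6_ofBlk] at h
      simp only [mul_one] at h
      rw [(hds t).deriv, (hc ht).deriv, adP_comm]
      exact h }

theorem isBlockReduction_D6D8 {D : Set ℂ} (hD : IsOpen D) (α β g : Fin 2 → ℂ) (ℓ : ℂ → ℂ)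
    (hα : α 0 + α 1 = 1) (hβ : β 0 + β 1 = 1) (hsα : swapParam α = α) (hsβ : swapParam β = β)
    (hℓ : IsLogBranch D ℓ) :
    IsBlockReduction (n := n) D (hamIIID6 α β) (regQ _) (backIIID6pp α β) g genLin'
      hamIIID8 (regQ _) (fun t => t ^ 2 / 16) (mapD6D8 ℓ (g 1)) :=
  ((slice_D6D8 hD α β g ℓ hα hβ hsα hsβ hℓ).conj_exp fun _ _ _ hy =>
    ⟨_, isHamVec_hamIIID8 _ hy, dcomm_vecIIID8 _ hy⟩).isBlockReduction

end D6D8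


/-! ### PIV to PIV -/

section IV

variable {R : Type*} [Ring R] [Algebra ℂ R]

/-- The blocks of a fixed point with the given off-diagonal blocks of `q`, in the order
`q₁₂, q₁₃, q₂₁, q₂₃, q₃₁, q₃₂`. Here `κ ^ 2 = -√3 i`. -/
def fixBlkIV (κ t : ℂ) (q : Fin 6 → R) : Matrix (Fin 3) (Fin 3) R × Matrix (Fin 3) (Fin 3) R :=
  (!![(2 * t / 3) • 1, ((1 - κ ^ 2) / 2) • q 0, ((1 + κ ^ 2) / 2) • q 1;
      ((1 + κ ^ 2) / 2) • q 2, (2 * t / 3) • 1, ((1 - κ ^ 2) / 2) • q 3;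
      ((1 - κ ^ 2) / 2) • q 4, ((1 + κ ^ 2) / 2) • q 5, (2 * t / 3) • 1],
    !![(-2 * t / 3) • 1, q 0, q 1; q 2, (-2 * t / 3) • 1, q 3; q 4, q 5, (-2 * t / 3) • 1])

/-- The off-diagonal blocks of the point of the slice. -/
def offIV (κ g₂ g₃ : ℂ) (y : R × R) : Fin 6 → R :=
  ![-(κ⁻¹ • y.1), 1, κ⁻¹ • y.2, 1,
    -((κ ^ 2)⁻¹ • (y.2 * y.1 + (Complex.I * g₂ + Complex.I * g₃) • 1)),
    -((κ ^ 2)⁻¹ • (y.2 * y.1 + (Complex.I * g₂) • 1))]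

/-- The derivative of `offIV`. -/
def doffIV (κ : ℂ) (y u : R × R) : Fin 6 → R :=
  ![-(κ⁻¹ • u.1), 0, κ⁻¹ • u.2, 0,
    -((κ ^ 2)⁻¹ • (u.2 * y.1 + y.2 * u.1)), -((κ ^ 2)⁻¹ • (u.2 * y.1 + y.2 * u.1))]

set_option maxHeartbeats 2000000 in
-- The gauge blocks are determined by q₁₃ = q₂₃ = 1: the first equation gives ξ₃ = q̇₁₃ and the
-- second ξ₂ = ξ₃ - q̇₂₃. Of κ only κ⁴ = -3 enters the identities.
theorem vecIV_fixBlkIV (α : Fin 3 → ℂ) (h1 : α 1 = 1 / 3) (h2 : α 2 = 1 / 3) (g₂ g₃ t : ℂ) {κ : ℂ}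
    (hκ : κ ^ 4 = -3) (y : R × R) :
    fixBlkIV κ 1 (doffIV κ y (κ • vecIV ![1 + Complex.I * g₃ / 2,
      -(Complex.I * g₂ + Complex.I * g₃) / 2, Complex.I * g₂ / 2] (κ * t) y)) =
      vecIV α t (fixBlkIV κ t (offIV κ g₂ g₃ y)) +
      gaugeBlk ![0, (vecIV α t (fixBlkIV κ t (offIV κ g₂ g₃ y))).2 0 2 -
          (vecIV α t (fixBlkIV κ t (offIV κ g₂ g₃ y))).2 1 2,
        (vecIV α t (fixBlkIV κ t (offIV κ g₂ g₃ y))).2 0 2]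
        (fixBlkIV κ t (offIV κ g₂ g₃ y)) := by
  have hκ0 : κ ≠ 0 := by rintro rfl; norm_num at hκ
  ext i j : 2 <;> fin_cases i <;> fin_cases j <;>
        simp only [vecIV, gaugeBlk, Matrix.mul_apply, Fin.sum_univ_three, h1, h2, Prod.fst_add,
      Prod.snd_add, Matrix.add_apply, Matrix.sub_apply, Matrix.neg_apply, Matrix.smul_apply,
      Matrix.one_apply, Matrix.of_apply, Fin.zero_eta, Fin.mk_one, Fin.reduceFinMk,
      Matrix.cons_val] <;>
        simp only [fixBlkIV, offIV, doffIV, Matrix.of_apply, Matrix.cons_val,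
      Matrix.cons_val_zero, Matrix.cons_val_one, Fin.isValue, Fin.reduceEq, if_true, if_false,
      reduceIte] <;>
        simp only [mul_add, add_mul, mul_sub, sub_mul, smul_sub, smul_add, smul_smul, mul_assoc,
      smul_mul_assoc, mul_smul_comm, mul_neg, neg_mul, mul_one, one_mul, mul_zero, zero_mul,
      smul_zero, smul_neg, Prod.smul_fst, Prod.smul_snd] <;>
    match_scalars <;> first | ring1 | grind

end IV


/-! ### The fixed points of PIV and the slice q₁₃ = q₂₃ = 1 -/

section IV

variable {n : ℕ}

theorem hasDerivAt_fixBlkIV (κ t τ : ℂ) {q : ℂ → Fin 6 → Matrix (Fin n) (Fin n) ℂ}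
    {q' : Fin 6 → Matrix (Fin n) (Fin n) ℂ}
    (hq : ∀ k, HasDerivAt (fun ε => q ε k) (q' k) 0) :
    HasDerivAt (fun ε => ofBlk (fixBlkIV κ (t + ε * τ) (q ε))) (ofBlk (fixBlkIV κ τ q')) 0 := by
  have h1 := (((hasDerivAt_add_mul t τ).const_mul 2).div_const 3).smul_const
    (1 : Matrix (Fin n) (Fin n) ℂ)
  have h2 := (((hasDerivAt_add_mul t τ).const_mul (-2)).div_const 3).smul_const
    (1 : Matrix (Fin n) (Fin n) ℂ)
  refine hasDerivAt_ofBlk (fun i j => ?_) fun i j => ?_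
  · fin_cases i <;> fin_cases j
    exacts [h1, (hq 0).const_smul _, (hq 1).const_smul _, (hq 2).const_smul _, h1,
      (hq 3).const_smul _, (hq 4).const_smul _, (hq 5).const_smul _, h1]
  · fin_cases i <;> fin_cases j
    exacts [h2, hq 0, hq 1, hq 2, h2, hq 3, hq 4, hq 5, h2]

theorem hasDerivAt_offIV (κ g₂ g₃ : ℂ) (y u : Phase (Fin n)) (k : Fin 6) :
    HasDerivAt (fun ε : ℂ => offIV κ g₂ g₃ (y + ε • u) k) (doffIV κ y u k) 0 := by
  have h1 := hasDerivAt_fst (hasDerivAt_line y u)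
  have h2 := hasDerivAt_snd (hasDerivAt_line y u)
  have h3 := hasDerivAt_matrix_mul h2 h1
  have h4 := ((h3.add_const ((Complex.I * g₂ + Complex.I * g₃) • 1)).const_smul (κ ^ 2)⁻¹).neg
  have h5 := ((h3.add_const ((Complex.I * g₂) • 1)).const_smul (κ ^ 2)⁻¹).neg
  simp only [zero_smul, add_zero] at h4 h5
  fin_cases k
  exacts [(h1.const_smul κ⁻¹).neg, hasDerivAt_const _ _, h2.const_smul κ⁻¹, hasDerivAt_const _ _,
    h4, h5]

theorem differentiableOn_fixBlkIV {κ : ℂ} {E : Type*} [NormedAddCommGroup E] [NormedSpace ℂ E]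
    {q : E → Fin 6 → Matrix (Fin n) (Fin n) ℂ} {t : E → ℂ} {Z : Set E}
    (ht : DifferentiableOn ℂ t Z) (hq : ∀ k, DifferentiableOn ℂ (fun z => q z k) Z) :
    DifferentiableOn ℂ (fun z => ofBlk (fixBlkIV κ (t z) (q z))) Z := by
  have h1 : DifferentiableOn ℂ (fun z => (2 * t z / 3) • (1 : Matrix (Fin n) (Fin n) ℂ)) Z := by
    fun_prop
  have h2 : DifferentiableOn ℂ (fun z => (-2 * t z / 3) • (1 : Matrix (Fin n) (Fin n) ℂ)) Z := by
    fun_prop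
  refine differentiableOn_ofBlk (fun i j => ?_) fun i j => ?_
  · fin_cases i <;> fin_cases j
    exacts [h1, (hq 0).const_smul _, (hq 1).const_smul _, (hq 2).const_smul _, h1,
      (hq 3).const_smul _, (hq 4).const_smul _, (hq 5).const_smul _, h1]
  · fin_cases i <;> fin_cases j
    exacts [h2, hq 0, hq 1, hq 2, h2, hq 3, hq 4, hq 5, h2]

/-- Since q₁₃ and q₂₃ are constant, only the pair q₁₂, q₂₁ contributes. The coefficients of p₁₂ and
p₂₁ differ by -κ², which the factors -κ⁻¹ and κ⁻¹ of the slice cancel. -/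
theorem sympl_fixBlkIV {κ : ℂ} (hκ : κ ^ 4 = -3) (y u u' : Phase (Fin n)) :
    sympl (ofBlk (fixBlkIV κ 0 (doffIV κ y u))) (ofBlk (fixBlkIV κ 0 (doffIV κ y u'))) =
      sympl u u' := by
  have hκ0 : κ ≠ 0 := by rintro rfl; norm_num at hκ
  have e1 := trace_mul_comm u.2 u'.1
  have e2 := trace_mul_comm u'.2 u.1
  rw [sympl_ofBlk]
  simp [Fin.sum_univ_three, fixBlkIV, doffIV, sympl, e1, e2]
  field_simp
  ring

theorem exp_two_pi_div_three {κ : ℂ} (hκ : κ ^ 2 = -(Real.sqrt 3 * Complex.I)) :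
    Complex.exp (2 * Real.pi * Complex.I / 3) = -((1 + κ ^ 2) / 2) := by
  rw [hκ, show 2 * (Real.pi : ℂ) * Complex.I / 3 = (Real.pi - Real.pi / 3 : ℝ) * Complex.I by
    push_cast; ring, Complex.exp_mul_I, ← Complex.ofReal_cos, ← Complex.ofReal_sin,
    Real.cos_pi_sub, Real.sin_pi_sub, Real.cos_pi_div_three, Real.sin_pi_div_three]
  push_cast
  ring

theorem pow_four_eq {κ : ℂ} (hκ : κ ^ 2 = -(Real.sqrt 3 * Complex.I)) : κ ^ 4 = -3 := by
  have h3 : (Real.sqrt 3 : ℂ) ^ 2 = 3 := by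
    rw [← Complex.ofReal_pow, Real.sq_sqrt (by norm_num)]; norm_num
  rw [show κ ^ 4 = (κ ^ 2) ^ 2 by ring, hκ, neg_sq, mul_pow, h3, Complex.I_sq]
  norm_num

/-- The off-diagonal blocks of `q`. -/
def offBlkIV (x : Phase (Fin n × Fin 3)) : Fin 6 → Matrix (Fin n) (Fin n) ℂ :=
  ![blk x.2 0 1, blk x.2 0 2, blk x.2 1 0, blk x.2 1 2, blk x.2 2 0, blk x.2 2 1]

theorem inv_exp_two_pi_div_three {κ : ℂ} (hκ : κ ^ 4 = -3) :
    (-((1 + κ ^ 2) / 2))⁻¹ = (κ ^ 2 - 1) / 2 := by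
  refine inv_eq_of_mul_eq_one_right ?_
  linear_combination (-1 / 4 : ℂ) * hκ

/-- The equation for q gives pᵢⱼ = -ζ^(i-j)qᵢⱼ with ζ = -(1 + κ²)/2. Substituted in the equation for
p, it reduces off the diagonal to 1 + ζ + ζ² = 0, and on the diagonal it forces q = -2t/3. -/
theorem backIVpi_fixedSet {κ : ℂ} (hκ : κ ^ 2 = -(Real.sqrt 3 * Complex.I)) {t : ℂ}
    (x : Phase (Fin n × Fin 3)) :
    x ∈ fixedSet Set.univ backIVpi t ↔ x = ofBlk (fixBlkIV κ t (offBlkIV x)) := by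
  have hκ4 := pow_four_eq hκ
  have hi := inv_exp_two_pi_div_three hκ4
  rw [mem_fixedSet_blk]
  simp only [Set.mem_univ, true_and, backIVpi, blk_neg, blk_add, blk_smul, blk_one, Nat.cast_ofNat,
    exp_two_pi_div_three hκ, ← inv_pow, hi]
  constructor
  · rintro ⟨h1, h2⟩
    have hd (i : Fin 3) : (-((1 + κ ^ 2) / 2)) ^ (i : ℕ) * ((κ ^ 2 - 1) / 2) ^ (i : ℕ) = 1 := by
      rw [← mul_pow, ← hi, mul_inv_cancel₀, one_pow]
      rintro h0
      rw [h0, _root_.inv_zero] at hi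
      grind
    have h3 (i : Fin 3) : blk x.1 i i = -blk x.2 i i := by
      have := h2 i i
      rw [hd, one_smul] at this
      rw [this, neg_neg]
    have h4 (i : Fin 3) : blk x.2 i i = (-2 * t / 3) • 1 := by
      have h5 := h1 i i
      rw [hd, one_smul, h3, neg_neg, if_pos rfl] at h5
      linear_combination (norm := module) (-1 / 3 : ℂ) • h5
    have h5 (i j : Fin 3) : blk x.1 i j = -(((-((1 + κ ^ 2) / 2)) ^ (i : ℕ) *
      ((κ ^ 2 - 1) / 2) ^ (j : ℕ)) • blk x.2 i j) := by rw [h2, neg_neg]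
    refine phase_ext (fun i j => ?_) fun i j => ?_
    · rw [blk_ofBlk_fst]
      fin_cases i <;> fin_cases j <;> simp [fixBlkIV, offBlkIV, h3, h4]
      any_goals module
      all_goals (simp [h5]; try (match_scalars <;> grind))
    · rw [blk_ofBlk_snd]
      fin_cases i <;> fin_cases j <;> simp [fixBlkIV, offBlkIV, h4]
  · intro hx
    have b1 (i j : Fin 3) : blk x.1 i j = (fixBlkIV κ t (offBlkIV x)).1 i j := by
      conv_lhs => rw [hx]
      rw [blk_ofBlk_fst]
    have b2 (i j : Fin 3) : blk x.2 i j = (fixBlkIV κ t (offBlkIV x)).2 i j := by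
      conv_lhs => rw [hx]
      rw [blk_ofBlk_snd]
    generalize offBlkIV x = f at b1 b2
    constructor <;> intro i j <;> rw [b1, b2] <;> fin_cases i <;> fin_cases j <;>
      simp [fixBlkIV] <;> match_scalars <;> grind

theorem offBlkIV_ofBlk (κ t : ℂ) (q : Fin 6 → Matrix (Fin n) (Fin n) ℂ) :
    offBlkIV (ofBlk (fixBlkIV κ t q)) = q := by
  funext k
  fin_cases k <;> simp [offBlkIV, fixBlkIV]

theorem fixBlkIV_mem {κ : ℂ} (hκ : κ ^ 2 = -(Real.sqrt 3 * Complex.I)) (t : ℂ)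
    (q : Fin 6 → Matrix (Fin n) (Fin n) ℂ) :
    ofBlk (fixBlkIV κ t q) ∈ fixedSet Set.univ backIVpi t := by
  rw [backIVpi_fixedSet hκ, offBlkIV_ofBlk]

theorem isOpen_genIV : IsOpen (genIV (n := n)) :=
  (isOpen_isUnit_comp ((continuous_blk 0 2).comp continuous_snd)).inter
    (isOpen_isUnit_comp ((continuous_blk 1 2).comp continuous_snd))

/-- The off-diagonal blocks of q are free linear coordinates of the fixed points; only q₁₃ and q₂₃
are moved, towards 1. -/
theorem dense_genIV {κ : ℂ} (hκ : κ ^ 2 = -(Real.sqrt 3 * Complex.I)) {t : ℂ}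
    {x : Phase (Fin n × Fin 3)} (hx : x ∈ fixedSet Set.univ backIVpi t) :
    x ∈ closure (fixedSet Set.univ backIVpi t ∩ genIV) := by
  set f := offBlkIV x with hf
  refine mem_closure_of_eventually_line x (ofBlk (fixBlkIV κ 0 ![0, 1 - f 1, 0, 1 - f 3, 0, 0])) ?_
  have h1 : IsUnit (f 1 + (1 : ℂ) • (1 - f 1)) := by simp
  have h2 : IsUnit (f 3 + (1 : ℂ) • (1 - f 3)) := by simp
  filter_upwards [eventually_isUnit_add_smul _ _ h1, eventually_isUnit_add_smul _ _ h2]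
    with ε hε1 hε2
  have e : x + ε • ofBlk (fixBlkIV κ 0 ![0, 1 - f 1, 0, 1 - f 3, 0, 0]) =
      ofBlk (fixBlkIV κ t (f + ε • ![0, 1 - f 1, 0, 1 - f 3, 0, 0])) := by
    rw [backIVpi_fixedSet hκ, ← hf] at hx
    rw [hx]
    refine phase_ext (fun i j => ?_) fun i j => ?_ <;>
      simp only [Prod.fst_add, Prod.snd_add, Prod.smul_fst, Prod.smul_snd, blk_add, blk_smul,
        blk_ofBlk_fst, blk_ofBlk_snd] <;>
      fin_cases i <;> fin_cases j <;> simp [fixBlkIV, smul_comm ε]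
  rw [e]
  refine ⟨fixBlkIV_mem hκ _ _, ?_, ?_⟩
  · simpa [fixBlkIV] using hε1
  · simpa [fixBlkIV] using hε2

/-- The gauge transformation to the slice. -/
def nrmIV (x : Phase (Fin n × Fin 3)) : Fin 3 → Matrix (Fin n) (Fin n) ℂ :=
  ![1, blk x.2 0 2 * (blk x.2 1 2)⁻¹, blk x.2 0 2]

theorem isUnit_matrix_inv {A : Matrix (Fin n) (Fin n) ℂ} (h : IsUnit A) : IsUnit A⁻¹ :=
  (isUnit_nonsing_inv_iff).2 h

theorem nrmIV_gauge (x : Phase (Fin n × Fin 3)) (h : Fin 3 → GL (Fin n) ℂ) (h0 : h 0 = 1)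
    (i : Fin 3) : nrmIV (gauge h x) i = nrmIV x i * ((h i)⁻¹ : GL (Fin n) ℂ).1 := by
  fin_cases i <;> simp only [nrmIV, blk_gauge_snd, gauge_inv] <;> simp [h0, mul_assoc]

theorem mapIV_gauge (κ t : ℂ) (x : Phase (Fin n × Fin 3)) (h : Fin 3 → GL (Fin n) ℂ)
    (h0 : h 0 = 1) : mapIV κ t (gauge h x) = mapIV κ t x := by
  simp only [mapIV, blk_gauge_snd, gauge_inv]
  simp [h0, mul_assoc]

/-- On the slice P and Q are multiples of q₁₂ and q₂₁, and the two moment conditions are linear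
equations for q₃₂ and q₃₁. -/
theorem offIV_mapIV {κ : ℂ} (hκ : κ ^ 2 = -(Real.sqrt 3 * Complex.I)) {t : ℂ} {g : Fin 3 → ℂ}
    {x : Phase (Fin n × Fin 3)} (hx : x ∈ fixedSet Set.univ backIVpi t) (hm : x ∈ momentLevel g)
    (hn : ∀ i, nrmIV x i = 1) : offIV κ (g 1) (g 2) (mapIV κ t x) = offBlkIV x := by
  have hκ4 := pow_four_eq hκ
  have hκ0 : κ ≠ 0 := by rintro rfl; norm_num at hκ4
  have h13 : blk x.2 0 2 = 1 := hn 2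
  have h23 : blk x.2 1 2 = 1 := by
    have h := hn 1
    simp only [nrmIV, h13, Matrix.cons_val_one, Matrix.cons_val_zero, one_mul] at h
    have h' : ((blk x.2 1 2)⁻¹)⁻¹ = 1 := by
      rw [show (blk x.2 1 2)⁻¹ = 1 from h, inv_one]
    -- The normalization only gives q₂₃⁻¹ = 1. This excludes a singular q₂₃, because the inverse is
    -- then not invertible either.
    by_cases hu : IsUnit (blk x.2 1 2).det
    · rwa [nonsing_inv_nonsing_inv _ hu] at h'
    · have h2 : (blk x.2 1 2)⁻¹ = 1 := h
      exact absurd ((isUnit_iff_isUnit_det _).1 ((isUnit_nonsing_inv_iff).1 (h2 ▸ isUnit_one))) hu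
  have hm1 := hm 1 (by decide)
  have hm2 := hm 2 (by decide)
  have e1 : offBlkIV x 1 = 1 := h13
  have e3 : offBlkIV x 3 = 1 := h23
  have hM : mapIV κ t x = (-(κ • offBlkIV x 0), κ • offBlkIV x 2) := by
    -- By κ² = -√3i the prefactor of P is -κ.
    have hk : κ⁻¹ * (Real.sqrt 3 * Complex.I) = -κ := by
      rw [← neg_eq_iff_eq_neg.2 hκ]
      field_simp
    simp [mapIV, h13, h23, hk, offBlkIV]
  rw [(backIVpi_fixedSet hκ x).1 hx, moment_ofBlk] at hm1 hm2
  rw [hM]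
  generalize offBlkIV x = f at e1 e3 hm1 hm2 ⊢
  simp [fixBlkIV, Matrix.mul_apply, Fin.sum_univ_three, e1, e3] at hm1 hm2
  have hf5 : f 5 = f 2 * f 0 - (κ ^ 2)⁻¹ • (Complex.I * g 1) • 1 := by
    linear_combination (norm := skip) (-(κ ^ 2)⁻¹ : ℂ) • hm1
    match_scalars <;> grind
  have hf4 : f 4 = f 2 * f 0 - (κ ^ 2)⁻¹ • (Complex.I * g 1 + Complex.I * g 2) • 1 := by
    linear_combination (norm := skip) (-(κ ^ 2)⁻¹ : ℂ) • hm1 - (κ ^ 2)⁻¹ • hm2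
    match_scalars <;> grind
  have hi : κ⁻¹ * κ = 1 := inv_mul_cancel₀ hκ0
  have hi2 : (κ ^ 2)⁻¹ * (κ * κ) = 1 := by rw [← sq, inv_mul_cancel₀ (pow_ne_zero 2 hκ0)]
  have hv (a b : Matrix (Fin n) (Fin n) ℂ) : offIV κ (g 1) (g 2) (-(κ • a), κ • b) = ![a, 1, b, 1,
      b * a - (κ ^ 2)⁻¹ • (Complex.I * g 1 + Complex.I * g 2) • 1,
      b * a - (κ ^ 2)⁻¹ • (Complex.I * g 1) • 1] := by
    simp only [offIV, smul_neg, smul_smul, smul_mul_assoc, mul_smul_comm, mul_neg, smul_add, hi,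
      hi2, one_smul, neg_neg, neg_add, sub_eq_add_neg]
  obtain ⟨a, ha⟩ : ∃ a, a = f 0 := ⟨_, rfl⟩
  obtain ⟨b, hb⟩ : ∃ b, b = f 2 := ⟨_, rfl⟩
  rw [← ha, ← hb] at hf4 hf5 ⊢
  rw [hv]
  funext k
  fin_cases k
  exacts [ha, e1.symm, hb, e3.symm, hf4.symm, hf5.symm]

theorem mapIV_ofBlk {κ : ℂ} (hκ : κ ^ 2 = -(Real.sqrt 3 * Complex.I)) (t g₂ g₃ : ℂ)
    (y : Phase (Fin n)) : mapIV κ t (ofBlk (fixBlkIV κ t (offIV κ g₂ g₃ y))) = y := by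
  have hκ4 := pow_four_eq hκ
  have hκ0 : κ ≠ 0 := by rintro rfl; norm_num at hκ4
  have hk : κ⁻¹ * (Real.sqrt 3 * Complex.I) = -κ := by
    rw [← neg_eq_iff_eq_neg.2 hκ]
    field_simp
  simp [mapIV, hk, fixBlkIV, offIV, smul_smul, hκ0]

theorem offIV_mem_momentLevel {κ : ℂ} (hκ4 : κ ^ 4 = -3) (t : ℂ) (g : Fin 3 → ℂ)
    (y : Phase (Fin n)) : ofBlk (fixBlkIV κ t (offIV κ (g 1) (g 2) y)) ∈ momentLevel g := by
  have hκ0 : κ ≠ 0 := by rintro rfl; norm_num at hκ4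
  intro i hi
  rw [moment_ofBlk]
  fin_cases i
  · exact absurd rfl hi
  · simp [fixBlkIV, offIV, Matrix.mul_apply, Fin.sum_univ_three]
    match_scalars <;> grind
  · simp [fixBlkIV, offIV, Matrix.mul_apply, Fin.sum_univ_three]
    match_scalars <;> grind

theorem rotParam_three_eq {α : Fin 3 → ℂ} (h : α 0 + α 1 + α 2 = 1) (hs : rotParam α = α) :
    α 1 = 1 / 3 ∧ α 2 = 1 / 3 := by
  have h0 : α 1 = α 0 := congrFun hs 0
  have h1 : α 2 = α 1 := congrFun hs 1
  rw [h1, ← h0] at h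
  have : α 1 = 1 / 3 := by linear_combination h / 3
  exact ⟨this, h1.trans this⟩

theorem slice_IV {D : Set ℂ} (hD : IsOpen D) (α g : Fin 3 → ℂ) (κ : ℂ)
    (hα : α 0 + α 1 + α 2 = 1) (hs : rotParam α = α) (hκ : κ ^ 2 = -(Real.sqrt 3 * Complex.I)) :
    Slice (n := n) D (hamIV α) Set.univ backIVpi g genIV
      (hamIV ![1 + Complex.I * g 2 / 2, -(Complex.I * g 1 + Complex.I * g 2) / 2,
        Complex.I * g 1 / 2]) Set.univ
      (fun t => κ * t) (mapIV κ) 0 nrmIV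
      fun t y => ofBlk (fixBlkIV κ t (offIV κ (g 1) (g 2) y)) := by
  obtain ⟨hα1, hα2⟩ := rotParam_three_eq hα hs
  have hκ4 := pow_four_eq hκ
  have hκ0 : κ ≠ 0 := by rintro rfl; norm_num at hκ4
  have hds (t : ℂ) : HasDerivAt (fun t => κ * t) κ t := by
    simpa using (hasDerivAt_id t).const_mul κ
  have hsec (t τ : ℂ) (y u : Phase (Fin n)) := hasDerivAt_fixBlkIV κ t τ
    (hasDerivAt_offIV κ (g 1) (g 2) y u)
  exact
  { isOpen_time := hD
    isOpen_gen := isOpen_genIV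
    dense_gen := fun t _ x hx => dense_genIV hκ hx.1
    comm_w := fun t _ x _ => by
      simp only [comm, backIVpi, add_mul, mul_add, neg_mul, mul_neg, smul_mul_assoc,
        mul_smul_comm, one_mul, mul_one]
      module
    conj_reg := fun _ _ _ => trivial
    conj_w := fun t _ u x _ => by
      refine Prod.ext ?_ ?_ <;>
        simp only [backIVpi, conjP_fst, conjP_snd, map_add, map_neg, map_smul, map_one]
    gauge_gen := fun h x hx => by
      refine ⟨?_, ?_⟩ <;> rw [blk_gauge_snd]
      exacts [isUnit_gauge hx.1, isUnit_gauge hx.2]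
    η_diff := by
      have h1 : DifferentiableOn ℂ (fun x : Phase (Fin n × Fin 3) => blk x.2 0 2) genIV :=
        ((differentiable_blk 0 2).comp differentiable_snd).differentiableOn
      refine differentiableOn_pi.2 fun i => ?_
      fin_cases i
      exacts [differentiableOn_const _, h1.mul (differentiableOn_blk_inv fun x hx => hx.2), h1]
    η_zero := fun x => rfl
    η_unit := fun x hx i => by
      fin_cases i
      exacts [isUnit_one, hx.1.mul (isUnit_matrix_inv hx.2), hx.1]
    η_gauge := fun x _ h h0 i => nrmIV_gauge x h h0 i
    Φ_gauge := fun t _ x _ h h0 => mapIV_gauge κ t x h h0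
    slice_eq := fun t _ x hx h => by
      refine ⟨trivial, ?_⟩
      rw [offIV_mapIV hκ hx.1.1 hx.1.2 h]
      exact ((backIVpi_fixedSet hκ x).1 hx.1.1).symm
    section_mem := fun t _ y _ => by
      refine ⟨⟨⟨fixBlkIV_mem hκ _ _, offIV_mem_momentLevel hκ4 t g y⟩, ?_, ?_⟩,
        mapIV_ofBlk hκ t _ _ y⟩
      · simp [fixBlkIV, offIV]
      · simp [fixBlkIV, offIV]
    isOpen_image := isOpen_univ
    dense_image := dense_univ
    conj_image := fun _ _ _ => trivial
    holo_time := fun t _ => (hds t).differentiableAt.differentiableWithinAt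
    deriv_time := fun t _ => by rw [(hds t).deriv]; exact hκ0
    holo_conj := differentiableOn_const 0
    holo := by
      have hb (i j : Fin 3) : DifferentiableOn ℂ
          (fun z : ℂ × Phase (Fin n × Fin 3) => blk z.2.2 i j) (D ×ˢ genIV) :=
        ((differentiable_blk i j).comp
          (differentiable_snd.comp differentiable_snd)).differentiableOn
      have h1 : DifferentiableOn ℂ (fun z : ℂ × Phase (Fin n × Fin 3) => (blk z.2.2 0 2)⁻¹)
        (D ×ˢ genIV) := (differentiableOn_blk_inv fun x hx => hx.1).comp differentiableOn_snd
          Set.mapsTo_snd_prod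
      have h2 : DifferentiableOn ℂ (fun z : ℂ × Phase (Fin n × Fin 3) => (blk z.2.2 1 2)⁻¹)
        (D ×ˢ genIV) := (differentiableOn_blk_inv fun x hx => hx.2).comp differentiableOn_snd
          Set.mapsTo_snd_prod
      have hb01 := hb 0 1
      have hb12 := hb 1 2
      have hb02 := hb 0 2
      have hb10 := hb 1 0
      simp only [mapIV]
      fun_prop
    holo_section := by
      refine differentiableOn_fixBlkIV differentiableOn_fst fun k => ?_
      fin_cases k <;> simp [offIV] <;> fun_prop
    sympl_section := fun t _ y _ u u' => by
      have h1 := hsec t 0 y u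
      have h2 := hsec t 0 y u'
      simp only [mul_zero, add_zero] at h1 h2
      exact ⟨_, _, h1, h2, sympl_fixBlkIV hκ4 y u u'⟩
    conj_ham := conjInvariant_hamIV α
    conj_ham' := conjInvariant_hamIV _
    ham := fun t _ y _ => by
      have h := hsec t 1 y (κ • vecIV ![1 + Complex.I * g 2 / 2,
        -(Complex.I * g 1 + Complex.I * g 2) / 2, Complex.I * g 1 / 2] (κ * t) y)
      rw [vecIV_fixBlkIV α hα1 hα2 (g 1) (g 2) t hκ4, ofBlk_add, ← infGauge_ofBlk,
        ← vecIV_ofBlk] at h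
      have h0 : deriv (0 : ℂ → ℂ) t = 0 := deriv_const t 0
      simp only [mul_one] at h
      have h2 : deriv (fun t => κ * t) t = κ := (hds t).deriv
      refine ⟨_, _, ?ξ, ?h0, isHamVec_hamIV _ _ _, isHamVec_hamIV _ _ _, ?hder⟩
      case hder =>
        rw [h2, h0, zero_smul, sub_zero]
        exact h
      case h0 => rfl }

theorem isBlockReduction_IV {D : Set ℂ} (hD : IsOpen D) (α g : Fin 3 → ℂ) (κ : ℂ)
    (hα : α 0 + α 1 + α 2 = 1) (hs : rotParam α = α) (hκ : κ ^ 2 = -(Real.sqrt 3 * Complex.I)) :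
    IsBlockReduction (n := n) D (hamIV α) Set.univ backIVpi g genIV
      (hamIV ![1 + Complex.I * g 2 / 2, -(Complex.I * g 1 + Complex.I * g 2) / 2,
        Complex.I * g 1 / 2]) Set.univ
      (fun t => κ * t) (mapIV κ) := (slice_IV hD α g κ hα hs hκ).isBlockReduction

end IV


/-! ### PV to PV -/

section V

variable {R : Type*} [Ring R] [Algebra ℂ R]

/-- The conjugation by `S_4` on blocks. -/
def twV : Matrix (Fin 4) (Fin 4) R →ₐ[ℂ] Matrix (Fin 4) (Fin 4) R where
  toFun A := Matrix.of fun i j =>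
    (Complex.I ^ (i : ℕ) * (Complex.I ^ (j : ℕ))⁻¹) • A i j
  map_one' := by
    ext i j
    by_cases h : i = j
    · subst h; simp
    · simp [h]
  map_mul' A B := by
    ext i j
    simp only [of_apply, Matrix.mul_apply, Finset.smul_sum]
    refine Finset.sum_congr rfl fun k _ => ?_
    rw [smul_mul_smul_comm]
    congr 1
    have : Complex.I ^ (k : ℕ) ≠ 0 := pow_ne_zero _ Complex.I_ne_zero
    field_simp
  map_zero' := by ext i j; simp
  map_add' A B := by ext i j; simp
  commutes' c := by
    ext i j
    by_cases h : i = j <;> simp [h, Matrix.algebraMap_matrix_apply]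

theorem twV_apply (A : Matrix (Fin 4) (Fin 4) R) (i j : Fin 4) :
    twV A i j = (Complex.I ^ (i : ℕ) * (Complex.I ^ (j : ℕ))⁻¹) • A i j := rfl

/-- The blocks of a fixed point, where `q = N + 1 / 2`. -/
def fixBlkV (t : ℂ) (N : Matrix (Fin 4) (Fin 4) R) :
    Matrix (Fin 4) (Fin 4) R × Matrix (Fin 4) (Fin 4) R :=
  (-(t • twV N) - (t / 2) • 1, N + (1 / 2 : ℂ) • 1)

/-- The `q`-component of the vector field of PV on the fixed points. -/
def fixVecV (t : ℂ) (N : Matrix (Fin 4) (Fin 4) R) : Matrix (Fin 4) (Fin 4) R :=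
  -(twV N * (N * N) + N * N * twV N) + (1 / 2 : ℂ) • twV N - (2 * t)⁻¹ • N

/-- At a fixed point p = -t·`twV` q. The p-component of the field is the time derivative of this
expression along the q-component, so only the latter has to be analysed. -/
theorem vecV_fixBlkV (α : Fin 4 → ℂ) (hα : ∀ i, α i = 1 / 4) {t : ℂ} (ht : t ≠ 0)
    (N : Matrix (Fin 4) (Fin 4) R) (hN : twV (twV N) = -N) :
    vecV α t (fixBlkV t N) =
      (-(twV N + t • twV (fixVecV t N)) - (1 / 2 : ℂ) • 1, fixVecV t N) := by
  simp only [fixVecV, map_sub, map_add, map_neg, map_mul, map_smul, hN]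
  simp only [vecV, fixBlkV, hα]
  generalize twV N = L
  refine Prod.ext ?_ ?_ <;>
    simp only [mul_add, add_mul, mul_sub, sub_mul, neg_mul, mul_neg, smul_mul_assoc,
      mul_smul_comm, smul_add, smul_sub, smul_neg, smul_smul, mul_one, one_mul, mul_assoc] <;>
    match_scalars <;> field_simp <;> ring

/-- The odd part of `q` on the slice, where `X = Q - 1` and `r = X⁻¹`. -/
def offV (c : Fin 4 → ℂ) (a X r : R) : Matrix (Fin 4) (Fin 4) R :=
  !![0, X, 0, X + 1;
    a + a * r - (c 1 + c 2 + c 3) • r, 0, a * X + a - (c 2 + c 3) • 1, 0;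
    0, 1, 0, 1;
    a, 0, a * X + a - c 3 • 1, 0]

/-- The derivative of `offV`. -/
def doffV (c c' : Fin 4 → ℂ) (a X r a' X' : R) : Matrix (Fin 4) (Fin 4) R :=
  !![0, X', 0, X';
    a' + a' * r - (c' 1 + c' 2 + c' 3) • r - a * r * X' * r
      + (c 1 + c 2 + c 3) • (r * X' * r), 0,
      a' * X + a * X' + a' - (c' 2 + c' 3) • 1, 0;
    0, 0, 0, 0;
    a', 0, a' * X + a * X' + a' - c' 3 • 1, 0]

theorem twV_offV (c : Fin 4 → ℂ) (a X r : R) : twV (twV (offV c a X r)) = -offV c a X r := by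
  have h3 : Complex.I ^ 3 = -Complex.I := Complex.I_pow_three
  ext i j
  simp only [twV_apply, smul_smul, Matrix.neg_apply]
  fin_cases i <;> fin_cases j <;> simp [offV, h3] <;> abel

/-- `fixVecV` on the slice. -/
def secVecV (c : Fin 4 → ℂ) (k : ℂ) (a X r : R) : Matrix (Fin 4) (Fin 4) R :=
  let b := a * X + a - c 3 • 1
  let e := a * X + a - (c 2 + c 3) • 1
  let f := a + a * r - (c 1 + c 2 + c 3) • r
  !![0, -((2 * Complex.I) • b) - (2 * Complex.I * (c 1 + c 2) + Complex.I / 2 + k) • X, 0,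
      -((2 * Complex.I) • (a * X + a)) - (2 * Complex.I * (c 2 + c 3)) • X
        + (Complex.I / 2 - k) • (X + 1);
    -((2 * Complex.I) • (e * f - c 1 • f - e * a)) + (Complex.I / 2 - k) • f, 0,
      -((2 * Complex.I) • ((e - c 1 • 1 + f) * b - e * e)) - (Complex.I / 2 + k) • e, 0;
    0, -((2 * Complex.I) • a) + (2 * Complex.I * (c 2 + c 3) + Complex.I / 2 - k) • 1, 0,
      -((2 * Complex.I) • f) + (2 * Complex.I * (c 1 + c 2) - Complex.I / 2 - k) • 1;
    -((2 * Complex.I) • (b * f - (b + c 3 • 1) * a)) - (Complex.I / 2 + k) • a, 0,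
      -((2 * Complex.I) • (b * b - a * X * e)) + (Complex.I / 2 - k) • b, 0]

theorem fixVecV_offV (c : Fin 4 → ℂ) (t : ℂ) (a X r : R) (h2 : r * X = 1) :
    fixVecV t (offV c a X r) = secVecV c (2 * t)⁻¹ a X r := by
  have h4 (z : R) : r * (X * z) = z := by rw [← mul_assoc, h2, one_mul]
  have hI3 : Complex.I ^ 3 = -Complex.I := Complex.I_pow_three
  have hi : Complex.I⁻¹ = -Complex.I := Complex.inv_I
  have hI2 : Complex.I ^ 2 = -1 := Complex.I_sq
  generalize hk : (2 * t)⁻¹ = k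
  ext i j : 2
  simp only [fixVecV, hk]
  fin_cases i <;> fin_cases j <;>
    simp only [twV_apply, Matrix.mul_apply, Fin.sum_univ_four,
      Matrix.add_apply, Matrix.sub_apply, Matrix.neg_apply,
      Matrix.smul_apply, Matrix.one_apply, Matrix.of_apply, Fin.zero_eta, Fin.mk_one,
      Fin.reduceFinMk, Matrix.cons_val] <;>
    simp only [offV, secVecV, Matrix.of_apply, Matrix.cons_val, Matrix.cons_val_zero,
      Matrix.cons_val_one, Fin.isValue, Fin.reduceEq, if_true, if_false, reduceIte,
      mul_zero, zero_mul, zero_add, add_zero, smul_zero, mul_one, one_mul, Fin.coe_ofNat_eq_mod,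
      Nat.reduceMod, pow_zero, pow_one, hI3, hI2, inv_one, inv_neg, neg_neg, hi, one_smul, sub_zero,
      neg_zero, zero_sub] <;>
    simp only [mul_add, add_mul, mul_sub, sub_mul, smul_sub, smul_add, smul_smul, mul_assoc,
      smul_mul_assoc, mul_smul_comm, mul_neg, neg_mul, mul_one, one_mul, mul_zero, zero_mul,
      smul_zero, smul_neg, h2, h4] <;>
    match_scalars <;> ring_nf

/-- The gauge direction on the slice. -/
def gaugeV (c : Fin 4 → ℂ) (k : ℂ) (a X r : R) : Fin 4 → R :=
  let f := a + a * r - (c 1 + c 2 + c 3) • r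
  let ξ := (-2 * Complex.I * c 1 + 3 * Complex.I / 2 - k) • 1 + (2 * Complex.I) • X
    + (2 * Complex.I) • ((X + 1) * (a - (c 1 + c 2 + c 3) • 1) * r)
  let ξ' := ξ + (2 * Complex.I) • a - (2 * Complex.I * (c 2 + c 3) + Complex.I / 2 - k) • 1
  ![0, ξ, ξ', ξ' - (2 * Complex.I) • f + (2 * Complex.I * (c 1 + c 2) - Complex.I / 2 - k) • 1]

set_option maxHeartbeats 2000000 in
-- The gauge blocks are solved from the three conditions that keep q₃₂ = q₃₄ = 1 and q₁₄ - q₁₂ = 1.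
-- Then `hX` and `ha` are the resulting equations for X = q₁₂ and a = q₄₁, and all other entries
-- follow from the moment relations. The derivative of c = g/(2t) is -2kc with k = 1/(2t).
theorem doffV_eq (c : Fin 4 → ℂ) (k : ℂ) (a X r a' X' : R) (h1 : X * r = 1) (h2 : r * X = 1)
    (hX : X' = secVecV c k a X r 0 1 - X * gaugeV c k a X r 1)
    (ha : a' = secVecV c k a X r 3 0 + gaugeV c k a X r 3 * a) :
    doffV c (-((2 * k) • c)) a X r a' X' = secVecV c k a X r +
      Matrix.of fun i j => gaugeV c k a X r i * offV c a X r i j - offV c a X r i j *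
          gaugeV c k a X r j := by
  have h3 (z : R) : X * (r * z) = z := by rw [← mul_assoc, h1, one_mul]
  have h4 (z : R) : r * (X * z) = z := by rw [← mul_assoc, h2, one_mul]
  ext i j : 2
  fin_cases i <;> fin_cases j <;>
    simp only [Matrix.add_apply, Matrix.sub_apply, Matrix.neg_apply,
      Matrix.smul_apply, Matrix.one_apply, Matrix.of_apply, Fin.zero_eta, Fin.mk_one,
      Fin.reduceFinMk, Matrix.cons_val] <;>
    simp only [doffV, hX, ha] <;>
    simp only [offV, secVecV, gaugeV, Matrix.of_apply, Matrix.cons_val, Matrix.cons_val_zero,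
      Matrix.cons_val_one, Fin.isValue, Fin.reduceEq, if_true, if_false, reduceIte,
      mul_zero, zero_mul, zero_add, add_zero, smul_zero, mul_one, one_mul, Pi.neg_apply,
      Pi.smul_apply, smul_eq_mul, sub_zero, zero_sub, sub_self] <;>
    simp only [mul_add, add_mul, mul_sub, sub_mul, smul_sub, smul_add, smul_smul, mul_assoc,
      smul_mul_assoc, mul_smul_comm, mul_neg, neg_mul, mul_one, one_mul, mul_zero, zero_mul,
      smul_zero, smul_neg, h1, h2, h3, h4] <;>
    match_scalars <;> ring_nf

/-- The equations for q₁₂ and q₄₁ found on the slice are those of PV in the time s = -2it, under X =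
Q - 1 and a = (i/(2t))P(Q - 1) + g₄/(2t). The term with t⁻¹ in the second identity is the explicit
time derivative of a. -/
theorem vecV_target (g₂ g₃ g₄ : ℂ) {t : ℂ} (ht : t ≠ 0) (P X r : R) (c : Fin 4 → ℂ)
    (h1 : X * r = 1) (h2 : r * X = 1) (hc1 : c 1 = g₂ / (2 * t)) (hc2 : c 2 = g₃ / (2 * t))
    (hc3 : c 3 = g₄ / (2 * t))
    (u : R × R) (a : R) (ha : a = (Complex.I / (2 * t)) • (P * X) + c 3 • 1)
    (hu : u = (-2 * Complex.I) • vecV ![1 + Complex.I * g₂, Complex.I * g₃ + Complex.I * g₄,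
      -(Complex.I * g₄), -(Complex.I * g₂) - Complex.I * g₃] (-2 * Complex.I * t) (P, X + 1)) :
    u.2 = secVecV c (2 * t)⁻¹ a X r 0 1 - X * gaugeV c (2 * t)⁻¹ a X r 1 ∧
    (Complex.I / (2 * t)) • (u.1 * X + P * u.2) - t⁻¹ • a =
      secVecV c (2 * t)⁻¹ a X r 3 0 + gaugeV c (2 * t)⁻¹ a X r 3 * a := by
  have h3 (z : R) : X * (r * z) = z := by rw [← mul_assoc, h1, one_mul]
  have h4 (z : R) : r * (X * z) = z := by rw [← mul_assoc, h2, one_mul]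
  have hI3 : Complex.I ^ 3 = -Complex.I := Complex.I_pow_three
  have hI2 : Complex.I ^ 2 = -1 := Complex.I_sq
  have hs : (-2 * Complex.I * t)⁻¹ = Complex.I / (2 * t) := by
    refine inv_eq_of_mul_eq_one_right ?_
    field_simp
    linear_combination -hI2
  constructor <;>
    simp only [hu, vecV, hs, ha, offV, secVecV, gaugeV, hc1, hc2, hc3, Matrix.of_apply,
      Matrix.cons_val, Matrix.cons_val_zero,
      Matrix.cons_val_one, Fin.isValue, Fin.reduceEq, if_true, if_false, reduceIte,
      mul_zero, zero_mul, zero_add, add_zero, smul_zero, mul_one, one_mul, Pi.neg_apply,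
      Pi.smul_apply, smul_eq_mul, sub_zero, zero_sub, sub_self, Prod.smul_fst, Prod.smul_snd] <;>
    simp only [mul_add, add_mul, mul_sub, sub_mul, smul_sub, smul_add, smul_smul, mul_assoc,
      smul_mul_assoc, mul_smul_comm, mul_neg, neg_mul, mul_one, one_mul, mul_zero, zero_mul,
      smul_zero, smul_neg, h1, h2, h3, h4] <;>
    match_scalars <;>
      first
      | (field_simp; done)
      | (field_simp; ring_nf; done)
      | (field_simp; ring_nf; simp only [hI3, hI2]; ring_nf; done)
      | (field_simp; grind)

end V


/-! ### The fixed points of PV and the density of the locus -/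

section V

section Algebra

variable {R : Type*} [Ring R] [Algebra ℂ R]

/-- The derivative of `fixBlkV`. -/
def dfixBlkV (t τ : ℂ) (N N' : Matrix (Fin 4) (Fin 4) R) :
    Matrix (Fin 4) (Fin 4) R × Matrix (Fin 4) (Fin 4) R :=
  (-(τ • twV N + t • twV N') - (τ / 2) • 1, N')

/-- The twist commutes with block diagonal gauge directions, so a gauge correction of q induces the
same correction of p. -/
theorem dfixBlkV_add_gauge (t : ℂ) (N W : Matrix (Fin 4) (Fin 4) R) (ξ : Fin 4 → R) :
    dfixBlkV t 1 N (W + Matrix.of fun i j => ξ i * N i j - N i j * ξ j) =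
      (-(twV N + t • twV W) - (1 / 2 : ℂ) • 1, W) + gaugeBlk ξ (fixBlkV t N) := by
  refine Prod.ext ?_ ?_ <;> ext i j : 2
  · simp only [dfixBlkV, gaugeBlk, fixBlkV, twV_apply, Prod.fst_add, Matrix.add_apply,
      Matrix.sub_apply, Matrix.neg_apply, Matrix.smul_apply, Matrix.of_apply, one_smul]
    by_cases h : i = j
    · subst h
      simp only [Matrix.one_apply_eq, smul_add, smul_sub, mul_sub, sub_mul, mul_neg, neg_mul,
        mul_smul_comm, smul_mul_assoc, mul_one, one_mul]
      module
    · simp only [Matrix.one_apply_ne h, smul_add, smul_sub, mul_sub, sub_mul, mul_neg, neg_mul,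
        mul_smul_comm, smul_mul_assoc, mul_zero, zero_mul, smul_zero]
      module
  · by_cases h : i = j
    · subst h
      simp [dfixBlkV, gaugeBlk, fixBlkV, mul_add, add_mul]
    · simp [dfixBlkV, gaugeBlk, fixBlkV, Matrix.one_apply_ne h]

/-- These matrices serve as directions inside the linear space of fixed points, with prescribed
effect on the four blocks of the locus. -/
theorem exists_oddV (z₁ z₂ z₃ z₄ : R) : ∃ E : Matrix (Fin 4) (Fin 4) R, twV (twV E) = -E ∧
    E 0 1 = z₁ ∧ E 2 1 = z₂ ∧ E 2 3 = z₃ ∧ E 0 3 = z₄ := by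
  refine ⟨!![0, z₁, 0, z₄; 0, 0, 0, 0; 0, z₂, 0, z₃; 0, 0, 0, 0], ?_, rfl, rfl, rfl, rfl⟩
  have h3 : Complex.I ^ 3 = -Complex.I := Complex.I_pow_three
  ext i j
  simp only [twV_apply, smul_smul, Matrix.neg_apply]
  fin_cases i <;> fin_cases j <;> simp [h3]

end Algebra

variable {n : ℕ}

theorem exp_two_pi_div_four : Complex.exp (2 * Real.pi * Complex.I / 4) = Complex.I := by
  rw [show 2 * (Real.pi : ℂ) * Complex.I / 4 = Real.pi / 2 * Complex.I by ring,
    Complex.exp_pi_div_two_mul_I]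

/-- The odd part of `q`. -/
def oddBlkV (x : Phase (Fin n × Fin 4)) : Matrix (Fin 4) (Fin 4) (Matrix (Fin n) (Fin n) ℂ) :=
  blkAlg n 4 x.2 - (1 / 2 : ℂ) • 1

theorem ofBlk_blkAlg {d : ℕ} (x : Phase (Fin n × Fin d)) :
    ofBlk (blkAlg n d x.1, blkAlg n d x.2) = x := by simp [ofBlk]

theorem oddBlkV_ofBlk (t : ℂ) (N : Matrix (Fin 4) (Fin 4) (Matrix (Fin n) (Fin n) ℂ)) :
    oddBlkV (ofBlk (fixBlkV t N)) = N := by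
  simp only [oddBlkV, ofBlk, AlgEquiv.apply_symm_apply, fixBlkV]
  abel

/-- The equation for q says p = -t·`twV` q. The one for p then becomes `twV`²q = 1 - q, so q - 1/2
is odd for the square of the twist. -/
theorem backVpi_fixedSet {t : ℂ} (ht : t ≠ 0) (x : Phase (Fin n × Fin 4)) :
    x ∈ fixedSet Set.univ backVpi t ↔
      x = ofBlk (fixBlkV t (oddBlkV x)) ∧ twV (twV (oddBlkV x)) = -oddBlkV x := by
  have h0 : x ∈ fixedSet Set.univ backVpi t ↔ twV (blkAlg n 4 x.1) = t • (blkAlg n 4 x.2 - 1) ∧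
      twV (blkAlg n 4 x.2) = -(t⁻¹ • blkAlg n 4 x.1) := by
    rw [mem_fixedSet_blk, ← Matrix.ext_iff, ← Matrix.ext_iff]
    simp only [Set.mem_univ, true_and, Nat.cast_ofNat, exp_two_pi_div_four, twV_apply, backVpi,
      ← blkAlg_apply, map_sub, map_smul, map_neg, map_one]
  have h1 : x = ofBlk (fixBlkV t (oddBlkV x)) ↔
      blkAlg n 4 x.1 = -(t • twV (oddBlkV x)) - (t / 2) • 1 := by
    constructor
    · intro h
      conv_lhs => rw [h]
      simp [ofBlk, fixBlkV]
    · intro h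
      conv_lhs => rw [← ofBlk_blkAlg x, h]
      simp [fixBlkV, oddBlkV]
  rw [h0, h1, oddBlkV]
  generalize blkAlg n 4 x.1 = p
  generalize blkAlg n 4 x.2 = q
  simp only [map_sub, map_smul, map_one]
  constructor
  · rintro ⟨h2, h3⟩
    have h4 : p = -(t • twV q) := by rw [h3, smul_neg, smul_smul, mul_inv_cancel₀ ht]; simp
    refine ⟨?_, ?_⟩
    · rw [h4, smul_sub, smul_smul]; module
    · rw [h3, map_neg, map_smul, h2, smul_smul, inv_mul_cancel₀ ht]; module
  · rintro ⟨h2, h3⟩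
    have h4 : p = -(t • twV q) := by rw [h2, smul_sub, smul_smul]; module
    have h5 : twV (twV q) = 1 - q := by
      rw [sub_eq_iff_eq_add] at h3
      rw [h3]; module
    refine ⟨?_, ?_⟩
    · rw [h4, map_neg, map_smul, h5]; module
    · rw [h4, smul_neg, smul_smul, inv_mul_cancel₀ ht]; simp

theorem fixBlkV_mem {t : ℂ} (ht : t ≠ 0) {N : Matrix (Fin 4) (Fin 4) (Matrix (Fin n) (Fin n) ℂ)}
    (hN : twV (twV N) = -N) : ofBlk (fixBlkV t N) ∈ fixedSet Set.univ backVpi t := by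
  rw [backVpi_fixedSet ht, oddBlkV_ofBlk]
  exact ⟨rfl, hN⟩

theorem fixBlkV_add_smul (t ε : ℂ) (N E : Matrix (Fin 4) (Fin 4) (Matrix (Fin n) (Fin n) ℂ)) :
    ofBlk (fixBlkV t N) + ε • ofBlk (-(t • twV E), E) = ofBlk (fixBlkV t (N + ε • E)) := by
  refine Prod.ext ?_ ?_
  · simp only [ofBlk, fixBlkV, Prod.fst_add, Prod.smul_fst, ← map_smul, ← map_add]
    congr 1
    simp only [map_add, map_smul]
    module
  · simp only [ofBlk, fixBlkV, Prod.snd_add, Prod.smul_snd, ← map_smul, ← map_add]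
    congr 1
    module

theorem blk_fixBlkV {t : ℂ} {N : Matrix (Fin 4) (Fin 4) (Matrix (Fin n) (Fin n) ℂ)} {i j : Fin 4}
    (h : i ≠ j) : blk (ofBlk (fixBlkV t N)).2 i j = N i j := by
  rw [blk_ofBlk_snd]
  simp [fixBlkV, Matrix.one_apply_ne h]

/-- The points of `genV` without the last condition. -/
def genV' : Set (Phase (Fin n × Fin 4)) :=
  {x | IsUnit (blk x.2 0 1) ∧ IsUnit (blk x.2 2 1) ∧ IsUnit (blk x.2 2 3)}

theorem isOpen_genV' : IsOpen (genV' (n := n)) :=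
  (isOpen_isUnit_comp ((continuous_blk 0 1).comp continuous_snd)).inter
    ((isOpen_isUnit_comp ((continuous_blk 2 1).comp continuous_snd)).inter
      (isOpen_isUnit_comp ((continuous_blk 2 3).comp continuous_snd)))

theorem differentiableOn_redV_snd : DifferentiableOn ℂ (fun x : Phase (Fin n × Fin 4) =>
    blk x.2 0 3 * (blk x.2 2 3)⁻¹ * blk x.2 2 1 * (blk x.2 0 1)⁻¹) genV' := by
  have h (i j : Fin 4) : DifferentiableOn ℂ (fun x : Phase (Fin n × Fin 4) => blk x.2 i j) genV' :=
    ((differentiable_blk i j).comp differentiable_snd).differentiableOn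
  exact (((h 0 3).mul (differentiableOn_blk_inv fun x hx => hx.2.2)).mul (h 2 1)).mul
    (differentiableOn_blk_inv fun x hx => hx.1)

/-- The last condition involves inverses, so it is open only relative to the open set where the
first three hold. -/
theorem isOpen_genV : IsOpen (genV (n := n)) := by
  have h := ((differentiableOn_redV_snd (n := n)).sub_const 1).continuousOn.isOpen_inter_preimage
    isOpen_genV' isOpen_isUnit_matrix
  convert! h using 1
  ext x
  exact ⟨fun h => ⟨⟨h.1, h.2.1, h.2.2.1⟩, h.2.2.2⟩, fun h => ⟨h.1.1, h.1.2.1, h.1.2.2, h.2⟩⟩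

theorem dense_genV' {t : ℂ} (ht : t ≠ 0) {x : Phase (Fin n × Fin 4)}
    (hx : x ∈ fixedSet Set.univ backVpi t) :
    x ∈ closure (fixedSet Set.univ backVpi t ∩ genV') := by
  obtain ⟨hx1, hx2⟩ := (backVpi_fixedSet ht x).1 hx
  set N := oddBlkV x
  obtain ⟨E, hE, e1, e2, e3, -⟩ :=
    exists_oddV (1 - N 0 1) (1 - N 2 1) (1 - N 2 3) (0 : Matrix (Fin n) (Fin n) ℂ)
  have h1 : IsUnit (N 0 1 + (1 : ℂ) • E 0 1) := by simp [e1]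
  have h2 : IsUnit (N 2 1 + (1 : ℂ) • E 2 1) := by simp [e2]
  have h3 : IsUnit (N 2 3 + (1 : ℂ) • E 2 3) := by simp [e3]
  refine mem_closure_of_eventually_line x (ofBlk (-(t • twV E), E)) ?_
  filter_upwards [eventually_isUnit_add_smul _ _ h1, eventually_isUnit_add_smul _ _ h2,
    eventually_isUnit_add_smul _ _ h3] with ε hε1 hε2 hε3
  rw [hx1, fixBlkV_add_smul]
  refine ⟨fixBlkV_mem ht ?_, ?_, ?_, ?_⟩
  · simp only [map_add, map_smul, hx2, hE]; module
  all_goals rw [blk_fixBlkV (by decide)]; assumption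

/-- A second perturbation suffices once q₁₂, q₃₂ and q₃₄ are invertible: it keeps these blocks and
shifts Q̃ - 1 by scalars, which avoid its finite spectrum. -/
theorem dense_genV {t : ℂ} (ht : t ≠ 0) {x : Phase (Fin n × Fin 4)}
    (hx : x ∈ fixedSet Set.univ backVpi t) :
    x ∈ closure (fixedSet Set.univ backVpi t ∩ genV) := by
  refine closure_minimal ?_ isClosed_closure (dense_genV' ht hx)
  rintro x ⟨hx, h01, h21, h23⟩
  obtain ⟨hx1, hx2⟩ := (backVpi_fixedSet ht x).1 hx
  set N := oddBlkV x
  have e (i j : Fin 4) (h : i ≠ j) : blk x.2 i j = N i j := by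
    conv_lhs => rw [hx1]
    exact blk_fixBlkV h
  rw [e _ _ (by decide)] at h01 h21 h23
  -- Moving q₁₄ along q₁₂q₃₂⁻¹q₃₄ moves Q̃ = q₁₄q₃₄⁻¹q₃₂q₁₂⁻¹ along the identity.
  obtain ⟨E, hE, e1, e2, e3, e4⟩ := exists_oddV 0 0 0 (N 0 1 * (N 2 1)⁻¹ * N 2 3)
  obtain ⟨μ, hμ⟩ := exists_isUnit_add_smul_one (N 0 3 * (N 2 3)⁻¹ * N 2 1 * (N 0 1)⁻¹ - 1)
  refine mem_closure_of_eventually_line x (ofBlk (-(t • twV E), E)) ?_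
  filter_upwards [eventually_isUnit_add_smul _ _ hμ] with ε hε
  rw [hx1, fixBlkV_add_smul]
  have f01 : (N + ε • E) 0 1 = N 0 1 := by
    rw [Matrix.add_apply, Matrix.smul_apply, e1, smul_zero, add_zero]
  have f21 : (N + ε • E) 2 1 = N 2 1 := by
    rw [Matrix.add_apply, Matrix.smul_apply, e2, smul_zero, add_zero]
  have f23 : (N + ε • E) 2 3 = N 2 3 := by
    rw [Matrix.add_apply, Matrix.smul_apply, e3, smul_zero, add_zero]
  have f03 : (N + ε • E) 0 3 = N 0 3 + ε • (N 0 1 * (N 2 1)⁻¹ * N 2 3) := by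
    rw [Matrix.add_apply, Matrix.smul_apply, e4]
  refine ⟨fixBlkV_mem ht ?_, ?_, ?_, ?_, ?_⟩
  · simp only [map_add, map_smul, hx2, hE]; module
  · rw [blk_fixBlkV (by decide), f01]; exact h01
  · rw [blk_fixBlkV (by decide), f21]; exact h21
  · rw [blk_fixBlkV (by decide), f23]; exact h23
  · rw [blk_fixBlkV (by decide), blk_fixBlkV (by decide), blk_fixBlkV (by decide),
      blk_fixBlkV (by decide), f01, f21, f23, f03]
    rw [isUnit_iff_isUnit_det] at h01 h21 h23
    have : (N 0 3 + ε • (N 0 1 * (N 2 1)⁻¹ * N 2 3)) * (N 2 3)⁻¹ * N 2 1 * (N 0 1)⁻¹ - 1 =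
        N 0 3 * (N 2 3)⁻¹ * N 2 1 * (N 0 1)⁻¹ - 1 + ε • (1 : Matrix (Fin n) (Fin n) ℂ) := by
      simp only [add_mul, smul_mul_assoc]
      rw [mul_nonsing_inv_cancel_right _ _ h23, nonsing_inv_mul_cancel_right _ _ h21,
        mul_nonsing_inv _ h01]
      abel
    rw [this]
    exact hε

theorem hasDerivAt_fixBlkV (t τ : ℂ) {N : ℂ → Matrix (Fin 4) (Fin 4) (Matrix (Fin n) (Fin n) ℂ)}
    {N' : Matrix (Fin 4) (Fin 4) (Matrix (Fin n) (Fin n) ℂ)}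
    (hN : ∀ i j, HasDerivAt (fun ε => N ε i j) (N' i j) 0) :
    HasDerivAt (fun ε => ofBlk (fixBlkV (t + ε * τ) (N ε))) (ofBlk (dfixBlkV t τ (N 0) N')) 0 := by
  refine hasDerivAt_ofBlk (fun i j => ?_) fun i j => ?_
  · have h1 := ((hasDerivAt_add_mul t τ).smul
      ((hN i j).const_smul (Complex.I ^ (i : ℕ) * (Complex.I ^ (j : ℕ))⁻¹))).neg.sub
      (((hasDerivAt_add_mul t τ).div_const 2).smul_const
        ((1 : Matrix (Fin 4) (Fin 4) (Matrix (Fin n) (Fin n) ℂ)) i j))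
    simp only [zero_mul, add_zero] at h1
    convert! h1 using 1
    simp only [dfixBlkV, twV_apply, Matrix.add_apply,
      Matrix.sub_apply, Matrix.neg_apply, Matrix.smul_apply, Pi.smul_apply]
    module
  · exact (hN i j).add_const _

theorem hasDerivAt_offV {c : ℂ → Fin 4 → ℂ} {c' : Fin 4 → ℂ}
    {a X r : ℂ → Matrix (Fin n) (Fin n) ℂ} {a' X' : Matrix (Fin n) (Fin n) ℂ}
    (hc : ∀ i, HasDerivAt (fun ε => c ε i) (c' i) 0) (ha : HasDerivAt a a' 0)
    (hX : HasDerivAt X X' 0) (hr : HasDerivAt r (-(r 0 * X' * r 0)) 0) (i j : Fin 4) :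
    HasDerivAt (fun ε => offV (c ε) (a ε) (X ε) (r ε) i j)
      (doffV (c 0) c' (a 0) (X 0) (r 0) a' X' i j) 0 := by
  have h1 := (hasDerivAt_matrix_mul ha hX).add ha
  have h2 := h1.sub (((hc 2).add (hc 3)).smul_const (1 : Matrix (Fin n) (Fin n) ℂ))
  have h3 := h1.sub ((hc 3).smul_const (1 : Matrix (Fin n) (Fin n) ℂ))
  have h4 := (ha.add (hasDerivAt_matrix_mul ha hr)).sub ((((hc 1).add (hc 2)).add (hc 3)).smul hr)
  have h5 := hX.add_const (1 : Matrix (Fin n) (Fin n) ℂ)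
  fin_cases i <;> fin_cases j
  any_goals exact hasDerivAt_const _ _
  · exact hX
  · exact h5
  · convert! h4 using 1
    simp only [doffV, Matrix.of_apply, Fin.mk_one, Fin.zero_eta, Matrix.cons_val_one,
      Matrix.cons_val_zero, smul_neg, mul_neg, ← mul_assoc, sub_eq_add_neg, neg_add, neg_neg]
    abel
  · exact h2
  · exact ha
  · exact h3

end V


/-! ### The slice of PV in terms of (P, Q) -/

section V

variable {n : ℕ}

/-- The block `q₄₁` on the slice. -/
def aV (g : Fin 4 → ℂ) (t : ℂ) (y : Phase (Fin n)) : Matrix (Fin n) (Fin n) ℂ :=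
  (Complex.I / (2 * t)) • (y.1 * (y.2 - 1)) + (g 3 / (2 * t)) • 1

/-- The odd part of `q` on the slice, in terms of `(P, Q)`. -/
def secV (g : Fin 4 → ℂ) (t : ℂ) (y : Phase (Fin n)) :
    Matrix (Fin 4) (Fin 4) (Matrix (Fin n) (Fin n) ℂ) :=
  offV (fun i => g i / (2 * t)) (aV g t y) (y.2 - 1) (y.2 - 1)⁻¹

theorem twV_secV (g : Fin 4 → ℂ) (t : ℂ) (y : Phase (Fin n)) :
    twV (twV (secV g t y)) = -secV g t y := twV_offV _ _ _ _

/-- The derivative of `secV`. -/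
def dsecV (g : Fin 4 → ℂ) (t τ : ℂ) (y u : Phase (Fin n)) :
    Matrix (Fin 4) (Fin 4) (Matrix (Fin n) (Fin n) ℂ) :=
  doffV (fun i => g i / (2 * t)) (-((τ / t) • fun i => g i / (2 * t))) (aV g t y) (y.2 - 1)
    (y.2 - 1)⁻¹
    ((Complex.I / (2 * t)) • (u.1 * (y.2 - 1) + y.1 * u.2) - (τ / t) • aV g t y) u.2

theorem hasDerivAt_inv_add_mul {t : ℂ} (ht : t ≠ 0) (τ c : ℂ) :
    HasDerivAt (fun ε : ℂ => c / (2 * (t + ε * τ))) (-(τ / t * (c / (2 * t)))) 0 := by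
  have h1 := (hasDerivAt_const (0 : ℂ) c).div ((hasDerivAt_add_mul t τ).const_mul 2)
    (by simpa using ht)
  convert! h1 using 1
  simp only [zero_mul, add_zero]
  field_simp
  ring

theorem hasDerivAt_aV (g : Fin 4 → ℂ) {t : ℂ} (ht : t ≠ 0) (τ : ℂ) (y u : Phase (Fin n)) :
    HasDerivAt (fun ε : ℂ => aV g (t + ε * τ) (y + ε • u))
      ((Complex.I / (2 * t)) • (u.1 * (y.2 - 1) + y.1 * u.2) - (τ / t) • aV g t y) 0 := by
  have h1 := hasDerivAt_fst (hasDerivAt_line y u)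
  have h2 := (hasDerivAt_snd (hasDerivAt_line y u)).sub_const 1
  have h3 := ((hasDerivAt_inv_add_mul ht τ Complex.I).smul (hasDerivAt_matrix_mul h1 h2)).add
    ((hasDerivAt_inv_add_mul ht τ (g 3)).smul_const (1 : Matrix (Fin n) (Fin n) ℂ))
  convert! h3 using 1
  simp only [aV, zero_mul, add_zero, zero_smul]
  module

theorem hasDerivAt_secV (g : Fin 4 → ℂ) {t : ℂ} (ht : t ≠ 0) (τ : ℂ) {y : Phase (Fin n)}
    (hy : IsUnit (y.2 - 1)) (u : Phase (Fin n)) (i j : Fin 4) :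
    HasDerivAt (fun ε : ℂ => secV g (t + ε * τ) (y + ε • u) i j) (dsecV g t τ y u i j) 0 := by
  have h2 := (hasDerivAt_snd (hasDerivAt_line y u)).sub_const 1
  have hr := hasDerivAt_matrix_inv h2 (by simpa using hy)
  have h := hasDerivAt_offV (c := fun ε i => g i / (2 * (t + ε * τ)))
    (c' := -((τ / t) • fun i => g i / (2 * t)))
    (fun i => hasDerivAt_inv_add_mul ht τ (g i)) (hasDerivAt_aV g ht τ y u) h2 hr i j
  simp only [zero_mul, add_zero, zero_smul] at h
  exact h

theorem hasDerivAt_ofBlk_secV (g : Fin 4 → ℂ) {t : ℂ} (ht : t ≠ 0) (τ : ℂ) {y : Phase (Fin n)}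
    (hy : IsUnit (y.2 - 1)) (u : Phase (Fin n)) :
    HasDerivAt (fun ε : ℂ => ofBlk (fixBlkV (t + ε * τ) (secV g (t + ε * τ) (y + ε • u))))
      (ofBlk (dfixBlkV t τ (secV g t y) (dsecV g t τ y u))) 0 := by
  have h := hasDerivAt_fixBlkV t τ (hasDerivAt_secV g ht τ hy u)
  simp only [zero_mul, add_zero, zero_smul] at h
  exact h

/-- With q₃₂ and q₃₄ constant and q₁₂, q₁₄ of equal derivative, the contributions of q₂₁ and q₄₁
have opposite twist weights. Only their difference matters: it is dP up to a scalar, plus a multiple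
of X⁻¹dX X⁻¹ that drops out by cyclicity. -/
theorem sympl_dsecV (g : Fin 4 → ℂ) {t : ℂ} (ht : t ≠ 0) {y : Phase (Fin n)}
    (hy : IsUnit (y.2 - 1)) (u u' : Phase (Fin n)) :
    sympl (ofBlk (dfixBlkV t 0 (secV g t y) (dsecV g t 0 y u)))
      (ofBlk (dfixBlkV t 0 (secV g t y) (dsecV g t 0 y u'))) = sympl u u' := by
  rw [isUnit_iff_isUnit_det] at hy
  have h1 := mul_nonsing_inv _ hy
  have key (v : Phase (Fin n)) : dsecV g t 0 y v 1 0 = dsecV g t 0 y v 3 0 +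
      (Complex.I / (2 * t)) • v.1 +
      ((g 1 + g 2) / (2 * t)) • ((y.2 - 1)⁻¹ * v.2 * (y.2 - 1)⁻¹) := by
    have h3 (z : Matrix (Fin n) (Fin n) ℂ) : (y.2 - 1) * ((y.2 - 1)⁻¹ * z) = z := by
      rw [← mul_assoc, h1, one_mul]
    simp only [dsecV, doffV, aV, Matrix.of_apply, Matrix.cons_val, Matrix.cons_val_zero,
      Matrix.cons_val_one]
    generalize (y.2 - 1)⁻¹ = r at h1 h3 ⊢
    generalize y.2 - 1 = X at h1 h3 ⊢
    simp only [mul_add, add_mul, mul_sub, sub_mul, smul_sub, smul_add, smul_smul, mul_assoc,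
      smul_mul_assoc, mul_smul_comm, mul_neg, neg_mul, mul_one, one_mul, mul_zero, zero_mul,
      smul_zero, smul_neg, h1, h3, zero_div, zero_smul, neg_zero, Pi.zero_apply]
    module
  have e01 (v : Phase (Fin n)) : dsecV g t 0 y v 0 1 = v.2 := rfl
  have e03 (v : Phase (Fin n)) : dsecV g t 0 y v 0 3 = v.2 := rfl
  have e21 (v : Phase (Fin n)) : dsecV g t 0 y v 2 1 = 0 := rfl
  have e23 (v : Phase (Fin n)) : dsecV g t 0 y v 2 3 = 0 := rfl
  have e00 (v : Phase (Fin n)) (i : Fin 4) : dsecV g t 0 y v i i = 0 := by fin_cases i <;> rfl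
  have e02 (v : Phase (Fin n)) : dsecV g t 0 y v 0 2 = 0 := rfl
  have e20 (v : Phase (Fin n)) : dsecV g t 0 y v 2 0 = 0 := rfl
  have e13 (v : Phase (Fin n)) : dsecV g t 0 y v 1 3 = 0 := rfl
  have e31 (v : Phase (Fin n)) : dsecV g t 0 y v 3 1 = 0 := rfl
  have c1 := trace_mul_comm u.1 u'.2
  have c2 := trace_mul_comm u'.1 u.2
  have c3 := trace_mul_comm u.2 (dsecV g t 0 y u' 3 0)
  have c4 := trace_mul_comm u'.2 (dsecV g t 0 y u 3 0)
  have c5 : trace (u.2 * ((y.2 - 1)⁻¹ * u'.2 * (y.2 - 1)⁻¹)) =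
      trace (u'.2 * ((y.2 - 1)⁻¹ * u.2 * (y.2 - 1)⁻¹)) := by
    rw [← mul_assoc, trace_mul_comm]
    simp only [← mul_assoc]
    rw [trace_mul_comm]
    simp only [← mul_assoc]
  have c6 := trace_mul_comm u.2 ((y.2 - 1)⁻¹ * u'.2 * (y.2 - 1)⁻¹)
  have c7 := trace_mul_comm u'.2 ((y.2 - 1)⁻¹ * u.2 * (y.2 - 1)⁻¹)
  rw [sympl_ofBlk]
  simp only [Fin.sum_univ_four, dfixBlkV, zero_smul, zero_add, zero_div, sub_zero,
    Matrix.neg_apply, Matrix.smul_apply, twV_apply, e01, e03, e21, e23, e00, e02, e20, e13, e31,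
    key, smul_zero, zero_mul, mul_zero, neg_zero, Matrix.trace_zero, sub_self, add_zero, smul_mul_assoc,
    mul_smul_comm, neg_mul, Matrix.trace_neg, Matrix.trace_smul, mul_add, add_mul, smul_add,
    Matrix.trace_add, smul_eq_mul, Fin.coe_ofNat_eq_mod, Nat.reduceMod, pow_zero, pow_one, inv_one,
    Complex.I_pow_three, Complex.inv_I, inv_neg, neg_neg, sympl, Fin.isValue]
  rw [← c1, ← c2, c3, c4, ← c6, ← c7, ← c5]
  field_simp
  linear_combination 2 * (trace (u'.1 * u.2) - trace (u.1 * u'.2)) * Complex.I_sq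

/-- The gauge transformation to the slice. -/
def nrmV (x : Phase (Fin n × Fin 4)) : Fin 4 → Matrix (Fin n) (Fin n) ℂ :=
  let η := blk x.2 0 3 * (blk x.2 2 3)⁻¹ * blk x.2 2 1 - blk x.2 0 1
  ![1, η, η * (blk x.2 2 1)⁻¹, η * (blk x.2 2 1)⁻¹ * blk x.2 2 3]

theorem isUnit_nrmV {x : Phase (Fin n × Fin 4)} (hx : x ∈ genV) (i : Fin 4) :
    IsUnit (nrmV x i) := by
  obtain ⟨h01, h21, h23, h⟩ := hx
  -- This block equals (Q̃ - 1)q₁₂, which explains the last condition of the locus.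
  have h1 : IsUnit (blk x.2 0 3 * (blk x.2 2 3)⁻¹ * blk x.2 2 1 - blk x.2 0 1) := by
    convert! h.mul h01 using 1
    rw [sub_mul, one_mul, nonsing_inv_mul_cancel_right _ _ ((isUnit_iff_isUnit_det _).1 h01)]
  fin_cases i
  exacts [isUnit_one, h1, h1.mul (isUnit_matrix_inv h21), (h1.mul (isUnit_matrix_inv h21)).mul h23]

theorem nrmV_gauge (x : Phase (Fin n × Fin 4)) (h : Fin 4 → GL (Fin n) ℂ) (h0 : h 0 = 1)
    (i : Fin 4) : nrmV (gauge h x) i = nrmV x i * ((h i)⁻¹ : GL (Fin n) ℂ).1 := by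
  fin_cases i <;> simp only [nrmV, blk_gauge_snd, gauge_inv] <;>
    simp [h0, mul_assoc, mul_sub, sub_mul]

theorem redV_gauge (t : ℂ) (x : Phase (Fin n × Fin 4)) (h : Fin 4 → GL (Fin n) ℂ)
    (h0 : h 0 = 1) : redV t (gauge h x) = redV t x := by
  simp only [redV, blk_gauge_snd, gauge_inv]
  simp [h0, mul_assoc]

theorem gauge_genV (x : Phase (Fin n × Fin 4)) (h : Fin 4 → GL (Fin n) ℂ)
    (hx : x ∈ genV) : gauge h x ∈ genV := by
  obtain ⟨h01, h21, h23, h4⟩ := hx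
  refine ⟨?_, ?_, ?_, ?_⟩
  · rw [blk_gauge_snd]; exact isUnit_gauge h01
  · rw [blk_gauge_snd]; exact isUnit_gauge h21
  · rw [blk_gauge_snd]; exact isUnit_gauge h23
  · convert! isUnit_gauge (h := h 0) (k := h 0) h4 using 1
    simp only [blk_gauge_snd, gauge_inv]
    simp [mul_assoc, mul_sub, sub_mul]

theorem mapV_ofBlk {t : ℂ} (ht : t ≠ 0) (g : Fin 4 → ℂ) {y : Phase (Fin n)}
    (hy : IsUnit (y.2 - 1)) : mapV (g 3) t (ofBlk (fixBlkV t (secV g t y))) = y := by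
  rw [isUnit_iff_isUnit_det] at hy
  have h1 := mul_nonsing_inv _ hy
  have h2 := nonsing_inv_mul _ hy
  have h3 (z : Matrix (Fin n) (Fin n) ℂ) : (y.2 - 1)⁻¹ * ((y.2 - 1) * z) = z := by
    rw [← mul_assoc, h2, one_mul]
  have e01 : secV g t y 0 1 = y.2 - 1 := rfl
  have e03 : secV g t y 0 3 = y.2 - 1 + 1 := rfl
  have e21 : secV g t y 2 1 = 1 := rfl
  have e23 : secV g t y 2 3 = 1 := rfl
  have e30 : secV g t y 3 0 = aV g t y := rfl
  have hr : redV t (ofBlk (fixBlkV t (secV g t y))) =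
      ((2 * Complex.I * t) • ((y.2 - 1) * aV g t y), 1 + (y.2 - 1)⁻¹) := by
    simp only [redV]
    rw [blk_fixBlkV (by decide), blk_fixBlkV (by decide), blk_fixBlkV (by decide),
      blk_fixBlkV (by decide), blk_fixBlkV (by decide), e01, e03, e21, e23, e30]
    simp only [inv_one, mul_one, add_mul, h1, one_mul]
  rw [mapV, hr]
  refine Prod.ext ?_ ?_
  · simp only [add_sub_cancel_left, mul_smul_comm, h3, aV]
    simp only [sub_mul, add_mul, smul_add, smul_mul_assoc, mul_assoc, one_mul, smul_smul, h1,
      mul_one]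
    match_scalars
    · field_simp
      linear_combination -Complex.I_sq
    · field_simp
      ring
  · simp only [add_sub_cancel_left]
    rw [nonsing_inv_nonsing_inv _ hy, add_mul, h2, one_mul, sub_add_cancel]

theorem secV_mem_genV {t : ℂ} (g : Fin 4 → ℂ) {y : Phase (Fin n)}
    (hy : IsUnit (y.2 - 1)) : ofBlk (fixBlkV t (secV g t y)) ∈ genV := by
  have e01 : secV g t y 0 1 = y.2 - 1 := rfl
  have e03 : secV g t y 0 3 = y.2 - 1 + 1 := rfl
  have e21 : secV g t y 2 1 = 1 := rfl
  have e23 : secV g t y 2 3 = 1 := rfl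
  refine ⟨?_, ?_, ?_, ?_⟩
  · rw [blk_fixBlkV (by decide), e01]; exact hy
  · rw [blk_fixBlkV (by decide), e21]; exact isUnit_one
  · rw [blk_fixBlkV (by decide), e23]; exact isUnit_one
  · rw [blk_fixBlkV (by decide), blk_fixBlkV (by decide), blk_fixBlkV (by decide),
      blk_fixBlkV (by decide), e01, e03, e21, e23]
    simp only [inv_one, mul_one, add_mul, one_mul]
    rw [mul_nonsing_inv _ ((isUnit_iff_isUnit_det _).1 hy), add_sub_cancel_left]
    exact isUnit_matrix_inv hy

/-- The scalar parts of p and q do not contribute, so the commutator is that of the odd part of q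
with its twist, whose neighbouring blocks carry the weights ±i. -/
theorem moment_fixBlkV (t : ℂ) (N : Matrix (Fin 4) (Fin 4) (Matrix (Fin n) (Fin n) ℂ)) :
    moment (ofBlk (fixBlkV t N)) 1 = (2 * Complex.I * t) • (N 1 2 * N 2 1 - N 1 0 * N 0 1) ∧
    moment (ofBlk (fixBlkV t N)) 2 = (2 * Complex.I * t) • (N 2 3 * N 3 2 - N 2 1 * N 1 2) ∧
    moment (ofBlk (fixBlkV t N)) 3 = (2 * Complex.I * t) • (N 3 0 * N 0 3 - N 3 2 * N 2 3) := by
  have hc : (fixBlkV t N).1 * (fixBlkV t N).2 - (fixBlkV t N).2 * (fixBlkV t N).1 =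
      -(t • (twV N * N - N * twV N)) := by
    simp only [fixBlkV, mul_add, add_mul, mul_sub, sub_mul, neg_mul, mul_neg, smul_mul_assoc,
      mul_smul_comm, one_mul, mul_one]
    module
  have h (i : Fin 4) : moment (ofBlk (fixBlkV t N)) i =
      -(t • (twV N * N - N * twV N) i i) := by
    rw [moment_ofBlk, hc]
    rfl
  simp only [h, Matrix.sub_apply, Matrix.mul_apply, Fin.sum_univ_four, twV_apply, Matrix.smul_apply,
    smul_mul_assoc, mul_smul_comm, Fin.coe_ofNat_eq_mod, Nat.reduceMod, pow_zero, pow_one, inv_one,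
    Complex.I_pow_three, Complex.inv_I, inv_neg, neg_neg, Fin.isValue, Complex.I_sq]
  have hI : Complex.I * Complex.I = -1 := Complex.I_mul_I
  have hI2 : Complex.I ^ 2 = -1 := Complex.I_sq
  refine ⟨?_, ?_, ?_⟩ <;> match_scalars <;> first | (field_simp; done) | grind

theorem isUnit_blk_of_nrmV_eq_one {x : Phase (Fin n × Fin 4)} (hx : x ∈ genV)
    (h : ∀ i, nrmV x i = 1) : blk x.2 2 1 = 1 ∧ blk x.2 2 3 = 1 ∧
      blk x.2 0 3 = blk x.2 0 1 + 1 := by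
  have h1 : blk x.2 0 3 * (blk x.2 2 3)⁻¹ * blk x.2 2 1 - blk x.2 0 1 = 1 := h 1
  have h2 : (blk x.2 0 3 * (blk x.2 2 3)⁻¹ * blk x.2 2 1 - blk x.2 0 1) * (blk x.2 2 1)⁻¹ = 1 :=
    h 2
  have h3 : (blk x.2 0 3 * (blk x.2 2 3)⁻¹ * blk x.2 2 1 - blk x.2 0 1) * (blk x.2 2 1)⁻¹ *
    blk x.2 2 3 = 1 := h 3
  rw [h2, one_mul] at h3
  rw [h1, one_mul] at h2
  have h4 : blk x.2 2 1 = 1 := by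
    have := nonsing_inv_nonsing_inv _ ((isUnit_iff_isUnit_det _).1 hx.2.1)
    rw [h2, inv_one] at this
    exact this.symm
  refine ⟨h4, h3, ?_⟩
  rw [h4, h3, inv_one, mul_one, mul_one] at h1
  rw [← h1]; abel

theorem oddV_even {N : Matrix (Fin 4) (Fin 4) (Matrix (Fin n) (Fin n) ℂ)}
    (hN : twV (twV N) = -N) (i j : Fin 4) (hij : (i : ℕ) % 2 = j % 2) : N i j = 0 := by
  have h := congrFun (congrFun hN i) j
  rw [twV_apply, twV_apply, smul_smul, Matrix.neg_apply] at h
  have hz : Complex.I ^ (i : ℕ) * (Complex.I ^ (j : ℕ))⁻¹ *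
      (Complex.I ^ (i : ℕ) * (Complex.I ^ (j : ℕ))⁻¹) = 1 := by
    fin_cases i <;> fin_cases j <;> simp_all [Complex.I_pow_three]
  rw [hz, one_smul] at h
  exact matrix_eq_neg_iff.1 h

/-- The even blocks vanish, and on the slice the moment conditions determine q₄₃, then q₂₃, then q₂₁
from q₁₂ and q₄₁; the last step divides by q₁₂. -/
theorem secV_mapV {t : ℂ} (ht : t ≠ 0) {g : Fin 4 → ℂ} {x : Phase (Fin n × Fin 4)}
    (hx : x ∈ fixedSet Set.univ backVpi t) (hm : x ∈ momentLevel g) (hg : x ∈ genV)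
    (h : ∀ i, nrmV x i = 1) :
    IsUnit ((mapV (g 3) t x).2 - 1) ∧ secV g t (mapV (g 3) t x) = oddBlkV x := by
  obtain ⟨h21, h23, h03⟩ := isUnit_blk_of_nrmV_eq_one hg h
  obtain ⟨hx1, hx2⟩ := (backVpi_fixedSet ht x).1 hx
  have hU := hg.1
  have hm1 := hm 1 (by decide)
  have hm2 := hm 2 (by decide)
  have hm3 := hm 3 (by decide)
  obtain ⟨k1, k2, k3⟩ := moment_fixBlkV t (oddBlkV x)
  rw [← hx1] at k1 k2 k3
  rw [k1] at hm1
  rw [k2] at hm2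
  rw [k3] at hm3
  have e (i j : Fin 4) (h : i ≠ j) : blk x.2 i j = oddBlkV x i j := by
    conv_lhs => rw [hx1]
    exact blk_fixBlkV h
  have hM : mapV (g 3) t x = (-(((2 * Complex.I * t) • oddBlkV x 3 0 - (Complex.I * g 3) • 1) *
      (oddBlkV x 0 1)⁻¹), oddBlkV x 0 1 + 1) := by
    rw [e _ _ (by decide)] at hU h03 h21 h23
    rw [isUnit_iff_isUnit_det] at hU
    have h3 (z : Matrix (Fin n) (Fin n) ℂ) : (oddBlkV x 0 1)⁻¹ * (oddBlkV x 0 1 * z) = z := by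
      rw [← mul_assoc, nonsing_inv_mul _ hU, one_mul]
    have hr : redV t x =
        ((2 * Complex.I * t) • (oddBlkV x 0 1 * oddBlkV x 3 0), 1 + (oddBlkV x 0 1)⁻¹) := by
      simp only [redV]
      rw [e 0 1 (by decide), e 2 1 (by decide), e 2 3 (by decide), e 3 0 (by decide),
        e 0 3 (by decide), h21, h23, h03, e 0 1 (by decide)]
      simp only [inv_one, mul_one, add_mul, mul_nonsing_inv _ hU, one_mul]
    rw [mapV, hr]
    refine Prod.ext ?_ ?_
    · simp only [add_sub_cancel_left, mul_smul_comm, h3]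
    · simp only [add_sub_cancel_left]
      rw [nonsing_inv_nonsing_inv _ hU, add_mul, nonsing_inv_mul _ hU, one_mul, add_comm]
  rw [e _ _ (by decide)] at hU h21 h23
  rw [e _ _ (by decide), e _ _ (by decide)] at h03
  rw [hM]
  refine ⟨by rwa [add_sub_cancel_right], ?_⟩
  have ev := oddV_even hx2
  generalize oddBlkV x = N at *
  have hU' := (isUnit_iff_isUnit_det _).1 hU
  have hr1 := nonsing_inv_mul _ hU'
  have hr2 := mul_nonsing_inv _ hU'
  -- The formula for P is inverted to recover q₄₁.
  have ha : aV g t (-(((2 * Complex.I * t) • N 3 0 - (Complex.I * g 3) • 1) * (N 0 1)⁻¹),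
      N 0 1 + 1) = N 3 0 := by
    simp only [aV, add_sub_cancel_right, neg_mul, mul_assoc, hr1, mul_one]
    match_scalars
    · field_simp
      linear_combination -Complex.I_sq
    · field_simp
      linear_combination g 3 * Complex.I_sq
  -- The moment condition of the fourth block, with q₃₄ = 1 and q₁₄ = q₁₂ + 1.
  have h32 : N 3 2 = N 3 0 * N 0 1 + N 3 0 - (g 3 / (2 * t)) • 1 := by
    rw [h03, h23] at hm3
    linear_combination (norm := skip) (-(2 * Complex.I * t)⁻¹) • hm3
    simp only [mul_add, mul_one]
    match_scalars <;> field_simp <;> simp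
  have h12 : N 1 2 = N 3 0 * N 0 1 + N 3 0 - (g 2 / (2 * t) + g 3 / (2 * t)) • 1 := by
    rw [h21, h23, h32] at hm2
    linear_combination (norm := skip) (-(2 * Complex.I * t)⁻¹) • hm2
    simp only [one_mul, mul_one]
    match_scalars <;> field_simp <;> ring
  have h10' : N 1 0 * N 0 1 =
      N 3 0 * N 0 1 + N 3 0 - (g 1 / (2 * t) + g 2 / (2 * t) + g 3 / (2 * t)) • 1 := by
    rw [h21, h12] at hm1
    linear_combination (norm := skip) (-(2 * Complex.I * t)⁻¹) • hm1
    simp only [one_mul, mul_one]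
    match_scalars <;> field_simp <;> ring
  have h10 : N 1 0 = N 3 0 + N 3 0 * (N 0 1)⁻¹ -
      (g 1 / (2 * t) + g 2 / (2 * t) + g 3 / (2 * t)) • (N 0 1)⁻¹ := by
    have := congrArg (· * (N 0 1)⁻¹) h10'
    simp only [mul_assoc, add_mul, sub_mul, hr2, mul_one, smul_mul_assoc, one_mul] at this
    exact this
  rw [secV, ha, add_sub_cancel_right]
  refine Matrix.ext fun i j => ?_
  fin_cases i <;> fin_cases j
  · exact (ev 0 0 rfl).symm
  · rfl
  · exact (ev 0 2 rfl).symm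
  · exact h03.symm
  · exact h10.symm
  · exact (ev 1 1 rfl).symm
  · exact h12.symm
  · exact (ev 1 3 rfl).symm
  · exact (ev 2 0 rfl).symm
  · exact h21.symm
  · exact (ev 2 2 rfl).symm
  · exact h23.symm
  · rfl
  · exact (ev 3 1 rfl).symm
  · exact h32.symm
  · exact (ev 3 3 rfl).symm

theorem secV_mem_momentLevel {t : ℂ} (ht : t ≠ 0) (g : Fin 4 → ℂ) {y : Phase (Fin n)}
    (hy : IsUnit (y.2 - 1)) : ofBlk (fixBlkV t (secV g t y)) ∈ momentLevel g := by
  have hr1 := nonsing_inv_mul _ ((isUnit_iff_isUnit_det _).1 hy)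
  obtain ⟨k1, k2, k3⟩ := moment_fixBlkV t (secV g t y)
  intro i hi
  fin_cases i
  · exact absurd rfl hi
  · refine k1.trans ?_
    simp only [secV, offV, Matrix.of_apply, Matrix.cons_val, Matrix.cons_val_zero,
      Matrix.cons_val_one, add_mul, sub_mul, mul_assoc, smul_mul_assoc, hr1, mul_one, Fin.mk_one]
    match_scalars <;> field_simp <;> ring
  · refine k2.trans ?_
    simp only [secV, offV, Matrix.of_apply, Matrix.cons_val, Matrix.cons_val_zero,
      Matrix.cons_val_one, add_mul, sub_mul, mul_assoc, smul_mul_assoc, hr1, mul_one, one_mul,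
      Fin.reduceFinMk]
    match_scalars <;> field_simp <;> ring
  · refine k3.trans ?_
    simp only [secV, offV, Matrix.of_apply, Matrix.cons_val, Matrix.cons_val_zero,
      Matrix.cons_val_one, add_mul, sub_mul, mul_add, mul_assoc, smul_mul_assoc, hr1, mul_one,
      one_mul, Fin.reduceFinMk]
    match_scalars <;> field_simp <;> ring

theorem rotParam_four_eq {α : Fin 4 → ℂ} (h : α 0 + α 1 + α 2 + α 3 = 1) (hs : rotParam α = α)
    (i : Fin 4) : α i = 1 / 4 := by
  have h0 : α 1 = α 0 := congrFun hs 0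
  have h1 : α 2 = α 1 := congrFun hs 1
  have h2 : α 3 = α 2 := congrFun hs 2
  rw [h2, h1, h0] at h
  have h3 : α 0 = 1 / 4 := by linear_combination h / 4
  fin_cases i
  exacts [h3, h0.trans h3, (h1.trans h0).trans h3, ((h2.trans h1).trans h0).trans h3]

theorem slice_V {D : Set ℂ} (hD : IsOpen D) (α g : Fin 4 → ℂ)
    (hα : α 0 + α 1 + α 2 + α 3 = 1) (hs : rotParam α = α) (h0 : 0 ∉ D) :
    Slice (n := n) D (hamV α) Set.univ backVpi g genV
      (hamV ![1 + Complex.I * g 1, Complex.I * g 2 + Complex.I * g 3, -(Complex.I * g 3),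
        -(Complex.I * g 1) - Complex.I * g 2]) {y | IsUnit (y.2 - 1)}
      (fun t => -2 * Complex.I * t) (mapV (g 3)) 0 nrmV
      fun t y => ofBlk (fixBlkV t (secV g t y)) := by
  have hα4 := rotParam_four_eq hα hs
  have hne : ∀ t ∈ D, t ≠ 0 := fun t ht h => h0 (h ▸ ht)
  have hds (t : ℂ) : HasDerivAt (fun t => -2 * Complex.I * t) (-2 * Complex.I) t := by
    simpa using (hasDerivAt_id t).const_mul (-2 * Complex.I)
  exact
  { isOpen_time := hD
    isOpen_gen := isOpen_genV
    dense_gen := fun t ht x hx => dense_genV (hne t ht) hx.1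
    comm_w := fun t ht x _ => comm_backVpi (hne t ht) x
    conj_reg := fun _ _ _ => trivial
    conj_w := fun t _ u x _ => backVpi_conjP t u x
    gauge_gen := fun h x hx => gauge_genV x h hx
    η_diff := by
      have h (i j : Fin 4) : DifferentiableOn ℂ (fun x : Phase (Fin n × Fin 4) => blk x.2 i j)
          genV := ((differentiable_blk i j).comp differentiable_snd).differentiableOn
      have h1 := (((h 0 3).mul (differentiableOn_blk_inv fun x hx => hx.2.2.1)).mul (h 2 1)).sub
        (h 0 1)
      have h2 := h1.mul (differentiableOn_blk_inv (i := 2) (j := 1) fun x hx => hx.2.1)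
      refine differentiableOn_pi.2 fun i => ?_
      fin_cases i
      exacts [differentiableOn_const _, h1, h2, h2.mul (h 2 3)]
    η_zero := fun x => rfl
    η_unit := fun x hx i => isUnit_nrmV hx i
    η_gauge := fun x _ h h0 i => nrmV_gauge x h h0 i
    Φ_gauge := fun t _ x _ h h0 => by rw [mapV, redV_gauge t x h h0, mapV]
    slice_eq := fun t ht x hx h => by
      obtain ⟨h1, h2⟩ := secV_mapV (hne t ht) hx.1.1 hx.1.2 hx.2 h
      refine ⟨h1, ?_⟩
      rw [h2]
      exact ((backVpi_fixedSet (hne t ht) x).1 hx.1.1).1.symm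
    section_mem := fun t ht y hy =>
      ⟨⟨⟨fixBlkV_mem (hne t ht) (twV_secV g t y), secV_mem_momentLevel (hne t ht) g hy⟩,
        secV_mem_genV g hy⟩, mapV_ofBlk (hne t ht) g hy⟩
    isOpen_image := isOpen_isUnit_comp (continuous_snd.sub continuous_const)
    dense_image := by
      simp only [sub_eq_add_neg]
      exact dense_isUnit_affine (LinearMap.snd ℂ _ _) (-1) (u := (0, 1)) rfl
    conj_image := fun u y hy => by
      have : (conjP u y).2 - 1 = conjAlg u (y.2 - 1) := by simp
      show IsUnit _
      rw [this]
      exact isUnit_conjAlg hy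
    holo_time := fun t _ => (hds t).differentiableAt.differentiableWithinAt
    deriv_time := fun t _ => by rw [(hds t).deriv]; simp
    holo_conj := differentiableOn_const 0
    holo := by
      have hb (i j : Fin 4) : DifferentiableOn ℂ
          (fun z : ℂ × Phase (Fin n × Fin 4) => blk z.2.2 i j) (D ×ˢ genV) :=
        ((differentiable_blk i j).comp
          (differentiable_snd.comp differentiable_snd)).differentiableOn
      have h1 : DifferentiableOn ℂ (fun z : ℂ × Phase (Fin n × Fin 4) => (blk z.2.2 0 1)⁻¹)
        (D ×ˢ genV) := (differentiableOn_blk_inv fun x hx => hx.1).comp differentiableOn_snd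
          Set.mapsTo_snd_prod
      have h2 : DifferentiableOn ℂ (fun z : ℂ × Phase (Fin n × Fin 4) => (blk z.2.2 2 1)⁻¹)
        (D ×ˢ genV) := (differentiableOn_blk_inv fun x hx => hx.2.1).comp differentiableOn_snd
          Set.mapsTo_snd_prod
      have h3 : DifferentiableOn ℂ (fun z : ℂ × Phase (Fin n × Fin 4) => (blk z.2.2 2 3)⁻¹)
        (D ×ˢ genV) := (differentiableOn_blk_inv fun x hx => hx.2.2.1).comp differentiableOn_snd
          Set.mapsTo_snd_prod
      have h4 : DifferentiableOn ℂ (fun z : ℂ × Phase (Fin n × Fin 4) =>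
          (blk z.2.2 0 3 * (blk z.2.2 2 3)⁻¹ * blk z.2.2 2 1 * (blk z.2.2 0 1)⁻¹ - 1)⁻¹)
          (D ×ˢ genV) := fun z hz =>
        (differentiableAt_matrix_inv hz.2.2.2.2).comp_differentiableWithinAt z
          ((((((hb 0 3).mul h3).mul (hb 2 1)).mul h1).sub_const 1) z hz)
      have hb01 := hb 0 1
      have hb21 := hb 2 1
      have hb23 := hb 2 3
      have hb03 := hb 0 3
      have hb30 := hb 3 0
      simp only [mapV, redV]
      fun_prop
    holo_section := by
      have ht : DifferentiableOn ℂ (fun z : ℂ × Phase (Fin n) => (2 * z.1)⁻¹)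
          (D ×ˢ {y : Phase (Fin n) | IsUnit (y.2 - 1)}) := fun z hz =>
        ((differentiableAt_inv (mul_ne_zero two_ne_zero (hne _ hz.1))).comp z
          (by fun_prop)).differentiableWithinAt
      have hr : DifferentiableOn ℂ (fun z : ℂ × Phase (Fin n) => (z.2.2 - 1)⁻¹)
          (D ×ˢ {y : Phase (Fin n) | IsUnit (y.2 - 1)}) := fun z hz =>
        ((differentiableAt_matrix_inv hz.2).comp z (f := fun z : ℂ × Phase (Fin n) => z.2.2 - 1)
          (by fun_prop)).differentiableWithinAt
      have ha : DifferentiableOn ℂ (fun z : ℂ × Phase (Fin n) => aV g z.1 z.2)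
          (D ×ˢ {y : Phase (Fin n) | IsUnit (y.2 - 1)}) := by
        simp only [aV, div_eq_mul_inv]
        fun_prop
      have hN (i j : Fin 4) : DifferentiableOn ℂ (fun z : ℂ × Phase (Fin n) => secV g z.1 z.2 i j)
          (D ×ˢ {y : Phase (Fin n) | IsUnit (y.2 - 1)}) := by
        fin_cases i <;> fin_cases j <;>
          simp only [secV, offV, div_eq_mul_inv, Matrix.of_apply, Matrix.cons_val,
            Matrix.cons_val_zero, Matrix.cons_val_one, Fin.zero_eta, Fin.mk_one,
            Fin.reduceFinMk] <;>
          fun_prop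
      refine differentiableOn_ofBlk (fun i j => ?_) fun i j => ?_
      · have := hN i j
        simp only [fixBlkV, Matrix.sub_apply, Matrix.neg_apply, Matrix.smul_apply, twV_apply]
        fun_prop
      · exact (hN i j).add_const _
    sympl_section := fun t ht y hy u u' => by
      have h1 := hasDerivAt_ofBlk_secV g (hne t ht) 0 hy u
      have h2 := hasDerivAt_ofBlk_secV g (hne t ht) 0 hy u'
      simp only [mul_zero, add_zero] at h1 h2
      exact ⟨_, _, h1, h2, sympl_dsecV g (hne t ht) hy u u'⟩
    conj_ham := conjInvariant_hamV α
    conj_ham' := conjInvariant_hamV _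
    ham := fun t ht y hy => by
      have hU := (isUnit_iff_isUnit_det _).1 hy
      have hr1 := mul_nonsing_inv _ hU
      have hr2 := nonsing_inv_mul _ hU
      have ht0 := hne t ht
      have h := hasDerivAt_ofBlk_secV g ht0 1 hy ((-2 * Complex.I) •
        vecV ![1 + Complex.I * g 1, Complex.I * g 2 + Complex.I * g 3, -(Complex.I * g 3),
        -(Complex.I * g 1) - Complex.I * g 2] (-2 * Complex.I * t) y)
      obtain ⟨k1, k2⟩ := vecV_target (g 1) (g 2) (g 3) ht0 y.1 (y.2 - 1) (y.2 - 1)⁻¹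
        (fun i => g i / (2 * t)) hr1 hr2 rfl rfl rfl _ (aV g t y) rfl rfl
      simp only [sub_add_cancel, Prod.mk.eta] at k1 k2
      rw [show t⁻¹ = 1 / t from inv_eq_one_div t] at k2
      -- The equations of the target field are the hypotheses on X' and a', so all entries of the
      -- velocity of the section are known.
      have k3 := doffV_eq (fun i => g i / (2 * t)) (2 * t)⁻¹ (aV g t y) (y.2 - 1) (y.2 - 1)⁻¹ _ _
        hr1 hr2 k1 k2
      rw [← fixVecV_offV _ _ _ _ _ hr2] at k3
      rw [show (2 * (2 * t)⁻¹ : ℂ) = 1 / t by field_simp] at k3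
      rw [dsecV, k3] at h
      replace h := h.congr_deriv (congrArg ofBlk (dfixBlkV_add_gauge t (secV g t y)
        (fixVecV t (secV g t y)) _))
      rw [← vecV_fixBlkV α hα4 ht0 _ (twV_secV g t y), ofBlk_add, ← infGauge_ofBlk,
        ← vecV_ofBlk] at h
      have h0 : deriv (0 : ℂ → ℂ) t = 0 := deriv_const t 0
      simp only [mul_one] at h
      refine ⟨_, _, ?ξ, ?h0, isHamVec_hamV _ _ _, isHamVec_hamV _ _ _, ?hder⟩
      case hder =>
        rw [(hds t).deriv, h0, zero_smul, sub_zero]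
        exact h
      case h0 => rfl }

theorem isBlockReduction_V {D : Set ℂ} (hD : IsOpen D) (α g : Fin 4 → ℂ)
    (hα : α 0 + α 1 + α 2 + α 3 = 1) (hs : rotParam α = α) (h0 : 0 ∉ D) :
    IsBlockReduction (n := n) D (hamV α) Set.univ backVpi g genV
      (hamV ![1 + Complex.I * g 1, Complex.I * g 2 + Complex.I * g 3, -(Complex.I * g 3),
        -(Complex.I * g 1) - Complex.I * g 2]) {y | IsUnit (y.2 - 1)}
      (fun t => -2 * Complex.I * t) (mapV (g 3)) := (slice_V hD α g hα hs h0).isBlockReduction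

end V


/-! ### The slice `q₂₁ = 1` of the non-linear reductions: algebra -/

section NL

variable {R : Type*} [Ring R] [Algebra ℂ R]

/-- The blocks of a point of the slice, conjugated by a shear. -/
def shBlk (t g : ℂ) (P C a : R) : Matrix (Fin 2) (Fin 2) R × Matrix (Fin 2) (Fin 2) R :=
  (!![(1 / 2 : ℂ) • P, -(t • C) - (Complex.I * g) • 1; C, (1 / 2 : ℂ) • P - (2 : ℂ) • (C * a)],
    !![(2 : ℂ) • a, -(t • 1); 1, 0])

/-- The derivative of `shBlk`. -/
def dshBlk (t : ℂ) (C a P' C' a' : R) : Matrix (Fin 2) (Fin 2) R × Matrix (Fin 2) (Fin 2) R :=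
  (!![(1 / 2 : ℂ) • P', -(C + t • C'); C', (1 / 2 : ℂ) • P' - (2 : ℂ) • (C' * a + C * a')],
    !![(2 : ℂ) • a', -1; 0, 0])

/-- The gauge direction, conjugated by the shear. -/
def shGauge (v : Matrix (Fin 2) (Fin 2) R × Matrix (Fin 2) (Fin 2) R) : Matrix (Fin 2) (Fin 2) R :=
  !![0, v.2 1 1; 0, -v.2 1 0]

set_option maxHeartbeats 4000000 in
-- In the sheared frame q is a companion matrix, and `shGauge` restores its second row (1, 0). The
-- hypothesis `hC` is the relation between p₂₁ and (P, a) that defines the slice. The velocities of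
-- P, C and a are read off three entries, and the identity says that the other entries agree.
theorem vecVI_shBlk (α : Fin 5 → ℂ) (h3 : α 3 = α 0) (h4 : α 4 = α 1)
    (h0 : α 0 = 1 / 2 - α 1 - α 2) (g : ℂ) {t : ℂ}
    (ht : t ≠ 0) (ht1 : t - 1 ≠ 0) (P C a : R)
    (hC : P * a = (2 * t) • C + (Complex.I * g - α 2) • 1)
    (v : Matrix (Fin 2) (Fin 2) R × Matrix (Fin 2) (Fin 2) R)
    (hv : v = vecVI α t (shBlk t g P C a)) (P' C' a' : R)
    (hP' : P' = (2 : ℂ) • (v.1 0 0 + v.2 1 1 * C)) (hC' : C' = v.1 1 0 - v.2 1 0 * C)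
    (ha' : a' = v.2 1 1 + a * v.2 1 0) :
    dshBlk t C a P' C' a' = (v.1 + (shGauge v * (shBlk t g P C a).1 -
        (shBlk t g P C a).1 * shGauge v), v.2 + (shGauge v * (shBlk t g P C a).2 -
        (shBlk t g P C a).2 * shGauge v)) := by
  -- The relation used as a rewriting rule inside right-associated words; it eliminates P followed
  -- by a.
  have hC2 (z : R) : P * (a * z) = (2 * t) • (C * z) + (Complex.I * g - α 2) • z := by
    rw [← mul_assoc, hC, add_mul, smul_mul_assoc, smul_mul_assoc, one_mul]
  subst hv
  refine Prod.ext (Matrix.ext fun i j => ?_) (Matrix.ext fun i j => ?_)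
  all_goals fin_cases i <;> fin_cases j
  all_goals
    simp only [dshBlk, hP', hC', ha']
    simp only [vecVI, shGauge, Matrix.mul_apply, Fin.sum_univ_two, Prod.fst_add, Prod.snd_add,
      Matrix.add_apply, Matrix.sub_apply, Matrix.neg_apply, Matrix.smul_apply,
      Matrix.one_apply, Matrix.of_apply, Fin.zero_eta, Fin.mk_one, Fin.reduceFinMk,
      Matrix.cons_val]
    generalize hk : (t * (t - 1))⁻¹ = k
    simp only [shBlk, h3, h4, h0, Matrix.of_apply, Matrix.cons_val, Matrix.cons_val_zero,
      Matrix.cons_val_one, Fin.isValue, Fin.reduceEq, if_true, if_false, reduceIte, zero_ne_one,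
      one_ne_zero, mul_zero, zero_mul, add_zero, zero_add, smul_zero, sub_zero, mul_one, one_mul]
    simp only [mul_add, add_mul, mul_sub, sub_mul, smul_sub, smul_add, smul_smul, mul_assoc,
      smul_mul_assoc, mul_smul_comm, mul_neg, neg_mul, mul_one, one_mul, mul_zero, zero_mul,
      smul_zero, smul_neg, hC, hC2]
    match_scalars <;> first | ring1 | (rw [← hk]; field_simp; ring1)

end NL


/-! ### PVI: comparison with the target field, and the linearized slice relation -/

section NL

variable {R : Type*} [Ring R] [Algebra ℂ R]

set_option maxHeartbeats 4000000 in
-- Here r = √t. The field of the target enters with the factor s', and `adComm` with minus the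
-- derivative of ℓ/2. The terms ±1/(2r²) come from the time dependence of the rescaling by r.
theorem vecVI_target (α : Fin 5 → ℂ) (h3 : α 3 = α 0) (h4 : α 4 = α 1)
    (h0 : α 0 = 1 / 2 - α 1 - α 2) (g : ℂ) {r : ℂ}
    (hr : r ≠ 0) (hr1 : r ^ 2 - 1 ≠ 0) (P C a : R)
    (hC : P * a = (2 * r ^ 2) • C + (Complex.I * g - α 2) • 1)
    (v : Matrix (Fin 2) (Fin 2) R × Matrix (Fin 2) (Fin 2) R)
    (hv : v = vecVI α (r ^ 2) (shBlk (r ^ 2) g P C a)) (y u : R × R)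
    (hy : y = ((2 * r) • P, (1 / 2 : ℂ) • (r⁻¹ • a + 1)))
    (hu : u = ((r - r⁻¹) / (8 * r ^ 2)) • vecVI ![2 * α 0, 2 * α 1, α 2 - Complex.I * g,
      Complex.I * g, Complex.I * g] (1 / 2 + (r + r⁻¹) / 4) y - (2 * r ^ 2)⁻¹ • adComm y) :
    (2 : ℂ) • (v.1 0 0 + v.2 1 1 * C) = (2 * r)⁻¹ • u.1 - (2 * r ^ 2)⁻¹ • P ∧
    v.2 1 1 + a * v.2 1 0 = (2 * r) • u.2 + (2 * r ^ 2)⁻¹ • a := by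
  have hC2 (z : R) : P * (a * z) = (2 * r ^ 2) • (C * z) + (Complex.I * g - α 2) • z := by
    rw [← mul_assoc, hC, add_mul, smul_mul_assoc, smul_mul_assoc, one_mul]
  -- For s = 1/2 + (r + r⁻¹)/4 one has s(s - 1) = (r - r⁻¹)²/16.
  have hs : ((1 / 2 + (r + r⁻¹) / 4) * (1 / 2 + (r + r⁻¹) / 4 - 1))⁻¹ =
      16 * r ^ 2 / (r ^ 2 - 1) ^ 2 := by
    rw [inv_eq_iff_eq_inv, inv_div]
    field_simp
    ring
  subst hv
  constructor
  all_goals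
    simp only [hu, vecVI, adComm, hy, hs, Prod.fst_sub, Prod.snd_sub, Prod.smul_fst, Prod.smul_snd,
      Matrix.mul_apply, Fin.sum_univ_two, Prod.fst_add, Prod.snd_add,
      Matrix.add_apply, Matrix.sub_apply, Matrix.neg_apply, Matrix.smul_apply,
      Matrix.one_apply, Matrix.of_apply, Fin.zero_eta, Fin.mk_one, Fin.reduceFinMk,
      Matrix.cons_val]
    simp only [shBlk, h3, h4, h0, Matrix.of_apply, Matrix.cons_val, Matrix.cons_val_zero,
      Matrix.cons_val_one, Fin.isValue, Fin.reduceEq, if_true, if_false, reduceIte, zero_ne_one,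
      one_ne_zero, mul_zero, zero_mul, add_zero, zero_add, smul_zero, sub_zero, mul_one, one_mul]
    simp only [mul_add, add_mul, mul_sub, sub_mul, smul_sub, smul_add, smul_smul, mul_assoc,
      smul_mul_assoc, mul_smul_comm, mul_neg, neg_mul, mul_one, one_mul, mul_zero, zero_mul,
      smul_zero, smul_neg, hC, hC2]
    match_scalars <;> field_simp <;> ring_nf

set_option maxHeartbeats 4000000 in
-- The velocities satisfy the derivative of the relation `hC`, so the velocity of p₂₁ is the one
-- induced by those of P and a. The term 2C is the explicit derivative of 2t.
theorem vecVI_relation (α : Fin 5 → ℂ) (h3 : α 3 = α 0) (h4 : α 4 = α 1)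
    (h0 : α 0 = 1 / 2 - α 1 - α 2) (g : ℂ) {t : ℂ}
    (ht : t ≠ 0) (ht1 : t - 1 ≠ 0) (P C a : R)
    (hC : P * a = (2 * t) • C + (Complex.I * g - α 2) • 1)
    (v : Matrix (Fin 2) (Fin 2) R × Matrix (Fin 2) (Fin 2) R)
    (hv : v = vecVI α t (shBlk t g P C a)) :
    (2 : ℂ) • (v.1 0 0 + v.2 1 1 * C) * a + P * (v.2 1 1 + a * v.2 1 0) =
      (2 : ℂ) • C + (2 * t) • (v.1 1 0 - v.2 1 0 * C) := by
  have hC2 (z : R) : P * (a * z) = (2 * t) • (C * z) + (Complex.I * g - α 2) • z := by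
    rw [← mul_assoc, hC, add_mul, smul_mul_assoc, smul_mul_assoc, one_mul]
  subst hv
  simp only [vecVI, shGauge, Matrix.mul_apply, Fin.sum_univ_two, Prod.fst_add, Prod.snd_add,
      Matrix.add_apply, Matrix.sub_apply, Matrix.neg_apply, Matrix.smul_apply,
      Matrix.one_apply, Matrix.of_apply, Fin.zero_eta, Fin.mk_one, Fin.reduceFinMk,
      Matrix.cons_val]
  simp only [shBlk, h3, h4, h0, Matrix.of_apply, Matrix.cons_val, Matrix.cons_val_zero,
      Matrix.cons_val_one, Fin.isValue, Fin.reduceEq, if_true, if_false, reduceIte, zero_ne_one,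
      one_ne_zero, mul_zero, zero_mul, add_zero, zero_add, smul_zero, sub_zero, mul_one, one_mul]
  simp only [mul_add, add_mul, mul_sub, sub_mul, smul_sub, smul_add, smul_smul, mul_assoc,
      smul_mul_assoc, mul_smul_comm, mul_neg, neg_mul, mul_one, one_mul, mul_zero, zero_mul,
      smul_zero, smul_neg, hC, hC2]
  match_scalars <;> field_simp <;> ring_nf

end NL


/-! ### PIII(D₆): the same identities on the sheared slice -/

section NL

variable {R : Type*} [Ring R] [Algebra ℂ R]

set_option maxHeartbeats 4000000 in
theorem vecIIID6_shBlk (α β : Fin 2 → ℂ) (h1 : β 1 = 1 / 2) (g : ℂ) {t : ℂ}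
    (ht : t ≠ 0) (P C a : R)
    (hC : P * a = (2 * t) • C + (Complex.I * g - α 1) • 1)
    (v : Matrix (Fin 2) (Fin 2) R × Matrix (Fin 2) (Fin 2) R)
    (hv : v = vecIIID6 α β t (shBlk t g P C a)) (P' C' a' : R)
    (hP' : P' = (2 : ℂ) • (v.1 0 0 + v.2 1 1 * C)) (hC' : C' = v.1 1 0 - v.2 1 0 * C)
    (ha' : a' = v.2 1 1 + a * v.2 1 0) :
    dshBlk t C a P' C' a' = (v.1 + (shGauge v * (shBlk t g P C a).1 -
        (shBlk t g P C a).1 * shGauge v), v.2 + (shGauge v * (shBlk t g P C a).2 -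
        (shBlk t g P C a).2 * shGauge v)) := by
  have hC2 (z : R) : P * (a * z) = (2 * t) • (C * z) + (Complex.I * g - α 1) • z := by
    rw [← mul_assoc, hC, add_mul, smul_mul_assoc, smul_mul_assoc, one_mul]
  subst hv
  refine Prod.ext (Matrix.ext fun i j => ?_) (Matrix.ext fun i j => ?_)
  all_goals fin_cases i <;> fin_cases j
  all_goals
    simp only [dshBlk, hP', hC', ha']
    simp only [vecIIID6, shGauge, Matrix.mul_apply, Fin.sum_univ_two, Prod.fst_add, Prod.snd_add,
      Prod.fst_sub, Prod.snd_sub, Prod.smul_fst, Prod.smul_snd,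
      Matrix.add_apply, Matrix.sub_apply, Matrix.neg_apply, Matrix.smul_apply,
      Matrix.one_apply, Matrix.of_apply, Fin.zero_eta, Fin.mk_one, Fin.reduceFinMk,
      Matrix.cons_val]
    simp only [shBlk, h1, Matrix.of_apply, Matrix.cons_val, Matrix.cons_val_zero,
      Matrix.cons_val_one, Fin.isValue, Fin.reduceEq, if_true, if_false, reduceIte, zero_ne_one,
      one_ne_zero, mul_zero, zero_mul, add_zero, zero_add, smul_zero, sub_zero, mul_one, one_mul]
    simp only [mul_add, add_mul, mul_sub, sub_mul, smul_sub, smul_add, smul_smul, mul_assoc,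
      smul_mul_assoc, mul_smul_comm, mul_neg, neg_mul, mul_one, one_mul, mul_zero, zero_mul,
      smul_zero, smul_neg, neg_neg, hC, hC2]
    try (match_scalars <;> field_simp <;> ring_nf)

set_option maxHeartbeats 4000000 in
theorem vecIIID6_relation (α β : Fin 2 → ℂ) (h1 : β 1 = 1 / 2) (g : ℂ) {t : ℂ}
    (ht : t ≠ 0) (P C a : R)
    (hC : P * a = (2 * t) • C + (Complex.I * g - α 1) • 1)
    (v : Matrix (Fin 2) (Fin 2) R × Matrix (Fin 2) (Fin 2) R)
    (hv : v = vecIIID6 α β t (shBlk t g P C a)) :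
    (2 : ℂ) • (v.1 0 0 + v.2 1 1 * C) * a + P * (v.2 1 1 + a * v.2 1 0) =
      (2 : ℂ) • C + (2 * t) • (v.1 1 0 - v.2 1 0 * C) := by
  have hC2 (z : R) : P * (a * z) = (2 * t) • (C * z) + (Complex.I * g - α 1) • z := by
    rw [← mul_assoc, hC, add_mul, smul_mul_assoc, smul_mul_assoc, one_mul]
  subst hv
  all_goals
    simp only [vecIIID6, Matrix.mul_apply, Fin.sum_univ_two, Prod.fst_add, Prod.snd_add,
      Prod.fst_sub, Prod.snd_sub, Prod.smul_fst, Prod.smul_snd,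
      Matrix.add_apply, Matrix.sub_apply, Matrix.neg_apply, Matrix.smul_apply,
      Matrix.one_apply, Matrix.of_apply, Fin.zero_eta, Fin.mk_one, Fin.reduceFinMk,
      Matrix.cons_val]
    simp only [shBlk, h1, Matrix.of_apply, Matrix.cons_val, Matrix.cons_val_zero,
      Matrix.cons_val_one, Fin.isValue, Fin.reduceEq, if_true, if_false, reduceIte, zero_ne_one,
      one_ne_zero, mul_zero, zero_mul, add_zero, zero_add, smul_zero, sub_zero, mul_one, one_mul]
    simp only [mul_add, add_mul, mul_sub, sub_mul, smul_sub, smul_add, smul_smul, mul_assoc,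
      smul_mul_assoc, mul_smul_comm, mul_neg, neg_mul, mul_one, one_mul, mul_zero, zero_mul,
      smul_zero, smul_neg, neg_neg, hC, hC2]
    match_scalars <;> field_simp <;> ring_nf

set_option maxHeartbeats 4000000 in
-- The factor -4/r is the derivative of s = -8√t. The sign of `adComm` is opposite to the PVI case,
-- in accordance with c = -ℓ/2.
theorem vecIIID6_target (α β : Fin 2 → ℂ) (h1 : β 1 = 1 / 2) (g : ℂ) {r : ℂ}
    (hr : r ≠ 0) (P C a : R)
    (hC : P * a = (2 * r ^ 2) • C + (Complex.I * g - α 1) • 1)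
    (v : Matrix (Fin 2) (Fin 2) R × Matrix (Fin 2) (Fin 2) R)
    (hv : v = vecIIID6 α β (r ^ 2) (shBlk (r ^ 2) g P C a)) (y u : R × R)
    (hy : y = ((2 * r) • P, (1 / 2 : ℂ) • (r⁻¹ • a + 1)))
    (hu : u = (-4 / r) • vecV ![1 - Complex.I * g - α 1, Complex.I * g, α 1 - Complex.I * g,
      Complex.I * g] (-8 * r) y + (2 * r ^ 2)⁻¹ • adComm y) :
    (2 : ℂ) • (v.1 0 0 + v.2 1 1 * C) = (2 * r)⁻¹ • u.1 - (2 * r ^ 2)⁻¹ • P ∧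
    v.2 1 1 + a * v.2 1 0 = (2 * r) • u.2 + (2 * r ^ 2)⁻¹ • a := by
  have hC2 (z : R) : P * (a * z) = (2 * r ^ 2) • (C * z) + (Complex.I * g - α 1) • z := by
    rw [← mul_assoc, hC, add_mul, smul_mul_assoc, smul_mul_assoc, one_mul]
  subst hv
  constructor
  all_goals
    simp only [hu, vecIIID6, vecV, adComm, hy, Matrix.mul_apply, Fin.sum_univ_two, Prod.fst_add, Prod.snd_add,
      Prod.fst_sub, Prod.snd_sub, Prod.smul_fst, Prod.smul_snd,
      Matrix.add_apply, Matrix.sub_apply, Matrix.neg_apply, Matrix.smul_apply,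
      Matrix.one_apply, Matrix.of_apply, Fin.zero_eta, Fin.mk_one, Fin.reduceFinMk,
      Matrix.cons_val]
    simp only [shBlk, h1, Matrix.of_apply, Matrix.cons_val, Matrix.cons_val_zero,
      Matrix.cons_val_one, Fin.isValue, Fin.reduceEq, if_true, if_false, reduceIte, zero_ne_one,
      one_ne_zero, mul_zero, zero_mul, add_zero, zero_add, smul_zero, sub_zero, mul_one, one_mul]
    simp only [mul_add, add_mul, mul_sub, sub_mul, smul_sub, smul_add, smul_smul, mul_assoc,
      smul_mul_assoc, mul_smul_comm, mul_neg, neg_mul, mul_one, one_mul, mul_zero, zero_mul,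
      smul_zero, smul_neg, neg_neg, hC, hC2]
    match_scalars <;> field_simp <;> ring_nf

end NL


/-! ### PIII(D₈): the same identities, with the inverse of the companion matrix -/

section NL

variable {R : Type*} [Ring R] [Algebra ℂ R]

/-- The inverse of the second component of `shBlk`. -/
def shInv (t : ℂ) (a : R) : Matrix (Fin 2) (Fin 2) R :=
  !![0, 1; -(t⁻¹ • 1), (2 / t) • a]

set_option maxHeartbeats 4000000 in
theorem vecIIID8_shBlk (g : ℂ) {t : ℂ}
    (ht : t ≠ 0) (P C a : R)
    (hC : P * a = (2 * t) • C + (Complex.I * g - 1 / 2) • 1)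
    (v : Matrix (Fin 2) (Fin 2) R × Matrix (Fin 2) (Fin 2) R)
    (hv : v = vecIIID8 t (shBlk t g P C a) (shInv t a)) (P' C' a' : R)
    (hP' : P' = (2 : ℂ) • (v.1 0 0 + v.2 1 1 * C)) (hC' : C' = v.1 1 0 - v.2 1 0 * C)
    (ha' : a' = v.2 1 1 + a * v.2 1 0) :
    dshBlk t C a P' C' a' = (v.1 + (shGauge v * (shBlk t g P C a).1 -
        (shBlk t g P C a).1 * shGauge v), v.2 + (shGauge v * (shBlk t g P C a).2 -
        (shBlk t g P C a).2 * shGauge v)) := by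
  have hC2 (z : R) : P * (a * z) = (2 * t) • (C * z) + (Complex.I * g - 1 / 2) • z := by
    rw [← mul_assoc, hC, add_mul, smul_mul_assoc, smul_mul_assoc, one_mul]
  subst hv
  refine Prod.ext (Matrix.ext fun i j => ?_) (Matrix.ext fun i j => ?_)
  all_goals fin_cases i <;> fin_cases j
  all_goals
    simp only [dshBlk, hP', hC', ha']
    simp only [vecIIID8, shGauge, Matrix.mul_apply, Fin.sum_univ_two, Prod.fst_add, Prod.snd_add,
      Prod.fst_sub, Prod.snd_sub, Prod.smul_fst, Prod.smul_snd,
      Matrix.add_apply, Matrix.sub_apply, Matrix.neg_apply, Matrix.smul_apply,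
      Matrix.one_apply, Matrix.of_apply, Fin.zero_eta, Fin.mk_one, Fin.reduceFinMk,
      Matrix.cons_val]
    simp only [shBlk, shInv, Matrix.of_apply, Matrix.cons_val, Matrix.cons_val_zero,
      Matrix.cons_val_one, Fin.isValue, Fin.reduceEq, if_true, if_false, reduceIte, zero_ne_one,
      one_ne_zero, mul_zero, zero_mul, add_zero, zero_add, smul_zero, sub_zero, mul_one, one_mul]
    simp only [mul_add, add_mul, mul_sub, sub_mul, smul_sub, smul_add, smul_smul, mul_assoc,
      smul_mul_assoc, mul_smul_comm, mul_neg, neg_mul, mul_one, one_mul, mul_zero, zero_mul,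
      smul_zero, smul_neg, neg_neg, hC, hC2]
    try (match_scalars <;> field_simp <;> ring_nf)

set_option maxHeartbeats 4000000 in
theorem vecIIID8_relation (g : ℂ) {t : ℂ}
    (ht : t ≠ 0) (P C a : R)
    (hC : P * a = (2 * t) • C + (Complex.I * g - 1 / 2) • 1)
    (v : Matrix (Fin 2) (Fin 2) R × Matrix (Fin 2) (Fin 2) R)
    (hv : v = vecIIID8 t (shBlk t g P C a) (shInv t a)) :
    (2 : ℂ) • (v.1 0 0 + v.2 1 1 * C) * a + P * (v.2 1 1 + a * v.2 1 0) =
      (2 : ℂ) • C + (2 * t) • (v.1 1 0 - v.2 1 0 * C) := by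
  have hC2 (z : R) : P * (a * z) = (2 * t) • (C * z) + (Complex.I * g - 1 / 2) • z := by
    rw [← mul_assoc, hC, add_mul, smul_mul_assoc, smul_mul_assoc, one_mul]
  subst hv
  all_goals
    simp only [vecIIID8, Matrix.mul_apply, Fin.sum_univ_two, Prod.fst_add, Prod.snd_add,
      Prod.fst_sub, Prod.snd_sub, Prod.smul_fst, Prod.smul_snd,
      Matrix.add_apply, Matrix.sub_apply, Matrix.neg_apply, Matrix.smul_apply,
      Matrix.one_apply, Matrix.of_apply, Fin.zero_eta, Fin.mk_one, Fin.reduceFinMk,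
      Matrix.cons_val]
    simp only [shBlk, shInv, Matrix.of_apply, Matrix.cons_val, Matrix.cons_val_zero,
      Matrix.cons_val_one, Fin.isValue, Fin.reduceEq, if_true, if_false, reduceIte, zero_ne_one,
      one_ne_zero, mul_zero, zero_mul, add_zero, zero_add, smul_zero, sub_zero, mul_one, one_mul]
    simp only [mul_add, add_mul, mul_sub, sub_mul, smul_sub, smul_add, smul_smul, mul_assoc,
      smul_mul_assoc, mul_smul_comm, mul_neg, neg_mul, mul_one, one_mul, mul_zero, zero_mul,
      smul_zero, smul_neg, neg_neg, hC, hC2]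
    match_scalars <;> field_simp <;> ring_nf

set_option maxHeartbeats 4000000 in
-- Here the rescaled q₁₁ becomes P and the shifted momentum becomes Q, so the roles of the two
-- target components are exchanged; 8/r is the derivative of s = 16√t.
theorem vecIIID8_target (g : ℂ) {r : ℂ}
    (hr : r ≠ 0) (P C a : R)
    (hC : P * a = (2 * r ^ 2) • C + (Complex.I * g - 1 / 2) • 1)
    (v : Matrix (Fin 2) (Fin 2) R × Matrix (Fin 2) (Fin 2) R)
    (hv : v = vecIIID8 (r ^ 2) (shBlk (r ^ 2) g P C a) (shInv (r ^ 2) a)) (y u : R × R)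
    (hy : y = ((1 / 2 : ℂ) • (1 - r⁻¹ • a), (2 * r) • P))
    (hu : u = (8 / r) • vecIIID6 ![1 - Complex.I * g, Complex.I * g] ![1 - Complex.I * g, Complex.I * g]
      (16 * r) y - (2 * r ^ 2)⁻¹ • adComm y) :
    (2 : ℂ) • (v.1 0 0 + v.2 1 1 * C) = (2 * r)⁻¹ • u.2 - (2 * r ^ 2)⁻¹ • P ∧
    v.2 1 1 + a * v.2 1 0 = (-(2 * r)) • u.1 + (2 * r ^ 2)⁻¹ • a := by
  have hC2 (z : R) : P * (a * z) = (2 * r ^ 2) • (C * z) + (Complex.I * g - 1 / 2) • z := by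
    rw [← mul_assoc, hC, add_mul, smul_mul_assoc, smul_mul_assoc, one_mul]
  subst hv
  constructor
  all_goals
    simp only [hu, vecIIID8, vecIIID6, adComm, hy, Matrix.mul_apply, Fin.sum_univ_two, Prod.fst_add, Prod.snd_add,
      Prod.fst_sub, Prod.snd_sub, Prod.smul_fst, Prod.smul_snd,
      Matrix.add_apply, Matrix.sub_apply, Matrix.neg_apply, Matrix.smul_apply,
      Matrix.one_apply, Matrix.of_apply, Fin.zero_eta, Fin.mk_one, Fin.reduceFinMk,
      Matrix.cons_val]
    simp only [shBlk, shInv, Matrix.of_apply, Matrix.cons_val, Matrix.cons_val_zero,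
      Matrix.cons_val_one, Fin.isValue, Fin.reduceEq, if_true, if_false, reduceIte, zero_ne_one,
      one_ne_zero, mul_zero, zero_mul, add_zero, zero_add, smul_zero, sub_zero, mul_one, one_mul]
    simp only [mul_add, add_mul, mul_sub, sub_mul, smul_sub, smul_add, smul_smul, mul_assoc,
      smul_mul_assoc, mul_smul_comm, mul_neg, neg_mul, mul_one, one_mul, mul_zero, zero_mul,
      smul_zero, smul_neg, neg_neg, hC, hC2]
    match_scalars <;> field_simp <;> ring_nf

end NL


/-! ### The slice `q₂₁ = 1` of the non-linear reductions -/

section NL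

section Algebra

variable {R : Type*} [Ring R] [Algebra ℂ R]

/-- The block `p₂₁` on the slice. -/
def nlC (t g ν : ℂ) (z : R × R) : R :=
  (2 * t)⁻¹ • (z.1 * z.2 + (ν - Complex.I * g) • 1)

/-- The derivative of `nlC`. -/
def dnlC (t τ g ν : ℂ) (z w : R × R) : R :=
  (2 * t)⁻¹ • (w.1 * z.2 + z.1 * w.2) - (τ / t) • nlC t g ν z

theorem mul_eq_nlC {t : ℂ} (ht : t ≠ 0) (g ν : ℂ) (z : R × R) :
    z.1 * z.2 = (2 * t) • nlC t g ν z + (Complex.I * g - ν) • 1 := by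
  rw [nlC, smul_smul, mul_inv_cancel₀ (mul_ne_zero two_ne_zero ht)]
  module

theorem dnlC_eq {t : ℂ} (ht : t ≠ 0) (g ν : ℂ) {z w : R × R} {C' : R}
    (h : w.1 * z.2 + z.1 * w.2 = (2 : ℂ) • nlC t g ν z + (2 * t) • C') :
    dnlC t 1 g ν z w = C' := by
  rw [dnlC, h]
  match_scalars <;> field_simp <;> ring

/-- The blocks of a point of the slice, in terms of `q₁₁ = a` and `z = (P, a)`, where
`2 t p₂₁ = P a - i g + ν`. -/
def nlBlk (t g ν : ℂ) (z : R × R) : Matrix (Fin 2) (Fin 2) R × Matrix (Fin 2) (Fin 2) R :=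
  (!![(1 / 2 : ℂ) • z.1 - z.2 * nlC t g ν z,
      z.2 * nlC t g ν z * z.2 - (1 / 2 : ℂ) • (z.2 * z.1) - ((Complex.I * g + ν) / 2) • 1;
      nlC t g ν z, (1 / 2 : ℂ) • z.1 - nlC t g ν z * z.2],
    !![z.2, z.2 * z.2 - t • 1; 1, z.2])

/-- The derivative of `nlBlk`. -/
def dnlBlk (t τ g ν : ℂ) (z w : R × R) : Matrix (Fin 2) (Fin 2) R × Matrix (Fin 2) (Fin 2) R :=
  (!![(1 / 2 : ℂ) • w.1 - (w.2 * nlC t g ν z + z.2 * dnlC t τ g ν z w),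
      (w.2 * nlC t g ν z + z.2 * dnlC t τ g ν z w) * z.2 + z.2 * nlC t g ν z * w.2
        - (1 / 2 : ℂ) • (w.2 * z.1 + z.2 * w.1);
      dnlC t τ g ν z w,
      (1 / 2 : ℂ) • w.1 - (dnlC t τ g ν z w * z.2 + nlC t g ν z * w.2)],
    !![w.2, w.2 * z.2 + z.2 * w.2 - τ • 1; 0, w.2])

/-- The shear with off-diagonal block `a`. -/
def shUnit (a : R) : (Matrix (Fin 2) (Fin 2) R)ˣ where
  val := !![1, a; 0, 1]
  inv := !![1, -a; 0, 1]
  val_inv := by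
    ext i j; fin_cases i <;> fin_cases j <;> simp [Matrix.mul_apply, Fin.sum_univ_two]
  inv_val := by
    ext i j; fin_cases i <;> fin_cases j <;> simp [Matrix.mul_apply, Fin.sum_univ_two]

/-- The conjugation by a shear. -/
def shear (a : R) : Matrix (Fin 2) (Fin 2) R →ₐ[ℂ] Matrix (Fin 2) (Fin 2) R where
  toFun A := (shUnit a)⁻¹.1 * A * (shUnit a).1
  map_one' := by simp
  map_mul' A B := by simp [mul_assoc]
  map_zero' := by simp
  map_add' A B := by simp [mul_add, add_mul]
  commutes' c := by
    rw [← Algebra.commutes, mul_assoc, Units.inv_mul, mul_one]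

theorem shear_apply (a : R) (A : Matrix (Fin 2) (Fin 2) R) :
    shear a A = !![1, -a; 0, 1] * A * !![1, a; 0, 1] := rfl

/-- The shear by a brings q with the rows (a, a² - t), (1, a) to the companion form with the rows
(2a, -t), (1, 0), where the field is easier to expand. -/
theorem nlBlk_eq_shear {t : ℂ} (ht : t ≠ 0) (g ν : ℂ) (z : R × R) :
    nlBlk t g ν z = (shear z.2 (shBlk t g z.1 (nlC t g ν z) z.2).1,
      shear z.2 (shBlk t g z.1 (nlC t g ν z) z.2).2) := by
  have hC := mul_eq_nlC ht g ν z
  generalize hc : nlC t g ν z = C at hC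
  refine Prod.ext (Matrix.ext fun i j => ?_) (Matrix.ext fun i j => ?_) <;>
    fin_cases i <;> fin_cases j <;>
    simp [shear_apply, Matrix.mul_apply, Fin.sum_univ_two, nlBlk, shBlk, hc, mul_add, add_mul,
      mul_sub, sub_mul, hC, smul_sub, smul_add, smul_smul, mul_assoc] <;> module

/-- The shear moves with a, and the product rule adds the commutator with its nilpotent velocity. -/
theorem dnlBlk_eq_shear {t : ℂ} (ht : t ≠ 0) (g ν : ℂ) {z w : R × R} {C' : R}
    (h : w.1 * z.2 + z.1 * w.2 = (2 : ℂ) • nlC t g ν z + (2 * t) • C') :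
    dnlBlk t 1 g ν z w = (shear z.2 ((dshBlk t (nlC t g ν z) z.2 w.1 C' w.2).1 -
        (!![0, w.2; 0, 0] * (shBlk t g z.1 (nlC t g ν z) z.2).1 -
        (shBlk t g z.1 (nlC t g ν z) z.2).1 * !![0, w.2; 0, 0])),
      shear z.2 ((dshBlk t (nlC t g ν z) z.2 w.1 C' w.2).2 -
        (!![0, w.2; 0, 0] * (shBlk t g z.1 (nlC t g ν z) z.2).2 -
        (shBlk t g z.1 (nlC t g ν z) z.2).2 * !![0, w.2; 0, 0]))) := by
  have hC := mul_eq_nlC ht g ν z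
  have hd := dnlC_eq ht g ν h
  have h' : w.1 * z.2 = (2 : ℂ) • nlC t g ν z + (2 * t) • C' - z.1 * w.2 := by rw [← h]; abel
  generalize hc : nlC t g ν z = C at hC h'
  refine Prod.ext (Matrix.ext fun i j => ?_) (Matrix.ext fun i j => ?_) <;>
    fin_cases i <;> fin_cases j <;>
    simp [shear_apply, Matrix.mul_apply, Fin.sum_univ_two, dnlBlk, dshBlk, shBlk, hc, hd, mul_add,
      add_mul, mul_sub, sub_mul, hC, h', smul_sub, smul_add, smul_smul, mul_assoc] <;> module

/-- The gauge matrix of the sheared frame is not block diagonal, but together with the velocity of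
the shear it becomes diag(0, -v₂₁) after undoing the shear, hence a true gauge direction. -/
theorem dnlBlk_eq {t : ℂ} (ht : t ≠ 0) (g ν : ℂ) {z w : R × R} {C' : R}
    (h : w.1 * z.2 + z.1 * w.2 = (2 : ℂ) • nlC t g ν z + (2 * t) • C')
    {v : Matrix (Fin 2) (Fin 2) R × Matrix (Fin 2) (Fin 2) R}
    (hv : dshBlk t (nlC t g ν z) z.2 w.1 C' w.2 =
      (v.1 + (shGauge v * (shBlk t g z.1 (nlC t g ν z) z.2).1 -
        (shBlk t g z.1 (nlC t g ν z) z.2).1 * shGauge v),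
      v.2 + (shGauge v * (shBlk t g z.1 (nlC t g ν z) z.2).2 -
        (shBlk t g z.1 (nlC t g ν z) z.2).2 * shGauge v)))
    (hw : w.2 = v.2 1 1 + z.2 * v.2 1 0) :
    dnlBlk t 1 g ν z w = (shear z.2 v.1, shear z.2 v.2) +
      gaugeBlk ![0, -v.2 1 0] (nlBlk t g ν z) := by
  have hG : shear z.2 (shGauge v - !![0, w.2; 0, 0]) = !![0, 0; 0, -v.2 1 0] := by
    refine Matrix.ext fun i j => ?_
    fin_cases i <;> fin_cases j <;>
      simp [shear_apply, Matrix.mul_apply, Fin.sum_univ_two, shGauge, hw]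
  have key (A B : Matrix (Fin 2) (Fin 2) R) : shear z.2 (A + (shGauge v * B - B * shGauge v) -
      (!![0, w.2; 0, 0] * B - B * !![0, w.2; 0, 0])) = shear z.2 A +
        Matrix.of fun i j => (![0, -v.2 1 0] : Fin 2 → R) i * shear z.2 B i j -
          shear z.2 B i j * (![0, -v.2 1 0] : Fin 2 → R) j := by
    have e : A + (shGauge v * B - B * shGauge v) - (!![0, w.2; 0, 0] * B - B * !![0, w.2; 0, 0]) =
        A + ((shGauge v - !![0, w.2; 0, 0]) * B - B * (shGauge v - !![0, w.2; 0, 0])) := by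
      rw [sub_mul, mul_sub]; abel
    rw [e, map_add, map_sub, map_mul, map_mul, hG]
    congr 1
    refine Matrix.ext fun i j => ?_
    simp only [Matrix.sub_apply, Matrix.mul_apply, Fin.sum_univ_two]
    fin_cases i <;> fin_cases j <;> simp
  rw [dnlBlk_eq_shear ht g ν h, hv, nlBlk_eq_shear ht]
  exact Prod.ext (key _ _) (key _ _)

/-- The conjugation by `S_2` on blocks. -/
def tw2 : Matrix (Fin 2) (Fin 2) R →ₐ[ℂ] Matrix (Fin 2) (Fin 2) R where
  toFun A := Matrix.of fun i j => ((-1 : ℂ) ^ (i : ℕ) * ((-1 : ℂ) ^ (j : ℕ))⁻¹) • A i j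
  map_one' := by
    ext i j; fin_cases i <;> fin_cases j <;> simp
  map_mul' A B := by
    ext i j; fin_cases i <;> fin_cases j <;> simp [Matrix.mul_apply, Fin.sum_univ_two] <;> abel
  map_zero' := by ext i j; simp
  map_add' A B := by ext i j; simp
  commutes' c := by
    ext i j
    fin_cases i <;> fin_cases j <;> simp [Matrix.algebraMap_matrix_apply]

theorem tw2_apply (A : Matrix (Fin 2) (Fin 2) R) :
    tw2 A = !![A 0 0, -A 0 1; -A 1 0, A 1 1] := by
  ext i j; fin_cases i <;> fin_cases j <;> simp [tw2]

end Algebra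

end NL


/-! ### Fixed points of the common transformation of the non-linear reductions -/

section NL

variable {n : ℕ}

/-- The common form of the transformations of the non-linear reductions. -/
def backNL {m : Type} [Fintype m] [DecidableEq m] (ν t : ℂ) (x : Phase m) : Phase m :=
  (-(t⁻¹ • (x.2 * (x.1 * x.2 + ν • 1))), t • x.2⁻¹)

theorem comm_backNL {m : Type} [Fintype m] [DecidableEq m] (ν : ℂ) {t : ℂ} (ht : t ≠ 0)
    {x : Phase m} (hx : IsUnit x.2) : comm (backNL ν t x) = comm x := by
  rw [isUnit_iff_isUnit_det] at hx
  have h1 := mul_nonsing_inv _ hx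
  have h3 := nonsing_inv_mul _ hx
  have h2 (z : Matrix m m ℂ) : x.2⁻¹ * (x.2 * z) = z := by
    rw [← mul_assoc, h3, one_mul]
  simp only [comm, backNL, neg_mul, mul_neg, smul_mul_assoc, mul_smul_comm, mul_add, add_mul,
    mul_assoc, h1, h2, h3, mul_one, smul_smul, one_mul, smul_add]
  match_scalars <;> field_simp <;> ring

theorem backNL_conjP {m : Type} [Fintype m] [DecidableEq m] (ν t : ℂ) (u : (Matrix m m ℂ)ˣ)
    (x : Phase m) : backNL ν t (conjP u x) = conjP u (backNL ν t x) := by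
  simp [backNL, conjP_apply, conjAlg_inv]

theorem conj_tw2 (A : Matrix (Fin n × Fin 2) (Fin n × Fin 2) ℂ) :
    blkAlg n 2 (conjAlg (twistUnit n 2) A) = tw2 (blkAlg n 2 A) := by
  refine Matrix.ext fun i j => ?_
  rw [blkAlg_apply, blk_conjAlg_twist]
  simp only [Nat.cast_ofNat, exp_two_pi_div_two]
  rfl

/-- Clearing the inverse gives polynomial equations. The first of them already forces q to be
invertible, because t ≠ 0. -/
theorem nl_fixedSet (ν : ℂ) {t : ℂ} (ht : t ≠ 0) (x : Phase (Fin n × Fin 2)) :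
    x ∈ fixedSet (regQ _) (backNL ν) t ↔
      tw2 (blkAlg n 2 x.2) * blkAlg n 2 x.2 = t • 1 ∧
      t • tw2 (blkAlg n 2 x.1) + blkAlg n 2 x.2 * blkAlg n 2 x.1 * blkAlg n 2 x.2 +
        ν • blkAlg n 2 x.2 = 0 := by
  rw [mem_fixedSet]
  have e1 (A B : Matrix (Fin n × Fin 2) (Fin n × Fin 2) ℂ) :
      A = B ↔ blkAlg n 2 A = blkAlg n 2 B := (blkAlg n 2).injective.eq_iff.symm
  have e2 : (conjP (twistUnit n 2) x = backNL ν t x) ↔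
      (tw2 (blkAlg n 2 x.1) = -(t⁻¹ • (blkAlg n 2 x.2 * (blkAlg n 2 x.1 * blkAlg n 2 x.2 + ν • 1)))
        ∧ tw2 (blkAlg n 2 x.2) = t • blkAlg n 2 x.2⁻¹) := by
    rw [Prod.ext_iff, conjP_fst, conjP_snd, e1, e1, conj_tw2, conj_tw2]
    simp only [backNL, map_neg, map_smul, map_mul, map_add, map_one]
  rw [e2]
  have e3 (hx : IsUnit x.2) : blkAlg n 2 x.2⁻¹ * blkAlg n 2 x.2 = 1 ∧
      blkAlg n 2 x.2 * blkAlg n 2 x.2⁻¹ = 1 := by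
    rw [isUnit_iff_isUnit_det] at hx
    rw [← map_mul, ← map_mul, nonsing_inv_mul _ hx, mul_nonsing_inv _ hx, map_one]
    exact ⟨rfl, rfl⟩
  constructor
  · rintro ⟨hx, h1, h2⟩
    refine ⟨?_, ?_⟩
    · rw [h2, smul_mul_assoc, (e3 hx).1]
    · rw [h1, smul_neg, smul_smul, mul_inv_cancel₀ ht, mul_add, mul_smul_comm, mul_one]
      simp only [mul_assoc]
      module
  · rintro ⟨h1, h2⟩
    have hx : IsUnit x.2 := by
      have h3 : (t⁻¹ • conjAlg (twistUnit n 2) x.2) * x.2 = 1 := by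
        rw [e1, map_mul, map_smul, conj_tw2, smul_mul_assoc, h1, smul_smul, inv_mul_cancel₀ ht,
          one_smul, map_one]
      exact .of_mul_eq_one_right _ h3
    refine ⟨hx, ?_, ?_⟩
    · have h3 : t • tw2 (blkAlg n 2 x.1) = -(blkAlg n 2 x.2 * (blkAlg n 2 x.1 * blkAlg n 2 x.2 +
          ν • 1)) := by
        rw [eq_neg_iff_add_eq_zero, ← h2, mul_add, mul_smul_comm, mul_one, mul_assoc, add_assoc]
      rw [← smul_neg, ← h3, smul_smul, inv_mul_cancel₀ ht, one_smul]
    · rw [← mul_one (tw2 _), ← (e3 hx).2, ← mul_assoc, h1, smul_mul_assoc, one_mul]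

theorem blkAlg_ofBlk_fst {d : ℕ} (b : Matrix (Fin d) (Fin d) (Matrix (Fin n) (Fin n) ℂ) ×
    Matrix (Fin d) (Fin d) (Matrix (Fin n) (Fin n) ℂ)) : blkAlg n d (ofBlk b).1 = b.1 := by
  simp [ofBlk]

theorem blkAlg_ofBlk_snd {d : ℕ} (b : Matrix (Fin d) (Fin d) (Matrix (Fin n) (Fin n) ℂ) ×
    Matrix (Fin d) (Fin d) (Matrix (Fin n) (Fin n) ℂ)) : blkAlg n d (ofBlk b).2 = b.2 := by
  simp [ofBlk]

theorem nlBlk_fix {R : Type*} [Ring R] [Algebra ℂ R] {t : ℂ} (ht : t ≠ 0) (g ν : ℂ) (z : R × R) :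
    tw2 (nlBlk t g ν z).2 * (nlBlk t g ν z).2 = t • 1 ∧
      t • tw2 (nlBlk t g ν z).1 + (nlBlk t g ν z).2 * (nlBlk t g ν z).1 * (nlBlk t g ν z).2 +
        ν • (nlBlk t g ν z).2 = 0 := by
  have hC := mul_eq_nlC ht g ν z
  have hC2 (y : R) : z.1 * (z.2 * y) = (2 * t) • (nlC t g ν z * y) + (Complex.I * g - ν) • y := by
    rw [← mul_assoc, hC, add_mul, smul_mul_assoc, smul_mul_assoc, one_mul]
  generalize hc : nlC t g ν z = C at hC hC2
  refine ⟨Matrix.ext fun i j => ?_, Matrix.ext fun i j => ?_⟩ <;>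
    fin_cases i <;> fin_cases j <;>
    simp [tw2_apply, Matrix.mul_apply, Fin.sum_univ_two, nlBlk, hc, mul_add, add_mul,
      mul_sub, sub_mul, hC, hC2, smul_sub, smul_add, smul_smul, mul_assoc] <;> module

theorem nlBlk_mem {t : ℂ} (ht : t ≠ 0) (g ν : ℂ) (z : Phase (Fin n)) :
    ofBlk (nlBlk t g ν z) ∈ fixedSet (regQ _) (backNL ν) t := by
  rw [nl_fixedSet ν ht, blkAlg_ofBlk_fst, blkAlg_ofBlk_snd]
  exact nlBlk_fix ht g ν z

theorem nlBlk_mem_momentLevel {t : ℂ} (ht : t ≠ 0) (g : Fin 2 → ℂ) (ν : ℂ) (z : Phase (Fin n)) :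
    ofBlk (nlBlk t (g 1) ν z) ∈ momentLevel g := by
  intro i hi
  fin_cases i
  · exact absurd rfl hi
  · have hC := mul_eq_nlC ht (g 1) ν z
    rw [moment_ofBlk]
    generalize hc : nlC t (g 1) ν z = C at hC
    simp [Matrix.mul_apply, Fin.sum_univ_two, nlBlk, hc, mul_add, add_mul,
      mul_sub, sub_mul, hC, smul_sub, smul_add, smul_smul, mul_assoc]
    module

/-- With q₂₁ = 1 the equation for q gives q₂₂ = q₁₁ and q₁₂ = q₁₁² - t. Two entries of the equation
for p give p₁₂ and p₂₂, and the moment condition gives p₁₁. -/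
theorem eq_nlBlk {t : ℂ} (ht : t ≠ 0) (ν : ℂ) {g : Fin 2 → ℂ} {x : Phase (Fin n × Fin 2)}
    (hx : x ∈ fixedSet (regQ _) (backNL ν) t) (hm : x ∈ momentLevel g)
    (h11 : IsUnit (blk x.2 0 0)) (h21 : blk x.2 1 0 = 1) :
    x = ofBlk (nlBlk t (g 1) ν ((redNL t x).1 + (Complex.I * g 1 - ν) • (redNL t x).2⁻¹,
      (redNL t x).2)) := by
  obtain ⟨h1, h2⟩ := (nl_fixedSet ν ht x).1 hx
  have hm := hm 1 (by simp)
  simp only [moment, comm, blk_sub, blk_mul, Fin.sum_univ_two, h21] at hm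
  have e (A : Matrix (Fin 2) (Fin 2) (Matrix (Fin n) (Fin n) ℂ)) (i j : Fin 2)
    (B : Matrix (Fin 2) (Fin 2) (Matrix (Fin n) (Fin n) ℂ)) (h : A = B) : A i j = B i j := by rw [h]
  have q10 := e _ 1 0 _ h1
  have q00 := e _ 0 0 _ h1
  have p10 := e _ 1 0 _ h2
  have p11 := e _ 1 1 _ h2
  simp [tw2_apply, Matrix.mul_apply, Fin.sum_univ_two, blkAlg_apply, h21] at q10 q00 p10 p11
  have hU := (isUnit_iff_isUnit_det _).1 h11
  have hr := nonsing_inv_mul _ hU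
  have hX : ((redNL t x).1 + (Complex.I * g 1 - ν) • (redNL t x).2⁻¹) * blk x.2 0 0 =
      (2 * t) • blk x.1 1 0 + (Complex.I * g 1 - ν) • 1 := by
    simp only [redNL, h21, inv_one, one_mul, add_mul, smul_mul_assoc, mul_assoc, hr, mul_one]
  rw [one_mul] at hm
  have ha : (redNL t x).2 = blk x.2 0 0 := rfl
  generalize (redNL t x).1 + (Complex.I * g 1 - ν) • (redNL t x).2⁻¹ = X at hX ⊢
  rw [ha]
  refine (ofBlk_blkAlg x).symm.trans ?_
  have hB (A : Matrix (Fin n × Fin 2) (Fin n × Fin 2) ℂ) : blkAlg n 2 A =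
      !![blk A 0 0, blk A 0 1; blk A 1 0, blk A 1 1] :=
    Matrix.ext fun i j => by fin_cases i <;> fin_cases j <;> rfl
  rw [hB, hB, h21]
  generalize blk x.2 0 0 = a at *
  generalize blk x.2 0 1 = b at *
  generalize blk x.2 1 1 = d at *
  generalize blk x.1 0 0 = p at *
  generalize blk x.1 0 1 = r at *
  generalize blk x.1 1 0 = C at *
  generalize blk x.1 1 1 = s at *
  obtain rfl : d = a := (neg_add_eq_zero.1 q10).symm
  obtain rfl : b = d * d - t • 1 := by rw [← q00]; abel
  obtain rfl : r = t • C - (p + d * C) * d - ν • 1 - d * s := by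
    linear_combination (norm := module) p10
  obtain rfl : s = p + d * C - C * d := by
    linear_combination (norm := skip) t⁻¹ • p11
    simp only [mul_add, add_mul, mul_sub, sub_mul, smul_add, smul_sub, mul_smul_comm,
      smul_mul_assoc, mul_one, one_mul, mul_assoc]
    match_scalars <;> field_simp <;> ring
  -- The moment condition determines p₁₁ + q₁₁p₂₁ only after right multiplication by q₁₁; this is
  -- where q₁₁ has to be invertible.
  obtain rfl : p = (1 / 2 : ℂ) • X - d * C := by
    have h : X * d = ((2 : ℂ) • (p + d * C)) * d := by
      rw [hX]
      linear_combination (norm := skip) -hm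
      simp only [mul_add, add_mul, mul_sub, sub_mul, smul_add, smul_sub, mul_smul_comm,
        smul_mul_assoc, mul_one, one_mul, mul_assoc]
      module
    rw [h11.mul_left_inj] at h
    rw [h]
    module
  have hC : nlC t (g 1) ν (X, d) = C := by
    rw [nlC, hX]
    match_scalars <;> field_simp <;> ring
  simp only [nlBlk, hC]
  congr 2
  refine Matrix.ext fun i j => ?_
  have hX2 : t • C = (1 / 2 : ℂ) • (X * d) - ((Complex.I * g 1 - ν) / 2) • 1 := by
    rw [hX]; module
  fin_cases i <;> fin_cases j <;> simp [hX2, mul_add, add_mul, mul_sub, sub_mul, mul_assoc] <;>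
    module

end NL


/-! ### Derivatives, symplecticity and normalization for the slice q₂₁ = 1 -/

section NL

variable {n : ℕ}

theorem hasDerivAt_nlC {T : ℂ → ℂ} {τ e : ℂ} (hT : HasDerivAt T τ e) (h0 : T e ≠ 0) (g ν : ℂ)
    {z : ℂ → Phase (Fin n)} {w : Phase (Fin n)} (hz : HasDerivAt z w e) :
    HasDerivAt (fun ε => nlC (T ε) g ν (z ε)) (dnlC (T e) τ g ν (z e) w) e := by
  have h1 := hasDerivAt_fst hz
  have h2 := hasDerivAt_snd hz
  have h3 := ((hT.const_mul 2).inv (mul_ne_zero two_ne_zero h0)).smul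
    ((hasDerivAt_matrix_mul h1 h2).add_const ((ν - Complex.I * g) • 1))
  convert! h3 using 1
  simp only [dnlC, nlC, Pi.inv_apply]
  match_scalars <;> field_simp

theorem hasDerivAt_nlBlk {T : ℂ → ℂ} {τ e : ℂ} (hT : HasDerivAt T τ e) (h0 : T e ≠ 0) (g ν : ℂ)
    {z : ℂ → Phase (Fin n)} {w : Phase (Fin n)} (hz : HasDerivAt z w e) :
    HasDerivAt (fun ε => ofBlk (nlBlk (T ε) g ν (z ε))) (ofBlk (dnlBlk (T e) τ g ν (z e) w)) e := by
  have hP := hasDerivAt_fst hz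
  have ha := hasDerivAt_snd hz
  have hC := hasDerivAt_nlC hT h0 g ν hz
  have haC := hasDerivAt_matrix_mul ha hC
  refine hasDerivAt_ofBlk (fun i j => ?_) fun i j => ?_
  · fin_cases i <;> fin_cases j
    · exact (hP.const_smul (1 / 2 : ℂ)).sub haC
    · exact ((hasDerivAt_matrix_mul haC ha).sub
        ((hasDerivAt_matrix_mul ha hP).const_smul (1 / 2 : ℂ))).sub_const _
    · exact hC
    · exact (hP.const_smul (1 / 2 : ℂ)).sub (hasDerivAt_matrix_mul hC ha)
  · fin_cases i <;> fin_cases j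
    · exact ha
    · exact (hasDerivAt_matrix_mul ha ha).sub (hT.smul_const 1)
    · exact hasDerivAt_const _ _
    · exact ha

/-- The block C = p₂₁ is paired with d(a²) and also occurs in p₁₁ and p₂₂, which are paired with da.
All terms with C or dC cancel by cyclicity, and Tr(dP ∧ da) remains. -/
theorem sympl_dnlBlk (t g ν : ℂ) (z w w' : Phase (Fin n)) :
    sympl (ofBlk (dnlBlk t 0 g ν z w)) (ofBlk (dnlBlk t 0 g ν z w')) = sympl w w' := by
  rw [sympl_ofBlk]
  simp only [dnlBlk, Fin.sum_univ_two, Matrix.of_apply, Matrix.cons_val, Matrix.cons_val_zero,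
    Matrix.cons_val_one, zero_smul, sub_zero, Matrix.cons_val', Matrix.cons_val_fin_one]
  generalize nlC t g ν z = C
  generalize dnlC t 0 g ν z w = C'
  generalize dnlC t 0 g ν z w' = C''
  have h1 := trace_mul_comm (C' * w'.2) z.2
  have h2 := trace_mul_comm (C'' * w.2) z.2
  have h3 := trace_mul_comm (C * w.2) w'.2
  have h4 := trace_mul_comm (C * w'.2) w.2
  simp only [← mul_assoc] at h1 h2 h3 h4
  simp only [sympl, sub_mul, add_mul, mul_add, trace_sub, trace_add, smul_mul_assoc,
    Matrix.trace_smul, mul_zero, Matrix.trace_zero, ← mul_assoc, smul_eq_mul]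
  linear_combination h1 - h2 - h3 + h4

/-- The gauge transformation to the slice. -/
def nlNrm (x : Phase (Fin n × Fin 2)) : Fin 2 → Matrix (Fin n) (Fin n) ℂ :=
  ![1, (blk x.2 1 0)⁻¹]

theorem isUnit_nlNrm {x : Phase (Fin n × Fin 2)} (hx : x ∈ genNL) (i : Fin 2) :
    IsUnit (nlNrm x i) := by
  fin_cases i
  exacts [isUnit_one, isUnit_matrix_inv hx.2]

theorem nlNrm_gauge (x : Phase (Fin n × Fin 2)) (h : Fin 2 → GL (Fin n) ℂ) (h0 : h 0 = 1)
    (i : Fin 2) : nlNrm (gauge h x) i = nlNrm x i * ((h i)⁻¹ : GL (Fin n) ℂ).1 := by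
  fin_cases i <;> simp only [nlNrm, blk_gauge_snd, gauge_inv] <;> simp [h0]

theorem redNL_gauge (t : ℂ) (x : Phase (Fin n × Fin 2)) (h : Fin 2 → GL (Fin n) ℂ)
    (h0 : h 0 = 1) : redNL t (gauge h x) = redNL t x := by
  simp only [redNL, blk_gauge_snd, blk_gauge_fst, gauge_inv]
  simp [h0, mul_assoc]

theorem gauge_genNL (x : Phase (Fin n × Fin 2)) (h : Fin 2 → GL (Fin n) ℂ)
    (hx : x ∈ genNL) : gauge h x ∈ genNL := by
  obtain ⟨h1, h2⟩ := hx
  refine ⟨?_, ?_⟩ <;> rw [blk_gauge_snd]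
  exacts [isUnit_gauge h1, isUnit_gauge h2]

theorem isOpen_genNL : IsOpen (genNL (n := n)) :=
  (isOpen_isUnit_comp ((continuous_blk 0 0).comp continuous_snd)).inter
    (isOpen_isUnit_comp ((continuous_blk 1 0).comp continuous_snd))

theorem blk_eq_one_of_nlNrm {x : Phase (Fin n × Fin 2)} (hx : x ∈ genNL)
    (h : ∀ i, nlNrm x i = 1) : blk x.2 1 0 = 1 := by
  have h1 : (blk x.2 1 0)⁻¹ = 1 := h 1
  have := nonsing_inv_nonsing_inv _ ((isUnit_iff_isUnit_det _).1 hx.2)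
  rw [h1, inv_one] at this
  exact this.symm

theorem nlBlk_mem_genNL (t g ν : ℂ) {z : Phase (Fin n)} (hz : IsUnit z.2) :
    ofBlk (nlBlk t g ν z) ∈ genNL := by
  refine ⟨?_, ?_⟩ <;> rw [blk_ofBlk_snd]
  exacts [hz, isUnit_one]

/-- The coordinates of `redNL`, shifted in the first component. -/
def nlRed (g ν t : ℂ) (x : Phase (Fin n × Fin 2)) : Phase (Fin n) :=
  ((redNL t x).1 + (Complex.I * g - ν) • (redNL t x).2⁻¹, (redNL t x).2)

theorem nlRed_nlBlk {t : ℂ} (ht : t ≠ 0) (g ν : ℂ) {z : Phase (Fin n)} (hz : IsUnit z.2) :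
    nlRed g ν t (ofBlk (nlBlk t g ν z)) = z := by
  have h1 := mul_nonsing_inv _ ((isUnit_iff_isUnit_det _).1 hz)
  have h := congrArg (· * z.2⁻¹) (mul_eq_nlC ht g ν z)
  simp only [mul_assoc, h1, mul_one, add_mul, smul_mul_assoc, one_mul] at h
  have e1 : blk (ofBlk (nlBlk t g ν z)).2 1 0 = 1 := blk_ofBlk_snd _ _ _
  have e2 : blk (ofBlk (nlBlk t g ν z)).1 1 0 = nlC t g ν z := blk_ofBlk_fst _ _ _
  have e3 : blk (ofBlk (nlBlk t g ν z)).2 0 0 = z.2 := blk_ofBlk_snd _ _ _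
  simp only [nlRed, redNL, e1, e2, e3, inv_one, one_mul]
  exact Prod.ext h.symm rfl

theorem nlRed_gauge (g ν t : ℂ) (x : Phase (Fin n × Fin 2)) (h : Fin 2 → GL (Fin n) ℂ)
    (h0 : h 0 = 1) : nlRed g ν t (gauge h x) = nlRed g ν t x := by
  rw [nlRed, redNL_gauge t x h h0, nlRed]

theorem differentiableOn_nlRed (g ν : ℂ) (D : Set ℂ) :
    DifferentiableOn ℂ (fun z : ℂ × Phase (Fin n × Fin 2) => nlRed g ν z.1 z.2)
      (D ×ˢ genNL) := by
  have h1 : DifferentiableOn ℂ (fun z : ℂ × Phase (Fin n × Fin 2) => (blk z.2.2 1 0)⁻¹)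
    (D ×ˢ genNL) := (differentiableOn_blk_inv fun x hx => hx.2).comp differentiableOn_snd
      Set.mapsTo_snd_prod
  have h2 : DifferentiableOn ℂ (fun z : ℂ × Phase (Fin n × Fin 2) => (blk z.2.2 0 0)⁻¹)
    (D ×ˢ genNL) := (differentiableOn_blk_inv fun x hx => hx.1).comp differentiableOn_snd
      Set.mapsTo_snd_prod
  simp only [nlRed, redNL]
  fun_prop

theorem differentiableOn_nlBlk {E : Type*} [NormedAddCommGroup E] [NormedSpace ℂ E] {Z : Set E}
    {T : E → ℂ} {z : E → Phase (Fin n)} (hT : DifferentiableOn ℂ T Z) (h0 : ∀ e ∈ Z, T e ≠ 0)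
    (hz : DifferentiableOn ℂ z Z) (g ν : ℂ) :
    DifferentiableOn ℂ (fun e => ofBlk (nlBlk (T e) g ν (z e))) Z := by
  have hP := hz.fst
  have ha := hz.snd
  have hi : DifferentiableOn ℂ (fun e => (2 * T e)⁻¹) Z :=
    (hT.const_mul 2).inv fun e he => mul_ne_zero two_ne_zero (h0 e he)
  have hC : DifferentiableOn ℂ (fun e => nlC (T e) g ν (z e)) Z := by
    simp only [nlC]
    fun_prop
  refine differentiableOn_ofBlk (fun i j => ?_) fun i j => ?_ <;>
    fin_cases i <;> fin_cases j <;>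
    simp only [nlBlk, Matrix.of_apply, Matrix.cons_val, Matrix.cons_val_zero,
      Matrix.cons_val_one, Fin.zero_eta, Fin.mk_one, Matrix.cons_val', Matrix.cons_val_fin_one] <;>
    fun_prop

end NL


/-! ### Density in the non-linear reductions -/

/-- The trace of an idempotent is its rank. Equal traces thus give isomorphic ranges and isomorphic
kernels, and the space is their direct sum. -/
theorem exists_conj_of_isIdempotentElem {V : Type*} [AddCommGroup V] [Module ℂ V]
    [FiniteDimensional ℂ V] {f g : V →ₗ[ℂ] V} (hf : IsIdempotentElem f) (hg : IsIdempotentElem g)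
    (h : LinearMap.trace ℂ V f = LinearMap.trace ℂ V g) :
    ∃ e : V ≃ₗ[ℂ] V, ∀ v, e (f v) = g (e v) := by
  have hr {f : V →ₗ[ℂ] V} (hf : IsIdempotentElem f) :
      LinearMap.trace ℂ V f = Module.finrank ℂ (LinearMap.range f) :=
    (LinearMap.IsProj.mk (fun v => LinearMap.mem_range_self f v) fun v hv =>
      (LinearMap.IsIdempotentElem.mem_range_iff hf).1 hv : LinearMap.IsProj (LinearMap.range f) f).trace
  have h1 : Module.finrank ℂ (LinearMap.range f) = Module.finrank ℂ (LinearMap.range g) := by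
    rw [hr hf, hr hg] at h
    exact_mod_cast h
  have h2 : Module.finrank ℂ (LinearMap.ker f) = Module.finrank ℂ (LinearMap.ker g) := by
    have h3 := f.finrank_range_add_finrank_ker
    have h4 := g.finrank_range_add_finrank_ker
    omega
  let e1 := LinearEquiv.ofFinrankEq _ _ h1
  let e2 := LinearEquiv.ofFinrankEq _ _ h2
  let a := Submodule.prodEquivOfIsCompl _ _ (LinearMap.IsIdempotentElem.isCompl hf)
  let b := Submodule.prodEquivOfIsCompl _ _ (LinearMap.IsIdempotentElem.isCompl hg)
  refine ⟨a.symm ≪≫ₗ e1.prodCongr e2 ≪≫ₗ b, fun v => ?_⟩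
  obtain ⟨⟨u, k⟩, rfl⟩ := a.surjective v
  have e3 : f (a (u, k)) = a (u, 0) := by
    have : f u = u := (LinearMap.IsIdempotentElem.mem_range_iff hf).1 u.2
    simp [a, this]
  rw [e3]
  have e4 : g (e1 u) = e1 u := (LinearMap.IsIdempotentElem.mem_range_iff hg).1 (e1 u).2
  simp [b, e4]

/-- If A² = r² and r ≠ 0, then (r + A)/(2r) is idempotent, and its trace determines and is
determined by that of A. -/
theorem exists_conj_of_sq_eq {m : Type} [Fintype m] [DecidableEq m] {A B : Matrix m m ℂ} {r : ℂ}
    (hr : r ≠ 0) (hA : A * A = r ^ 2 • (1 : Matrix m m ℂ)) (hB : B * B = r ^ 2 • (1 : Matrix m m ℂ))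
    (h : trace A = trace B) : ∃ u : (Matrix m m ℂ)ˣ, u.1 * A = B * u.1 := by
  have hp {A : Matrix m m ℂ} (hA : A * A = r ^ 2 • (1 : Matrix m m ℂ)) :
      IsIdempotentElem (Matrix.toLin' ((2 * r)⁻¹ • (r • 1 + A))) := by
    rw [IsIdempotentElem, Module.End.mul_eq_comp, ← Matrix.toLin'_mul]
    congr 1
    simp only [smul_mul_assoc, mul_smul_comm, mul_add, add_mul, hA, mul_one, one_mul]
    match_scalars <;> field_simp <;> ring
  obtain ⟨e, he⟩ := exists_conj_of_isIdempotentElem (hp hA) (hp hB) (by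
    rw [Matrix.trace_toLin'_eq, Matrix.trace_toLin'_eq]
    simp [h])
  have h1 : LinearMap.toMatrix' e.toLinearMap * LinearMap.toMatrix' e.symm.toLinearMap = 1 := by
    rw [← LinearMap.toMatrix'_comp]; simp
  have h2 : LinearMap.toMatrix' e.symm.toLinearMap * LinearMap.toMatrix' e.toLinearMap = 1 := by
    rw [← LinearMap.toMatrix'_comp]; simp
  refine ⟨⟨_, _, h1, h2⟩, ?_⟩
  have h3 : e.toLinearMap ∘ₗ Matrix.toLin' ((2 * r)⁻¹ • (r • 1 + A)) =
    Matrix.toLin' ((2 * r)⁻¹ • (r • 1 + B)) ∘ₗ e.toLinearMap := LinearMap.ext he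
  have h4 := congrArg LinearMap.toMatrix' h3
  rw [LinearMap.toMatrix'_comp, LinearMap.toMatrix'_comp, LinearMap.toMatrix'_toLin',
    LinearMap.toMatrix'_toLin'] at h4
  change LinearMap.toMatrix' e.toLinearMap * A = B * LinearMap.toMatrix' e.toLinearMap
  generalize LinearMap.toMatrix' e.toLinearMap = u at h4 ⊢
  simp only [mul_smul_comm, smul_mul_assoc, mul_add, add_mul, mul_one, one_mul] at h4
  have h5 := (smul_right_injective _ (inv_ne_zero (mul_ne_zero two_ne_zero hr))) h4
  exact add_left_cancel h5

section NL

variable {n : ℕ}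

theorem twist_two_mul_self : twist n 2 * twist n 2 = 1 := by
  rw [twist, diagonal_mul_diagonal, ← diagonal_one]
  congr 1
  ext ⟨a, i⟩
  simp only [Nat.cast_ofNat, exp_two_pi_div_two]
  fin_cases i <;> simp

theorem conjAlg_twistUnit_two (A : Matrix (Fin n × Fin 2) (Fin n × Fin 2) ℂ) :
    conjAlg (twistUnit n 2) A = twist n 2 * A * twist n 2 := by
  have : ((twistUnit n 2)⁻¹).1 = twist n 2 := by
    rw [← one_mul (twist n 2), ← Units.inv_mul (twistUnit n 2), mul_assoc]
    exact ((congrArg (((twistUnit n 2)⁻¹).1 * ·) twist_two_mul_self).trans (mul_one _)).symm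
  rw [conjAlg_apply, this]
  rfl

/-- Written in S₂q and pS₂, the equations no longer contain the twist, so they are invariant under
simultaneous conjugation by arbitrary invertible matrices. -/
theorem nl_fixedSet_twist (ν : ℂ) {t : ℂ} (ht : t ≠ 0) (x : Phase (Fin n × Fin 2)) :
    x ∈ fixedSet (regQ _) (backNL ν) t ↔
      twist n 2 * x.2 * (twist n 2 * x.2) = t • 1 ∧
      t • (x.1 * twist n 2) + twist n 2 * x.2 * (x.1 * twist n 2) * (twist n 2 * x.2) +
        ν • (twist n 2 * x.2) = 0 := by
  have h1 (A : Matrix (Fin n × Fin 2) (Fin n × Fin 2) ℂ) :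
      twist n 2 * (twist n 2 * A) = A := by rw [← mul_assoc, twist_two_mul_self, one_mul]
  have e (A B : Matrix (Fin n × Fin 2) (Fin n × Fin 2) ℂ) :
      A = B ↔ twist n 2 * A = twist n 2 * B :=
    ⟨fun h => by rw [h], fun h => by rw [← h1 A, h, h1]⟩
  rw [nl_fixedSet ν ht, ← conj_tw2, ← conj_tw2]
  simp only [← map_smul (blkAlg n 2), ← map_mul (blkAlg n 2), ← map_add (blkAlg n 2)]
  rw [map_eq_zero_iff _ (blkAlg n 2).injective, ← map_one (blkAlg n 2), ← map_smul,
    (blkAlg n 2).injective.eq_iff, conjAlg_twistUnit_two, conjAlg_twistUnit_two]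
  refine and_congr (by rw [mul_assoc (twist n 2 * x.2)]) ?_
  rw [e _ 0]
  simp only [mul_add, mul_smul_comm, mul_zero, mul_assoc, h1]

theorem nl_conj_mem (ν : ℂ) {t : ℂ} (ht : t ≠ 0) {x : Phase (Fin n × Fin 2)}
    (hx : x ∈ fixedSet (regQ _) (backNL ν) t)
    (u : (Matrix (Fin n × Fin 2) (Fin n × Fin 2) ℂ)ˣ) :
    ((conjAlg u (x.1 * twist n 2) * twist n 2, twist n 2 * conjAlg u (twist n 2 * x.2)) :
      Phase (Fin n × Fin 2)) ∈ fixedSet (regQ _) (backNL ν) t := by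
  have h1 (A : Matrix (Fin n × Fin 2) (Fin n × Fin 2) ℂ) :
      twist n 2 * (twist n 2 * A) = A := by rw [← mul_assoc, twist_two_mul_self, one_mul]
  have h2 (A : Matrix (Fin n × Fin 2) (Fin n × Fin 2) ℂ) :
      A * twist n 2 * twist n 2 = A := by rw [mul_assoc, twist_two_mul_self, mul_one]
  rw [nl_fixedSet_twist ν ht] at hx ⊢
  dsimp only
  rw [h1, h2]
  have k1 := congrArg (conjAlg u) hx.1
  have k2 := congrArg (conjAlg u) hx.2
  simp only [map_mul (conjAlg u) (twist n 2 * x.2), map_smul, map_one, map_add, map_zero,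
    map_mul (conjAlg u) (twist n 2 * x.2 * (x.1 * twist n 2))] at k1 k2
  exact ⟨k1, k2⟩

theorem blk_twist_mul {d : ℕ} (A : Matrix (Fin n × Fin d) (Fin n × Fin d) ℂ) (i j : Fin d) :
    blk (twist n d * A) i j =
      Complex.exp (2 * Real.pi * Complex.I / d) ^ (i : ℕ) • blk A i j := by
  ext a b
  simp [blk, twist, diagonal_mul]

theorem mul_mul_adjugate {m : Type} [Fintype m] [DecidableEq m] (u : (Matrix m m ℂ)ˣ)
    (T : Matrix m m ℂ) : u.1 * T * u.1.adjugate = u.1.det • conjAlg u T := by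
  have h : u.1.adjugate = u.1.det • (u⁻¹).1 := by
    rw [← one_mul u.1.adjugate, ← Units.inv_mul u, mul_assoc, mul_adjugate, mul_smul_comm, mul_one]
  rw [h, mul_smul_comm, conjAlg_apply]

/-- The conjugate is rational in ε, but its product with det v is vT adj(v), which is polynomial;
the determinant of the block of this matrix is nonzero at ε = 1. -/
theorem eventually_isUnit_blk_conj {T : Matrix (Fin n × Fin 2) (Fin n × Fin 2) ℂ}
    {u : (Matrix (Fin n × Fin 2) (Fin n × Fin 2) ℂ)ˣ} {i j : Fin 2}
    (h : IsUnit (blk (conjAlg u T) i j)) :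
    ∀ᶠ ε in 𝓝[≠] (0 : ℂ), ∀ v : (Matrix (Fin n × Fin 2) (Fin n × Fin 2) ℂ)ˣ,
      v.1 = 1 + ε • (u.1 - 1) → IsUnit (blk (conjAlg v T) i j) := by
  have hM (ε : ℂ) (v : (Matrix (Fin n × Fin 2) (Fin n × Fin 2) ℂ)ˣ)
      (hv : v.1 = 1 + ε • (u.1 - 1)) :
      (((polyLine 1 (u.1 - 1) * T.map (Polynomial.C (R := ℂ)) *
        (polyLine 1 (u.1 - 1)).adjugate).submatrix (fun a => (a, i)) fun b => (b, j)).det).eval ε =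
        (v.1.det • blk (conjAlg v T) i j).det := by
    have h1 : (Polynomial.evalRingHom ε).mapMatrix (T.map (Polynomial.C (R := ℂ))) = T := by
      ext a b
      simp
    have h2 : v.1.det • blk (conjAlg v T) i j = ((Polynomial.evalRingHom ε).mapMatrix
        (polyLine 1 (u.1 - 1) * T.map (Polynomial.C (R := ℂ)) *
          (polyLine 1 (u.1 - 1)).adjugate)).submatrix (fun a => (a, i)) fun b => (b, j) := by
      rw [map_mul, map_mul, RingHom.map_adjugate, polyLine_eval, h1, ← hv, mul_mul_adjugate]
      rfl
    rw [← Polynomial.coe_evalRingHom, RingHom.map_det, h2]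
    rfl
  have hd (v : (Matrix (Fin n × Fin 2) (Fin n × Fin 2) ℂ)ˣ) : v.1.det ≠ 0 :=
    ((isUnit_iff_isUnit_det _).1 v.isUnit).ne_zero
  have h0 := ((isUnit_iff_isUnit_det _).1 (isUnit_smul_of_ne_zero (hd u) h)).ne_zero
  rw [← hM 1 u (by simp)] at h0
  filter_upwards [eventually_eval_ne_zero h0] with ε hε v hv
  rw [hM ε v hv, ← isUnit_iff_ne_zero, ← isUnit_iff_isUnit_det] at hε
  have := isUnit_smul_of_ne_zero (inv_ne_zero (hd v)) hε
  rwa [smul_smul, inv_mul_cancel₀ (hd v), one_smul] at this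

/-- The matrix T = S₂q has T² = r² and, by assumption, trace 0, hence it is conjugate to the model K
by some u. Conjugating by 1 + ε(u - 1) stays in the fixed point set, and the required blocks are
invertible for small ε ≠ 0 because they are at ε = 1. -/
theorem dense_genNL (ν : ℂ) {r t : ℂ} (hr : r ^ 2 = t) (ht : t ≠ 0) {x : Phase (Fin n × Fin 2)}
    (hx : x ∈ fixedSet (regQ _) (backNL ν) t) (h0 : trace (twist n 2 * x.2) = 0) :
    x ∈ closure (fixedSet (regQ _) (backNL ν) t ∩ genNL) := by
  subst hr
  have hr : r ≠ 0 := fun h => ht (by simp [h])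
  -- The entries are chosen so that K² = 4r² - 3r² = r², Tr K = 0, and the blocks 11 and 21 are
  -- nonzero scalars.
  let K : Matrix (Fin n × Fin 2) (Fin n × Fin 2) ℂ := (blkAlg n 2).symm
    !![(2 * r) • 1, (3 * r ^ 2) • 1; (-1 : ℂ) • 1, (-(2 * r)) • 1]
  have hb (i j) : blk K i j = (!![(2 * r) • 1, (3 * r ^ 2) • 1; (-1 : ℂ) • 1, (-(2 * r)) • 1] :
    Matrix (Fin 2) (Fin 2) (Matrix (Fin n) (Fin n) ℂ)) i j := blk_symm _ _ _
  have hK : K * K = r ^ 2 • (1 : Matrix (Fin n × Fin 2) (Fin n × Fin 2) ℂ) := by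
    refine (blkAlg n 2).injective ?_
    rw [map_mul, AlgEquiv.apply_symm_apply, map_smul, map_one]
    refine Matrix.ext fun i j => ?_
    fin_cases i <;> fin_cases j <;>
      simp [Matrix.mul_apply, Fin.sum_univ_two, smul_smul, ← add_smul] <;> module
  have htr : trace (twist n 2 * x.2) = trace K := by
    rw [h0, trace_eq_sum_blk, Fin.sum_univ_two, hb, hb]
    simp
  obtain ⟨u, hu⟩ := exists_conj_of_sq_eq hr ((nl_fixedSet_twist ν ht x).1 hx).1 hK htr
  have hc : conjAlg u (twist n 2 * x.2) = K := by
    rw [conjAlg_apply, hu, Units.mul_inv_cancel_right]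
  have h00 : IsUnit (blk (conjAlg u (twist n 2 * x.2)) 0 0) := by
    rw [hc, hb]
    exact isUnit_smul_of_ne_zero (mul_ne_zero two_ne_zero hr) isUnit_one
  have h10 : IsUnit (blk (conjAlg u (twist n 2 * x.2)) 1 0) := by
    rw [hc, hb]
    exact isUnit_smul_of_ne_zero (by norm_num) isUnit_one
  let A : ℂ → Matrix (Fin n × Fin 2) (Fin n × Fin 2) ℂ := fun ε => 1 + ε • (u.1 - 1)
  -- The inverse is taken of the matrix 1 + ε(u - 1) itself, so F is defined for every ε and
  -- continuous at 0.
  let F : ℂ → Phase (Fin n × Fin 2) := fun ε =>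
    (A ε * (x.1 * twist n 2) * (A ε)⁻¹ * twist n 2, twist n 2 * (A ε * (twist n 2 * x.2) * (A ε)⁻¹))
  have hF : ContinuousAt F 0 := by
    have hA : ContinuousAt A 0 := by fun_prop
    have hi : ContinuousAt (fun ε => (A ε)⁻¹) 0 :=
      ((differentiableAt_matrix_inv (by simp [A])).continuousAt.comp
        (f := A) (g := fun B : Matrix (Fin n × Fin 2) (Fin n × Fin 2) ℂ => B⁻¹) hA)
    exact (((hA.mul continuousAt_const).mul hi).mul continuousAt_const).prodMk
      (continuousAt_const.mul ((hA.mul continuousAt_const).mul hi))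
  have hF0 : F 0 = x := by
    have h1 : A 0 = 1 := by simp [A]
    simp only [F, h1, inv_one, one_mul, mul_one, mul_assoc, twist_two_mul_self]
    rw [← mul_assoc, twist_two_mul_self, one_mul]
  have hT : Filter.Tendsto F (𝓝[≠] 0) (𝓝 x) := by
    have := hF.tendsto.mono_left (nhdsWithin_le_nhds (s := {0}ᶜ))
    rwa [hF0] at this
  refine mem_closure_of_tendsto hT ?_
  filter_upwards [eventually_isUnit_blk_conj h00, eventually_isUnit_blk_conj h10,
    eventually_isUnit_add_smul (1 : Matrix (Fin n × Fin 2) (Fin n × Fin 2) ℂ) (u.1 - 1) (ε₀ := 0)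
      (by simp)] with ε hε1 hε2 hε3
  obtain ⟨v, hv⟩ := hε3
  have e : F ε = (conjAlg v (x.1 * twist n 2) * twist n 2,
      twist n 2 * conjAlg v (twist n 2 * x.2)) := by
    have h1 : A ε = v.1 := hv.symm
    simp only [F, h1, conjAlg_apply, Matrix.coe_units_inv]
  rw [e]
  refine ⟨nl_conj_mem ν ht hx v, ?_, ?_⟩
  · rw [blk_twist_mul]
    exact isUnit_smul_of_ne_zero (pow_ne_zero _ (Complex.exp_ne_zero _)) (hε1 v hv)
  · rw [blk_twist_mul]
    exact isUnit_smul_of_ne_zero (pow_ne_zero _ (Complex.exp_ne_zero _)) (hε2 v hv)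

end NL


/-! ### The general slice of the non-linear reductions -/

section NL

variable {n : ℕ}

theorem IsLogBranch.exp_half_sq {D : Set ℂ} {ℓ : ℂ → ℂ} (hℓ : IsLogBranch D ℓ) {t : ℂ}
    (ht : t ∈ D) : Complex.exp (ℓ t / 2) ^ 2 = t := by
  rw [← Complex.exp_nat_mul, ← hℓ.2 t ht]
  congr 1
  rw [hℓ.2 t ht]
  push_cast
  ring

theorem IsLogBranch.hasDerivAt_exp_half {D : Set ℂ} {ℓ : ℂ → ℂ} (hℓ : IsLogBranch D ℓ)
    (hD : IsOpen D) {t : ℂ} (ht : t ∈ D) :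
    HasDerivAt (fun t => Complex.exp (ℓ t / 2)) (Complex.exp (ℓ t / 2) / (2 * t)) t := by
  convert! ((hℓ.hasDerivAt hD ht).div_const 2).cexp using 1
  field_simp

/-- `A` and `B + b` are the rescaled coordinates of the slice in terms of `(P, Q)`, and `E` is the
inverse of `(A, B + b)`. -/
structure IsNLChart (A B : Phase (Fin n) →L[ℂ] Matrix (Fin n) (Fin n) ℂ) (b : ℂ)
    (E : Phase (Fin n) → Phase (Fin n)) : Prop where
  left_inv : ∀ y, E (A y, B y + b • 1) = y
  fst_eq : ∀ z, A (E z) = z.1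
  snd_eq : ∀ z, B (E z) + b • 1 = z.2
  diff : Differentiable ℂ E
  conj : ∀ u y, B (conjP u y) = conjAlg u (B y)
  sympl_eq : ∀ u u', sympl (A u, B u) (A u', B u') = 2 * sympl u u'

/-- The coordinates of the slice in terms of `(P, Q)`, where `r = √t`. -/
def nlLift (A B : Phase (Fin n) →L[ℂ] Matrix (Fin n) (Fin n) ℂ) (b r : ℂ) (y : Phase (Fin n)) :
    Phase (Fin n) :=
  ((2 * r)⁻¹ • A y, r • (B y + b • 1))

/-- The derivative of `nlLift` along a curve with velocity `u`. -/
def dnlLift (A B : Phase (Fin n) →L[ℂ] Matrix (Fin n) (Fin n) ℂ) (b t r : ℂ)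
    (y u : Phase (Fin n)) : Phase (Fin n) :=
  (-((2 * t)⁻¹ • (nlLift A B b r y).1) + (2 * r)⁻¹ • A u,
    (2 * t)⁻¹ • (nlLift A B b r y).2 + r • B u)

theorem hasDerivAt_nlLift (A B : Phase (Fin n) →L[ℂ] Matrix (Fin n) (Fin n) ℂ) (b : ℂ)
    {R : ℂ → ℂ} {t e : ℂ} (ht : t ≠ 0) (hR : HasDerivAt R (R e / (2 * t)) e) (hR0 : R e ≠ 0)
    {y : ℂ → Phase (Fin n)} {u : Phase (Fin n)} (hy : HasDerivAt y u e) :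
    HasDerivAt (fun ε => nlLift A B b (R ε) (y ε)) (dnlLift A B b t (R e) (y e) u) e := by
  have hA : HasDerivAt (fun ε => A (y ε)) (A u) e := A.hasFDerivAt.comp_hasDerivAt e hy
  have hB : HasDerivAt (fun ε => B (y ε)) (B u) e := B.hasFDerivAt.comp_hasDerivAt e hy
  have h1 := ((hR.const_mul 2).inv (mul_ne_zero two_ne_zero hR0)).smul hA
  have h2 := hR.smul (hB.add_const (b • (1 : Matrix (Fin n) (Fin n) ℂ)))
  convert! h1.prodMk h2 using 1
  refine Prod.ext ?_ ?_
  · simp only [dnlLift, nlLift, Pi.inv_apply]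
    match_scalars <;> field_simp
  · simp only [dnlLift, nlLift]
    match_scalars <;> field_simp

theorem hasDerivAt_nlLift_const (A B : Phase (Fin n) →L[ℂ] Matrix (Fin n) (Fin n) ℂ) (b r : ℂ)
    (y u : Phase (Fin n)) : HasDerivAt (fun ε : ℂ => nlLift A B b r (y + ε • u))
      ((2 * r)⁻¹ • A u, r • B u) 0 := by
  have hy := hasDerivAt_line y u
  have hA : HasDerivAt (fun ε : ℂ => A (y + ε • u)) (A u) 0 := A.hasFDerivAt.comp_hasDerivAt _ hy
  have hB : HasDerivAt (fun ε : ℂ => B (y + ε • u)) (B u) 0 := B.hasFDerivAt.comp_hasDerivAt _ hy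
  exact (hA.const_smul (2 * r)⁻¹).prodMk ((hB.add_const (b • (1 : Matrix (Fin n) (Fin n) ℂ))).const_smul r)

/-- The transformation is the same for PIII(D₈), PIII(D₆) and PVI up to ν. The cases differ only in
the chart, the time data and the comparison `ham` of the Hamiltonian vectors. -/
theorem slice_NL {D : Set ℂ} (hD : IsOpen D) {ℓ : ℂ → ℂ} (hℓ : IsLogBranch D ℓ) (ν : ℂ)
    (g : Fin 2 → ℂ) {A B : Phase (Fin n) →L[ℂ] Matrix (Fin n) (Fin n) ℂ} {b : ℂ}
    {E : Phase (Fin n) → Phase (Fin n)} (hE : IsNLChart A B b E)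
    {H : ℂ → Phase (Fin n × Fin 2) → ℂ} {H' : ℂ → Phase (Fin n) → ℂ} (hH : ConjInvariant H)
    (hH' : ConjInvariant H') {V : Set (Phase (Fin n))} (hV : V = {y | IsUnit (B y + b • 1)})
    {s c : ℂ → ℂ} (hs : DifferentiableOn ℂ s D) (hs' : ∀ t ∈ D, deriv s t ≠ 0)
    (hc : DifferentiableOn ℂ c D)
    (ham : ∀ t ∈ D, ∀ y ∈ V, ∃ v v' ξ, ξ 0 = 0 ∧
      IsHamVec H t (ofBlk (nlBlk t (g 1) ν (nlLift A B b (Complex.exp (ℓ t / 2)) y))) (ofBlk v) ∧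
      IsHamVec H' (s t) y v' ∧
      dnlBlk t 1 (g 1) ν (nlLift A B b (Complex.exp (ℓ t / 2)) y)
        (dnlLift A B b t (Complex.exp (ℓ t / 2)) y (deriv s t • v' - deriv c t • adComm y)) =
        v + gaugeBlk ξ (nlBlk t (g 1) ν (nlLift A B b (Complex.exp (ℓ t / 2)) y))) :
    Slice D H (regQ _) (backNL ν) g genNL H' V s
      (fun t x => E ((2 * Complex.exp (ℓ t / 2)) • (nlRed (g 1) ν t x).1,
        (Complex.exp (ℓ t / 2))⁻¹ • (nlRed (g 1) ν t x).2)) c nlNrm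
      fun t y => ofBlk (nlBlk t (g 1) ν (nlLift A B b (Complex.exp (ℓ t / 2)) y)) := by
  subst hV
  have hr (t : ℂ) : Complex.exp (ℓ t / 2) ≠ 0 := Complex.exp_ne_zero _
  have hlift (t : ℂ) (z : Phase (Fin n)) : nlLift A B b (Complex.exp (ℓ t / 2))
      (E ((2 * Complex.exp (ℓ t / 2)) • z.1, (Complex.exp (ℓ t / 2))⁻¹ • z.2)) = z := by
    rw [nlLift, hE.fst_eq, hE.snd_eq, smul_smul, smul_smul, mul_inv_cancel₀ (hr t),
      inv_mul_cancel₀ (mul_ne_zero two_ne_zero (hr t)), one_smul, one_smul]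
  have hunlift (t : ℂ) (y : Phase (Fin n)) : E ((2 * Complex.exp (ℓ t / 2)) •
      (nlLift A B b (Complex.exp (ℓ t / 2)) y).1, (Complex.exp (ℓ t / 2))⁻¹ •
        (nlLift A B b (Complex.exp (ℓ t / 2)) y).2) = y := by
    rw [nlLift, smul_smul, smul_smul, inv_mul_cancel₀ (hr t),
      mul_inv_cancel₀ (mul_ne_zero two_ne_zero (hr t)), one_smul, one_smul, hE.left_inv]
  have hu {t : ℂ} {y : Phase (Fin n)} (hy : IsUnit (B y + b • 1)) :
      IsUnit (nlLift A B b (Complex.exp (ℓ t / 2)) y).2 := isUnit_smul_of_ne_zero (hr t) hy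
  have hrd : DifferentiableOn ℂ (fun t => Complex.exp (ℓ t / 2)) D := fun t ht =>
    (hℓ.hasDerivAt_exp_half hD ht).differentiableAt.differentiableWithinAt
  exact
  { isOpen_time := hD
    isOpen_gen := isOpen_genNL
    dense_gen := fun t ht x hx =>
      dense_genNL ν (hℓ.exp_half_sq ht) (hℓ.ne_zero ht) hx.1 hx.2
    comm_w := fun t ht x hx => comm_backNL ν (hℓ.ne_zero ht) hx
    conj_reg := fun u x hx => isUnit_conjAlg hx
    conj_w := fun t _ u x _ => backNL_conjP ν t u x
    gauge_gen := fun h x hx => gauge_genNL x h hx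
    η_diff := by
      refine differentiableOn_pi.2 fun i => ?_
      fin_cases i
      exacts [differentiableOn_const _, differentiableOn_blk_inv fun x hx => hx.2]
    η_zero := fun x => rfl
    η_unit := fun x hx i => isUnit_nlNrm hx i
    η_gauge := fun x _ h h0 i => nlNrm_gauge x h h0 i
    Φ_gauge := fun t _ x _ h h0 => by rw [nlRed_gauge _ _ t x h h0]
    slice_eq := fun t ht x hx h => by
      refine ⟨?_, ?_⟩
      · show IsUnit _
        rw [hE.snd_eq]
        exact isUnit_smul_of_ne_zero (inv_ne_zero (hr t)) hx.2.1
      · rw [hlift]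
        exact (eq_nlBlk (hℓ.ne_zero ht) ν hx.1.1 hx.1.2 hx.2.1 (blk_eq_one_of_nlNrm hx.2 h)).symm
    section_mem := fun t ht y hy => by
      refine ⟨⟨⟨nlBlk_mem (hℓ.ne_zero ht) _ _ _, nlBlk_mem_momentLevel (hℓ.ne_zero ht) g ν _⟩,
        nlBlk_mem_genNL _ _ _ (hu hy)⟩, ?_⟩
      rw [nlRed_nlBlk (hℓ.ne_zero ht) _ _ (hu hy), hunlift]
    isOpen_image := isOpen_isUnit_comp (B.continuous.add continuous_const)
    -- The chart sends the chosen direction u to B u + b = 1 + b, so B u = 1.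
    dense_image := dense_isUnit_affine B.toLinearMap (b • 1) (u := E (0, 1 + b • 1))
      (add_right_cancel (hE.snd_eq (0, 1 + b • 1)))
    conj_image := fun u y hy => by
      have : B (conjP u y) + b • 1 = conjAlg u (B y + b • 1) := by
        rw [hE.conj, map_add, map_smul, map_one]
      show IsUnit _
      rw [this]
      exact isUnit_conjAlg hy
    holo_time := hs
    deriv_time := hs'
    holo_conj := hc
    holo := by
      have h1 := differentiableOn_nlRed (n := n) (g 1) ν D
      have h2 : DifferentiableOn ℂ (fun z : ℂ × Phase (Fin n × Fin 2) => Complex.exp (ℓ z.1 / 2))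
        (D ×ˢ genNL) := hrd.comp differentiableOn_fst Set.mapsTo_fst_prod
      have h3 := h2.inv fun z _ => hr z.1
      exact hE.diff.comp_differentiableOn
        (((h2.const_mul 2).smul h1.fst).prodMk (h3.smul h1.snd))
    holo_section := by
      have h2 : DifferentiableOn ℂ (fun z : ℂ × Phase (Fin n) => Complex.exp (ℓ z.1 / 2))
        (D ×ˢ {y | IsUnit (B y + b • 1)}) := hrd.comp differentiableOn_fst Set.mapsTo_fst_prod
      have h3 := (h2.const_mul 2).inv fun z _ => mul_ne_zero two_ne_zero (hr z.1)
      have hA : Differentiable ℂ fun z : ℂ × Phase (Fin n) => A z.2 :=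
        A.differentiable.comp differentiable_snd
      have hB : Differentiable ℂ fun z : ℂ × Phase (Fin n) => B z.2 :=
        B.differentiable.comp differentiable_snd
      exact differentiableOn_nlBlk differentiableOn_fst (fun z hz => hℓ.ne_zero hz.1)
        ((h3.smul hA.differentiableOn).prodMk (h2.smul (hB.add_const _).differentiableOn)) _ _
    sympl_section := fun t ht y hy u u' => by
      have h (u : Phase (Fin n)) := hasDerivAt_nlBlk (hasDerivAt_const (0 : ℂ) t) (hℓ.ne_zero ht)
        (g 1) ν (hasDerivAt_nlLift_const A B b (Complex.exp (ℓ t / 2)) y u)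
      refine ⟨_, _, h u, h u', ?_⟩
      simp only [zero_smul, add_zero]
      rw [sympl_dnlBlk]
      -- The factor 2 in the chart compensates the product (2r)⁻¹r of the two rescalings.
      have := hE.sympl_eq u u'
      have h0 := hr t
      simp only [sympl, smul_mul_assoc, mul_smul_comm, Matrix.trace_smul, smul_eq_mul] at this ⊢
      field_simp
      linear_combination this
    conj_ham := hH
    conj_ham' := hH'
    ham := fun t ht y hy => by
      obtain ⟨v, v', ξ, h0, h1, h2, h3⟩ := ham t ht y hy
      refine ⟨_, _, ξ, h0, h1, h2, ?_⟩
      rw [infGauge_ofBlk, ← ofBlk_add, ← h3, adP_comm]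
      have hT : HasDerivAt (fun ε : ℂ => t + ε) 1 0 := (hasDerivAt_id (0 : ℂ)).const_add t
      have hR : HasDerivAt (fun ε => Complex.exp (ℓ (t + ε) / 2))
          (Complex.exp (ℓ (t + 0) / 2) / (2 * t)) 0 := by
        have h4 := hℓ.hasDerivAt_exp_half hD ht
        rw [← add_zero t] at h4
        have h5 : HasDerivAt (fun ε => Complex.exp (ℓ (t + ε) / 2)) _ 0 := h4.comp 0 hT
        simpa using h5
      have h4 := hasDerivAt_nlBlk hT (by simpa using hℓ.ne_zero ht) (g 1) ν
        (hasDerivAt_nlLift A B b (hℓ.ne_zero ht) hR (Complex.exp_ne_zero _)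
          (hasDerivAt_line y (deriv s t • v' - deriv c t • adComm y)))
      simp only [add_zero, zero_smul] at h4
      exact h4 }

end NL


/-! ### The two charts, and the non-linear cases -/

section NL

variable {n : ℕ}

theorem isNLChart_fst : IsNLChart (n := n) (ContinuousLinearMap.fst ℂ _ _)
    ((2 : ℂ) • ContinuousLinearMap.snd ℂ _ _) (-1) fun z => (z.1, (1 / 2 : ℂ) • (z.2 + 1)) where
  left_inv y := Prod.ext rfl (by
    show (1 / 2 : ℂ) • ((2 : ℂ) • y.2 + (-1 : ℂ) • 1 + 1) = y.2
    module)
  fst_eq _ := rfl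
  snd_eq z := by
    show (2 : ℂ) • ((1 / 2 : ℂ) • (z.2 + 1)) + (-1 : ℂ) • 1 = z.2
    module
  diff := by fun_prop
  conj u y := by simp
  sympl_eq u u' := by
    simp [sympl]
    ring

theorem isNLChart_snd : IsNLChart (n := n) (ContinuousLinearMap.snd ℂ _ _)
    ((-2 : ℂ) • ContinuousLinearMap.fst ℂ _ _) 1 fun z => (-((1 / 2 : ℂ) • (z.2 - 1)), z.1) where
  left_inv y := Prod.ext (by
    show -((1 / 2 : ℂ) • ((-2 : ℂ) • y.1 + (1 : ℂ) • 1 - 1)) = y.1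
    module) rfl
  fst_eq _ := rfl
  snd_eq z := by
    show (-2 : ℂ) • (-((1 / 2 : ℂ) • (z.2 - 1))) + (1 : ℂ) • 1 = z.2
    module
  diff := by fun_prop
  conj u y := by simp
  sympl_eq u u' := by
    rw [sympl, sympl, trace_mul_comm u.1, trace_mul_comm u'.1]
    simp
    ring

/-- Expresses the target point through the rescaled coordinates, in the form that `vecVI_target` and
`vecIIID6_target` require. -/
theorem shBlk_nlLift_fst {r : ℂ} (hr : r ≠ 0) (y : Phase (Fin n)) :
    y = ((2 * r) • (nlLift (ContinuousLinearMap.fst ℂ _ _)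
        ((2 : ℂ) • ContinuousLinearMap.snd ℂ _ _) (-1) r y).1,
      (1 / 2 : ℂ) • (r⁻¹ • (nlLift (ContinuousLinearMap.fst ℂ _ _)
        ((2 : ℂ) • ContinuousLinearMap.snd ℂ _ _) (-1) r y).2 + 1)) := by
  refine Prod.ext ?_ ?_
  · show y.1 = (2 * r) • ((2 * r)⁻¹ • y.1)
    rw [smul_smul, mul_inv_cancel₀ (mul_ne_zero two_ne_zero hr), one_smul]
  · show y.2 = (1 / 2 : ℂ) • (r⁻¹ • r • ((2 : ℂ) • y.2 + (-1 : ℂ) • 1) + 1)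
    rw [smul_smul, inv_mul_cancel₀ hr]
    module

theorem shBlk_nlLift_snd {r : ℂ} (hr : r ≠ 0) (y : Phase (Fin n)) :
    y = ((1 / 2 : ℂ) • (1 - r⁻¹ • (nlLift (ContinuousLinearMap.snd ℂ _ _)
        ((-2 : ℂ) • ContinuousLinearMap.fst ℂ _ _) 1 r y).2),
      (2 * r) • (nlLift (ContinuousLinearMap.snd ℂ _ _)
        ((-2 : ℂ) • ContinuousLinearMap.fst ℂ _ _) 1 r y).1) := by
  refine Prod.ext ?_ ?_
  · show y.1 = (1 / 2 : ℂ) • (1 - r⁻¹ • r • ((-2 : ℂ) • y.1 + (1 : ℂ) • 1))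
    rw [smul_smul, inv_mul_cancel₀ hr]
    module
  · show y.2 = (2 * r) • ((2 * r)⁻¹ • y.2)
    rw [smul_smul, mul_inv_cancel₀ (mul_ne_zero two_ne_zero hr), one_smul]

/-! ### PVI to PVI -/

theorem vecVI_ofBlk {d : ℕ} (α : Fin 5 → ℂ) (t : ℂ)
    (b : Matrix (Fin d) (Fin d) (Matrix (Fin n) (Fin n) ℂ) ×
      Matrix (Fin d) (Fin d) (Matrix (Fin n) (Fin n) ℂ)) :
    vecVI α t (ofBlk b) = ofBlk (vecVI α t b) :=
  map_vecVI (blkAlg n d).symm.toAlgHom α t b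

theorem vecVI_nlBlk (α : Fin 5 → ℂ) {t : ℂ} (ht : t ≠ 0) (g ν : ℂ) (z : Phase (Fin n)) :
    vecVI α t (nlBlk t g ν z) = (shear z.2 (vecVI α t (shBlk t g z.1 (nlC t g ν z) z.2)).1,
      shear z.2 (vecVI α t (shBlk t g z.1 (nlC t g ν z) z.2)).2) := by
  rw [nlBlk_eq_shear ht]
  exact map_vecVI (shear z.2) α t _

theorem vecIIID6_nlBlk (α β : Fin 2 → ℂ) {t : ℂ} (ht : t ≠ 0) (g ν : ℂ) (z : Phase (Fin n)) :
    vecIIID6 α β t (nlBlk t g ν z) =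
      (shear z.2 (vecIIID6 α β t (shBlk t g z.1 (nlC t g ν z) z.2)).1,
        shear z.2 (vecIIID6 α β t (shBlk t g z.1 (nlC t g ν z) z.2)).2) := by
  rw [nlBlk_eq_shear ht]
  exact map_vecIIID6 (shear z.2) α β t _

theorem pi1Param_eq {α : Fin 5 → ℂ} (h : α 0 + α 1 + 2 * α 2 + α 3 + α 4 = 1)
    (hs : pi1Param α = α) : α 3 = α 0 ∧ α 4 = α 1 ∧ α 0 = 1 / 2 - α 1 - α 2 := by
  have h0 : α 3 = α 0 := congrFun hs 0
  have h1 : α 4 = α 1 := congrFun hs 1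
  refine ⟨h0, h1, ?_⟩
  rw [h0, h1] at h
  linear_combination h / 2

theorem isBlockReduction_VI {D : Set ℂ} (hD : IsOpen D) (α : Fin 5 → ℂ) (g : Fin 2 → ℂ)
    (ℓ : ℂ → ℂ) (hα : α 0 + α 1 + 2 * α 2 + α 3 + α 4 = 1) (hs : pi1Param α = α) (h1 : 1 ∉ D)
    (hℓ : IsLogBranch D ℓ) :
    IsBlockReduction (n := n) D (hamVI α) (regQ _) (backVIpi1 α) g genNL
      (hamVI ![2 * α 0, 2 * α 1, α 2 - Complex.I * g 1, Complex.I * g 1, Complex.I * g 1])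
      {y | IsUnit ((2 : ℂ) • y.2 - 1)}
      (fun t => 1 / 2 + (Complex.exp (ℓ t / 2) + (Complex.exp (ℓ t / 2))⁻¹) / 4)
      (mapNL (1 / 2) ℓ (α 2) (g 1)) := by
  obtain ⟨h3, h4, h0⟩ := pi1Param_eq hα hs
  have hr1 {t : ℂ} (ht : t ∈ D) : Complex.exp (ℓ t / 2) ^ 2 - 1 ≠ 0 := by
    rw [hℓ.exp_half_sq ht]
    exact sub_ne_zero.2 fun h => h1 (h ▸ ht)
  have hd {t : ℂ} (ht : t ∈ D) : HasDerivAt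
      (fun t => 1 / 2 + (Complex.exp (ℓ t / 2) + (Complex.exp (ℓ t / 2))⁻¹) / 4)
      ((Complex.exp (ℓ t / 2) - (Complex.exp (ℓ t / 2))⁻¹) / (8 * Complex.exp (ℓ t / 2) ^ 2)) t := by
    have h := hℓ.hasDerivAt_exp_half hD ht
    have hr := Complex.exp_ne_zero (ℓ t / 2)
    convert! ((h.add (h.inv hr)).div_const 4).const_add (1 / 2) using 1
    have hr2 := hℓ.exp_half_sq ht
    have ht2 := hℓ.ne_zero ht
    generalize Complex.exp (ℓ t / 2) = r at *
    field_simp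
    rw [← hr2]
    ring
  have hc {t : ℂ} (ht : t ∈ D) : HasDerivAt (fun t => 1 / 2 * ℓ t) (1 / 2 * t⁻¹) t :=
    (hℓ.hasDerivAt hD ht).const_mul _
  refine ((slice_NL hD hℓ (α 2) g isNLChart_fst (conjInvariant_hamVI α) (conjInvariant_hamVI _)
    (c := fun t => 1 / 2 * ℓ t) ?hV (fun t ht => (hd ht).differentiableAt.differentiableWithinAt)
    (fun t ht => ?hs') (fun t ht => (hc ht).differentiableAt.differentiableWithinAt)
    (fun t ht y hy => ?ham)).conj_exp fun _ _ _ _ =>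
    ⟨_, isHamVec_hamVI _ _ _, dcomm_vecVI _ _ _⟩).isBlockReduction
  case hV =>
    ext y
    simp [sub_eq_add_neg]
  case hs' =>
    rw [(hd ht).deriv]
    have hr := Complex.exp_ne_zero (ℓ t / 2)
    have := hr1 ht
    generalize Complex.exp (ℓ t / 2) = r at *
    -- The derivative of s vanishes only for r = r⁻¹, that is for t = r² = 1.
    refine div_ne_zero (fun h => this ?_) (mul_ne_zero (by norm_num) (pow_ne_zero _ hr))
    field_simp at h
    rw [h, mul_zero]
  case ham =>
    have ht0 := hℓ.ne_zero ht
    have hr := Complex.exp_ne_zero (ℓ t / 2)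
    have hr2 := hℓ.exp_half_sq ht
    have hy2 := shBlk_nlLift_fst hr y
    generalize hz : nlLift (ContinuousLinearMap.fst ℂ _ _)
        ((2 : ℂ) • ContinuousLinearMap.snd ℂ _ _) (-1) (Complex.exp (ℓ t / 2)) y = z at *
    have hC := mul_eq_nlC ht0 (g 1) (α 2) z
    -- The target identity turns the velocities read off the slice into those of the lifted curve;
    -- substituted in the relation and in the sheared identity, they give the hypotheses of
    -- `dnlBlk_eq`.
    have key := vecVI_target α h3 h4 h0 (g 1) hr (hr1 ht) z.1 (nlC t (g 1) (α 2) z) z.2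
      (by rw [hr2]; exact hC) _ rfl y _ hy2 rfl
    have hr12 := hr1 ht
    rw [hr2] at key hr12
    have hrel := vecVI_relation α h3 h4 h0 (g 1) ht0 hr12 z.1 _ z.2 hC _ rfl
    have hsh := vecVI_shBlk α h3 h4 h0 (g 1) ht0 hr12 z.1 _ z.2 hC _ rfl _ _ _ rfl rfl rfl
    rw [key.1, key.2] at hrel
    rw [key.1, key.2] at hsh
    have hdn := dnlBlk_eq ht0 (g 1) (α 2) (w := (_, _)) hrel hsh key.2.symm
    refine ⟨_, _, _, ?h0, ?hH, isHamVec_hamVI _ _ _, Eq.trans ?heq hdn⟩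
    case heq =>
      rw [(hd ht).deriv, (hc ht).deriv]
      congr 1
      rw [dnlLift, hz, hr2, show 1 / 2 * t⁻¹ = (2 * t)⁻¹ by rw [mul_inv, one_div]]
      refine Prod.ext (neg_add_eq_sub _ _) ?_
      refine (add_comm _ _).trans (congrArg (· + _) ?_)
      exact (smul_smul _ _ _).trans (congrArg (· • _) (mul_comm _ _))
    case h0 => rfl
    case hH =>
      rw [← vecVI_nlBlk α ht0, ← vecVI_ofBlk]
      exact isHamVec_hamVI _ _ _

/-! ### PIII(D₆) to PV -/

theorem isBlockReduction_D6V {D : Set ℂ} (hD : IsOpen D) (α β g : Fin 2 → ℂ)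
    (ℓ : ℂ → ℂ) (hβ : β 0 + β 1 = 1) (hs : swapParam β = β) (hℓ : IsLogBranch D ℓ) :
    IsBlockReduction (n := n) D (hamIIID6 α β) (regQ _) (backIIID6p α) g genNL
      (hamV ![1 - Complex.I * g 1 - α 1, Complex.I * g 1, α 1 - Complex.I * g 1,
        Complex.I * g 1])
      {y | IsUnit ((2 : ℂ) • y.2 - 1)}
      (fun t => -8 * Complex.exp (ℓ t / 2)) (mapNL (-1 / 2) ℓ (α 1) (g 1)) := by
  have h1 := (swapParam_eq_half hβ hs).2
  have hd {t : ℂ} (ht : t ∈ D) : HasDerivAt (fun t => -8 * Complex.exp (ℓ t / 2))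
      (-4 / Complex.exp (ℓ t / 2)) t := by
    have h := hℓ.hasDerivAt_exp_half hD ht
    have hr := Complex.exp_ne_zero (ℓ t / 2)
    convert! h.const_mul (-8) using 1
    have hr2 := hℓ.exp_half_sq ht
    have ht2 := hℓ.ne_zero ht
    generalize Complex.exp (ℓ t / 2) = r at *
    field_simp
    rw [← hr2]
    ring
  have hc {t : ℂ} (ht : t ∈ D) : HasDerivAt (fun t => -1 / 2 * ℓ t) (-1 / 2 * t⁻¹) t :=
    (hℓ.hasDerivAt hD ht).const_mul _
  refine ((slice_NL hD hℓ (α 1) g isNLChart_fst (conjInvariant_hamIIID6 α β)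
    (conjInvariant_hamV _) (c := fun t => -1 / 2 * ℓ t) ?hV
    (fun t ht => (hd ht).differentiableAt.differentiableWithinAt)
    (fun t ht => ?hs') (fun t ht => (hc ht).differentiableAt.differentiableWithinAt)
    (fun t ht y hy => ?ham)).conj_exp fun _ _ _ _ =>
    ⟨_, isHamVec_hamV _ _ _, dcomm_vecV _ _ _⟩).isBlockReduction
  case hV =>
    ext y
    simp [sub_eq_add_neg]
  case hs' =>
    rw [(hd ht).deriv]
    exact div_ne_zero (by norm_num) (Complex.exp_ne_zero _)
  case ham =>
    have ht0 := hℓ.ne_zero ht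
    have hr := Complex.exp_ne_zero (ℓ t / 2)
    have hr2 := hℓ.exp_half_sq ht
    have hy2 := shBlk_nlLift_fst hr y
    generalize hz : nlLift (ContinuousLinearMap.fst ℂ _ _)
        ((2 : ℂ) • ContinuousLinearMap.snd ℂ _ _) (-1) (Complex.exp (ℓ t / 2)) y = z at *
    have hC := mul_eq_nlC ht0 (g 1) (α 1) z
    have key := vecIIID6_target α β h1 (g 1) hr z.1 (nlC t (g 1) (α 1) z) z.2
      (by rw [hr2]; exact hC) _ rfl y _ hy2 rfl
    rw [hr2] at key
    have hrel := vecIIID6_relation α β h1 (g 1) ht0 z.1 _ z.2 hC _ rfl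
    have hsh := vecIIID6_shBlk α β h1 (g 1) ht0 z.1 _ z.2 hC _ rfl _ _ _ rfl rfl rfl
    rw [key.1, key.2] at hrel
    rw [key.1, key.2] at hsh
    have hdn := dnlBlk_eq ht0 (g 1) (α 1) (w := (_, _)) hrel hsh key.2.symm
    refine ⟨_, _, _, ?h0, ?hH, isHamVec_hamV _ _ _, Eq.trans ?heq hdn⟩
    case heq =>
      rw [(hd ht).deriv, (hc ht).deriv]
      congr 1
      rw [dnlLift, hz, show -1 / 2 * t⁻¹ = -(2 * t)⁻¹ by rw [mul_inv]; ring, neg_smul,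
        sub_neg_eq_add]
      refine Prod.ext (neg_add_eq_sub _ _) ?_
      refine (add_comm _ _).trans (congrArg (· + _) ?_)
      exact (smul_smul _ _ _).trans (congrArg (· • _) (mul_comm _ _))
    case h0 => rfl
    case hH =>
      rw [← vecIIID6_nlBlk α β ht0, ← vecIIID6_ofBlk]
      exact isHamVec_hamIIID6 _ _ _ _

/-! ### PIII(D₈) to PIII(D₆) -/

theorem shBlk_mul_shInv {R : Type*} [Ring R] [Algebra ℂ R] {t : ℂ} (ht : t ≠ 0) (g : ℂ)
    (P C a : R) : (shBlk t g P C a).2 * shInv t a = 1 := by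
  refine Matrix.ext fun i j => ?_
  fin_cases i <;> fin_cases j <;>
    simp [shBlk, shInv, Matrix.mul_apply, Fin.sum_univ_two, smul_smul, ht]

/-- The PIII(D₈) field contains q⁻¹. Its inverse is known explicitly in the sheared frame and is
carried back by the shear and the block isomorphism. -/
theorem isHamVec_hamIIID8_nlBlk {t : ℂ} (ht : t ≠ 0) (g ν : ℂ) (z : Phase (Fin n)) :
    IsHamVec hamIIID8 t (ofBlk (nlBlk t g ν z))
      (ofBlk (shear z.2 (vecIIID8 t (shBlk t g z.1 (nlC t g ν z) z.2) (shInv t z.2)).1,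
        shear z.2 (vecIIID8 t (shBlk t g z.1 (nlC t g ν z) z.2) (shInv t z.2)).2)) := by
  rw [nlBlk_eq_shear ht]
  have h := congrArg (blkAlg n 2).symm (congrArg (shear z.2)
    (shBlk_mul_shInv ht g z.1 (nlC t g ν z) z.2))
  rw [map_mul, map_mul, map_one, map_one] at h
  have h1 := isHamVec_hamIIID8 t (x := ofBlk (shear z.2 (shBlk t g z.1 (nlC t g ν z) z.2).1,
    shear z.2 (shBlk t g z.1 (nlC t g ν z) z.2).2)) (.of_mul_eq_one _ h)
  have h2 : (ofBlk (shear z.2 (shBlk t g z.1 (nlC t g ν z) z.2).1,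
    shear z.2 (shBlk t g z.1 (nlC t g ν z) z.2).2)).2⁻¹ = _ := Matrix.inv_eq_right_inv h
  rw [h2] at h1
  convert! h1 using 1
  exact ((map_vecIIID8 ((blkAlg n 2).symm.toAlgHom.comp (shear z.2)) t _ _)).symm

theorem isBlockReduction_D8D6 {D : Set ℂ} (hD : IsOpen D) (g : Fin 2 → ℂ)
    (ℓ : ℂ → ℂ) (hℓ : IsLogBranch D ℓ) :
    IsBlockReduction (n := n) D hamIIID8 (regQ _) backIIID8pi g genNL
      (hamIIID6 ![1 - Complex.I * g 1, Complex.I * g 1] ![1 - Complex.I * g 1, Complex.I * g 1])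
      {y | IsUnit (1 - (2 : ℂ) • y.1)}
      (fun t => 16 * Complex.exp (ℓ t / 2)) (mapD8D6 ℓ (g 1)) := by
  have hd {t : ℂ} (ht : t ∈ D) : HasDerivAt (fun t => 16 * Complex.exp (ℓ t / 2))
      (8 / Complex.exp (ℓ t / 2)) t := by
    have h := hℓ.hasDerivAt_exp_half hD ht
    have hr := Complex.exp_ne_zero (ℓ t / 2)
    convert! h.const_mul 16 using 1
    have hr2 := hℓ.exp_half_sq ht
    have ht2 := hℓ.ne_zero ht
    generalize Complex.exp (ℓ t / 2) = r at *
    field_simp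
    rw [← hr2]
    ring
  have hc {t : ℂ} (ht : t ∈ D) : HasDerivAt (fun t => ℓ t / 2) (t⁻¹ / 2) t :=
    (hℓ.hasDerivAt hD ht).div_const _
  -- The transformation of PIII(D₈) is the common one with ν = 1/2; the second chart is used because
  -- q₁₁ now corresponds to P.
  refine ((slice_NL hD hℓ (1 / 2) g isNLChart_snd conjInvariant_hamIIID8
    (conjInvariant_hamIIID6 _ _) (c := fun t => ℓ t / 2) ?hV
    (fun t ht => (hd ht).differentiableAt.differentiableWithinAt)
    (fun t ht => ?hs') (fun t ht => (hc ht).differentiableAt.differentiableWithinAt)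
    (fun t ht y hy => ?ham)).conj_exp fun _ _ _ _ =>
    ⟨_, isHamVec_hamIIID6 _ _ _ _, dcomm_vecIIID6 _ _ _ _⟩).isBlockReduction
  case hV =>
    ext y
    simp [sub_eq_neg_add]
  case hs' =>
    rw [(hd ht).deriv]
    exact div_ne_zero (by norm_num) (Complex.exp_ne_zero _)
  case ham =>
    have ht0 := hℓ.ne_zero ht
    have hr := Complex.exp_ne_zero (ℓ t / 2)
    have hr2 := hℓ.exp_half_sq ht
    have hy2 := shBlk_nlLift_snd hr y
    generalize hz : nlLift (ContinuousLinearMap.snd ℂ _ _)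
        ((-2 : ℂ) • ContinuousLinearMap.fst ℂ _ _) 1 (Complex.exp (ℓ t / 2)) y = z at *
    have hC := mul_eq_nlC ht0 (g 1) (1 / 2) z
    have key := vecIIID8_target (g 1) hr z.1 (nlC t (g 1) (1 / 2) z) z.2
      (by rw [hr2]; exact hC) _ rfl y _ hy2 rfl
    rw [hr2] at key
    have hrel := vecIIID8_relation (g 1) ht0 z.1 _ z.2 hC _ rfl
    have hsh := vecIIID8_shBlk (g 1) ht0 z.1 _ z.2 hC _ rfl _ _ _ rfl rfl rfl
    rw [key.1, key.2] at hrel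
    rw [key.1, key.2] at hsh
    have hdn := dnlBlk_eq ht0 (g 1) (1 / 2) (w := (_, _)) hrel hsh key.2.symm
    refine ⟨_, _, _, ?h0, ?hH, isHamVec_hamIIID6 _ _ _ _, Eq.trans ?heq hdn⟩
    case heq =>
      rw [(hd ht).deriv, (hc ht).deriv]
      congr 1
      rw [dnlLift, hz, show t⁻¹ / 2 = (2 * t)⁻¹ by rw [mul_inv]; ring]
      refine Prod.ext (neg_add_eq_sub _ _) ?_
      refine (add_comm _ _).trans (congrArg (· + _) ?_)
      exact (smul_smul _ _ _).trans (congrArg (· • _) (by ring))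
    case h0 => rfl
    case hH => exact isHamVec_hamIIID8_nlBlk ht0 _ _ _

end NL

end MatrixPainleve

end

open MatrixPainleve in
theorem mainTheorem1 (n : ℕ) (D : Set ℂ) (hD : IsOpen D) :
    -- PII to PII, with `w = r`
    (∀ (α : Fin 2 → ℂ) (g : Fin 2 → ℂ) (c : ℂ),
      α 0 + α 1 = 1 → swapParam α = α → c ^ 3 = 2 →
      IsBlockReduction (n := n) D (hamII α) Set.univ backIIr g genLin
        (hamII ![1 + Complex.I * g 1, -(Complex.I * g 1)]) Set.univ
        (fun t => -c * t) (mapII c)) ∧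
    -- PIII(D₆) to PIII(D₈), with `w = π ∘ π'`
    (∀ (α β : Fin 2 → ℂ) (g : Fin 2 → ℂ) (ℓ : ℂ → ℂ),
      α 0 + α 1 = 1 → β 0 + β 1 = 1 → swapParam α = α → swapParam β = β → IsLogBranch D ℓ →
      IsBlockReduction (n := n) D (hamIIID6 α β) (regQ _) (backIIID6pp α β) g genLin'
        hamIIID8 (regQ _)
        (fun t => t ^ 2 / 16) (mapD6D8 ℓ (g 1))) ∧
    -- PV to PIII(D₆), with `w = π²`
    (∀ (α : Fin 4 → ℂ) (g : Fin 2 → ℂ) (ℓ : ℂ → ℂ),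
      α 0 + α 1 + α 2 + α 3 = 1 → rotParam (rotParam α) = α → IsLogBranch D ℓ →
      IsBlockReduction (n := n) D (hamV α) Set.univ (fun t x => backVpi t (backVpi t x)) g genLin
        (hamIIID6 ![1 + Complex.I * g 1, -(Complex.I * g 1)] ![1 - 2 * α 1, 2 * α 1]) Set.univ
        (fun t => -t ^ 2 / 16) (mapVD6 ℓ)) ∧
    -- PIV to PIV, with `w = π`
    (∀ (α : Fin 3 → ℂ) (g : Fin 3 → ℂ) (κ : ℂ),
      α 0 + α 1 + α 2 = 1 → rotParam α = α → κ ^ 2 = -(Real.sqrt 3 * Complex.I) →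
      IsBlockReduction (n := n) D (hamIV α) Set.univ backIVpi g genIV
        (hamIV ![1 + Complex.I * g 2 / 2, -(Complex.I * g 1 + Complex.I * g 2) / 2,
          Complex.I * g 1 / 2]) Set.univ
        (fun t => κ * t) (mapIV κ)) ∧
    -- PV to PV, with `w = π`
    (∀ (α : Fin 4 → ℂ) (g : Fin 4 → ℂ),
      α 0 + α 1 + α 2 + α 3 = 1 → rotParam α = α → 0 ∉ D →
      IsBlockReduction (n := n) D (hamV α) Set.univ backVpi g genV
        (hamV ![1 + Complex.I * g 1, Complex.I * g 2 + Complex.I * g 3, -(Complex.I * g 3),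
          -(Complex.I * g 1) - Complex.I * g 2]) {y | IsUnit (y.2 - 1)}
        (fun t => -2 * Complex.I * t) (mapV (g 3))) ∧
    -- PIII(D₈) to PIII(D₆), with `w = π`
    (∀ (g : Fin 2 → ℂ) (ℓ : ℂ → ℂ), IsLogBranch D ℓ →
      IsBlockReduction (n := n) D hamIIID8 (regQ _) backIIID8pi g genNL
        (hamIIID6 ![1 - Complex.I * g 1, Complex.I * g 1] ![1 - Complex.I * g 1, Complex.I * g 1])
        {y | IsUnit (1 - (2 : ℂ) • y.1)}
        (fun t => 16 * Complex.exp (ℓ t / 2)) (mapD8D6 ℓ (g 1))) ∧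
    -- PIII(D₆) to PV, with `w = π'`
    (∀ (α β : Fin 2 → ℂ) (g : Fin 2 → ℂ) (ℓ : ℂ → ℂ),
      α 0 + α 1 = 1 → β 0 + β 1 = 1 → swapParam β = β → IsLogBranch D ℓ →
      IsBlockReduction (n := n) D (hamIIID6 α β) (regQ _) (backIIID6p α) g genNL
        (hamV ![1 - Complex.I * g 1 - α 1, Complex.I * g 1, α 1 - Complex.I * g 1,
          Complex.I * g 1])
        {y | IsUnit ((2 : ℂ) • y.2 - 1)}
        (fun t => -8 * Complex.exp (ℓ t / 2)) (mapNL (-1 / 2) ℓ (α 1) (g 1))) ∧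
    -- PVI to PVI, with `w = π₁`
    (∀ (α : Fin 5 → ℂ) (g : Fin 2 → ℂ) (ℓ : ℂ → ℂ),
      α 0 + α 1 + 2 * α 2 + α 3 + α 4 = 1 → pi1Param α = α → 1 ∉ D → IsLogBranch D ℓ →
      IsBlockReduction (n := n) D (hamVI α) (regQ _) (backVIpi1 α) g genNL
        (hamVI ![2 * α 0, 2 * α 1, α 2 - Complex.I * g 1, Complex.I * g 1, Complex.I * g 1])
        {y | IsUnit ((2 : ℂ) • y.2 - 1)}
        (fun t => 1 / 2 + (Complex.exp (ℓ t / 2) + (Complex.exp (ℓ t / 2))⁻¹) / 4)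
        (mapNL (1 / 2) ℓ (α 2) (g 1))) := by
  refine ⟨fun α g c hα hs hc => isBlockReduction_II hD α g c hα hs hc,
    fun α β g ℓ hα hβ hsα hsβ hℓ => isBlockReduction_D6D8 hD α β g ℓ hα hβ hsα hsβ hℓ,
    fun α g ℓ hα hs hℓ => isBlockReduction_VD6 hD α g ℓ hα hs hℓ,
    fun α g κ hα hs hκ => isBlockReduction_IV hD α g κ hα hs hκ,
    fun α g hα hs h0 => isBlockReduction_V hD α g hα hs h0,
    fun g ℓ hℓ => isBlockReduction_D8D6 hD g ℓ hℓ,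
    fun α β g ℓ _ hβ hs hℓ => isBlockReduction_D6V hD α β g ℓ hβ hs hℓ,
    fun α g ℓ hα hs h1 hℓ => isBlockReduction_VI hD α g ℓ hα hs h1 hℓ⟩
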